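/- **Conventions.** An *Adams graded cdga* is a graded-commutative differential graded $\mathbb Q$-algebra $A=\bigoplus_{n\in\mathbb Z,\,r\ge 0}A^n(r)$ whose differential has bidegree $(1,0)$ and with $A^*(0)=\mathbb Q\cdot 1$; it has the canonical augmentation $A\to\mathbb Q$ with kernel $A^+=\bigoplus_{r>0}A^*(r)$. For a homomorphism $\phi:\mathcal N\to\mathcal A$ of Adams graded cdgas, $\mathcal A$ is *generalized nilpotent over $\mathcal N$* if there is a bigraded subspace $E\subset\mathcal A$, with $E^n(r)=0$ if $n\le 0$ or $r\le 0$, such that multiplication is an isomorphism $\mathcal N\otimes\mathrm{Sym}^*E\to\mathcal A$ of bigraded algebras ($\mathrm{Sym}^*$ being free graded-commutative), and such that for all $n\ge 0$, $\mathcal A_{(n+1)}=\bigcup_{q}\mathcal A_{(n+1,q)}$. Here $\mathcal A_{(n)}$ is the $\mathcal N$-subalgebra generated by $E^{\le n}$, $\mathcal A_{(n+1,0)}=\mathcal A_{(n)}$, and $\mathcal A_{(n+1,q+1)}$ is the $\mathcal N$-subalgebra generated by $\mathcal A_{(n)}$ and the $x\in\mathcal A_{(n+1)}$ of cohomological degree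 $n+1$ with $dx\in\mathcal A_{(n+1,q)}$. $\mathcal N$ is *generalized nilpotent* if it is so over $\mathbb Q$. For a generalized nilpotent algebra $A$ (or one that is generalized nilpotent over a generalized nilpotent algebra), let $\bar B(A)$ be the (normalized) reduced bar complex, spanned by the words $[x_1|\dots|x_m]$, $x_i\in A^+$, of degree $\sum_i(\deg x_i-1)$; with the shuffle product and deconcatenation, $\chi_A=H^0(\bar B(A))$ is a commutative Hopf algebra, and $G_A=\mathrm{Spec}\,\chi_A$ is an affine group scheme over $\mathbb Q$. **Theorem.** Let $\mathcal N$ be a generalized nilpotent Adams graded cdga, and let $\phi:\mathcal N\to\mathcal A$, $\epsilon:\mathcal A\to\mathcal N$ be homomorphisms of Adams graded cdgas with $\epsilon\phi=\mathrm{id}$, such that $\mathcal A=\mathcal N\otimes\mathrm{Sym}^*E$ is generalized nilpotent over $\mathcal N$. Let $\mathcal A\otimes_{\mathcal N}\mathbb Q\cong\mathrm{Sym}^*E$ be the fiber over the canonical augmentation of $\mathcal N$, with its induced differential $d^0$, and let $K=\mathrm{Spec}\,H^0(\bar B(\mathcal A\otimes_{\mathcal N}\mathbb Q))=\mathrm{Spec}\,H^0(\bar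 B(\mathrm{Sym}^*E))$. Then: 1. The sequence $1\to K\xrightarrow{j}G_{\mathcal A}\xrightarrow{\pi}G_{\mathcal N}\to 1$ induced by $\mathcal N\xrightarrow{\phi}\mathcal A\to\mathcal A\otimes_{\mathcal N}\mathbb Q$ identifies $K$ with the kernel of $\pi$, and the map $s:G_{\mathcal N}\to G_{\mathcal A}$ induced by $\epsilon$ is a section of $\pi$ (for points in all $\mathbb Q$-algebras). 2. There is an action $\alpha$ of $G_{\mathcal N}$ on $K$ by automorphisms of group schemes with $j(\alpha_g(k))=s(g)\,j(k)\,s(g)^{-1}$, and $(k,g)\mapsto j(k)s(g)$ is an isomorphism of group schemes $K\rtimes_\alpha G_{\mathcal N}\cong G_{\mathcal A}$. Let $K_s$ denote $K$ with the action $\alpha$. 3. Suppose that $\epsilon$ vanishes on $E$, i.e. that $\epsilon$ is induced by $\mathrm{Sym}^*E=\mathbb Q\oplus\mathrm{Sym}^{\ge 1}E$. Let $\Gamma:\mathrm{Sym}^*E\to\mathcal N^+\otimes\mathrm{Sym}^*E$ be the flat $\mathcal N$-connection given by the component of $d_{\mathcal A}|_{1\otimes\mathrm{Sym}^*E}$ in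 $\mathcal N^+\otimes\mathrm{Sym}^*E$, and let $\bar B(\Gamma)$ be its extension to words as a derivation. Then $\alpha$ is the action given by $\Gamma$: it is the one and only action of $G_{\mathcal N}$ on the group scheme $K$ whose infinitesimal coaction $\chi_K\to\gamma_{\mathcal N}\otimes\chi_K$ of the co-Lie algebra $\gamma_{\mathcal N}=\mathcal N^1$ is the restriction of $\bar B(\Gamma)$ to $\chi_K=H^0(\bar B(\mathrm{Sym}^*E))$. 4. Let $\bar B_{\mathcal N}(\mathcal A)$ be the relative bar complex, the sum of the tensor powers over $\mathcal N$ of the (shifted) augmentation ideal $I=\ker\epsilon$. Reduction along $\mathcal N\to\mathbb Q$ identifies the complex $\bar B_{\mathcal N}(\mathcal A)\otimes_{\mathcal N}\mathbb Q$ with $\bar B(\mathcal A\otimes_{\mathcal N}\mathbb Q)$. Hence $H^0_{\mathcal N}(\bar B_{\mathcal N}(\mathcal A))$ is the Hopf algebra $H^0(\bar B(\mathcal A\otimes_{\mathcal N}\mathbb Q))$ with the connection $H^0\to\mathcal N^1\otimes H^0$ that sends a cocycle $z$ to the reduction of the differential in $\bar B_{\mathcal N}(\mathcal A)$ of a lift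 of $z$ to a word in letters of $I^1$; and $\alpha$ is the one and only action of $G_{\mathcal N}$ on the group scheme $K$ whose infinitesimal coaction is this connection. In other words, $$K_s\cong\mathrm{Spec}\,H^0_{\mathcal N}(\bar B_{\mathcal N}(\mathcal A))$$ as group schemes over $\mathbb Q$ with $G_{\mathcal N}$-action. -/

import Mathlib

open scoped TensorProduct

universe u

namespace Adams

section Words

variable {V : Type*} [AddCommGroup V] [Module ℚ V]
variable {M : Type*} [AddCommGroup M] [Module ℚ M]

/-- Words `[x₁|…|xₙ]` in letters from `V`: the tensor algebra `⨁ₙ V^{⊗ n}`. -/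
abbrev Word (V : Type*) [AddCommGroup V] [Module ℚ V] : Type _ := TensorAlgebra ℚ V

/-- `cons x [x₁|…|xₙ] = [x|x₁|…|xₙ]`. -/
noncomputable def cons : V →ₗ[ℚ] Word V →ₗ[ℚ] Word V :=
  (LinearMap.mul ℚ (Word V)) ∘ₗ TensorAlgebra.ι ℚ

theorem cons_apply (x : V) (w : Word V) : cons x w = TensorAlgebra.ι ℚ x * w := rfl

theorem word_top (S : Submodule ℚ (Word V)) (h1 : (1 : Word V) ∈ S)
    (hc : ∀ x w, w ∈ S → cons x w ∈ S) : S = ⊤ := by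
  have key : ∀ w : Word V, ∀ v ∈ S, w * v ∈ S := by
    intro w
    induction w using TensorAlgebra.induction with
    | algebraMap r =>
      intro v hv
      rw [← Algebra.smul_def]
      exact S.smul_mem r hv
    | ι x => intro v hv; exact hc x v hv
    | mul a b ha hb => intro v hv; rw [mul_assoc]; exact ha _ (hb _ hv)
    | add a b ha hb => intro v hv; rw [add_mul]; exact S.add_mem (ha _ hv) (hb _ hv)
  rw [eq_top_iff]
  intro w _
  simpa using key w 1 h1

/-- Two linear maps on words agree if they agree on the empty word and agreement on `w`
implies agreement on `cons x w`. -/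
theorem word_ext {f g : Word V →ₗ[ℚ] M} (h1 : f 1 = g 1)
    (hc : ∀ x w, f w = g w → f (cons x w) = g (cons x w)) : f = g := by
  have := word_top (LinearMap.eqLocus f g) h1 hc
  ext w
  have hw : w ∈ LinearMap.eqLocus f g := by rw [this]; trivial
  exact hw

/-- The one-step map used for recursion on words. -/
noncomputable def wordStep (a : V →ₗ[ℚ] Word V →ₗ[ℚ] M) (b : V →ₗ[ℚ] M →ₗ[ℚ] M) :
    V →ₗ[ℚ] Module.End ℚ (Word V × M) where
  toFun x := ((cons x) ∘ₗ LinearMap.fst ℚ _ _).prod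
    ((a x) ∘ₗ LinearMap.fst ℚ _ _ + (b x) ∘ₗ LinearMap.snd ℚ _ _)
  map_add' x y := by
    ext w <;> simp
  map_smul' r x := by
    ext w <;> simp

theorem wordStep_apply (a : V →ₗ[ℚ] Word V →ₗ[ℚ] M) (b : V →ₗ[ℚ] M →ₗ[ℚ] M) (x : V)
    (p : Word V × M) : wordStep a b x p = (cons x p.1, a x p.1 + b x p.2) := rfl

/-- Recursion on words: the unique linear map `f` with `f [] = m₀` and
`f (cons x w) = a x w + b x (f w)`. -/
noncomputable def wordRec (m₀ : M) (a : V →ₗ[ℚ] Word V →ₗ[ℚ] M) (b : V →ₗ[ℚ] M →ₗ[ℚ] M) :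
    Word V →ₗ[ℚ] M :=
  LinearMap.snd ℚ _ _ ∘ₗ (LinearMap.applyₗ ((1 : Word V), m₀)) ∘ₗ
    (TensorAlgebra.lift ℚ (wordStep a b)).toLinearMap

variable (m₀ : M) (a : V →ₗ[ℚ] Word V →ₗ[ℚ] M) (b : V →ₗ[ℚ] M →ₗ[ℚ] M)

@[simp] theorem wordRec_one : wordRec m₀ a b 1 = m₀ := by simp [wordRec]

@[simp] theorem wordRec_cons (x : V) (w : Word V) :
    wordRec m₀ a b (cons x w) = a x w + b x (wordRec m₀ a b w) := by
  have h1 : ∀ w : Word V, ((TensorAlgebra.lift ℚ (wordStep a b)) w (1, m₀)).1 = w := by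
    have : (LinearMap.fst ℚ _ _ ∘ₗ (LinearMap.applyₗ ((1 : Word V), m₀)) ∘ₗ
        (TensorAlgebra.lift ℚ (wordStep a b)).toLinearMap : Word V →ₗ[ℚ] Word V)
        = LinearMap.id := by
      apply word_ext
      · simp
      · intro x w hw
        simp only [LinearMap.comp_apply, LinearMap.id_apply, AlgHom.toLinearMap_apply,
          LinearMap.applyₗ_apply_apply, LinearMap.fst_apply] at hw ⊢
        rw [cons_apply, map_mul, TensorAlgebra.lift_ι_apply, Module.End.mul_apply]
        rw [wordStep_apply, hw, cons_apply]
    intro w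
    exact LinearMap.congr_fun this w
  simp only [wordRec, LinearMap.comp_apply, AlgHom.toLinearMap_apply,
    LinearMap.applyₗ_apply_apply, LinearMap.snd_apply]
  rw [cons_apply, map_mul, TensorAlgebra.lift_ι_apply, Module.End.mul_apply]
  rw [wordStep_apply, h1]

/-- Deconcatenation `[x₁|…|xₙ] ↦ ∑ᵢ [x₁|…|xᵢ] ⊗ [xᵢ₊₁|…|xₙ]`. -/
noncomputable def deconc : Word V →ₗ[ℚ] Word V ⊗[ℚ] Word V :=
  wordRec (1 ⊗ₜ 1) ((LinearMap.llcomp ℚ _ _ _ (TensorProduct.mk ℚ (Word V) (Word V) 1)) ∘ₗ cons)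
    (LinearMap.rTensorHom (Word V) ∘ₗ cons)

@[simp] theorem deconc_one : deconc (1 : Word V) = 1 ⊗ₜ 1 := by simp [deconc]

@[simp] theorem deconc_cons (x : V) (w : Word V) :
    deconc (cons x w) = 1 ⊗ₜ (cons x w) + (cons x).rTensor (Word V) (deconc w) := by
  simp [deconc]

/-- The step of the shuffle product: `F ↦ (v ↦ ∑ v' · x · F v'')` where `∑ v' ⊗ v''` is the
deconcatenation of `v`. -/
noncomputable def shuffleStep : V →ₗ[ℚ] Module.End ℚ (Word V) →ₗ[ℚ] Module.End ℚ (Word V) :=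
  LinearMap.mk₂ ℚ (fun x F => LinearMap.mul' ℚ (Word V) ∘ₗ
      (LinearMap.lTensor (Word V) (cons x ∘ₗ F)) ∘ₗ deconc)
    (by intro x y F; simp [LinearMap.add_comp, LinearMap.comp_add, LinearMap.lTensor_add])
    (by intro r x F; simp [LinearMap.smul_comp, LinearMap.comp_smul, LinearMap.lTensor_smul])
    (by intro x F G; simp [LinearMap.add_comp, LinearMap.comp_add, LinearMap.lTensor_add])
    (by intro r x F; simp [LinearMap.smul_comp, LinearMap.comp_smul, LinearMap.lTensor_smul])

/-- The shuffle product: the sum over all shuffles of two words. It is characterised by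
`shuffle_one_left`, `shuffle_one_right` and `shuffle_cons_cons`. -/
noncomputable def shuffle : Word V →ₗ[ℚ] Word V →ₗ[ℚ] Word V :=
  wordRec LinearMap.id 0 shuffleStep

@[simp] theorem shuffle_one_left (v : Word V) : shuffle 1 v = v := by simp [shuffle]

theorem shuffle_cons (x : V) (u v : Word V) : shuffle (cons x u) v =
    LinearMap.mul' ℚ (Word V) ((LinearMap.lTensor (Word V) (cons x ∘ₗ shuffle u)) (deconc v)) := by
  simp [shuffle, shuffleStep]

@[simp] theorem shuffle_one_right (u : Word V) : shuffle u 1 = u := by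
  have : (shuffle (V := V)).flip 1 = LinearMap.id := by
    apply word_ext
    · simp
    · intro x w hw
      simp only [LinearMap.flip_apply, LinearMap.id_apply] at hw ⊢
      rw [shuffle_cons]
      simp [hw]
  exact LinearMap.congr_fun this u

theorem cons_mul (x : V) (u v : Word V) : cons x u * v = cons x (u * v) := by
  simp [cons_apply, mul_assoc]

theorem mul'_rTensor_cons (x : V) (t : Word V ⊗[ℚ] Word V) :
    LinearMap.mul' ℚ (Word V) ((cons x).rTensor (Word V) t)
      = cons x (LinearMap.mul' ℚ (Word V) t) := by
  induction t with
  | zero => simp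
  | tmul u v => simp [cons_mul]
  | add s t hs ht => simp only [map_add, hs, ht]

theorem shuffle_cons_cons (x y : V) (u v : Word V) :
    shuffle (cons x u) (cons y v) =
      cons x (shuffle u (cons y v)) + cons y (shuffle (cons x u) v) := by
  rw [shuffle_cons, deconc_cons, map_add, map_add]
  congr 1
  · simp
  · rw [shuffle_cons, ← mul'_rTensor_cons]
    congr 1
    rw [← LinearMap.comp_apply (LinearMap.lTensor _ _), LinearMap.lTensor_comp_rTensor,
      ← LinearMap.comp_apply (LinearMap.rTensor _ _), LinearMap.rTensor_comp_lTensor]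

theorem shuffle_comm (u v : Word V) : shuffle u v = shuffle v u := by
  have : (shuffle (V := V)) = (shuffle (V := V)).flip := by
    apply word_ext
    · ext v; simp
    · intro x u hu
      apply word_ext
      · simp
      · intro y v hv
        simp only [LinearMap.flip_apply] at hv ⊢
        rw [shuffle_cons_cons, shuffle_cons_cons, hv, add_comm]
        congr 2
        have := LinearMap.congr_fun hu (cons y v)
        simpa using this
  exact LinearMap.congr_fun₂ this u v

theorem shuffle_assoc (u v w : Word V) :
    shuffle (shuffle u v) w = shuffle u (shuffle v w) := by
  revert v w
  have : ∀ u : Word V, u ∈ (⊤ : Submodule ℚ (Word V)) := fun _ => trivial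
  have main : (⨅ v : Word V, ⨅ w : Word V, LinearMap.eqLocus
      ((shuffle.flip w) ∘ₗ (shuffle.flip v)) (shuffle.flip (shuffle v w))) = ⊤ := by
    apply word_top
    · simp [Submodule.mem_iInf, LinearMap.mem_eqLocus]
    · intro x u hu
      simp only [Submodule.mem_iInf, LinearMap.mem_eqLocus, LinearMap.comp_apply,
        LinearMap.flip_apply] at hu ⊢
      suffices h : (⨅ w : Word V, LinearMap.eqLocus ((shuffle.flip w) ∘ₗ (shuffle (cons x u)))
          ((shuffle (cons x u)) ∘ₗ (shuffle.flip w))) = ⊤ by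
        intro v w
        have hv : v ∈ (⊤ : Submodule ℚ (Word V)) := trivial
        rw [← h] at hv
        simp only [Submodule.mem_iInf, LinearMap.mem_eqLocus] at hv
        exact hv w
      apply word_top
      · simp [Submodule.mem_iInf, LinearMap.mem_eqLocus]
      · intro y v hv
        simp only [Submodule.mem_iInf, LinearMap.mem_eqLocus, LinearMap.comp_apply,
          LinearMap.flip_apply] at hv ⊢
        suffices h : (shuffle (shuffle (cons x u) (cons y v)))
            = (shuffle (cons x u)) ∘ₗ (shuffle (cons y v)) from LinearMap.congr_fun h
        apply word_ext
        · simp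
        · intro z w hw
          simp only [LinearMap.comp_apply] at hw ⊢
          rw [shuffle_cons_cons y z, map_add, shuffle_cons_cons x y, shuffle_cons_cons x z,
            map_add, LinearMap.add_apply, shuffle_cons_cons x z, shuffle_cons_cons y z,
            hu, hv, shuffle_cons_cons x y]
          rw [shuffle_cons_cons x y, map_add, LinearMap.add_apply] at hw
          rw [← hw]
          simp only [map_add, shuffle_cons_cons y z]
          abel
  intro v w
  have hu := this u
  rw [← main] at hu
  simp only [Submodule.mem_iInf, LinearMap.mem_eqLocus] at hu
  exact hu v w

end Words

section ShuffleHopf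

variable {V : Type*} [AddCommGroup V] [Module ℚ V]

/-- The space of words in `V`, as a commutative Hopf algebra with the shuffle product, the
deconcatenation coproduct and the antipode `[x₁|…|xₙ] ↦ (-1)ⁿ [xₙ|…|x₁]`. -/
def Shuffle (V : Type*) [AddCommGroup V] [Module ℚ V] : Type _ := Word V

noncomputable instance : AddCommGroup (Shuffle V) := inferInstanceAs (AddCommGroup (Word V))
noncomputable instance : Module ℚ (Shuffle V) := inferInstanceAs (Module ℚ (Word V))

/-- The empty word. -/
noncomputable def Shuffle.empty : Shuffle V := (1 : Word V)

noncomputable instance : CommRing (Shuffle V) where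
  __ := (inferInstance : AddCommGroup (Shuffle V))
  mul u v := shuffle (V := V) u v
  one := Shuffle.empty
  left_distrib u v w := (shuffle (V := V) u).map_add v w
  right_distrib u v w := LinearMap.congr_fun ((shuffle (V := V)).map_add u v) w
  zero_mul v := LinearMap.congr_fun ((shuffle (V := V)).map_zero) v
  mul_zero u := (shuffle (V := V) u).map_zero
  mul_assoc := shuffle_assoc (V := V)
  one_mul := shuffle_one_left (V := V)
  mul_one := shuffle_one_right (V := V)
  mul_comm := shuffle_comm (V := V)

theorem Shuffle.mul_def (u v : Shuffle V) : u * v = shuffle (V := V) u v := rfl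

noncomputable instance : Algebra ℚ (Shuffle V) :=
  Algebra.ofModule (fun r u v => LinearMap.congr_fun ((shuffle (V := V)).map_smul r u) v)
    (fun r u v => (shuffle (V := V) u).map_smul r v)

/-- The identity, from words to the shuffle algebra. -/
noncomputable def toSh : Word V ≃ₗ[ℚ] Shuffle V := LinearEquiv.refl ℚ (Word V)

/-- `cons` on the shuffle algebra. -/
noncomputable def scons : V →ₗ[ℚ] Shuffle V →ₗ[ℚ] Shuffle V := cons (V := V)

/-- The deconcatenation coproduct. -/
noncomputable def sdeconc : Shuffle V →ₗ[ℚ] Shuffle V ⊗[ℚ] Shuffle V := deconc (V := V)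

/-- The counit: the coefficient of the empty word. -/
noncomputable def scounit : Shuffle V →ₗ[ℚ] ℚ :=
  (TensorAlgebra.algebraMapInv (M := V)).toLinearMap

variable {M : Type*} [AddCommGroup M] [Module ℚ M]

theorem sh_top (S : Submodule ℚ (Shuffle V)) (h1 : (1 : Shuffle V) ∈ S)
    (hc : ∀ x w, w ∈ S → scons x w ∈ S) : S = ⊤ := word_top (V := V) S h1 hc

theorem sh_ext {f g : Shuffle V →ₗ[ℚ] M} (h1 : f 1 = g 1)
    (hc : ∀ x w, f w = g w → f (scons x w) = g (scons x w)) : f = g :=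
  word_ext (V := V) h1 hc

theorem scons_mul_scons (x y : V) (u v : Shuffle V) :
    scons x u * scons y v = scons x (u * scons y v) + scons y (scons x u * v) :=
  shuffle_cons_cons x y u v

theorem sdeconc_one : sdeconc (1 : Shuffle V) = 1 ⊗ₜ 1 := deconc_one (V := V)

theorem sdeconc_scons (x : V) (w : Shuffle V) :
    sdeconc (scons x w) = 1 ⊗ₜ (scons x w) + (scons x).rTensor (Shuffle V) (sdeconc w) :=
  deconc_cons x w

theorem scounit_one : scounit (1 : Shuffle V) = 1 :=
  map_one (TensorAlgebra.algebraMapInv (R := ℚ) (M := V))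

theorem scounit_scons (x : V) (w : Shuffle V) : scounit (scons x w) = 0 := by
  change TensorAlgebra.algebraMapInv (TensorAlgebra.ι ℚ x * (show Word V from w)) = 0
  rw [map_mul]
  simp [TensorAlgebra.algebraMapInv]

noncomputable instance : Coalgebra ℚ (Shuffle V) where
  comul := sdeconc
  counit := scounit
  coassoc := by
    apply sh_ext
    · simp [sdeconc_one]
    · intro x w hw
      simp only [LinearMap.comp_apply] at hw ⊢
      rw [sdeconc_scons]
      simp only [map_add, LinearMap.rTensor_tmul, LinearMap.lTensor_tmul, sdeconc_one,
        sdeconc_scons, TensorProduct.tmul_add, add_assoc]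
      congr 1
      have h1 : ∀ t : Shuffle V ⊗[ℚ] Shuffle V,
          TensorProduct.assoc ℚ _ _ _ (sdeconc.rTensor (Shuffle V)
            ((scons x).rTensor (Shuffle V) t)) = 1 ⊗ₜ ((scons x).rTensor _ t) +
            (scons x).rTensor _ (TensorProduct.assoc ℚ _ _ _ (sdeconc.rTensor (Shuffle V) t)) := by
        intro t
        induction t with
        | zero => simp
        | add s t hs ht => simp only [map_add, hs, ht, TensorProduct.tmul_add]; abel
        | tmul u v =>
          simp only [LinearMap.rTensor_tmul, sdeconc_scons, TensorProduct.add_tmul, map_add,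
            TensorProduct.assoc_tmul]
          congr 1
          induction sdeconc u with
          | zero => simp
          | add s t hs ht => simp only [map_add, hs, ht, TensorProduct.add_tmul]
          | tmul a b => simp
      refine (h1 _).trans ?_
      congr 1
      erw [hw]
      rw [← LinearMap.comp_apply (LinearMap.lTensor _ _) (LinearMap.rTensor _ _),
        LinearMap.lTensor_comp_rTensor, ← LinearMap.rTensor_comp_lTensor]
      rfl
  rTensor_counit_comp_comul := by
    apply sh_ext
    · simp [sdeconc_one, scounit_one]
    · intro x w hw
      simp only [LinearMap.comp_apply] at hw ⊢
      have : scounit ∘ₗ (scons x) = 0 := by ext w; exact scounit_scons x w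
      rw [sdeconc_scons, map_add, ← LinearMap.comp_apply (LinearMap.rTensor _ _) (LinearMap.rTensor _ _),
        ← LinearMap.rTensor_comp, this]
      simp [scounit_one]
  lTensor_counit_comp_comul := by
    apply sh_ext
    · simp [sdeconc_one, scounit_one]
    · intro x w hw
      simp only [LinearMap.comp_apply] at hw ⊢
      rw [sdeconc_scons, map_add, ← LinearMap.comp_apply (LinearMap.lTensor _ _),
        LinearMap.lTensor_comp_rTensor, ← LinearMap.rTensor_comp_lTensor, LinearMap.comp_apply, hw]
      simp [scounit_scons]

theorem comul_scons (x : V) (w : Shuffle V) :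
    Coalgebra.comul (R := ℚ) (scons x w) = 1 ⊗ₜ (scons x w) +
      (scons x).rTensor (Shuffle V) (Coalgebra.comul (R := ℚ) w) := sdeconc_scons x w

theorem comul_sh_one : Coalgebra.comul (R := ℚ) (1 : Shuffle V) = 1 ⊗ₜ 1 := sdeconc_one

theorem counit_scons (x : V) (w : Shuffle V) :
    Coalgebra.counit (R := ℚ) (scons x w) = 0 := scounit_scons x w

theorem counit_sh_one : Coalgebra.counit (R := ℚ) (1 : Shuffle V) = 1 := scounit_one

theorem scons_tmul_mul (x y : V) (s t : Shuffle V ⊗[ℚ] Shuffle V) :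
    (scons x).rTensor (Shuffle V) s * (scons y).rTensor (Shuffle V) t =
      (scons x).rTensor (Shuffle V) (s * (scons y).rTensor (Shuffle V) t) +
      (scons y).rTensor (Shuffle V) ((scons x).rTensor (Shuffle V) s * t) := by
  induction s with
  | zero => simp
  | add s s' hs hs' => simp only [map_add, add_mul, hs, hs']; abel
  | tmul a b =>
    induction t with
    | zero => simp
    | add s s' hs hs' => simp only [map_add, mul_add, hs, hs']; abel
    | tmul c d => simp [scons_mul_scons, TensorProduct.add_tmul]

theorem one_tmul_mul_scons (x : V) (v : Shuffle V) (t : Shuffle V ⊗[ℚ] Shuffle V) :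
    ((1 : Shuffle V) ⊗ₜ[ℚ] v) * (scons x).rTensor (Shuffle V) t =
      (scons x).rTensor (Shuffle V) ((1 ⊗ₜ v) * t) := by
  induction t with
  | zero => simp
  | add s s' hs hs' => simp only [map_add, mul_add, hs, hs']
  | tmul c d => simp

theorem comul_shuffle_mul (u v : Shuffle V) : Coalgebra.comul (R := ℚ) (u * v) =
    Coalgebra.comul (R := ℚ) u * Coalgebra.comul (R := ℚ) v := by
  have : (LinearMap.mul ℚ (Shuffle V)).compr₂ Coalgebra.comul =
      (LinearMap.mul ℚ (Shuffle V ⊗[ℚ] Shuffle V)).compl₁₂ Coalgebra.comul Coalgebra.comul := by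
    apply sh_ext
    · ext v; simp [comul_sh_one, ← Algebra.TensorProduct.one_def]
    · intro x u hu
      apply sh_ext
      · simp [comul_sh_one, ← Algebra.TensorProduct.one_def]
      · intro y v hv
        have hu' := LinearMap.congr_fun hu (scons y v)
        simp only [LinearMap.compr₂_apply, LinearMap.compl₁₂_apply, LinearMap.mul_apply'] at *
        rw [scons_mul_scons, map_add, comul_scons, comul_scons, hu', hv,
          comul_scons x u, comul_scons y v]
        simp only [add_mul, mul_add, map_add, scons_tmul_mul, one_tmul_mul_scons,
          Algebra.TensorProduct.tmul_mul_tmul, one_mul, scons_mul_scons, TensorProduct.tmul_add]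
        have : (scons x).rTensor (Shuffle V) (Coalgebra.comul u) *
            ((1 : Shuffle V) ⊗ₜ[ℚ] scons y v) = (scons x).rTensor (Shuffle V)
              (Coalgebra.comul u * ((1 : Shuffle V) ⊗ₜ[ℚ] scons y v)) := by
          rw [mul_comm, one_tmul_mul_scons, mul_comm]
        rw [this]
        abel
  exact LinearMap.congr_fun₂ this u v

theorem counit_shuffle_mul (u v : Shuffle V) : Coalgebra.counit (R := ℚ) (u * v) =
    Coalgebra.counit (R := ℚ) u * Coalgebra.counit (R := ℚ) v := by
  have : (LinearMap.mul ℚ (Shuffle V)).compr₂ Coalgebra.counit =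
      (LinearMap.mul ℚ ℚ).compl₁₂ Coalgebra.counit Coalgebra.counit := by
    apply sh_ext
    · ext v; simp [counit_sh_one]
    · intro x u hu
      apply sh_ext
      · simp [counit_sh_one]
      · intro y v hv
        simp [scons_mul_scons, counit_scons]
  exact LinearMap.congr_fun₂ this u v

noncomputable instance : Bialgebra ℚ (Shuffle V) :=
  Bialgebra.mk' ℚ (Shuffle V) counit_sh_one (counit_shuffle_mul _ _)
    comul_sh_one (comul_shuffle_mul _ _)

open WithConv in
theorem exists_conv_right_inv (g : Shuffle V →ₗ[ℚ] Shuffle V) (hg : g 1 = 1) :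
    ∃ h : Shuffle V →ₗ[ℚ] Shuffle V, h 1 = 1 ∧ toConv g * toConv h = 1 := by
  let m : Shuffle V ⊗[ℚ] Shuffle V →ₗ[ℚ] Shuffle V := LinearMap.mul' ℚ (Shuffle V) ∘ₗ g.rTensor _
  let st : V →ₗ[ℚ] (Shuffle V ⊗[ℚ] Shuffle V) →ₗ[ℚ] (Shuffle V ⊗[ℚ] Shuffle V) :=
    (LinearMap.lcomp ℚ _ (LinearMap.id) ∘ₗ LinearMap.id) ∘ₗ
      ((LinearMap.llcomp ℚ _ _ _ (LinearMap.id - (TensorProduct.mk ℚ (Shuffle V) (Shuffle V) 1) ∘ₗ m))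
      ∘ₗ (LinearMap.rTensorHom (Shuffle V) ∘ₗ scons))
  have hst : ∀ x t, st x t = (scons x).rTensor _ t - 1 ⊗ₜ m ((scons x).rTensor _ t) := by
    intro x t; simp [st]
  let f : Shuffle V →ₗ[ℚ] Shuffle V ⊗[ℚ] Shuffle V := wordRec (V := V) (1 ⊗ₜ 1) 0 st
  have f1 : f 1 = 1 ⊗ₜ 1 := wordRec_one (V := V) _ _ _
  have fc : ∀ x w, f (scons x w) = (scons x).rTensor _ (f w) - 1 ⊗ₜ m ((scons x).rTensor _ (f w)) := by
    intro x w
    refine (wordRec_cons (V := V) _ _ _ x w).trans ?_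
    exact (zero_add _).trans (hst x (f w))
  let h : Shuffle V →ₗ[ℚ] Shuffle V :=
    (TensorProduct.lid ℚ (Shuffle V)).toLinearMap ∘ₗ (scounit (V := V)).rTensor _ ∘ₗ f
  have h1 : h 1 = 1 := by simp [h, f1, scounit_one]
  have hc : ∀ x w, h (scons x w) = - m ((scons x).rTensor _ (f w)) := by
    intro x w
    have h0 : (scounit (V := V)).rTensor (Shuffle V) ((scons x).rTensor _ (f w)) = 0 := by
      have : scounit ∘ₗ (scons x) = 0 := by ext w; exact scounit_scons x w
      rw [← LinearMap.comp_apply (LinearMap.rTensor _ _), ← LinearMap.rTensor_comp, this]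
      simp
    simp only [h, LinearMap.comp_apply, fc, map_sub, h0]
    simp [scounit_one]
  have hf : f = h.lTensor _ ∘ₗ Coalgebra.comul := by
    apply sh_ext
    · change _ = h.lTensor _ (Coalgebra.comul _)
      rw [f1, comul_sh_one, LinearMap.lTensor_tmul, h1]
    · intro x w hw
      change _ = h.lTensor _ (Coalgebra.comul _)
      change _ = h.lTensor _ (Coalgebra.comul _) at hw
      have e : h.lTensor (Shuffle V) ((scons x).rTensor _ (Coalgebra.comul w)) =
          (scons x).rTensor _ (h.lTensor _ (Coalgebra.comul w)) := by
        rw [← LinearMap.comp_apply (LinearMap.lTensor _ _) (LinearMap.rTensor _ _),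
          LinearMap.lTensor_comp_rTensor, ← LinearMap.rTensor_comp_lTensor, LinearMap.comp_apply]
      rw [fc, comul_scons, map_add, LinearMap.lTensor_tmul, hc, e, ← hw, TensorProduct.tmul_neg]
      abel
  refine ⟨h, h1, ?_⟩
  have key : m ∘ₗ f = Algebra.linearMap ℚ (Shuffle V) ∘ₗ Coalgebra.counit := by
    apply sh_ext
    · simp [f1, m, hg]
    · intro x w _
      simp only [LinearMap.comp_apply, fc, map_sub, counit_scons]
      have : ∀ z, m (1 ⊗ₜ z) = z := by intro z; simp [m, hg]
      rw [this]; simp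
  apply WithConv.ext
  ext w
  have := LinearMap.congr_fun key w
  rw [hf] at this
  simp only [m, LinearMap.comp_apply] at this
  change LinearMap.mul' ℚ (Shuffle V) (TensorProduct.map g h (Coalgebra.comul w)) = _
  rw [← LinearMap.comp_apply (LinearMap.rTensor _ _) (LinearMap.lTensor _ _),
    LinearMap.rTensor_comp_lTensor] at this
  rw [this]
  rfl

open WithConv in
theorem exists_antipode : ∃ S : Shuffle V →ₗ[ℚ] Shuffle V,
    toConv S * toConv LinearMap.id = 1 ∧ toConv LinearMap.id * toConv S = 1 := by
  obtain ⟨S, hS, h⟩ := exists_conv_right_inv (V := V) LinearMap.id rfl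
  obtain ⟨T, -, hT⟩ := exists_conv_right_inv S hS
  have : toConv LinearMap.id = toConv T := left_inv_eq_right_inv h hT
  exact ⟨S, by rw [this]; exact hT, h⟩

noncomputable instance : HopfAlgebra ℚ (Shuffle V) where
  antipode := Classical.choose (exists_antipode (V := V))
  mul_antipode_rTensor_comul :=
    congrArg WithConv.ofConv (Classical.choose_spec (exists_antipode (V := V))).1
  mul_antipode_lTensor_comul :=
    congrArg WithConv.ofConv (Classical.choose_spec (exists_antipode (V := V))).2

end ShuffleHopf

section SubHopf

variable {H : Type*} [CommRing H] [HopfAlgebra ℚ H]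

/-- A subalgebra closed under the coproduct and the antipode. -/
structure IsSubHopf (Z : Subalgebra ℚ H) : Prop where
  comul_mem : ∀ z ∈ Z, Coalgebra.comul (R := ℚ) z ∈
    (Algebra.TensorProduct.map Z.val Z.val).range
  antipode_mem : ∀ z ∈ Z, HopfAlgebra.antipode ℚ z ∈ Z

theorem map_val_injective {P Q : Type*} [Ring P] [Algebra ℚ P] [Ring Q] [Algebra ℚ Q]
    {P' Q' : Type*} [Ring P'] [Algebra ℚ P'] [Ring Q'] [Algebra ℚ Q']
    (f : P →ₐ[ℚ] P') (g : Q →ₐ[ℚ] Q')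
    (hf : Function.Injective f) (hg : Function.Injective g) :
    Function.Injective (Algebra.TensorProduct.map f g) := by
  have : Function.Injective (TensorProduct.map f.toLinearMap g.toLinearMap) := by
    rw [← LinearMap.lTensor_comp_rTensor]
    exact (Module.Flat.lTensor_preserves_injective_linearMap _ hg).comp
      (Module.Flat.rTensor_preserves_injective_linearMap _ hf)
  exact this

variable {Z : Subalgebra ℚ H} (h : IsSubHopf Z)

theorem IsSubHopf.exists_comul {Z : Subalgebra ℚ H} (h : IsSubHopf Z) : ∃ c : Z →ₗ[ℚ] Z ⊗[ℚ] Z, ∀ z,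
    Algebra.TensorProduct.map Z.val Z.val (c z) = Coalgebra.comul (R := ℚ) (z : H) := by
  let j := Algebra.TensorProduct.map Z.val Z.val
  have hj : Function.Injective j.toLinearMap :=
    map_val_injective _ _ Subtype.val_injective Subtype.val_injective
  let e := LinearEquiv.ofInjective j.toLinearMap hj
  refine ⟨e.symm.toLinearMap ∘ₗ (LinearMap.codRestrict (LinearMap.range j.toLinearMap)
    (Coalgebra.comul ∘ₗ Z.val.toLinearMap) ?_), ?_⟩
  · intro z; exact h.comul_mem z z.2
  · intro z
    exact congrArg Subtype.val (e.apply_symm_apply _)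

/-- The coproduct of a sub-Hopf algebra. -/
noncomputable def IsSubHopf.comul : Z →ₗ[ℚ] Z ⊗[ℚ] Z := Classical.choose h.exists_comul

theorem IsSubHopf.map_comul (z : Z) : Algebra.TensorProduct.map Z.val Z.val (h.comul z) =
    Coalgebra.comul (R := ℚ) (z : H) := Classical.choose_spec h.exists_comul z

/-- The coalgebra structure of a sub-Hopf algebra. -/
@[reducible] noncomputable def IsSubHopf.coalgebra : Coalgebra ℚ Z where
  comul := h.comul
  counit := Coalgebra.counit ∘ₗ Z.val.toLinearMap
  coassoc := by
    ext z
    apply map_val_injective Z.val (Algebra.TensorProduct.map Z.val Z.val) Subtype.val_injective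
      (map_val_injective _ _ Subtype.val_injective Subtype.val_injective)
    have h1 : (Algebra.TensorProduct.map Z.val (Algebra.TensorProduct.map Z.val Z.val)).toLinearMap ∘ₗ
        (TensorProduct.assoc ℚ Z Z Z).toLinearMap ∘ₗ h.comul.rTensor Z =
        (TensorProduct.assoc ℚ H H H).toLinearMap ∘ₗ Coalgebra.comul.rTensor H ∘ₗ
          (Algebra.TensorProduct.map Z.val Z.val).toLinearMap := by
      have h0 : (Algebra.TensorProduct.map Z.val
          (Algebra.TensorProduct.map Z.val Z.val)).toLinearMap ∘ₗ
          (TensorProduct.assoc ℚ Z Z Z).toLinearMap = (TensorProduct.assoc ℚ H H H).toLinearMap ∘ₗ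
          TensorProduct.map (Algebra.TensorProduct.map Z.val Z.val).toLinearMap
            Z.val.toLinearMap := by
        apply TensorProduct.ext_threefold
        intro a b c
        rfl
      rw [← LinearMap.comp_assoc, h0]
      apply TensorProduct.ext'
      intro a b
      simp only [LinearMap.comp_apply, LinearMap.rTensor_tmul, TensorProduct.map_tmul,
        AlgHom.toLinearMap_apply, h.map_comul, Algebra.TensorProduct.map_tmul, Subalgebra.coe_val]
    have h2 : ∀ t : Z ⊗[ℚ] Z, Algebra.TensorProduct.map Z.val (Algebra.TensorProduct.map Z.val Z.val)
        (h.comul.lTensor Z t) =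
        Coalgebra.comul.lTensor H (Algebra.TensorProduct.map Z.val Z.val t) := by
      intro t
      induction t with
      | zero => simp
      | add s t hs ht => simp only [map_add, hs, ht]
      | tmul a b => simp [h.map_comul]
    refine (LinearMap.congr_fun h1 (h.comul z)).trans (Eq.trans ?_ (h2 _).symm)
    simp only [LinearMap.comp_apply, AlgHom.toLinearMap_apply]
    rw [h.map_comul]
    exact Coalgebra.coassoc_apply _
  rTensor_counit_comp_comul := by
    ext z
    have h1 : ∀ t : Z ⊗[ℚ] Z, Z.val.toLinearMap.lTensor ℚ
        ((Coalgebra.counit ∘ₗ Z.val.toLinearMap).rTensor Z t) =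
        Coalgebra.counit.rTensor H (Algebra.TensorProduct.map Z.val Z.val t) := by
      intro t
      induction t with
      | zero => simp
      | add s t hs ht => simp only [map_add, hs, ht]
      | tmul a b => simp
    apply Module.Flat.lTensor_preserves_injective_linearMap (M := ℚ) Z.val.toLinearMap
      Subtype.val_injective
    refine (h1 _).trans ?_
    rw [h.map_comul]
    exact Coalgebra.rTensor_counit_comul _
  lTensor_counit_comp_comul := by
    ext z
    have h1 : ∀ t : Z ⊗[ℚ] Z, Z.val.toLinearMap.rTensor ℚ
        ((Coalgebra.counit ∘ₗ Z.val.toLinearMap).lTensor Z t) =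
        Coalgebra.counit.lTensor H (Algebra.TensorProduct.map Z.val Z.val t) := by
      intro t
      induction t with
      | zero => simp
      | add s t hs ht => simp only [map_add, hs, ht]
      | tmul a b => simp
    apply Module.Flat.rTensor_preserves_injective_linearMap (M := ℚ) Z.val.toLinearMap
      Subtype.val_injective
    refine (h1 _).trans ?_
    rw [h.map_comul]
    exact Coalgebra.lTensor_counit_comul _

/-- The bialgebra structure of a sub-Hopf algebra. -/
@[reducible] noncomputable def IsSubHopf.bialgebra : Bialgebra ℚ Z :=
  letI := h.coalgebra
  Bialgebra.mk' ℚ Z (Bialgebra.counit_one (R := ℚ) (A := H))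
    (Bialgebra.counit_mul (R := ℚ) (A := H) _ _)
    (by
      apply map_val_injective Z.val Z.val Subtype.val_injective Subtype.val_injective
      exact (h.map_comul 1).trans ((Bialgebra.comul_one (R := ℚ) (A := H)).trans
        (map_one (Algebra.TensorProduct.map Z.val Z.val)).symm))
    (by
      intro a b
      apply map_val_injective Z.val Z.val Subtype.val_injective Subtype.val_injective
      refine (h.map_comul _).trans ?_
      refine (Bialgebra.comul_mul (R := ℚ) (A := H) _ _).trans ?_
      refine Eq.trans ?_ (map_mul (Algebra.TensorProduct.map Z.val Z.val) _ _).symm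
      exact congrArg₂ _ (h.map_comul a).symm (h.map_comul b).symm)

/-- The Hopf algebra structure of a sub-Hopf algebra. -/
@[reducible] noncomputable def IsSubHopf.hopfAlgebra : HopfAlgebra ℚ Z :=
  letI := h.bialgebra
  let S : Z →ₗ[ℚ] Z := LinearMap.codRestrict Z.toSubmodule
    (HopfAlgebra.antipode ℚ ∘ₗ Z.val.toLinearMap) (fun z => h.antipode_mem z z.2)
  { antipode := S
    mul_antipode_rTensor_comul := by
      ext z
      have h1 : ∀ t : Z ⊗[ℚ] Z, ((LinearMap.mul' ℚ Z (S.rTensor Z t) : Z) : H) =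
          LinearMap.mul' ℚ H ((HopfAlgebra.antipode ℚ).rTensor H
            (Algebra.TensorProduct.map Z.val Z.val t)) := by
        intro t
        induction t with
        | zero => simp
        | add s t hs ht => simp only [map_add, Subalgebra.coe_add, hs, ht]
        | tmul a b => rfl
      refine (h1 _).trans ?_
      refine (congrArg _ (congrArg _ (h.map_comul z))).trans ?_
      exact HopfAlgebra.mul_antipode_rTensor_comul_apply _
    mul_antipode_lTensor_comul := by
      ext z
      have h1 : ∀ t : Z ⊗[ℚ] Z, ((LinearMap.mul' ℚ Z (S.lTensor Z t) : Z) : H) =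
          LinearMap.mul' ℚ H ((HopfAlgebra.antipode ℚ).lTensor H
            (Algebra.TensorProduct.map Z.val Z.val t)) := by
        intro t
        induction t with
        | zero => simp
        | add s t hs ht => simp only [map_add, Subalgebra.coe_add, hs, ht]
        | tmul a b => rfl
      refine (h1 _).trans ?_
      refine (congrArg _ (congrArg _ (h.map_comul z))).trans ?_
      exact HopfAlgebra.mul_antipode_lTensor_comul_apply _ }

end SubHopf

section Invariants

open WithConv

variable {H : Type*} [CommRing H] [HopfAlgebra ℚ H] {T : Type*} [CommRing T] [Algebra ℚ T]

/-- The inverse of a point `g` of the group scheme `Spec H`. -/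
noncomputable def convInv {R : Type*} [CommRing R] [Algebra ℚ R] (g : WithConv (H →ₐ[ℚ] R)) :
    WithConv (H →ₐ[ℚ] R) := toConv (g.ofConv.comp (HopfAlgebra.antipodeAlgHom ℚ H))

theorem convInv_mul_cancel {R : Type*} [CommRing R] [Algebra ℚ R] (f : WithConv (H →ₐ[ℚ] R)) :
    convInv f * f = 1 := by
  have e : convInv f = toConv (f.ofConv.comp
      (toConv (HopfAlgebra.antipodeAlgHom ℚ H)).ofConv) := rfl
  have e2 : f = toConv (f.ofConv.comp (toConv (AlgHom.id ℚ H)).ofConv) := rfl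
  conv_lhs => rw [e]; arg 2; rw [e2]
  apply WithConv.ofConv_injective
  rw [← AlgHom.comp_convMul_distrib, AlgHom.antipode_id_cancel]
  ext
  simp [AlgHom.convOne_def]

/-- The group `G(R)` of `R`-valued points of the affine group scheme `G = Spec H`. -/
def Points (H : Type*) [CommRing H] [HopfAlgebra ℚ H] (R : Type*) [CommRing R] [Algebra ℚ R] :
    Type _ := WithConv (H →ₐ[ℚ] R)

noncomputable instance (R : Type*) [CommRing R] [Algebra ℚ R] : Group (Points H R) where
  __ := (inferInstance : Monoid (WithConv (H →ₐ[ℚ] R)))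
  inv := convInv
  inv_mul_cancel := convInv_mul_cancel

/-- For a `T`-valued point `β` of the group scheme `Spec H`, the functions `w ∈ H` with
`w (g β h) = w (g h)` for all points `g`, `h`: the functions on the quotient by the normal
subgroup generated by `β`. -/
noncomputable def invariants (β : H →ₐ[ℚ] T) : Subalgebra ℚ H :=
  AlgHom.equalizer
    (toConv (Algebra.TensorProduct.includeLeft : H →ₐ[ℚ] H ⊗[ℚ] (T ⊗[ℚ] H)) *
      toConv ((Algebra.TensorProduct.includeRight : T ⊗[ℚ] H →ₐ[ℚ] H ⊗[ℚ] (T ⊗[ℚ] H)).comp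
        (Algebra.TensorProduct.includeLeft.comp β)) *
      toConv ((Algebra.TensorProduct.includeRight : T ⊗[ℚ] H →ₐ[ℚ] H ⊗[ℚ] (T ⊗[ℚ] H)).comp
        Algebra.TensorProduct.includeRight)).ofConv
    (toConv (Algebra.TensorProduct.includeLeft : H →ₐ[ℚ] H ⊗[ℚ] (T ⊗[ℚ] H)) *
      toConv ((Algebra.TensorProduct.includeRight : T ⊗[ℚ] H →ₐ[ℚ] H ⊗[ℚ] (T ⊗[ℚ] H)).comp
        Algebra.TensorProduct.includeRight)).ofConv

theorem comp_conv_mul {R S : Type*} [CommRing R] [Algebra ℚ R] [CommRing S] [Algebra ℚ S]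
    (f : R →ₐ[ℚ] S) (g h : WithConv (H →ₐ[ℚ] R)) (w : H) :
    f ((g * h).ofConv w) = (toConv (f.comp g.ofConv) * toConv (f.comp h.ofConv)).ofConv w :=
  DFunLike.congr_fun (AlgHom.comp_convMul_distrib f g h) w

theorem invariants_spec {β : H →ₐ[ℚ] T} {w : H} (hw : w ∈ invariants β) {R : Type*} [CommRing R]
    [Algebra ℚ R] (g h : WithConv (H →ₐ[ℚ] R)) (t : T →ₐ[ℚ] R) :
    (g * toConv (t.comp β) * h).ofConv w = (g * h).ofConv w := by
  let F : H ⊗[ℚ] (T ⊗[ℚ] H) →ₐ[ℚ] R := Algebra.TensorProduct.lift g.ofConv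
    (Algebra.TensorProduct.lift t h.ofConv (fun _ _ => Commute.all _ _)) (fun _ _ => Commute.all _ _)
  have hF := congrArg F hw
  simp only [comp_conv_mul] at hF
  have e1 : F.comp (Algebra.TensorProduct.includeLeft) = g.ofConv := by ext; simp [F]
  have e2 : F.comp ((Algebra.TensorProduct.includeRight : T ⊗[ℚ] H →ₐ[ℚ] H ⊗[ℚ] (T ⊗[ℚ] H)).comp
      (Algebra.TensorProduct.includeLeft.comp β)) = t.comp β := by ext; simp [F]
  have e3 : F.comp ((Algebra.TensorProduct.includeRight : T ⊗[ℚ] H →ₐ[ℚ] H ⊗[ℚ] (T ⊗[ℚ] H)).comp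
      Algebra.TensorProduct.includeRight) = h.ofConv := by ext; simp [F]
  have e4 : F.comp (toConv (Algebra.TensorProduct.includeLeft : H →ₐ[ℚ] H ⊗[ℚ] (T ⊗[ℚ] H)) *
      toConv ((Algebra.TensorProduct.includeRight : T ⊗[ℚ] H →ₐ[ℚ] H ⊗[ℚ] (T ⊗[ℚ] H)).comp
        (Algebra.TensorProduct.includeLeft.comp β))).ofConv = (g * toConv (t.comp β)).ofConv := by
    rw [AlgHom.comp_convMul_distrib]
    simp only [e1, e2]
  simp only [e1, e3, e4] at hF
  exact hF

theorem map_eq_conv {P Q : Type*} [CommRing P] [Algebra ℚ P] [CommRing Q] [Algebra ℚ Q]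
    (f : H →ₐ[ℚ] P) (g : H →ₐ[ℚ] Q) (w : H) :
    Algebra.TensorProduct.map f g (Coalgebra.comul (R := ℚ) w) =
      (toConv ((Algebra.TensorProduct.includeLeft : P →ₐ[ℚ] P ⊗[ℚ] Q).comp f) *
        toConv ((Algebra.TensorProduct.includeRight : Q →ₐ[ℚ] P ⊗[ℚ] Q).comp g)).ofConv w := by
  rw [AlgHom.convMul_apply]
  congr 1
  ext <;> simp

theorem mem_range_of_eq {P Q : Type*} [AddCommGroup P] [Module ℚ P] [AddCommGroup Q] [Module ℚ Q]
    (f g : P →ₗ[ℚ] Q) (x : P ⊗[ℚ] P) (h1 : f.rTensor P x = g.rTensor P x)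
    (h2 : f.lTensor P x = g.lTensor P x) : x ∈ LinearMap.range (TensorProduct.map
      (LinearMap.eqLocus f g).subtype (LinearMap.eqLocus f g).subtype) := by
  have hL : LinearMap.eqLocus f g = LinearMap.ker (f - g) := LinearMap.eqLocus_eq_ker_sub f g
  rw [hL]
  have h1' : (f - g).rTensor P x = 0 := by
    rw [LinearMap.rTensor_sub, LinearMap.sub_apply, h1, sub_self]
  have h2' : (f - g).lTensor P x = 0 := by
    rw [LinearMap.lTensor_sub, LinearMap.sub_apply, h2, sub_self]
  generalize f - g = L at h1' h2'
  have hex : Function.Exact (LinearMap.ker L).subtype L := by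
    rw [LinearMap.exact_iff]; simp
  obtain ⟨y, rfl⟩ := (Module.Flat.rTensor_exact P hex x).1 h1'
  have h3 : L.lTensor _ y = 0 := by
    apply Module.Flat.rTensor_preserves_injective_linearMap (M := Q) (LinearMap.ker L).subtype
      Subtype.val_injective
    rw [map_zero, ← h2', ← LinearMap.comp_apply, LinearMap.rTensor_comp_lTensor,
      ← LinearMap.lTensor_comp_rTensor, LinearMap.comp_apply]
  obtain ⟨z, rfl⟩ := (Module.Flat.lTensor_exact (LinearMap.ker L) hex y).1 h3
  refine ⟨z, ?_⟩
  rw [← LinearMap.comp_apply, LinearMap.rTensor_comp_lTensor]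

theorem comul_mem_equalizer {R : Type*} [CommRing R] [Algebra ℚ R] (f g : H →ₐ[ℚ] R) (w : H)
    (h1 : (toConv ((Algebra.TensorProduct.includeLeft : R →ₐ[ℚ] R ⊗[ℚ] H).comp f) *
        toConv ((Algebra.TensorProduct.includeRight : H →ₐ[ℚ] R ⊗[ℚ] H).comp
          (AlgHom.id ℚ H))).ofConv w =
      (toConv ((Algebra.TensorProduct.includeLeft : R →ₐ[ℚ] R ⊗[ℚ] H).comp g) *
        toConv ((Algebra.TensorProduct.includeRight : H →ₐ[ℚ] R ⊗[ℚ] H).comp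
          (AlgHom.id ℚ H))).ofConv w)
    (h2 : (toConv ((Algebra.TensorProduct.includeLeft : H →ₐ[ℚ] H ⊗[ℚ] R).comp (AlgHom.id ℚ H)) *
        toConv ((Algebra.TensorProduct.includeRight : R →ₐ[ℚ] H ⊗[ℚ] R).comp f)).ofConv w =
      (toConv ((Algebra.TensorProduct.includeLeft : H →ₐ[ℚ] H ⊗[ℚ] R).comp (AlgHom.id ℚ H)) *
        toConv ((Algebra.TensorProduct.includeRight : R →ₐ[ℚ] H ⊗[ℚ] R).comp g)).ofConv w) :
    Coalgebra.comul (R := ℚ) w ∈ (Algebra.TensorProduct.map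
      (AlgHom.equalizer f g).val (AlgHom.equalizer f g).val).range := by
  rw [← map_eq_conv, ← map_eq_conv] at h1 h2
  obtain ⟨z, hz⟩ := mem_range_of_eq f.toLinearMap g.toLinearMap (Coalgebra.comul (R := ℚ) w) h1 h2
  exact ⟨z, hz⟩

theorem invariants_left {β : H →ₐ[ℚ] T} {w : H} (hw : w ∈ invariants β) {R S : Type*}
    [CommRing R] [Algebra ℚ R] [CommRing S] [Algebra ℚ S] (a c : WithConv (H →ₐ[ℚ] R))
    (t : T →ₐ[ℚ] R) (f : R →ₐ[ℚ] S) (g : WithConv (H →ₐ[ℚ] S)) :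
    (toConv (f.comp (a * toConv (t.comp β) * c).ofConv) * g).ofConv w =
      (toConv (f.comp (a * c).ofConv) * g).ofConv w := by
  rw [AlgHom.comp_convMul_distrib, AlgHom.comp_convMul_distrib, AlgHom.comp_convMul_distrib]
  simp only [toConv_ofConv]
  rw [mul_assoc, mul_assoc _ _ g]
  exact invariants_spec hw _ _ (f.comp t)

theorem invariants_right {β : H →ₐ[ℚ] T} {w : H} (hw : w ∈ invariants β) {R S : Type*}
    [CommRing R] [Algebra ℚ R] [CommRing S] [Algebra ℚ S] (a c : WithConv (H →ₐ[ℚ] R))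
    (t : T →ₐ[ℚ] R) (f : R →ₐ[ℚ] S) (g : WithConv (H →ₐ[ℚ] S)) :
    (g * toConv (f.comp (a * toConv (t.comp β) * c).ofConv)).ofConv w =
      (g * toConv (f.comp (a * c).ofConv)).ofConv w := by
  rw [AlgHom.comp_convMul_distrib, AlgHom.comp_convMul_distrib, AlgHom.comp_convMul_distrib]
  simp only [toConv_ofConv]
  rw [← mul_assoc, ← mul_assoc, ← mul_assoc]
  exact invariants_spec hw _ _ (f.comp t)

theorem invariants_comul_mem (β : H →ₐ[ℚ] T) (w : H) (hw : w ∈ invariants β) :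
    Coalgebra.comul (R := ℚ) w ∈ (Algebra.TensorProduct.map
      (invariants β).val (invariants β).val).range := by
  have h1 := invariants_left (S := (H ⊗[ℚ] (T ⊗[ℚ] H)) ⊗[ℚ] H) hw (toConv Algebra.TensorProduct.includeLeft)
    (toConv (Algebra.TensorProduct.includeRight.comp Algebra.TensorProduct.includeRight))
    (Algebra.TensorProduct.includeRight.comp Algebra.TensorProduct.includeLeft)
    (Algebra.TensorProduct.includeLeft : H ⊗[ℚ] (T ⊗[ℚ] H) →ₐ[ℚ] (H ⊗[ℚ] (T ⊗[ℚ] H)) ⊗[ℚ] H)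
    (toConv ((Algebra.TensorProduct.includeRight :
      H →ₐ[ℚ] (H ⊗[ℚ] (T ⊗[ℚ] H)) ⊗[ℚ] H).comp (AlgHom.id ℚ H)))
  have h2 := invariants_right (S := H ⊗[ℚ] (H ⊗[ℚ] (T ⊗[ℚ] H))) hw (toConv Algebra.TensorProduct.includeLeft)
    (toConv (Algebra.TensorProduct.includeRight.comp Algebra.TensorProduct.includeRight))
    (Algebra.TensorProduct.includeRight.comp Algebra.TensorProduct.includeLeft)
    (Algebra.TensorProduct.includeRight : H ⊗[ℚ] (T ⊗[ℚ] H) →ₐ[ℚ] H ⊗[ℚ] (H ⊗[ℚ] (T ⊗[ℚ] H)))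
    (toConv ((Algebra.TensorProduct.includeLeft :
      H →ₐ[ℚ] H ⊗[ℚ] (H ⊗[ℚ] (T ⊗[ℚ] H))).comp (AlgHom.id ℚ H)))
  rw [AlgHom.comp_assoc] at h1 h2
  unfold invariants
  exact comul_mem_equalizer _ _ w h1 h2

theorem invariants_antipode_mem (β : H →ₐ[ℚ] T) (w : H) (hw : w ∈ invariants β) :
    HopfAlgebra.antipode ℚ w ∈ invariants β := by
  let a : Points H (H ⊗[ℚ] (T ⊗[ℚ] H)) := toConv Algebra.TensorProduct.includeLeft
  let c : Points H (H ⊗[ℚ] (T ⊗[ℚ] H)) :=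
    toConv (Algebra.TensorProduct.includeRight.comp Algebra.TensorProduct.includeRight)
  let b : Points H (H ⊗[ℚ] (T ⊗[ℚ] H)) :=
    toConv (Algebra.TensorProduct.includeRight.comp (Algebra.TensorProduct.includeLeft.comp β))
  have h1 : WithConv.ofConv (c⁻¹ * b⁻¹ * b * a⁻¹ : Points H (H ⊗[ℚ] (T ⊗[ℚ] H))) w =
      WithConv.ofConv (c⁻¹ * b⁻¹ * a⁻¹ : Points H (H ⊗[ℚ] (T ⊗[ℚ] H))) w :=
    invariants_spec hw (c⁻¹ * b⁻¹ : Points H (H ⊗[ℚ] (T ⊗[ℚ] H)))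
      (a⁻¹ : Points H (H ⊗[ℚ] (T ⊗[ℚ] H)))
      (Algebra.TensorProduct.includeRight.comp Algebra.TensorProduct.includeLeft)
  rw [inv_mul_cancel_right, ← mul_inv_rev, mul_assoc, ← mul_inv_rev, ← mul_inv_rev] at h1
  exact h1.symm

theorem invariants_isSubHopf (β : H →ₐ[ℚ] T) : IsSubHopf (invariants β) :=
  ⟨invariants_comul_mem β, invariants_antipode_mem β⟩

end Invariants

section BarPoint

/-- The square-zero extension `ℚ ⊕ U`. -/
@[ext] structure SqZero (U : Type*) where
  /-- the scalar part -/
  fst : ℚ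
  /-- the part of square zero -/
  snd : U

variable {U : Type*} [AddCommGroup U] [Module ℚ U]

/-- A square-zero extension as a product. -/
def SqZero.equiv (U : Type*) : SqZero U ≃ ℚ × U := ⟨fun a => (a.1, a.2), fun a => ⟨a.1, a.2⟩,
  fun _ => rfl, fun _ => rfl⟩

noncomputable instance : AddCommGroup (SqZero U) := (SqZero.equiv U).addCommGroup
noncomputable instance : Module ℚ (SqZero U) := (SqZero.equiv U).module ℚ

noncomputable instance : CommRing (SqZero U) where
  __ := (inferInstance : AddCommGroup (SqZero U))
  mul a b := ⟨a.1 * b.1, a.1 • b.2 + b.1 • a.2⟩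
  one := ⟨1, 0⟩
  left_distrib a b c := SqZero.ext (mul_add a.1 b.1 c.1)
    (show a.1 • (b.2 + c.2) + (b.1 + c.1) • a.2 = (a.1 • b.2 + b.1 • a.2) + (a.1 • c.2 + c.1 • a.2)
      by module)
  right_distrib a b c := SqZero.ext (add_mul a.1 b.1 c.1)
    (show (a.1 + b.1) • c.2 + c.1 • (a.2 + b.2) = (a.1 • c.2 + c.1 • a.2) + (b.1 • c.2 + c.1 • b.2)
      by module)
  zero_mul a := SqZero.ext (zero_mul a.1) (show (0 : ℚ) • a.2 + a.1 • (0 : U) = 0 by simp)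
  mul_zero a := SqZero.ext (mul_zero a.1) (show a.1 • (0 : U) + (0 : ℚ) • a.2 = 0 by simp)
  mul_assoc a b c := SqZero.ext (mul_assoc a.1 b.1 c.1)
    (show (a.1 * b.1) • c.2 + c.1 • (a.1 • b.2 + b.1 • a.2) =
      a.1 • (b.1 • c.2 + c.1 • b.2) + (b.1 * c.1) • a.2 by module)
  one_mul a := SqZero.ext (one_mul a.1) (show (1 : ℚ) • a.2 + a.1 • (0 : U) = a.2 by simp)
  mul_one a := SqZero.ext (mul_one a.1) (show a.1 • (0 : U) + (1 : ℚ) • a.2 = a.2 by simp)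
  mul_comm a b := SqZero.ext (mul_comm a.1 b.1)
    (show a.1 • b.2 + b.1 • a.2 = b.1 • a.2 + a.1 • b.2 by module)

noncomputable instance : Algebra ℚ (SqZero U) := Algebra.ofModule
  (fun r a b => SqZero.ext (mul_assoc r a.1 b.1)
    (show (r * a.1) • b.2 + b.1 • r • a.2 = r • (a.1 • b.2 + b.1 • a.2) by module))
  (fun r a b => SqZero.ext (mul_left_comm a.1 r b.1)
    (show a.1 • r • b.2 + (r * b.1) • a.2 = r • (a.1 • b.2 + b.1 • a.2) by module))

/-- The inclusion of the square-zero ideal. -/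
noncomputable def SqZero.inr : U →ₗ[ℚ] SqZero U where
  toFun u := ⟨0, u⟩
  map_add' _ _ := SqZero.ext (zero_add (0 : ℚ)).symm rfl
  map_smul' r _ := SqZero.ext (mul_zero r).symm rfl

variable {V : Type*} [AddCommGroup V] [Module ℚ V]

/-- `[x₁|…|xₙ] ↦ x₁ ⊗ [x₂|…|xₙ]`, and `[] ↦ 0`. -/
noncomputable def uncons : Word V →ₗ[ℚ] V ⊗[ℚ] Word V :=
  wordRec 0 (TensorProduct.mk ℚ V (Word V)) 0

@[simp] theorem uncons_one : uncons (1 : Word V) = 0 := by simp [uncons]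

@[simp] theorem uncons_cons (x : V) (w : Word V) : uncons (cons x w) = x ⊗ₜ w := by simp [uncons]

/-- The coefficient of the empty word. -/
noncomputable def wcounit : Word V →ₗ[ℚ] ℚ := (TensorAlgebra.algebraMapInv (M := V)).toLinearMap

@[simp] theorem wcounit_one : wcounit (1 : Word V) = 1 := scounit_one (V := V)

@[simp] theorem wcounit_cons (x : V) (w : Word V) : wcounit (cons x w) = 0 := scounit_scons x w

/-- The projection to the words of length one. -/
noncomputable def pr₁ : Word V →ₗ[ℚ] V :=
  (TensorProduct.rid ℚ V).toLinearMap ∘ₗ (wcounit.lTensor V) ∘ₗ uncons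

@[simp] theorem pr₁_one : pr₁ (1 : Word V) = 0 := by simp [pr₁, LinearMap.comp_apply]

@[simp] theorem pr₁_cons (x : V) (w : Word V) : pr₁ (cons x w) = wcounit w • x := by
  simp [pr₁, LinearMap.comp_apply]

/-- For `d : V → U` and a bilinear `c : V × V → U`, the map
`[x₁|…|xₙ] ↦ ∑ᵢ [x₁|…] ⊗ d xᵢ ⊗ […|xₙ] + ∑ᵢ [x₁|…] ⊗ c xᵢ xᵢ₊₁ ⊗ […|xₙ]`. -/
noncomputable def split₂ (d : V →ₗ[ℚ] U) (c : V →ₗ[ℚ] V →ₗ[ℚ] U) :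
    Word V →ₗ[ℚ] Word V ⊗[ℚ] (U ⊗[ℚ] Word V) :=
  wordRec 0 ((LinearMap.llcomp ℚ _ _ _ (TensorProduct.mk ℚ (Word V) (U ⊗[ℚ] Word V) 1)) ∘ₗ
    (TensorProduct.mk ℚ U (Word V) ∘ₗ d + (LinearMap.lcomp ℚ _ uncons) ∘ₗ
      LinearMap.rTensorHom (Word V) ∘ₗ c)) (LinearMap.rTensorHom _ ∘ₗ cons)

variable (d : V →ₗ[ℚ] U) (c : V →ₗ[ℚ] V →ₗ[ℚ] U)

@[simp] theorem split₂_one : split₂ d c 1 = 0 := by simp [split₂]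

@[simp] theorem split₂_cons (x : V) (w : Word V) : split₂ d c (cons x w) =
    1 ⊗ₜ (d x ⊗ₜ w + (c x).rTensor _ (uncons w)) + (cons x).rTensor _ (split₂ d c w) := by
  simp [split₂, TensorProduct.tmul_add]

/-- `[x] ↦ d x`, `[x|y] ↦ c x y`, and the other words go to zero. -/
noncomputable def len₂ : Word V →ₗ[ℚ] U :=
  (TensorProduct.rid ℚ U).toLinearMap ∘ₗ (TensorProduct.lid ℚ _).toLinearMap ∘ₗ
    TensorProduct.map wcounit (wcounit.lTensor U) ∘ₗ split₂ d c

@[simp] theorem len₂_one : len₂ d c 1 = 0 := by simp [len₂, LinearMap.comp_apply]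

theorem rid_lTensor_rTensor {P : Type*} [AddCommGroup P] [Module ℚ P] (f : V →ₗ[ℚ] U)
    (g : P →ₗ[ℚ] ℚ) (t : V ⊗[ℚ] P) : TensorProduct.rid ℚ U (g.lTensor U (f.rTensor P t)) =
      f (TensorProduct.rid ℚ V (g.lTensor V t)) := by
  induction t with
  | zero => simp
  | tmul x y => simp
  | add s t hs ht => simp only [map_add, hs, ht]

@[simp] theorem len₂_cons (x : V) (w : Word V) :
    len₂ d c (cons x w) = wcounit w • d x + c x (pr₁ w) := by
  have h0 : TensorProduct.map wcounit (wcounit.lTensor U) ((cons x).rTensor _ (split₂ d c w)) = 0 := by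
    have : (wcounit ∘ₗ cons x : Word V →ₗ[ℚ] ℚ) = 0 := by ext w; exact wcounit_cons x w
    rw [← LinearMap.comp_apply (TensorProduct.map _ _), LinearMap.rTensor, ← TensorProduct.map_comp,
      this]
    simp
  simp only [len₂, LinearMap.comp_apply, split₂_cons, map_add, h0, TensorProduct.map_tmul]
  simp [rid_lTensor_rTensor, pr₁, LinearMap.comp_apply]

theorem wcounit_shuffle (u v : Word V) : wcounit (shuffle u v) = wcounit u * wcounit v :=
  counit_shuffle_mul (V := V) u v

theorem pr₁_shuffle (u v : Word V) :
    pr₁ (shuffle u v) = wcounit u • pr₁ v + wcounit v • pr₁ u := by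
  have : (shuffle (V := V)).compr₂ pr₁ =
      (LinearMap.lsmul ℚ V).compl₁₂ wcounit pr₁ + ((LinearMap.lsmul ℚ V).compl₁₂ wcounit pr₁).flip := by
    apply word_ext
    · ext v; simp
    · intro x u _
      apply word_ext
      · simp
      · intro y v _
        simp [shuffle_cons_cons, wcounit_shuffle]
  exact LinearMap.congr_fun₂ this u v

theorem len₂_shuffle (hc : ∀ x y, c x y + c y x = 0) (u v : Word V) :
    len₂ d c (shuffle u v) = wcounit u • len₂ d c v + wcounit v • len₂ d c u := by
  have : (shuffle (V := V)).compr₂ (len₂ d c) =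
      (LinearMap.lsmul ℚ U).compl₁₂ wcounit (len₂ d c) +
        ((LinearMap.lsmul ℚ U).compl₁₂ wcounit (len₂ d c)).flip := by
    apply word_ext
    · ext v; simp
    · intro x u _
      apply word_ext
      · simp
      · intro y v _
        simp only [LinearMap.compr₂_apply, shuffle_cons_cons, map_add, len₂_cons, wcounit_shuffle,
          pr₁_shuffle, wcounit_cons, LinearMap.add_apply, LinearMap.flip_apply,
          LinearMap.compl₁₂_apply, LinearMap.lsmul_apply, pr₁_cons, map_smul]
        simp only [mul_zero, zero_mul, zero_smul, zero_add, add_zero, smul_zero]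
        rw [smul_smul, smul_smul, mul_comm, ← smul_add, hc, smul_zero]
  exact LinearMap.congr_fun₂ this u v

/-- The point of the shuffle group with values in `ℚ ⊕ U` defined by `len₂`. -/
noncomputable def barPoint (hc : ∀ x y, c x y + c y x = 0) : Shuffle V →ₐ[ℚ] SqZero U :=
  AlgHom.ofLinearMap
    { toFun := fun w => ⟨wcounit (V := V) w, len₂ (V := V) d c w⟩
      map_add' := fun u v => SqZero.ext (map_add (wcounit (V := V)) u v)
        (map_add (len₂ (V := V) d c) u v)
      map_smul' := fun r v => SqZero.ext (map_smul (wcounit (V := V)) r v)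
        (map_smul (len₂ (V := V) d c) r v) }
    (SqZero.ext (wcounit_one (V := V)) (len₂_one (V := V) d c))
    (fun u v => SqZero.ext (wcounit_shuffle (V := V) u v) (len₂_shuffle (V := V) d c hc u v))

theorem wcounit_deconc (w : Word V) : (wcounit (V := V)).rTensor (Word V) (deconc w) = 1 ⊗ₜ w :=
  Coalgebra.rTensor_counit_comul (R := ℚ) (A := Shuffle V) w

theorem rTensor_comp_cons {P : Type*} [AddCommGroup P] [Module ℚ P] (f : Word V →ₗ[ℚ] P) (x : V)
    (t : Word V ⊗[ℚ] Word V) : f.rTensor (Word V) ((cons x).rTensor _ t) =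
      (f ∘ₗ cons x).rTensor _ t := by
  rw [LinearMap.rTensor_comp, LinearMap.comp_apply]

theorem pr₁_deconc (w : Word V) : pr₁.rTensor (Word V) (deconc w) = uncons w := by
  have : pr₁.rTensor (Word V) ∘ₗ deconc = uncons (V := V) := by
    apply word_ext
    · simp [LinearMap.comp_apply]
    · intro x w _
      have e : pr₁ ∘ₗ cons x = LinearMap.toSpanSingleton ℚ V x ∘ₗ wcounit := by
        ext w
        simp [LinearMap.comp_apply]
      rw [LinearMap.comp_apply, deconc_cons, map_add, rTensor_comp_cons, e, LinearMap.rTensor_comp,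
        LinearMap.comp_apply, wcounit_deconc]
      simp
  exact LinearMap.congr_fun this w

theorem len₂_deconc_cons (x : V) (w : Word V) : (len₂ d c).rTensor (Word V) (deconc (cons x w)) =
    d x ⊗ₜ w + (c x).rTensor _ (uncons w) := by
  have e : len₂ d c ∘ₗ cons x = LinearMap.toSpanSingleton ℚ U (d x) ∘ₗ wcounit + c x ∘ₗ pr₁ := by
    ext w
    simp [LinearMap.comp_apply]
  rw [deconc_cons, map_add, rTensor_comp_cons, e, LinearMap.rTensor_add, LinearMap.add_apply,
    LinearMap.rTensor_comp, LinearMap.rTensor_comp, LinearMap.comp_apply, LinearMap.comp_apply,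
    wcounit_deconc, pr₁_deconc]
  simp

theorem split₂_eq (w : Word V) : split₂ d c w =
    ((len₂ d c).rTensor (Word V) ∘ₗ deconc).lTensor (Word V) (deconc w) := by
  have : split₂ d c = ((len₂ d c).rTensor (Word V) ∘ₗ deconc).lTensor (Word V) ∘ₗ deconc := by
    apply word_ext
    · simp [LinearMap.comp_apply]
    · intro x w hw
      rw [LinearMap.comp_apply] at hw
      have e : ∀ t : Word V ⊗[ℚ] Word V,
          ((len₂ d c).rTensor (Word V) ∘ₗ deconc).lTensor (Word V) ((cons x).rTensor _ t) =
          (cons x).rTensor _ (((len₂ d c).rTensor (Word V) ∘ₗ deconc).lTensor (Word V) t) := by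
        intro t
        rw [← LinearMap.comp_apply (LinearMap.lTensor _ _) (LinearMap.rTensor _ _),
          LinearMap.lTensor_comp_rTensor, ← LinearMap.rTensor_comp_lTensor, LinearMap.comp_apply]
      rw [LinearMap.comp_apply, deconc_cons, map_add, LinearMap.lTensor_tmul, LinearMap.comp_apply,
        len₂_deconc_cons, e, ← hw, split₂_cons]
  exact LinearMap.congr_fun this w

open WithConv in
theorem conv_eq {H T : Type*} [CommRing H] [HopfAlgebra ℚ H] [CommRing T] [Algebra ℚ T]
    (β : H →ₐ[ℚ] T) (w : H) :
    (toConv (Algebra.TensorProduct.includeLeft : H →ₐ[ℚ] H ⊗[ℚ] (T ⊗[ℚ] H)) *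
      toConv ((Algebra.TensorProduct.includeRight : T ⊗[ℚ] H →ₐ[ℚ] H ⊗[ℚ] (T ⊗[ℚ] H)).comp
        (Algebra.TensorProduct.includeLeft.comp β)) *
      toConv ((Algebra.TensorProduct.includeRight : T ⊗[ℚ] H →ₐ[ℚ] H ⊗[ℚ] (T ⊗[ℚ] H)).comp
        Algebra.TensorProduct.includeRight)).ofConv w =
      (β.toLinearMap.rTensor H ∘ₗ Coalgebra.comul).lTensor H (Coalgebra.comul w) := by
  let g : H →ₐ[ℚ] T ⊗[ℚ] H := (toConv ((Algebra.TensorProduct.includeLeft : T →ₐ[ℚ] T ⊗[ℚ] H).comp β) *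
    toConv ((Algebra.TensorProduct.includeRight : H →ₐ[ℚ] T ⊗[ℚ] H).comp (AlgHom.id ℚ H))).ofConv
  have hg : g.toLinearMap = β.toLinearMap.rTensor H ∘ₗ Coalgebra.comul := by
    ext w
    exact (map_eq_conv β (AlgHom.id ℚ H) w).symm
  have h := map_eq_conv (AlgHom.id ℚ H) g w
  rw [← hg]
  refine Eq.trans ?_ h.symm
  simp only [g]
  rw [AlgHom.comp_convMul_distrib, toConv_ofConv, ← mul_assoc]
  rfl

theorem mem_invariants_conv {H T : Type*} [CommRing H] [HopfAlgebra ℚ H] [CommRing T] [Algebra ℚ T]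
    (β : H →ₐ[ℚ] T) (w : H) : w ∈ invariants β ↔
      (β.toLinearMap.rTensor H ∘ₗ Coalgebra.comul).lTensor H (Coalgebra.comul w) =
      (Algebra.TensorProduct.includeRight : H →ₐ[ℚ] T ⊗[ℚ] H).toLinearMap.lTensor H
        (Coalgebra.comul w) := by
  rw [← conv_eq]
  have h2 := map_eq_conv (AlgHom.id ℚ H)
    (Algebra.TensorProduct.includeRight : H →ₐ[ℚ] T ⊗[ℚ] H) w
  change _ ↔ _ = Algebra.TensorProduct.map (AlgHom.id ℚ H)
    (Algebra.TensorProduct.includeRight : H →ₐ[ℚ] T ⊗[ℚ] H) (Coalgebra.comul w)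
  rw [h2]
  rfl

theorem mem_invariants_iff (hc : ∀ x y, c x y + c y x = 0) (w : Word V) :
    (show Shuffle V from w) ∈ invariants (barPoint d c hc) ↔ split₂ d c w = 0 := by
  let J : U ⊗[ℚ] Shuffle V →ₗ[ℚ] SqZero U ⊗[ℚ] Shuffle V := SqZero.inr.rTensor (Shuffle V)
  have hJ : Function.Injective (J.lTensor (Shuffle V)) :=
    Module.Flat.lTensor_preserves_injective_linearMap _
      (Module.Flat.rTensor_preserves_injective_linearMap _
        (fun a b h => congrArg SqZero.snd h))
  let i1 : Shuffle V →ₗ[ℚ] SqZero U ⊗[ℚ] Shuffle V :=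
    (Algebra.TensorProduct.includeRight : Shuffle V →ₐ[ℚ] SqZero U ⊗[ℚ] Shuffle V).toLinearMap
  let L : Shuffle V →ₗ[ℚ] U := len₂ (V := V) d c
  let ctn : Shuffle V →ₗ[ℚ] ℚ := Coalgebra.counit
  let G : Shuffle V →ₗ[ℚ] U ⊗[ℚ] Shuffle V := L.rTensor (Shuffle V) ∘ₗ Coalgebra.comul
  have h0 : (barPoint d c hc).toLinearMap.rTensor (Shuffle V) ∘ₗ Coalgebra.comul =
      J ∘ₗ G + i1 := by
    have e : (barPoint d c hc).toLinearMap = SqZero.inr ∘ₗ L +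
        Algebra.linearMap ℚ (SqZero U) ∘ₗ ctn := by
      apply LinearMap.ext
      intro w
      change barPoint d c hc w = SqZero.inr (L w) + algebraMap ℚ (SqZero U) (ctn w)
      rw [Algebra.algebraMap_eq_smul_one]
      apply SqZero.ext
      · change ctn w = 0 + ctn w * 1
        rw [zero_add, mul_one]
      · change L w = L w + ctn w • (0 : U)
        rw [smul_zero, add_zero]
    rw [e, LinearMap.rTensor_add, LinearMap.add_comp, LinearMap.rTensor_comp, LinearMap.rTensor_comp]
    congr 1
    apply LinearMap.ext
    intro w
    change (Algebra.linearMap ℚ (SqZero U)).rTensor (Shuffle V)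
      (Coalgebra.counit.rTensor (Shuffle V) (Coalgebra.comul w)) = _
    rw [Coalgebra.rTensor_counit_comul]
    simp [i1]
  have h3 : (J ∘ₗ G).lTensor (Shuffle V)
      (Coalgebra.comul (show Shuffle V from w)) = J.lTensor (Shuffle V) (split₂ d c w) := by
    rw [split₂_eq, LinearMap.lTensor_comp]
    rfl
  rw [mem_invariants_conv, h0, LinearMap.lTensor_add, LinearMap.add_apply, h3, add_eq_right]
  constructor
  · intro h
    exact hJ (h.trans (map_zero _).symm)
  · intro h
    rw [h]
    exact map_zero _

end BarPoint

/-- An Adams graded commutative differential graded algebra over `ℚ`: a bigraded algebra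
`A = ⨁ Aⁿ(r)` with cohomological degree `n ∈ ℤ` and Adams degree `r ≥ 0`, with a differential of
degree `1` preserving the Adams degree, graded commutative for the cohomological degree, and with
`A(0) = ℚ · 1`. -/
structure AdamsCDGA where
  /-- the underlying algebra -/
  carrier : Type u
  [ring : Ring carrier]
  [algebra : Algebra ℚ carrier]
  [nontrivial : Nontrivial carrier]
  /-- the homogeneous component `Aⁿ(r)` is `gr (n, r)` -/
  gr : ℤ × ℕ → Submodule ℚ carrier
  [graded : GradedAlgebra gr]
  /-- the differential -/
  d : carrier →ₗ[ℚ] carrier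
  d_mem : ∀ (n : ℤ) (r : ℕ) (x : carrier), x ∈ gr (n, r) → d x ∈ gr (n + 1, r)
  d_d : ∀ x, d (d x) = 0
  leibniz : ∀ (n : ℤ) (r : ℕ) (x y : carrier), x ∈ gr (n, r) →
    d (x * y) = d x * y + (-1 : ℚ) ^ n • (x * d y)
  comm : ∀ (n m : ℤ) (r s : ℕ) (x y : carrier), x ∈ gr (n, r) → y ∈ gr (m, s) →
    x * y = (-1 : ℚ) ^ (n * m) • (y * x)
  gr_zero : gr (0, 0) = 1
  gr_ne_zero : ∀ n : ℤ, n ≠ 0 → gr (n, 0) = ⊥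

namespace AdamsCDGA

instance : CoeSort AdamsCDGA.{u} (Type u) := ⟨carrier⟩

attribute [instance] ring algebra nontrivial graded

variable (A B C : AdamsCDGA.{u})

/-- The operator acting on the part of cohomological degree `n` as the scalar `c n`. -/
noncomputable def scale (c : ℤ → ℚ) : A →ₗ[ℚ] A :=
  (DirectSum.toModule ℚ (ℤ × ℕ) A (fun i => c i.1 • (A.gr i).subtype)) ∘ₗ
    (DirectSum.decomposeLinearEquiv A.gr).toLinearMap

/-- The sign operator `x ↦ (-1)ⁿ x` on the part of cohomological degree `n`. -/
noncomputable def J : A →ₗ[ℚ] A := A.scale (fun n => (-1 : ℚ) ^ n)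

/-- The part `Aᵐ = ⨁ᵣ Aᵐ(r)` of cohomological degree `m`. -/
def deg (m : ℤ) : Submodule ℚ A := ⨆ r : ℕ, A.gr (m, r)

/-- The part `A₊ = ⨁_{r > 0} A(r)` of positive Adams degree. -/
def plus : Submodule ℚ A := ⨆ i : {i : ℤ × ℕ // 0 < i.2}, A.gr i

variable {A B C}

theorem scale_of_mem_gr (c : ℤ → ℚ) {i : ℤ × ℕ} {x : A} (hx : x ∈ A.gr i) :
    A.scale c x = c i.1 • x := by
  lift x to A.gr i using hx
  have h : DirectSum.decomposeLinearEquiv A.gr (x : A) = DirectSum.lof ℚ _ _ i x :=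
    DirectSum.decompose_coe A.gr x
  rw [scale, LinearMap.comp_apply, LinearEquiv.coe_coe, h, DirectSum.toModule_lof]
  rfl

theorem gr_le_deg (n : ℤ) (r : ℕ) : A.gr (n, r) ≤ A.deg n := le_iSup (fun r => A.gr (n, r)) r

@[elab_as_elim]
theorem deg_induction {m : ℤ} {p : ∀ x : A, x ∈ A.deg m → Prop}
    (h : ∀ r x, ∀ hx : x ∈ A.gr (m, r), p x (gr_le_deg m r hx)) (h0 : p 0 (zero_mem _))
    (ha : ∀ x y hx hy, p x hx → p y hy → p (x + y) (add_mem hx hy)) {x : A} (hx : x ∈ A.deg m) :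
    p x hx :=
  Submodule.iSup_induction' (fun r => A.gr (m, r)) (motive := p) h h0 ha hx

theorem gr_induction {p : A → Prop} (h : ∀ n r, ∀ x ∈ A.gr (n, r), p x) (h0 : p 0)
    (ha : ∀ x y, p x → p y → p (x + y)) (x : A) : p x := by
  have hx : x ∈ ⨆ i, A.gr i := by
    rw [(DirectSum.Decomposition.isInternal A.gr).submodule_iSup_eq_top]; trivial
  exact Submodule.iSup_induction A.gr (motive := p) hx (fun i => h i.1 i.2) h0 ha

theorem scale_of_mem (c : ℤ → ℚ) {m : ℤ} {x : A} (hx : x ∈ A.deg m) : A.scale c x = c m • x := by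
  induction hx using deg_induction with
  | h r x hx => exact scale_of_mem_gr c hx
  | h0 => simp
  | ha x y _ _ hx hy => rw [map_add, hx, hy, smul_add]

theorem J_of_mem {m : ℤ} {x : A} (hx : x ∈ A.deg m) : A.J x = (-1 : ℚ) ^ m • x := scale_of_mem _ hx

theorem scale_single_mem (m : ℤ) (x : A) : A.scale (Pi.single m 1) x ∈ A.deg m := by
  induction x using gr_induction with
  | h n r x hx =>
    rw [scale_of_mem_gr _ hx]
    by_cases h : n = m
    · subst h; exact Submodule.smul_mem _ _ (gr_le_deg _ _ hx)
    · simp [h]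
  | h0 => simp
  | ha x y hx hy => rw [map_add]; exact add_mem hx hy

theorem d_mem_deg {m : ℤ} {x : A} (hx : x ∈ A.deg m) : A.d x ∈ A.deg (m + 1) := by
  induction hx using deg_induction with
  | h r x hx => exact gr_le_deg _ _ (A.d_mem _ _ _ hx)
  | h0 => simp
  | ha x y _ _ hx hy => rw [map_add]; exact add_mem hx hy

theorem mul_mem_deg {m n : ℤ} {x y : A} (hx : x ∈ A.deg m) (hy : y ∈ A.deg n) :
    x * y ∈ A.deg (m + n) := by
  induction hx using deg_induction with
  | h0 => simp
  | ha x z _ _ hx hz => rw [add_mul]; exact add_mem hx hz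
  | h r x hx =>
    induction hy using deg_induction with
    | h0 => simp
    | ha y z _ _ hy hz => rw [mul_add]; exact add_mem hy hz
    | h s y hy => exact gr_le_deg _ _ (SetLike.GradedMul.mul_mem hx hy)

theorem comm_deg {m n : ℤ} {x y : A} (hx : x ∈ A.deg m) (hy : y ∈ A.deg n) :
    x * y = (-1 : ℚ) ^ (m * n) • (y * x) := by
  induction hx using deg_induction with
  | h0 => simp
  | ha x z _ _ hx hz => rw [add_mul, mul_add, hx, hz, smul_add]
  | h r x hx =>
    induction hy using deg_induction with
    | h0 => simp
    | ha y z _ _ hy hz => rw [add_mul, mul_add, hy, hz, smul_add]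
    | h s y hy => exact A.comm _ _ _ _ _ _ hx hy

theorem d_mul (x y : A) : A.d (x * y) = A.d x * y + A.J x * A.d y := by
  induction x using gr_induction with
  | h0 => simp
  | ha x z hx hz => simp only [add_mul, map_add, hx, hz]; abel
  | h n r x hx => rw [A.leibniz _ _ _ _ hx, J_of_mem (gr_le_deg _ _ hx), smul_mul_assoc]

/-- A morphism of Adams graded cdgas. -/
structure Hom (A B : AdamsCDGA.{u}) extends A.carrier →ₐ[ℚ] B.carrier where
  map_gr : ∀ i x, x ∈ A.gr i → toFun x ∈ B.gr i
  map_d : ∀ x, toFun (A.d x) = B.d (toFun x)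

instance : CoeFun (Hom A B) (fun _ => A → B) := ⟨fun f => f.toAlgHom⟩

theorem Hom.map_gr' (f : Hom A B) {i : ℤ × ℕ} {x : A} (hx : x ∈ A.gr i) : f x ∈ B.gr i :=
  f.map_gr i x hx

theorem Hom.map_d' (f : Hom A B) (x : A) : f (A.d x) = B.d (f x) := f.map_d x

theorem Hom.map_deg (f : Hom A B) {m : ℤ} {x : A} (hx : x ∈ A.deg m) : f x ∈ B.deg m := by
  induction hx using deg_induction with
  | h r x hx => exact gr_le_deg _ _ (f.map_gr' hx)
  | h0 => simp
  | ha x y _ _ hx hy => rw [map_add]; exact add_mem hx hy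

theorem Hom.map_J (f : Hom A B) (x : A) : f (A.J x) = B.J (f x) := by
  induction x using gr_induction with
  | h0 => simp
  | ha x z hx hz => simp only [map_add, hx, hz]
  | h n r x hx =>
    rw [J_of_mem (gr_le_deg _ _ hx), J_of_mem (gr_le_deg _ _ (f.map_gr' hx)), map_smul]

/-- The identity morphism. -/
def Hom.id (A : AdamsCDGA.{u}) : Hom A A where
  __ := AlgHom.id ℚ A
  map_gr _ _ h := h
  map_d _ := rfl

/-- Composition of morphisms. -/
def Hom.comp (g : Hom B C) (f : Hom A B) : Hom A C where
  __ := g.toAlgHom.comp f.toAlgHom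
  map_gr _ _ h := g.map_gr' (f.map_gr' h)
  map_d x := by
    change g (f (A.d x)) = C.d (g (f x))
    rw [f.map_d', g.map_d']

end AdamsCDGA

section BarGeneral

variable {V : Type*} [AddCommGroup V] [Module ℚ V]

/-- `z, [y|w] ↦ [z y|w]` for a bilinear product on `V`, and `z, [] ↦ 0`. -/
noncomputable def merge (m : V →ₗ[ℚ] V →ₗ[ℚ] V) : V →ₗ[ℚ] Word V →ₗ[ℚ] Word V :=
  LinearMap.llcomp ℚ _ _ _ (TensorProduct.lift (cons (V := V))) ∘ₗ
    LinearMap.lcomp ℚ _ (uncons (V := V)) ∘ₗ LinearMap.rTensorHom (Word V) ∘ₗ m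

@[simp] theorem merge_one (m : V →ₗ[ℚ] V →ₗ[ℚ] V) (z : V) : merge m z 1 = 0 := by
  simp [merge]

@[simp] theorem merge_cons (m : V →ₗ[ℚ] V →ₗ[ℚ] V) (z y : V) (w : Word V) :
    merge m z (cons y w) = cons (m z y) w := by
  simp [merge]

/-- The differential of the bar complex of a differential graded algebra `V` with differential `d`,
product `m` and sign operator `J x = (-1)ⁿ x`: a letter of cohomological degree `n` has degree
`n - 1`, and
`D [x₁|…|xₙ] = ∑ᵢ ± [x₁|…|d xᵢ|…|xₙ] + ∑ᵢ ± [x₁|…|(J xᵢ) xᵢ₊₁|…|xₙ]`,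
where `±` is the Koszul sign of moving `D` past `x₁, …, xᵢ₋₁`. -/
noncomputable def barD (d J : V →ₗ[ℚ] V) (m : V →ₗ[ℚ] V →ₗ[ℚ] V) : Word V →ₗ[ℚ] Word V :=
  wordRec 0 (cons ∘ₗ d + merge m ∘ₗ J) (-(cons ∘ₗ J))

variable (d J : V →ₗ[ℚ] V) (m : V →ₗ[ℚ] V →ₗ[ℚ] V)

@[simp] theorem barD_one : barD d J m 1 = 0 := by simp [barD]

@[simp] theorem barD_cons (x : V) (w : Word V) : barD d J m (cons x w) =
    cons (d x) w + merge m (J x) w - cons (J x) (barD d J m w) := by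
  simp [barD, sub_eq_add_neg]

/-- The map induced on words by a linear map on letters. -/
noncomputable def wmap {W : Type*} [AddCommGroup W] [Module ℚ W] (f : V →ₗ[ℚ] W) :
    Word V →ₗ[ℚ] Word W := wordRec 1 0 (cons ∘ₗ f)

section wmap

variable {W X : Type*} [AddCommGroup W] [Module ℚ W] [AddCommGroup X] [Module ℚ X] (f : V →ₗ[ℚ] W)

@[simp] theorem wmap_one : wmap f 1 = 1 := by simp [wmap]

@[simp] theorem wmap_cons (x : V) (w : Word V) : wmap f (cons x w) = cons (f x) (wmap f w) := by
  simp [wmap]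

theorem wmap_id (w : Word V) : wmap LinearMap.id w = w := by
  have : wmap (LinearMap.id : V →ₗ[ℚ] V) = LinearMap.id := by
    apply word_ext
    · simp
    · intro x w hw; simpa using congrArg (cons x) hw
  exact LinearMap.congr_fun this w

theorem wmap_wmap (g : W →ₗ[ℚ] X) (w : Word V) : wmap g (wmap f w) = wmap (g ∘ₗ f) w := by
  have : wmap g ∘ₗ wmap f = wmap (g ∘ₗ f) := by
    apply word_ext
    · simp
    · intro x w hw
      rw [LinearMap.comp_apply] at hw
      simp [hw]
  exact LinearMap.congr_fun this w

theorem wcounit_wmap (w : Word V) : wcounit (wmap f w) = wcounit w := by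
  have : wcounit ∘ₗ wmap f = wcounit := by
    apply word_ext
    · simp
    · intro x w _; simp
  exact LinearMap.congr_fun this w

theorem wmap_shuffle (u v : Word V) : wmap f (shuffle u v) = shuffle (wmap f u) (wmap f v) := by
  have : (shuffle (V := V)).compr₂ (wmap f) = (shuffle (V := W)).compl₁₂ (wmap f) (wmap f) := by
    apply word_ext
    · ext v; simp
    · intro x u hu
      apply word_ext
      · simp
      · intro y v hv
        have hu' := LinearMap.congr_fun hu (cons y v)
        simp only [LinearMap.compr₂_apply, LinearMap.compl₁₂_apply, wmap_cons] at hu' hv ⊢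
        rw [shuffle_cons_cons, shuffle_cons_cons, map_add, wmap_cons, wmap_cons, hu', hv]
  exact LinearMap.congr_fun₂ this u v

theorem deconc_wmap (w : Word V) :
    deconc (wmap f w) = TensorProduct.map (wmap f) (wmap f) (deconc w) := by
  have : deconc ∘ₗ wmap f = TensorProduct.map (wmap f) (wmap f) ∘ₗ deconc := by
    apply word_ext
    · simp
    · intro x w hw
      rw [LinearMap.comp_apply, LinearMap.comp_apply] at hw
      have e : ∀ t : Word V ⊗[ℚ] Word V, TensorProduct.map (wmap f) (wmap f) ((cons x).rTensor _ t) =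
          (cons (f x)).rTensor _ (TensorProduct.map (wmap f) (wmap f) t) := by
        intro t
        induction t with
        | zero => simp
        | tmul a b => simp
        | add s t hs ht => simp only [map_add, hs, ht]
      simp [hw, e]
  exact LinearMap.congr_fun this w

theorem uncons_wmap (w : Word V) :
    uncons (wmap f w) = TensorProduct.map f (wmap f) (uncons w) := by
  have : uncons ∘ₗ wmap f = TensorProduct.map f (wmap f) ∘ₗ uncons := by
    apply word_ext
    · simp
    · intro x w _; simp
  exact LinearMap.congr_fun this w

theorem barD_wmap {d' J' : W →ₗ[ℚ] W} {m' : W →ₗ[ℚ] W →ₗ[ℚ] W} (hd : ∀ x, f (d x) = d' (f x))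
    (hJ : ∀ x, f (J x) = J' (f x)) (hm : ∀ x y, f (m x y) = m' (f x) (f y)) (w : Word V) :
    wmap f (barD d J m w) = barD d' J' m' (wmap f w) := by
  have hmer : ∀ z w, wmap f (merge m z w) = merge m' (f z) (wmap f w) := by
    intro z w
    have : wmap f ∘ₗ merge m z = merge m' (f z) ∘ₗ wmap f := by
      apply word_ext
      · simp
      · intro x w _; simp [hm]
    exact LinearMap.congr_fun this w
  have : wmap f ∘ₗ barD d J m = barD d' J' m' ∘ₗ wmap f := by
    apply word_ext
    · simp
    · intro x w hw
      rw [LinearMap.comp_apply, LinearMap.comp_apply] at hw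
      simp [hd, hJ, hmer, hw]
  exact LinearMap.congr_fun this w

end wmap

end BarGeneral

namespace AdamsCDGA

variable (A B : AdamsCDGA.{u})

/-- The differential of the bar complex of `A` with respect to its augmentation `A → ℚ`. It is
defined on all words in `A`; the reduced bar complex consists of the words in `A₊`. -/
noncomputable def bar : Word A →ₗ[ℚ] Word A := barD A.d A.J (LinearMap.mul ℚ A)

/-- The words `[x₁|…|xₖ]` with `xᵢ ∈ A₊` homogeneous and of total degree `∑ᵢ (deg xᵢ - 1) = m`. -/
inductive IsBarWord : ℤ → Word A → Prop
  | nil : IsBarWord 0 1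
  | cons (n : ℤ) (r : ℕ) (x : A) (m : ℤ) (w : Word A) : 0 < r → x ∈ A.gr (n, r) →
      IsBarWord m w → IsBarWord (n - 1 + m) (cons x w)

/-- The part of degree `m` of the reduced bar complex of `A`. -/
noncomputable def barDeg (m : ℤ) : Submodule ℚ (Word A) :=
  Submodule.span ℚ {w | A.IsBarWord m w}

/-- `A` is cohomologically connected at the level of complexes: `Aⁿ(r) = 0` for `r > 0`, `n ≤ 0`. -/
def IsConnected : Prop := ∀ (n : ℤ) (r : ℕ), 0 < r → n ≤ 0 → A.gr (n, r) = ⊥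

end AdamsCDGA

namespace AdamsCDGA

variable {A B C : AdamsCDGA.{u}}

/-- The inclusion of the words in letters of degree `1` in all words. -/
noncomputable def incl (A : AdamsCDGA.{u}) : Word (A.deg 1) →ₗ[ℚ] Word A := wmap (A.deg 1).subtype

theorem IsConnected.isBarWord (hA : A.IsConnected) {m : ℤ} {w : Word A} (h : A.IsBarWord m w) :
    w = 0 ∨ (0 ≤ m ∧ (m = 0 → w ∈ LinearMap.range A.incl)) := by
  induction h with
  | nil => exact Or.inr ⟨le_rfl, fun _ => ⟨1, wmap_one _⟩⟩
  | cons n r x m w hr hx _ ih =>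
    rcases ih with rfl | ⟨h1, h2⟩
    · exact Or.inl (map_zero _)
    · by_cases hn : n ≤ 0
      · rw [hA n r hr hn, Submodule.mem_bot] at hx
        exact Or.inl (by rw [hx]; simp)
      · refine Or.inr ⟨by omega, fun h0 => ?_⟩
        obtain rfl : n = 1 := by omega
        obtain ⟨v, rfl⟩ := h2 (by omega)
        exact ⟨cons ⟨x, gr_le_deg 1 r hx⟩ v, wmap_cons _ _ _⟩

theorem cons_mem_barDeg {w : Word A} (hw : w ∈ A.barDeg 0) {x : A} (hx : x ∈ A.deg 1) :
    cons x w ∈ A.barDeg 0 := by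
  induction hx using deg_induction with
  | h0 => simp
  | ha y z _ _ hy hz => rw [map_add, LinearMap.add_apply]; exact add_mem hy hz
  | h r x hx =>
    rcases Nat.eq_zero_or_pos r with rfl | hr
    · rw [A.gr_ne_zero 1 one_ne_zero, Submodule.mem_bot] at hx
      rw [hx]; simp
    · induction hw using Submodule.span_induction with
      | zero => simp
      | add a b _ _ ha hb => rw [map_add]; exact add_mem ha hb
      | smul r a _ ha => rw [map_smul]; exact Submodule.smul_mem _ _ ha
      | mem a ha => exact Submodule.subset_span (IsBarWord.cons 1 r x 0 a hr hx ha)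

/-- The bar complex of a connected algebra has no component of negative degree … -/
theorem IsConnected.barDeg_neg (hA : A.IsConnected) {m : ℤ} (hm : m < 0) : A.barDeg m = ⊥ := by
  rw [barDeg, Submodule.span_eq_bot]
  intro w hw
  rcases hA.isBarWord hw with h | h
  · exact h
  · omega

/-- … and its component of degree `0` consists of the words in letters of degree `1`. -/
theorem IsConnected.barDeg_zero (hA : A.IsConnected) : A.barDeg 0 = LinearMap.range A.incl := by
  apply le_antisymm
  · rw [barDeg, Submodule.span_le]
    intro w hw
    rcases hA.isBarWord hw with h | h
    · rw [h]; exact zero_mem _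
    · exact h.2 rfl
  · rw [← Submodule.map_top, Submodule.map_le_iff_le_comap, top_le_iff]
    apply word_top
    · rw [Submodule.mem_comap, incl, wmap_one]
      exact Submodule.subset_span IsBarWord.nil
    · intro x w hw
      rw [Submodule.mem_comap] at hw ⊢
      rw [incl, wmap_cons]
      exact cons_mem_barDeg hw x.2

theorem d_mem_two {x : A} (hx : x ∈ A.deg 1) : A.d x ∈ A.deg 2 := by
  have := d_mem_deg hx
  rwa [one_add_one_eq_two] at this

theorem mul_mem_two {x y : A} (hx : x ∈ A.deg 1) (hy : y ∈ A.deg 1) : x * y ∈ A.deg 2 := by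
  have := mul_mem_deg hx hy
  rwa [one_add_one_eq_two] at this

/-- The differential `A¹ → A²`. -/
noncomputable def d₁ (A : AdamsCDGA.{u}) : A.deg 1 →ₗ[ℚ] A.deg 2 :=
  A.d.restrict (fun _ hx => d_mem_two hx)

/-- The negative of the product `A¹ × A¹ → A²`. -/
noncomputable def c₁ (A : AdamsCDGA.{u}) : A.deg 1 →ₗ[ℚ] A.deg 1 →ₗ[ℚ] A.deg 2 :=
  LinearMap.mk₂ ℚ (fun x y => ⟨-(x * y : A), neg_mem (mul_mem_two x.2 y.2)⟩)
    (fun x y z => Subtype.ext (show -((x + y : A) * z) = -(x * z : A) + -(y * z : A) by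
      rw [add_mul, neg_add]))
    (fun r x z => Subtype.ext (show -((r • x : A) * z) = r • -(x * z : A) by
      rw [smul_mul_assoc, smul_neg]))
    (fun z x y => Subtype.ext (show -(z * (x + y : A)) = -(z * x : A) + -(z * y : A) by
      rw [mul_add, neg_add]))
    (fun r z x => Subtype.ext (show -(z * (r • x : A)) = r • -(z * x : A) by
      rw [mul_smul_comm, smul_neg]))

theorem c₁_coe (x y : A.deg 1) : (A.c₁ x y : A) = -(x * y) := rfl

theorem c₁_add (x y : A.deg 1) : A.c₁ x y + A.c₁ y x = 0 := by
  apply Subtype.ext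
  have := comm_deg x.2 y.2
  rw [Submodule.coe_add, c₁_coe, c₁_coe, this]
  simp

/-- `u ⊗ y ⊗ v ↦ u · y · v`. -/
noncomputable def glue (A : AdamsCDGA.{u}) :
    Word (A.deg 1) ⊗[ℚ] (A.deg 2 ⊗[ℚ] Word (A.deg 1)) →ₗ[ℚ] Word A :=
  TensorProduct.lift ((LinearMap.mul ℚ (Word A)).compl₁₂ A.incl
    (TensorProduct.lift ((cons (V := A)).compl₁₂ (A.deg 2).subtype A.incl)))

theorem glue_tmul (u : Word (A.deg 1)) (y : A.deg 2) (v : Word (A.deg 1)) :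
    A.glue (u ⊗ₜ (y ⊗ₜ v)) = A.incl u * cons (y : A) (A.incl v) := by
  simp [glue]

theorem bar_incl (w : Word (A.deg 1)) : A.bar (A.incl w) = A.glue (split₂ A.d₁ A.c₁ w) := by
  have : A.bar ∘ₗ A.incl = A.glue ∘ₗ split₂ A.d₁ A.c₁ := by
    apply word_ext
    · simp [bar, incl]
    · intro x w hw
      rw [LinearMap.comp_apply, LinearMap.comp_apply] at hw
      have hJ : A.J x = -(x : A) := by rw [J_of_mem x.2]; simp
      have h1 : ∀ t, A.glue ((cons x).rTensor _ t) = cons (x : A) (A.glue t) := by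
        intro t
        induction t with
        | zero => simp
        | add s t hs ht => simp only [map_add, hs, ht]
        | tmul u v =>
          induction v with
          | zero => simp
          | add s t hs ht => simp only [map_add, TensorProduct.tmul_add, hs, ht]
          | tmul y v => simp [glue_tmul, incl, cons_mul]
      have h2 : ∀ w, merge (LinearMap.mul ℚ A) (x : A) (A.incl w) =
          - A.glue (1 ⊗ₜ (A.c₁ x).rTensor _ (uncons w)) := by
        intro w
        have : merge (LinearMap.mul ℚ A) (x : A) ∘ₗ A.incl = - (A.glue ∘ₗ
            TensorProduct.mk ℚ (Word (A.deg 1)) _ 1 ∘ₗ (A.c₁ x).rTensor _ ∘ₗ uncons) := by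
          apply word_ext
          · simp [incl]
          · intro y w _
            simp [glue_tmul, incl, c₁_coe]
        exact LinearMap.congr_fun this w
      rw [LinearMap.comp_apply, LinearMap.comp_apply, split₂_cons, map_add, h1, ← hw,
        TensorProduct.tmul_add, map_add, glue_tmul]
      simp only [bar]
      rw [show A.incl (cons x w) = cons (x : A) (A.incl w) from wmap_cons _ _ _, barD_cons, hJ,
        map_neg, map_neg, LinearMap.neg_apply, LinearMap.neg_apply, h2]
      simp [incl, d₁]
  exact LinearMap.congr_fun this w

/-- The projection to the part of degree `m`. -/
noncomputable def proj (A : AdamsCDGA.{u}) (m : ℤ) : A →ₗ[ℚ] A.deg m :=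
  LinearMap.codRestrict _ (A.scale (Pi.single m 1)) (scale_single_mem m)

theorem proj_coe (m : ℤ) (x : A.deg m) : A.proj m x = x := by
  ext
  change A.scale _ _ = _
  rw [scale_of_mem _ x.2]; simp

theorem proj_ne {m n : ℤ} (h : n ≠ m) (x : A.deg n) : A.proj m (x : A) = 0 := by
  ext
  change A.scale _ _ = _
  rw [scale_of_mem _ x.2]; simp [h]

theorem glue_injective : Function.Injective A.glue := by
  let R : Word A →ₗ[ℚ] Word (A.deg 1) ⊗[ℚ] (A.deg 2 ⊗[ℚ] Word (A.deg 1)) :=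
    wordRec 0 ((LinearMap.llcomp ℚ _ _ _ (TensorProduct.mk ℚ (Word (A.deg 1)) _ 1)) ∘ₗ
      (TensorProduct.mk ℚ (A.deg 2) (Word (A.deg 1))).compl₁₂ (A.proj 2) (wmap (A.proj 1)))
      (LinearMap.rTensorHom _ ∘ₗ cons ∘ₗ A.proj 1)
  have hR : ∀ x w, R (cons x w) = 1 ⊗ₜ (A.proj 2 x ⊗ₜ wmap (A.proj 1) w) +
      (cons (A.proj 1 x)).rTensor _ (R w) := by
    intro x w; simp [R]
  have hi : ∀ w, wmap (A.proj 1) (A.incl w) = w := by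
    intro w
    rw [incl, wmap_wmap]
    convert wmap_id w
    ext x : 1
    exact proj_coe 1 x
  have hRi : ∀ w, R (A.incl w) = 0 := by
    intro w
    have : R ∘ₗ A.incl = 0 := by
      apply word_ext
      · simp [R, incl]
      · intro x w hw
        rw [LinearMap.comp_apply] at hw ⊢
        rw [show A.incl (cons x w) = cons (x : A) (A.incl w) from wmap_cons _ _ _, hR, hw,
          proj_ne (by norm_num)]
        simp
    exact LinearMap.congr_fun this w
  have key : R ∘ₗ A.glue = LinearMap.id := by
    apply TensorProduct.ext
    refine word_ext (M := A.deg 2 ⊗[ℚ] Word (A.deg 1) →ₗ[ℚ]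
      Word (A.deg 1) ⊗[ℚ] (A.deg 2 ⊗[ℚ] Word (A.deg 1))) ?_ ?_
    · apply TensorProduct.ext'
      intro y v
      have h := glue_tmul (1 : Word (A.deg 1)) y v
      rw [show A.incl 1 = 1 from wmap_one _, one_mul] at h
      simp only [LinearMap.compr₂ₛₗ_apply, TensorProduct.mk_apply, LinearMap.comp_apply,
        LinearMap.id_apply]
      rw [h, hR, hRi, proj_coe, hi, map_zero, add_zero]
    · intro x u hu
      apply TensorProduct.ext'
      intro y v
      have hu' := LinearMap.congr_fun hu (y ⊗ₜ v)
      simp only [LinearMap.compr₂ₛₗ_apply, TensorProduct.mk_apply, LinearMap.comp_apply,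
        LinearMap.id_apply] at hu' ⊢
      rw [glue_tmul] at hu' ⊢
      rw [show A.incl (cons x u) = cons (x : A) (A.incl u) from wmap_cons _ _ _, cons_mul, hR, hu',
        proj_coe, proj_ne (by norm_num)]
      simp
  exact Function.LeftInverse.injective (g := R) (LinearMap.congr_fun key)

theorem bar_incl_eq_zero_iff (w : Word (A.deg 1)) :
    A.bar (A.incl w) = 0 ↔ (show Shuffle (A.deg 1) from w) ∈ invariants (barPoint A.d₁ A.c₁ c₁_add) := by
  rw [mem_invariants_iff, bar_incl]
  exact ⟨fun h => glue_injective (h.trans (map_zero _).symm), fun h => by rw [h, map_zero]⟩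

/-- The Hopf algebra `χ_A = H⁰(B̄(A))` of a connected `A`: the cocycles among the elements of degree
`0` of the reduced bar complex, which are the words in letters of degree `1`; there are no
coboundaries as the complex is zero in negative degrees. -/
noncomputable def χSub (A : AdamsCDGA.{u}) : Subalgebra ℚ (Shuffle (A.deg 1)) :=
  (invariants (barPoint A.d₁ A.c₁ c₁_add)).copy
    {w : Shuffle (A.deg 1) | A.bar (A.incl (show Word (A.deg 1) from w)) = 0}
    (Set.ext fun w => bar_incl_eq_zero_iff (A := A) w)

theorem χSub_isSubHopf (A : AdamsCDGA.{u}) : IsSubHopf A.χSub := by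
  have h : A.χSub = invariants (barPoint A.d₁ A.c₁ c₁_add) := Subalgebra.copy_eq _ _ _
  rw [h]
  exact invariants_isSubHopf _

/-- The Hopf algebra `χ_A = H⁰(B̄(A))`. -/
def χ (A : AdamsCDGA.{u}) : Type u := A.χSub

noncomputable instance : CommRing A.χ := inferInstanceAs (CommRing A.χSub)
noncomputable instance : HopfAlgebra ℚ A.χ := A.χSub_isSubHopf.hopfAlgebra

end AdamsCDGA

/-- The map of shuffle algebras induced by a linear map. -/
noncomputable def shMap {V W : Type*} [AddCommGroup V] [Module ℚ V] [AddCommGroup W] [Module ℚ W]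
    (f : V →ₗ[ℚ] W) : Shuffle V →ₐ[ℚ] Shuffle W :=
  AlgHom.ofLinearMap (wmap f : Word V →ₗ[ℚ] Word W) (wmap_one f) (wmap_shuffle f)

namespace AdamsCDGA

variable {A B C : AdamsCDGA.{u}}

/-- The underlying word of an element of `χ_A`. -/
noncomputable def χ.word : A.χ →ₗ[ℚ] Word (A.deg 1) := A.χSub.val.toLinearMap

/-- The map `A¹ → B¹` induced by a morphism. -/
noncomputable def Hom.deg₁ (f : Hom A B) : A.deg 1 →ₗ[ℚ] B.deg 1 :=
  LinearMap.restrict f.toAlgHom.toLinearMap (fun _ hx => f.map_deg hx)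

theorem Hom.bar_wmap (f : Hom A B) (w : Word A) :
    wmap f.toAlgHom.toLinearMap (A.bar w) = B.bar (wmap f.toAlgHom.toLinearMap w) :=
  barD_wmap _ _ _ _ f.map_d' f.map_J (map_mul f.toAlgHom) w

theorem Hom.incl_wmap (f : Hom A B) (w : Word (A.deg 1)) :
    B.incl (wmap f.deg₁ w) = wmap f.toAlgHom.toLinearMap (A.incl w) := by
  rw [incl, incl, wmap_wmap, wmap_wmap]
  rfl

theorem Hom.shMap_mem (f : Hom A B) (w : Shuffle (A.deg 1)) (hw : w ∈ A.χSub) :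
    shMap f.deg₁ w ∈ B.χSub := by
  have h : ∀ v : Word (A.deg 1), A.bar (A.incl v) = 0 → B.bar (B.incl (wmap f.deg₁ v)) = 0 := by
    intro v hv
    rw [f.incl_wmap, ← f.bar_wmap, hv, map_zero]
  exact h w hw

/-- The map of algebras `χ_A → χ_B`, `[x₁|…|xₙ] ↦ [f x₁|…|f xₙ]`. -/
noncomputable def Hom.χAlgHom (f : Hom A B) : A.χSub →ₐ[ℚ] B.χSub :=
  ((shMap f.deg₁).comp A.χSub.val).codRestrict B.χSub (fun w => f.shMap_mem w w.2)

/-- The map of Hopf algebras `χ_A → χ_B` induced by a morphism `A → B`. -/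
noncomputable def Hom.χMap (f : Hom A B) : A.χ →ₐc[ℚ] B.χ :=
  BialgHom.ofAlgHom (show A.χ →ₐ[ℚ] B.χ from f.χAlgHom)
    (by
      ext w
      exact wcounit_wmap f.deg₁ (show Word (A.deg 1) from w.1))
    (by
      ext w
      apply map_val_injective B.χSub.val B.χSub.val Subtype.val_injective Subtype.val_injective
      have h1 : ∀ t : A.χSub ⊗[ℚ] A.χSub, Algebra.TensorProduct.map B.χSub.val B.χSub.val
          (Algebra.TensorProduct.map f.χAlgHom f.χAlgHom t) =
          Algebra.TensorProduct.map (shMap f.deg₁) (shMap f.deg₁)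
            (Algebra.TensorProduct.map A.χSub.val A.χSub.val t) := by
        intro t
        induction t with
        | zero => simp
        | add s t hs ht => simp only [map_add, hs, ht]
        | tmul a b => rfl
      refine (h1 _).trans ((congrArg _ (A.χSub_isSubHopf.map_comul w)).trans ?_)
      refine Eq.trans ?_ (B.χSub_isSubHopf.map_comul (f.χAlgHom w)).symm
      exact (deconc_wmap f.deg₁ (show Word (A.deg 1) from w.1)).symm)

theorem Hom.χMap_word (f : Hom A B) (w : A.χ) : (f.χMap w).word = wmap f.deg₁ w.word := rfl

end AdamsCDGA

section PointsFunctor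

open WithConv

variable {H H' : Type*} [CommRing H] [HopfAlgebra ℚ H] [CommRing H'] [HopfAlgebra ℚ H']

/-- The homomorphism `G'(R) → G(R)` of groups of points induced by a map of Hopf algebras
`H → H'`, where `G = Spec H` and `G' = Spec H'`. -/
noncomputable def Points.comap (f : H →ₐc[ℚ] H') (R : Type*) [CommRing R] [Algebra ℚ R] :
    Points H' R →* Points H R where
  toFun g := toConv (AlgHom.comp g.ofConv (f : H →ₐ[ℚ] H'))
  map_one' := by
    apply WithConv.ofConv_injective
    ext x
    change algebraMap ℚ R (Coalgebra.counit (R := ℚ) (f x)) = algebraMap ℚ R (Coalgebra.counit x)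
    rw [CoalgHomClass.counit_comp_apply]
  map_mul' g h := WithConv.ofConv_injective (AlgHom.convMul_comp_bialgHom_distrib _ _ f)

/-- The homomorphism `G(R) → G(S)` induced by a map of test rings `R → S`. -/
noncomputable def Points.map (H : Type*) [CommRing H] [HopfAlgebra ℚ H] {R S : Type*} [CommRing R]
    [Algebra ℚ R] [CommRing S] [Algebra ℚ S] (f : R →ₐ[ℚ] S) : Points H R →* Points H S where
  toFun g := toConv (f.comp g.ofConv)
  map_one' := by
    apply WithConv.ofConv_injective
    ext x
    change f (algebraMap ℚ R _) = algebraMap ℚ S _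
    rw [AlgHom.commutes]
  map_mul' g h := WithConv.ofConv_injective (AlgHom.comp_convMul_distrib f _ _)

end PointsFunctor

/-- An action of the affine group scheme `G = Spec H` on the affine group scheme `K = Spec B` by
automorphisms of group schemes: actions of `G(R)` on `K(R)` by group automorphisms for all
`ℚ`-algebras `R`, natural in `R`. -/
structure GroupAction (H B : Type u) [CommRing H] [HopfAlgebra ℚ H] [CommRing B]
    [HopfAlgebra ℚ B] where
  /-- the action on `R`-valued points -/
  act : ∀ (R : Type u) [CommRing R] [Algebra ℚ R], Points H R →* MulAut (Points B R)
  natural : ∀ (R S : Type u) [CommRing R] [Algebra ℚ R] [CommRing S] [Algebra ℚ S]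
    (f : R →ₐ[ℚ] S) (g : Points H R) (k : Points B R),
    Points.map B f (act R g k) = act S (Points.map H f g) (Points.map B f k)

/-- The coaction `B → H ⊗ B` of an action of `G = Spec H` on `K = Spec B`, i.e. the map of algebras
corresponding to the morphism of schemes `G × K → K`, `(g, k) ↦ g · k`. -/
noncomputable def GroupAction.coaction {H B : Type u} [CommRing H] [HopfAlgebra ℚ H] [CommRing B]
    [HopfAlgebra ℚ B] (α : GroupAction H B) : B →ₐ[ℚ] H ⊗[ℚ] B :=
  WithConv.ofConv (α.act (H ⊗[ℚ] B)
    (WithConv.toConv (Algebra.TensorProduct.includeLeft : H →ₐ[ℚ] H ⊗[ℚ] B))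
    (WithConv.toConv (Algebra.TensorProduct.includeRight : B →ₐ[ℚ] H ⊗[ℚ] B)))

namespace AdamsCDGA

variable {A B C : AdamsCDGA.{u}}

theorem gr_zero_eq_range (A : AdamsCDGA.{u}) :
    A.gr (0, 0) = LinearMap.range (Algebra.linearMap ℚ A) := by
  rw [A.gr_zero, Submodule.one_eq_range]

/-- The coefficient of `1` in the component of degree `(0, 0)`. -/
noncomputable def augLin (A : AdamsCDGA.{u}) : A →ₗ[ℚ] ℚ :=
  (LinearEquiv.ofInjective (Algebra.linearMap ℚ A)
    (FaithfulSMul.algebraMap_injective ℚ A)).symm.toLinearMap ∘ₗ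
  LinearMap.codRestrict _ (GradedAlgebra.proj A.gr (0, 0))
    (fun x => by rw [← gr_zero_eq_range, GradedAlgebra.proj_apply]; exact Subtype.property _)

theorem augLin_one : A.augLin 1 = 1 := by
  rw [augLin, LinearMap.comp_apply]
  apply (LinearEquiv.symm_apply_eq _).2
  ext
  have h : (1 : A) ∈ A.gr (0, 0) := SetLike.GradedOne.one_mem
  change GradedAlgebra.proj A.gr (0, 0) 1 = algebraMap ℚ A 1
  rw [GradedAlgebra.proj_apply, DirectSum.decompose_of_mem_same _ h, map_one]

theorem augLin_of_ne {i : ℤ × ℕ} (hi : i ≠ (0, 0)) {x : A} (hx : x ∈ A.gr i) : A.augLin x = 0 := by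
  rw [augLin, LinearMap.comp_apply]
  apply (LinearEquiv.symm_apply_eq _).2
  ext
  simp [GradedAlgebra.proj_apply, DirectSum.decompose_of_mem_ne _ hx hi]

theorem eq_smul_one {x : A} (hx : x ∈ A.gr (0, 0)) : x = A.augLin x • (1 : A) := by
  rw [A.gr_zero_eq_range] at hx
  obtain ⟨q, rfl⟩ := hx
  rw [Algebra.linearMap_apply, Algebra.algebraMap_eq_smul_one, map_smul, augLin_one]
  simp

theorem augLin_of_pos {n : ℤ} {r : ℕ} (hr : 0 < r) {x : A} (hx : x ∈ A.gr (n, r)) :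
    A.augLin x = 0 :=
  augLin_of_ne (by rintro h; simp only [Prod.mk.injEq] at h; omega) hx

/-- An element of `A(0)` is a multiple of `1`. -/
theorem eq_smul_one' {n : ℤ} {x : A} (hx : x ∈ A.gr (n, 0)) : x = A.augLin x • (1 : A) := by
  by_cases hn : n = 0
  · subst hn; exact eq_smul_one hx
  · rw [A.gr_ne_zero n hn, Submodule.mem_bot] at hx
    rw [hx]; simp

theorem augLin_mul (x y : A) : A.augLin (x * y) = A.augLin x * A.augLin y := by
  induction x using gr_induction with
  | h0 => simp
  | ha x z hx hz => simp only [add_mul, map_add, hx, hz]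
  | h n r x hx =>
    rcases Nat.eq_zero_or_pos r with rfl | hr
    · rw [eq_smul_one' hx, smul_mul_assoc, one_mul, map_smul, map_smul, augLin_one]
      simp
    · rw [augLin_of_pos hr hx, zero_mul]
      induction y using gr_induction with
      | h0 => simp
      | ha y z hy hz => simp only [mul_add, map_add, hy, hz, add_zero]
      | h m s y hy =>
        exact augLin_of_pos (n := n + m) (r := r + s) (by omega) (SetLike.GradedMul.mul_mem hx hy)

/-- The canonical augmentation `A → A(0) = ℚ`. -/
noncomputable def aug (A : AdamsCDGA.{u}) : A →ₐ[ℚ] ℚ :=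
  AlgHom.ofLinearMap A.augLin augLin_one augLin_mul

theorem gr_le_plus {n : ℤ} {r : ℕ} (hr : 0 < r) : A.gr (n, r) ≤ A.plus :=
  le_iSup (fun i : {i : ℤ × ℕ // 0 < i.2} => A.gr i) ⟨(n, r), hr⟩

@[elab_as_elim]
theorem plus_induction {p : ∀ x : A, x ∈ A.plus → Prop}
    (h : ∀ n r, ∀ hr : 0 < r, ∀ x, ∀ hx : x ∈ A.gr (n, r), p x (gr_le_plus hr hx))
    (h0 : p 0 (zero_mem _))
    (ha : ∀ x y hx hy, p x hx → p y hy → p (x + y) (add_mem hx hy)) {x : A} (hx : x ∈ A.plus) :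
    p x hx :=
  Submodule.iSup_induction' (fun i : {i : ℤ × ℕ // 0 < i.2} => A.gr i) (motive := p)
    (fun i x hx => h i.1.1 i.1.2 i.2 x hx) h0 ha hx

theorem aug_of_mem_plus {x : A} (hx : x ∈ A.plus) : A.aug x = 0 := by
  induction hx using plus_induction with
  | h n r hr x hx => exact augLin_of_pos hr hx
  | h0 => simp
  | ha x y _ _ hx hy => rw [map_add, hx, hy, add_zero]

theorem sub_aug_mem_plus (x : A) : x - A.aug x • (1 : A) ∈ A.plus := by
  induction x using gr_induction with
  | h0 => simp
  | ha x z hx hz =>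
    rw [map_add, add_smul, add_sub_add_comm]
    exact add_mem hx hz
  | h n r x hx =>
    rcases Nat.eq_zero_or_pos r with rfl | hr
    · rw [show x - A.aug x • (1 : A) = 0 from sub_eq_zero.2 (eq_smul_one' hx)]
      exact zero_mem _
    · rw [aug_of_mem_plus (gr_le_plus hr hx), zero_smul, sub_zero]
      exact gr_le_plus hr hx

theorem d_mem_plus {x : A} (hx : x ∈ A.plus) : A.d x ∈ A.plus := by
  induction hx using plus_induction with
  | h n r hr x hx => exact gr_le_plus hr (A.d_mem _ _ _ hx)
  | h0 => simp
  | ha x y _ _ hx hy => rw [map_add]; exact add_mem hx hy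

theorem Hom.aug_comp (f : Hom A B) (x : A) : B.aug (f x) = A.aug x := by
  induction x using gr_induction with
  | h0 => simp
  | ha x z hx hz => simp only [map_add, hx, hz]
  | h n r x hx =>
    rcases Nat.eq_zero_or_pos r with rfl | hr
    · rw [eq_smul_one' hx]; simp
    · rw [aug_of_mem_plus (gr_le_plus hr hx), aug_of_mem_plus (gr_le_plus hr (f.map_gr' hx))]

section Fiber

variable {N : AdamsCDGA.{u}} (φ : Hom N A)

/-- The ideal of `A` generated by the image of `N₊`. -/
def fiberIdeal : Ideal A := Ideal.span (φ '' {n : N | ∃ i : ℤ × ℕ, 0 < i.2 ∧ n ∈ N.gr i})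

theorem map_mem_fiberIdeal {n : N} (hn : n ∈ N.plus) : φ n ∈ fiberIdeal φ := by
  induction hn using plus_induction with
  | h n r hr x hx => exact Ideal.subset_span ⟨x, ⟨(n, r), hr, hx⟩, rfl⟩
  | h0 => simp
  | ha x y _ _ hx hy => rw [map_add]; exact add_mem hx hy

theorem fiberIdeal_homogeneous : (fiberIdeal φ).IsHomogeneous A.gr := by
  apply Ideal.homogeneous_span
  rintro _ ⟨n, ⟨i, -, hn⟩, rfl⟩
  exact ⟨i, φ.map_gr' hn⟩

instance : (fiberIdeal φ).IsTwoSided := by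
  refine ⟨fun {a} b ha => ?_⟩
  revert b
  refine Submodule.span_induction (p := fun a _ => ∀ b, a * b ∈ fiberIdeal φ) ?_ ?_ ?_ ?_ ha
  · rintro _ ⟨n, ⟨i, hi, hn⟩, rfl⟩ b
    induction b using gr_induction with
    | h0 => simp
    | ha x z hx hz => rw [mul_add]; exact add_mem hx hz
    | h m r b hb =>
      rw [A.comm i.1 m i.2 r _ _ (φ.map_gr' hn) hb, ← smul_mul_assoc]
      exact Ideal.mul_mem_left _ _ (Ideal.subset_span ⟨n, ⟨i, hi, hn⟩, rfl⟩)
  · intro b; simp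
  · intro x y _ _ hx hy b
    rw [add_mul]; exact add_mem (hx b) (hy b)
  · intro c x _ hx b
    rw [smul_eq_mul, mul_assoc]
    exact Ideal.mul_mem_left _ _ (hx b)

theorem J_mem_fiberIdeal {x : A} (hx : x ∈ fiberIdeal φ) (c : ℤ → ℚ) :
    A.scale c x ∈ fiberIdeal φ := by
  classical
  rw [← DirectSum.sum_support_decompose A.gr x, map_sum]
  refine sum_mem fun i _ => ?_
  rw [scale_of_mem_gr c (Subtype.property _), Algebra.smul_def]
  exact Ideal.mul_mem_left _ _ (fiberIdeal_homogeneous φ i hx)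

theorem d_mem_fiberIdeal {x : A} (hx : x ∈ fiberIdeal φ) : A.d x ∈ fiberIdeal φ := by
  refine Submodule.span_induction (p := fun a _ => A.d a ∈ fiberIdeal φ) ?_ ?_ ?_ ?_ hx
  · rintro _ ⟨n, ⟨i, hi, hn⟩, rfl⟩
    rw [← φ.map_d']
    exact map_mem_fiberIdeal φ (d_mem_plus (gr_le_plus hi hn))
  · simp
  · intro x y _ _ hx hy
    rw [map_add]; exact add_mem hx hy
  · intro c x hx h
    rw [smul_eq_mul, d_mul]
    exact add_mem (Ideal.mul_mem_left _ _ hx) (Ideal.mul_mem_left _ _ h)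

end Fiber

end AdamsCDGA

/-- The images of the homogeneous components decompose the quotient by a homogeneous subspace. -/
theorem isInternal_map {A Q : Type*} [AddCommGroup A] [Module ℚ A] [AddCommGroup Q] [Module ℚ Q]
    (gr : ℤ × ℕ → Submodule ℚ A) [DirectSum.Decomposition gr] (π : A →ₗ[ℚ] Q)
    (hπ : Function.Surjective π)
    (hker : ∀ x, π x = 0 → ∀ i, π (DirectSum.decompose gr x i) = 0) :
    DirectSum.IsInternal (fun i => (gr i).map π) := by
  classical
  let F : (DirectSum (ℤ × ℕ) fun i => gr i) →+ DirectSum (ℤ × ℕ) fun i => ((gr i).map π) :=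
    DFinsupp.mapRange.addMonoidHom (fun i => (π.submoduleMap (gr i)).toAddMonoidHom)
  have hF : ∀ z i, ((F z i : (gr i).map π) : Q) = π (z i) := fun _ _ => rfl
  have hFs : Function.Surjective F :=
    (DFinsupp.mapRange_surjective _ (fun i => map_zero _)).2
      (fun i => LinearMap.submoduleMap_surjective π (gr i))
  have hsum : ∀ z, DirectSum.coeAddMonoidHom (fun i => (gr i).map π) (F z) =
      π (DirectSum.coeAddMonoidHom gr z) := by
    intro z
    induction z using DirectSum.induction_on with
    | zero => simp
    | of i x =>
      have : F (DirectSum.of _ i x) = DirectSum.of _ i (π.submoduleMap (gr i) x) :=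
        DFinsupp.mapRange_single (hf := fun i => map_zero (π.submoduleMap (gr i)))
      rw [this, DirectSum.coeAddMonoidHom_of, DirectSum.coeAddMonoidHom_of]
      rfl
    | add x y hx hy => simp only [map_add, hx, hy]
  constructor
  · rw [injective_iff_map_eq_zero]
    intro z hz
    obtain ⟨y, rfl⟩ := hFs z
    rw [hsum] at hz
    have h := hker _ hz
    have hy : DirectSum.decompose gr (DirectSum.coeAddMonoidHom gr y) = y :=
      DirectSum.Decomposition.right_inv y
    rw [hy] at h
    apply DFinsupp.ext
    intro i
    apply Subtype.ext
    rw [hF, h i]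
    rfl
  · intro q
    obtain ⟨a, rfl⟩ := hπ q
    refine ⟨F (DirectSum.decompose gr a), ?_⟩
    rw [hsum]
    congr 1
    exact DirectSum.Decomposition.left_inv a

namespace AdamsCDGA

variable {A N : AdamsCDGA.{u}} (φ : Hom N A)

/-- The projection `A → A ⊗_N ℚ`. -/
noncomputable def fiberMk : A →ₐ[ℚ] A ⧸ fiberIdeal φ := Ideal.Quotient.mkₐ ℚ (fiberIdeal φ)

theorem fiberMk_surjective : Function.Surjective (fiberMk φ) := Ideal.Quotient.mk_surjective

theorem fiberMk_eq_zero {x : A} : fiberMk φ x = 0 ↔ x ∈ fiberIdeal φ := Ideal.Quotient.eq_zero_iff_mem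

/-- The differential of `A ⊗_N ℚ`. -/
noncomputable def fiberD : (A ⧸ fiberIdeal φ) →ₗ[ℚ] (A ⧸ fiberIdeal φ) where
  toFun := QuotientAddGroup.map _ _ A.d.toAddMonoidHom (fun x hx => d_mem_fiberIdeal φ hx)
  map_add' := map_add _
  map_smul' r x := by
    obtain ⟨x, rfl⟩ := fiberMk_surjective φ x
    rw [← map_smul]
    exact congrArg (fiberMk φ) (map_smul A.d r x)

theorem fiberD_mk (x : A) : fiberD φ (fiberMk φ x) = fiberMk φ (A.d x) := rfl

theorem fiber_isInternal : DirectSum.IsInternal (fun i => (A.gr i).map (fiberMk φ).toLinearMap) :=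
  isInternal_map A.gr _ (fiberMk_surjective φ) (fun _ hx i =>
    (fiberMk_eq_zero φ).2 (fiberIdeal_homogeneous φ i ((fiberMk_eq_zero φ).1 hx)))

theorem aug_of_mem_fiberIdeal {x : A} (hx : x ∈ fiberIdeal φ) : A.aug x = 0 := by
  refine Submodule.span_induction (p := fun a _ => A.aug a = 0) ?_ ?_ ?_ ?_ hx
  · rintro _ ⟨n, ⟨i, hi, hn⟩, rfl⟩
    rw [φ.aug_comp, aug_of_mem_plus (gr_le_plus hi hn)]
  · simp
  · intro x y _ _ hx hy
    rw [map_add, hx, hy, add_zero]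
  · intro c x _ h
    rw [smul_eq_mul, map_mul, h, mul_zero]

/-- The fiber `A ⊗_N ℚ` over the augmentation of `N`: the quotient of `A` by the ideal generated by
`N₊`. -/
noncomputable def fiber : AdamsCDGA.{u} where
  carrier := A ⧸ fiberIdeal φ
  nontrivial := Ideal.Quotient.nontrivial_iff.2 (by
    intro h
    have : (1 : A) ∈ fiberIdeal φ := by rw [h]; trivial
    exact one_ne_zero ((map_one A.aug).symm.trans (aug_of_mem_fiberIdeal φ this)))
  gr i := (A.gr i).map (fiberMk φ).toLinearMap
  graded :=
    { one_mem := ⟨1, SetLike.GradedOne.one_mem, map_one (fiberMk φ)⟩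
      mul_mem := by
        rintro i j _ _ ⟨x, hx, rfl⟩ ⟨y, hy, rfl⟩
        exact ⟨x * y, SetLike.GradedMul.mul_mem hx hy, map_mul (fiberMk φ) x y⟩
      __ := (fiber_isInternal φ).chooseDecomposition }
  d := fiberD φ
  d_mem := by
    rintro n r _ ⟨x, hx, rfl⟩
    exact ⟨A.d x, A.d_mem n r x hx, rfl⟩
  d_d x := by
    obtain ⟨x, rfl⟩ := fiberMk_surjective φ x
    rw [fiberD_mk, fiberD_mk, A.d_d, map_zero]
  leibniz := by
    rintro n r _ y ⟨x, hx, rfl⟩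
    obtain ⟨y, rfl⟩ := fiberMk_surjective φ y
    have := congrArg (fiberMk φ) (A.leibniz n r x y hx)
    rw [map_add, map_smul, map_mul (fiberMk φ) (A.d x), map_mul (fiberMk φ) x] at this
    rw [AlgHom.toLinearMap_apply, ← map_mul, fiberD_mk, fiberD_mk, fiberD_mk, this]
  comm := by
    rintro n m r s _ _ ⟨x, hx, rfl⟩ ⟨y, hy, rfl⟩
    have := congrArg (fiberMk φ) (A.comm n m r s x y hx hy)
    rw [map_smul, map_mul, map_mul] at this
    exact this
  gr_zero := by
    rw [A.gr_zero, Submodule.map_one]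
  gr_ne_zero n hn := by rw [A.gr_ne_zero n hn, Submodule.map_bot]

/-- The projection `A → A ⊗_N ℚ` as a morphism. -/
noncomputable def fiberHom : Hom A (fiber φ) where
  __ := fiberMk φ
  map_gr _ x hx := ⟨x, hx, rfl⟩
  map_d _ := rfl

theorem fiberHom_apply (n : N) : fiberHom φ (φ n) = N.aug n • (1 : fiber φ) := by
  have h3 : fiberHom φ (φ (n - N.aug n • (1 : N))) = 0 :=
    (fiberMk_eq_zero φ).2 (map_mem_fiberIdeal φ (sub_aug_mem_plus n))
  rw [map_sub, map_sub, sub_eq_zero] at h3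
  rw [h3]
  simp

end AdamsCDGA

section GrSym

variable {A : Type u} [Ring A] [Algebra ℚ A] (E : ℤ × ℕ → Submodule ℚ A)

/-- The relations `x y = (-1)^{n m} y x` for `x` of degree `n` and `y` of degree `m`. -/
inductive SymRel : TensorAlgebra ℚ ↥(⨆ i, E i) → TensorAlgebra ℚ ↥(⨆ i, E i) → Prop
  | swap (i j : ℤ × ℕ) (x y : ↥(⨆ i, E i)) : (x : A) ∈ E i → (y : A) ∈ E j →
      SymRel (TensorAlgebra.ι ℚ x * TensorAlgebra.ι ℚ y)
        ((-1 : ℚ) ^ (i.1 * j.1) • (TensorAlgebra.ι ℚ y * TensorAlgebra.ι ℚ x))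

/-- `Sym^* E`, the free graded commutative algebra on the bigraded vector space `E`: the exterior
algebra on the part of odd degree tensored with the symmetric algebra on the part of even degree. -/
abbrev GrSym : Type u := RingQuot (SymRel E)

end GrSym

/-- The relations of `Sym^* E` hold in a graded commutative algebra containing `E`. -/
theorem symRel_lift {A : AdamsCDGA.{u}} (E : ℤ × ℕ → Submodule ℚ A) (hE : ∀ i, E i ≤ A.gr i)
    ⦃x y : TensorAlgebra ℚ ↥(⨆ i, E i)⦄ (h : SymRel E x y) :
    TensorAlgebra.lift ℚ (⨆ i, E i).subtype x = TensorAlgebra.lift ℚ (⨆ i, E i).subtype y := by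
  obtain ⟨i, j, x, y, hx, hy⟩ := h
  simp only [map_mul, map_smul, TensorAlgebra.lift_ι_apply, Submodule.subtype_apply]
  exact A.comm _ _ _ _ _ _ (hE i hx) (hE j hy)

/-- For a base algebra `B` and `f : B → A`: the `B`-subalgebra of `A` generated by the elements of
`E` of cohomological degree at most `n`. -/
noncomputable def subalgLE {A : AdamsCDGA.{u}} {B : Type*} [Ring B] [Algebra ℚ B]
    (f : B →ₐ[ℚ] A) (E : ℤ × ℕ → Submodule ℚ A) (n : ℤ) : Subalgebra ℚ A :=
  Algebra.adjoin ℚ (Set.range f ∪ {x | ∃ i : ℤ × ℕ, i.1 ≤ n ∧ x ∈ E i})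

/-- The subalgebras `A_{(n+1,q)}`: `A_{(n+1,0)} = A_{(n)}`, and `A_{(n+1,q+1)}` is generated by
`A_{(n)}` and the `x ∈ A_{(n+1)}` of degree `n + 1` with `d x ∈ A_{(n+1,q)}`. -/
noncomputable def stage {A : AdamsCDGA.{u}} {B : Type*} [Ring B] [Algebra ℚ B]
    (f : B →ₐ[ℚ] A) (E : ℤ × ℕ → Submodule ℚ A) (n : ℤ) : ℕ → Subalgebra ℚ A
  | 0 => subalgLE f E n
  | q + 1 => Algebra.adjoin ℚ ((subalgLE f E n : Set A) ∪
      {x | x ∈ subalgLE f E (n + 1) ∧ x ∈ A.deg (n + 1) ∧ A.d x ∈ stage f E n q})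

/-- The data of generators exhibiting `A` as generalized nilpotent over the base `B`, via
`f : B → A`. -/
structure Generators {A : AdamsCDGA.{u}} {B : Type*} [Ring B] [Algebra ℚ B]
    (f : B →ₐ[ℚ] A) where
  /-- the bigraded space of generators -/
  E : ℤ × ℕ → Submodule ℚ A
  E_le : ∀ i, E i ≤ A.gr i
  E_eq_bot : ∀ (n : ℤ) (r : ℕ), n ≤ 0 ∨ r = 0 → E (n, r) = ⊥
  free : Function.Bijective (TensorProduct.lift ((LinearMap.mul ℚ A).compl₁₂ f.toLinearMap
    (RingQuot.liftAlgHom ℚ (s := SymRel E)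
      ⟨TensorAlgebra.lift ℚ (⨆ i, E i).subtype, symRel_lift E E_le⟩ : GrSym E →ₐ[ℚ] A).toLinearMap))
  nilp : ∀ n : ℕ, ∀ x ∈ subalgLE f E (n + 1), ∃ q, x ∈ stage f E n q

/-- `A` is generalized nilpotent (over `ℚ`). -/
def AdamsCDGA.IsGenNilp (A : AdamsCDGA.{u}) : Prop :=
  Nonempty (Generators (A := A) (Algebra.ofId ℚ A))

section Connection

open AdamsCDGA

variable {N A : AdamsCDGA.{u}} {φ : Hom N A} (P : Generators φ.toAlgHom)

namespace Generators

/-- The inclusion `Sym^* E → A`. -/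
noncomputable def lift : GrSym P.E →ₐ[ℚ] A := RingQuot.liftAlgHom ℚ (s := SymRel P.E)
  ⟨TensorAlgebra.lift ℚ (⨆ i, P.E i).subtype, symRel_lift P.E P.E_le⟩

/-- The isomorphism `N ⊗ Sym^* E ≅ A`, `n ⊗ s ↦ n s`. -/
noncomputable def equiv : N ⊗[ℚ] GrSym P.E ≃ₗ[ℚ] A := LinearEquiv.ofBijective _ P.free

theorem equiv_tmul (n : N) (s : GrSym P.E) : P.equiv (n ⊗ₜ s) = φ n * P.lift s := rfl

/-- The projection `A ≅ N ⊗ Sym^* E → Sym^* E` given by the augmentation of `N`. -/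
noncomputable def toSym : A →ₗ[ℚ] GrSym P.E :=
  (TensorProduct.lid ℚ _).toLinearMap ∘ₗ N.aug.toLinearMap.rTensor _ ∘ₗ P.equiv.symm.toLinearMap

theorem toSym_mul (n : N) (a : A) : P.toSym (φ n * a) = N.aug n • P.toSym a := by
  obtain ⟨t, rfl⟩ := P.equiv.surjective a
  have h : φ n * P.equiv t = P.equiv ((LinearMap.mul ℚ N n).rTensor _ t) := by
    induction t with
    | zero => simp
    | add s t hs ht => simp only [map_add, mul_add, hs, ht]
    | tmul m s => simp [equiv_tmul, mul_assoc]
  rw [h]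
  simp only [toSym, LinearMap.comp_apply, LinearEquiv.coe_coe, LinearEquiv.symm_apply_apply]
  clear h
  induction t with
  | zero => simp
  | add s t hs ht => simp only [map_add, smul_add, hs, ht]
  | tmul m s => simp [mul_smul]

theorem toSym_of_mem {a : A} (ha : a ∈ fiberIdeal φ) : P.toSym a = 0 := by
  suffices h : ∀ c, P.toSym (c * a) = 0 by simpa using h 1
  refine Submodule.span_induction (p := fun a _ => ∀ c, P.toSym (c * a) = 0) ?_ ?_ ?_ ?_ ha
  · rintro _ ⟨n, ⟨i, hi, hn⟩, rfl⟩ c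
    induction c using gr_induction with
    | h0 => simp
    | ha x z hx hz => rw [add_mul, map_add, hx, hz, add_zero]
    | h m r c hc =>
      rw [A.comm m i.1 r i.2 _ _ hc (φ.map_gr' hn), map_smul, toSym_mul,
        aug_of_mem_plus (gr_le_plus hi hn), zero_smul, smul_zero]
  · intro c; simp
  · intro x y _ _ hx hy c
    rw [mul_add, map_add, hx, hy, add_zero]
  · intro b x _ h c
    rw [smul_eq_mul, ← mul_assoc, h]

/-- The identification `A ⊗_N ℚ → Sym^* E` given by the generators. -/
noncomputable def fiberToSym : fiber φ →ₗ[ℚ] GrSym P.E where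
  toFun := QuotientAddGroup.lift _ P.toSym.toAddMonoidHom (fun _ hx => P.toSym_of_mem hx)
  map_add' := map_add _
  map_smul' r x := by
    obtain ⟨x, rfl⟩ := fiberMk_surjective φ x
    exact map_smul P.toSym r x

theorem fiberToSym_mk (a : A) : P.fiberToSym (fiberHom φ a) = P.toSym a := rfl

/-- The identification `Sym^* E → A ⊗_N ℚ` given by the generators. -/
noncomputable def symToFiber : GrSym P.E →ₗ[ℚ] fiber φ :=
  (fiberHom φ).toAlgHom.toLinearMap ∘ₗ P.lift.toLinearMap

theorem fiberToSym_symToFiber (s : GrSym P.E) : P.fiberToSym (P.symToFiber s) = s := by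
  have h : P.lift s = P.equiv (1 ⊗ₜ s) := by rw [equiv_tmul, map_one, one_mul]
  change P.toSym (P.lift s) = s
  rw [h]
  simp [toSym]

theorem symToFiber_fiberToSym (x : fiber φ) : P.symToFiber (P.fiberToSym x) = x := by
  obtain ⟨a, rfl⟩ := fiberMk_surjective φ x
  change fiberHom φ (P.lift (P.toSym a)) = fiberHom φ a
  obtain ⟨t, rfl⟩ := P.equiv.surjective a
  induction t with
  | zero => simp
  | add s t hs ht => simp only [map_add, hs, ht]
  | tmul n s =>
    have h1 : P.toSym (P.equiv (n ⊗ₜ s)) = N.aug n • s := by simp [toSym]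
    rw [h1, equiv_tmul, map_mul, fiberHom_apply]
    simp

/-- The component `d⁰` of the differential of `A` restricted to `Sym^* E`. -/
noncomputable def dZero : GrSym P.E →ₗ[ℚ] GrSym P.E := P.toSym ∘ₗ A.d ∘ₗ P.lift.toLinearMap

theorem symToFiber_dZero (s : GrSym P.E) : P.symToFiber (P.dZero s) = (fiber φ).d (P.symToFiber s) := by
  change P.symToFiber (P.fiberToSym (fiberHom φ (A.d (P.lift s)))) = _
  rw [symToFiber_fiberToSym]
  rfl

/-- The flat connection `Γ : Sym^* E → N⁺ ⊗ Sym^* E`: the component in `N⁺ ⊗ Sym^* E` of the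
differential of `A = N ⊗ Sym^* E` restricted to `1 ⊗ Sym^* E`. -/
noncomputable def Γ : GrSym P.E →ₗ[ℚ] N ⊗[ℚ] GrSym P.E :=
  (LinearMap.id - Algebra.linearMap ℚ N ∘ₗ N.aug.toLinearMap).rTensor _ ∘ₗ
    P.equiv.symm.toLinearMap ∘ₗ A.d ∘ₗ P.lift.toLinearMap

/-- The connection `Γ`, transported to `A ⊗_N ℚ ≅ Sym^* E`. -/
noncomputable def conn : fiber φ →ₗ[ℚ] N ⊗[ℚ] fiber φ :=
  P.symToFiber.lTensor N ∘ₗ P.Γ ∘ₗ P.fiberToSym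

end Generators

end Connection

section BarConnection

variable {V M : Type*} [AddCommGroup V] [Module ℚ V] [AddCommGroup M] [Module ℚ M]

/-- The extension of a connection `Γ : V → M ⊗ V` of degree `1` to words, as a derivation:
`[x₁|…|xₙ] ↦ ∑ᵢ ± m ⊗ [x₁|…|y|…|xₙ]` for `Γ xᵢ = ∑ m ⊗ y`. The sign is the Koszul sign of moving
`Γ` and then `m` past `x₁, …, xᵢ₋₁`, where letters of degree `n` have degree `n - 1`; `J` and `JM`
are the operators `(-1)ⁿ` on the parts of degree `n` of `V` and `M`. -/
noncomputable def barConn (JM : M →ₗ[ℚ] M) (J : V →ₗ[ℚ] V) (Γ : V →ₗ[ℚ] M ⊗[ℚ] V) :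
    Word V →ₗ[ℚ] M ⊗[ℚ] Word V :=
  wordRec 0
    (TensorProduct.curry ((TensorProduct.lift (cons (V := V))).lTensor M ∘ₗ
      (TensorProduct.assoc ℚ M V (Word V)).toLinearMap) ∘ₗ Γ)
    (TensorProduct.mapBilinear (RingHom.id ℚ) M (Word V) M (Word V)
        ((1 / 2 : ℚ) • (LinearMap.id + JM)) ∘ₗ cons ∘ₗ (-J) +
      TensorProduct.mapBilinear (RingHom.id ℚ) M (Word V) M (Word V)
        ((1 / 2 : ℚ) • (LinearMap.id - JM)) ∘ₗ cons)

end BarConnection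

section Connected

open AdamsCDGA

/-- The homogeneous elements of `A` of positive cohomological degree and positive Adams degree. -/
def posSet (A : AdamsCDGA.{u}) : Set A := {x | ∃ i : ℤ × ℕ, 1 ≤ i.1 ∧ 1 ≤ i.2 ∧ x ∈ A.gr i}

theorem isConnected_of_adjoin {A : AdamsCDGA.{u}} (h : Algebra.adjoin ℚ (posSet A) = ⊤) :
    A.IsConnected := by
  have hm : ∀ x ∈ Submonoid.closure (posSet A),
      ∃ i : ℤ × ℕ, (i = (0, 0) ∨ 1 ≤ i.1) ∧ x ∈ A.gr i := by
    intro x hx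
    induction hx using Submonoid.closure_induction with
    | mem x hx =>
      obtain ⟨i, h1, _, hi⟩ := hx
      exact ⟨i, Or.inr h1, hi⟩
    | one => exact ⟨(0, 0), Or.inl rfl, SetLike.GradedOne.one_mem⟩
    | mul x y _ _ hx hy =>
      obtain ⟨i, hi, hx⟩ := hx
      obtain ⟨j, hj, hy⟩ := hy
      refine ⟨i + j, ?_, SetLike.GradedMul.mul_mem hx hy⟩
      rcases hi with rfl | hi <;> rcases hj with rfl | hj
      · exact Or.inl rfl
      · exact Or.inr (by simpa using hj)
      · exact Or.inr (by simpa using hi)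
      · exact Or.inr (by rw [Prod.fst_add]; omega)
  intro n r hr hn
  rw [Submodule.eq_bot_iff]
  intro x hx
  have hs : x ∈ Submodule.span ℚ (Submonoid.closure (posSet A) : Set A) := by
    rw [← Algebra.adjoin_eq_span, h]; trivial
  have hp : GradedAlgebra.proj A.gr (n, r) x = 0 := by
    clear hx
    induction hs using Submodule.span_induction with
    | zero => simp
    | add a b _ _ ha hb => rw [map_add, ha, hb, add_zero]
    | smul q a _ ha => rw [map_smul, ha, smul_zero]
    | mem a ha =>
      obtain ⟨i, hi, ha⟩ := hm a ha
      rw [GradedAlgebra.proj_apply, DirectSum.decompose_of_mem_ne _ ha]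
      rintro rfl
      rcases hi with hi | hi
      · simp only [Prod.mk.injEq] at hi; omega
      · simp only at hi; omega
  rwa [GradedAlgebra.proj_apply, DirectSum.decompose_of_mem_same _ hx] at hp

theorem Generators.adjoin_eq_top {A : AdamsCDGA.{u}} {B : Type*} [Ring B] [Algebra ℚ B]
    {f : B →ₐ[ℚ] A} (P : Generators f) (hf : ∀ b, f b ∈ Algebra.adjoin ℚ (posSet A)) :
    Algebra.adjoin ℚ (posSet A) = ⊤ := by
  rw [Algebra.eq_top_iff]
  intro a
  obtain ⟨t, rfl⟩ := P.free.2 a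
  induction t with
  | zero => rw [map_zero]; exact zero_mem _
  | add s t hs ht => rw [map_add]; exact add_mem hs ht
  | tmul b s =>
    obtain ⟨s, rfl⟩ := RingQuot.mkAlgHom_surjective ℚ (SymRel P.E) s
    rw [TensorProduct.lift.tmul]
    simp only [LinearMap.compl₁₂_apply, AlgHom.toLinearMap_apply, LinearMap.mul_apply',
      RingQuot.liftAlgHom_mkAlgHom_apply]
    refine mul_mem (hf b) ?_
    induction s using TensorAlgebra.induction with
    | algebraMap q => rw [AlgHom.commutes]; exact Subalgebra.algebraMap_mem _ _
    | add x y hx hy => rw [map_add]; exact add_mem hx hy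
    | mul x y hx hy => rw [map_mul]; exact mul_mem hx hy
    | ι v =>
      rw [TensorAlgebra.lift_ι_apply]
      have hle : (⨆ i, P.E i) ≤ Subalgebra.toSubmodule (Algebra.adjoin ℚ (posSet A)) := by
        refine iSup_le fun i x hx => ?_
        by_cases hi : i.1 ≤ 0 ∨ i.2 = 0
        · rw [P.E_eq_bot i.1 i.2 hi, Submodule.mem_bot] at hx
          rw [hx]; exact zero_mem _
        · exact Algebra.subset_adjoin ⟨i, by omega, by omega, P.E_le i hx⟩
      exact hle v.2

theorem AdamsCDGA.IsGenNilp.adjoin_eq_top {N : AdamsCDGA.{u}} (h : N.IsGenNilp) :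
    Algebra.adjoin ℚ (posSet N) = ⊤ := by
  obtain ⟨P⟩ := h
  exact P.adjoin_eq_top (fun b => Subalgebra.algebraMap_mem _ b)

/-- Generalized nilpotent algebras are connected. -/
theorem AdamsCDGA.IsGenNilp.isConnected {N : AdamsCDGA.{u}} (h : N.IsGenNilp) : N.IsConnected :=
  isConnected_of_adjoin h.adjoin_eq_top

/-- An algebra that is generalized nilpotent over a generalized nilpotent algebra is connected. -/
theorem Generators.isConnected {N A : AdamsCDGA.{u}} {φ : Hom N A} (hN : N.IsGenNilp)
    (P : Generators φ.toAlgHom) : A.IsConnected := by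
  refine isConnected_of_adjoin (P.adjoin_eq_top fun b => ?_)
  have hb : b ∈ Algebra.adjoin ℚ (posSet N) := by rw [hN.adjoin_eq_top]; trivial
  have : φ.toAlgHom b ∈ (Algebra.adjoin ℚ (posSet N)).map φ.toAlgHom := ⟨b, hb, rfl⟩
  rw [AlgHom.map_adjoin] at this
  refine Algebra.adjoin_mono ?_ this
  rintro _ ⟨x, ⟨i, h1, h2, hx⟩, rfl⟩
  exact ⟨i, h1, h2, φ.map_gr' hx⟩

/-- The fiber `A ⊗_N ℚ` of a connected algebra is connected. -/
theorem AdamsCDGA.IsConnected.fiber {N A : AdamsCDGA.{u}} (hA : A.IsConnected) (φ : Hom N A) :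
    (AdamsCDGA.fiber φ).IsConnected := by
  intro n r hr hn
  change (A.gr (n, r)).map _ = ⊥
  rw [hA n r hr hn, Submodule.map_bot]

end Connected

section RelBar

open AdamsCDGA

variable {N A : AdamsCDGA.{u}} (φ : Hom N A) (ε : Hom A N)

/-- The augmentation ideal of the augmentation `ε : A → N`. -/
def augIdeal : Submodule ℚ A := LinearMap.ker ε.toAlgHom.toLinearMap

theorem mem_augIdeal {x : A} : x ∈ augIdeal ε ↔ ε x = 0 := Iff.rfl

/-- The differential on the augmentation ideal. -/
noncomputable def augIdeal.d : augIdeal ε →ₗ[ℚ] augIdeal ε :=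
  A.d.restrict (fun x hx => by
    rw [mem_augIdeal] at hx ⊢
    rw [ε.map_d', hx, map_zero])

/-- The sign operator on the augmentation ideal. -/
noncomputable def augIdeal.J : augIdeal ε →ₗ[ℚ] augIdeal ε :=
  A.J.restrict (fun x hx => by
    rw [mem_augIdeal] at hx ⊢
    rw [ε.map_J, hx, map_zero])

/-- The product on the augmentation ideal. -/
noncomputable def augIdeal.mul : augIdeal ε →ₗ[ℚ] augIdeal ε →ₗ[ℚ] augIdeal ε :=
  LinearMap.mk₂ ℚ (fun x y => ⟨x * y, by rw [mem_augIdeal, map_mul, (mem_augIdeal ε).1 x.2, zero_mul]⟩)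
    (fun x y z => Subtype.ext (add_mul (x : A) y z))
    (fun r x z => Subtype.ext (smul_mul_assoc r (x : A) z))
    (fun z x y => Subtype.ext (mul_add (z : A) x y))
    (fun r z x => Subtype.ext (mul_smul_comm r (z : A) x))

/-- The left action of `N` on the augmentation ideal. -/
noncomputable def augIdeal.smulL : N →ₗ[ℚ] augIdeal ε →ₗ[ℚ] augIdeal ε :=
  LinearMap.mk₂ ℚ (fun n y => ⟨φ n * y, by rw [mem_augIdeal, map_mul, (mem_augIdeal ε).1 y.2, mul_zero]⟩)
    (fun x y z => Subtype.ext (by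
      change φ (x + y) * (z : A) = φ x * z + φ y * z
      rw [map_add, add_mul]))
    (fun r x z => Subtype.ext (by
      change φ (r • x) * (z : A) = r • (φ x * z)
      rw [map_smul, smul_mul_assoc]))
    (fun z x y => Subtype.ext (mul_add (φ z) x y))
    (fun r z x => Subtype.ext (mul_smul_comm r (φ z) (x : A)))

/-- The right action of `N` on the augmentation ideal. -/
noncomputable def augIdeal.smulR : augIdeal ε →ₗ[ℚ] N →ₗ[ℚ] augIdeal ε :=
  LinearMap.mk₂ ℚ (fun y n => ⟨y * φ n, by rw [mem_augIdeal, map_mul, (mem_augIdeal ε).1 y.2, zero_mul]⟩)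
    (fun x y z => Subtype.ext (add_mul (x : A) y (φ z)))
    (fun r x z => Subtype.ext (smul_mul_assoc r (x : A) (φ z)))
    (fun z x y => Subtype.ext (by
      change (z : A) * φ (x + y) = z * φ x + z * φ y
      rw [map_add, mul_add]))
    (fun r z x => Subtype.ext (by
      change (z : A) * φ (r • x) = r • (z * φ x)
      rw [map_smul, mul_smul_comm]))

/-- The differential of the (absolute) bar complex on words in the augmentation ideal. -/
noncomputable def augIdeal.bar : Word (augIdeal ε) →ₗ[ℚ] Word (augIdeal ε) :=
  barD (augIdeal.d ε) (augIdeal.J ε) (augIdeal.mul ε)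

/-- The relations between words expressing that the tensor product of letters is over `N`:
`[…|x n|y|…] = ± […|x|n y|…]`, where `±` is the Koszul sign of the shift between the letters. -/
inductive RelGen : Word (augIdeal ε) → Prop
  | base (x y : augIdeal ε) (n : N) (w : Word (augIdeal ε)) :
      RelGen (cons (augIdeal.smulR φ ε x n) (cons y w) -
        cons x (cons (augIdeal.smulL φ ε (N.J n) y) w))
  | cons (x : augIdeal ε) (w : Word (augIdeal ε)) : RelGen w → RelGen (cons x w)

/-- The span of the relations between words. -/
def relWord : Submodule ℚ (Word (augIdeal ε)) := Submodule.span ℚ {w | RelGen φ ε w}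

/-- The relations in `N ⊗ T(I)` defining the relative bar complex. -/
def relBarRel : Submodule ℚ (N ⊗[ℚ] Word (augIdeal ε)) :=
  Submodule.span ℚ ({t | ∃ n w, RelGen φ ε w ∧ t = n ⊗ₜ w} ∪
    {t | ∃ n m x w, t = n ⊗ₜ cons (augIdeal.smulL φ ε m x) w - (n * m) ⊗ₜ cons x w})

/-- The relative bar complex `B̄_N(A)`: the sum of the tensor powers over `N` of the
augmentation ideal `I` of `A`, as a quotient of `N ⊗ T(I)`. -/
abbrev RelBar : Type u := (N ⊗[ℚ] Word (augIdeal ε)) ⧸ relBarRel φ ε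

/-- The differential on `N ⊗ T(I)`. -/
noncomputable def preRelBarD : N ⊗[ℚ] Word (augIdeal ε) →ₗ[ℚ] N ⊗[ℚ] Word (augIdeal ε) :=
  N.d.rTensor _ + TensorProduct.map N.J (augIdeal.bar ε)

variable {φ ε}

theorem J_J (A : AdamsCDGA.{u}) (x : A) : A.J (A.J x) = x := by
  induction x using gr_induction with
  | h0 => simp
  | ha x z hx hz => simp only [map_add, hx, hz]
  | h n r x hx =>
    rw [J_of_mem (gr_le_deg _ _ hx), map_smul, J_of_mem (gr_le_deg _ _ hx), smul_smul,
      ← zpow_add₀ (by norm_num), ← two_mul, zpow_mul]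
    norm_num

theorem J_d (A : AdamsCDGA.{u}) (x : A) : A.J (A.d x) = -A.d (A.J x) := by
  induction x using gr_induction with
  | h0 => simp
  | ha x z hx hz => simp only [map_add, hx, hz]; abel
  | h n r x hx =>
    rw [J_of_mem (gr_le_deg _ _ hx), map_smul, J_of_mem (d_mem_deg (gr_le_deg _ _ hx)),
      zpow_add₀ (by norm_num)]
    simp

theorem J_mul (A : AdamsCDGA.{u}) (x y : A) : A.J (x * y) = A.J x * A.J y := by
  induction x using gr_induction with
  | h0 => simp
  | ha x z hx hz => simp only [add_mul, map_add, hx, hz]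
  | h n r x hx =>
    induction y using gr_induction with
    | h0 => simp
    | ha y z hy hz => simp only [mul_add, map_add, hy, hz]
    | h m s y hy =>
      rw [J_of_mem (gr_le_deg _ _ hx), J_of_mem (gr_le_deg _ _ hy),
        J_of_mem (mul_mem_deg (gr_le_deg _ _ hx) (gr_le_deg _ _ hy)), zpow_add₀ (by norm_num),
        smul_mul_smul_comm]

theorem cons_mem_relWord (x : augIdeal ε) {w : Word (augIdeal ε)} (hw : w ∈ relWord φ ε) :
    cons x w ∈ relWord φ ε := by
  induction hw using Submodule.span_induction with
  | zero => simp
  | add a b _ _ ha hb => rw [map_add]; exact add_mem ha hb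
  | smul r a _ ha => rw [map_smul]; exact Submodule.smul_mem _ _ ha
  | mem a ha => exact Submodule.subset_span (RelGen.cons x a ha)

theorem base_mem (x y : augIdeal ε) (n : N) (w : Word (augIdeal ε)) :
    cons (augIdeal.smulR φ ε x n) (cons y w) -
        cons x (cons (augIdeal.smulL φ ε (N.J n) y) w) ∈ relWord φ ε :=
  Submodule.subset_span (RelGen.base x y n w)

theorem merge_mem_relWord (z : augIdeal ε) {w : Word (augIdeal ε)} (hw : RelGen φ ε w) :
    merge (augIdeal.mul ε) z w ∈ relWord φ ε := by
  cases hw with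
  | cons x w hw =>
    rw [merge_cons]
    exact Submodule.subset_span (RelGen.cons _ _ hw)
  | base x y n w =>
    rw [map_sub, merge_cons, merge_cons]
    have h : augIdeal.mul ε z (augIdeal.smulR φ ε x n) =
        augIdeal.smulR φ ε (augIdeal.mul ε z x) n := Subtype.ext (mul_assoc (z : A) x (φ n)).symm
    rw [h]
    exact base_mem _ _ _ _

theorem base_merge_mem (x y : augIdeal ε) (n : N) (w : Word (augIdeal ε)) :
    cons (augIdeal.smulR φ ε x n) (merge (augIdeal.mul ε) y w) -
      cons x (merge (augIdeal.mul ε) (augIdeal.smulL φ ε (N.J n) y) w) ∈ relWord φ ε := by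
  have : Submodule.comap (cons (augIdeal.smulR φ ε x n) ∘ₗ merge (augIdeal.mul ε) y -
      cons x ∘ₗ merge (augIdeal.mul ε) (augIdeal.smulL φ ε (N.J n) y)) (relWord φ ε) = ⊤ := by
    apply word_top
    · simp
    · intro z w _
      rw [Submodule.mem_comap]
      simp only [LinearMap.sub_apply, LinearMap.comp_apply, merge_cons]
      have h : augIdeal.mul ε (augIdeal.smulL φ ε (N.J n) y) z =
          augIdeal.smulL φ ε (N.J n) (augIdeal.mul ε y z) := Subtype.ext (mul_assoc (φ _) (y : A) z)
      rw [h]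
      exact base_mem _ _ _ _
  have hw : w ∈ (⊤ : Submodule ℚ (Word (augIdeal ε))) := trivial
  rw [← this] at hw
  exact hw

theorem d_smulR (x : augIdeal ε) (n : N) : augIdeal.d ε (augIdeal.smulR φ ε x n) =
    augIdeal.smulR φ ε (augIdeal.d ε x) n +
      augIdeal.smulR φ ε (augIdeal.J ε x) (N.d n) := by
  apply Subtype.ext
  change A.d (x * φ n) = A.d x * φ n + A.J x * φ (N.d n)
  rw [d_mul, φ.map_d']

theorem d_smulL (n : N) (x : augIdeal ε) : augIdeal.d ε (augIdeal.smulL φ ε n x) =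
    augIdeal.smulL φ ε (N.d n) x + augIdeal.smulL φ ε (N.J n) (augIdeal.d ε x) := by
  apply Subtype.ext
  change A.d (φ n * x) = φ (N.d n) * x + φ (N.J n) * A.d x
  rw [d_mul, φ.map_d', φ.map_J]

theorem J_smulR (x : augIdeal ε) (n : N) : augIdeal.J ε (augIdeal.smulR φ ε x n) =
    augIdeal.smulR φ ε (augIdeal.J ε x) (N.J n) := by
  apply Subtype.ext
  change A.J (x * φ n) = A.J x * φ (N.J n)
  rw [J_mul, φ.map_J]

theorem J_smulL (n : N) (x : augIdeal ε) : augIdeal.J ε (augIdeal.smulL φ ε n x) =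
    augIdeal.smulL φ ε (N.J n) (augIdeal.J ε x) := by
  apply Subtype.ext
  change A.J (φ n * x) = φ (N.J n) * A.J x
  rw [J_mul, φ.map_J]

theorem bar_mem_relWord {w : Word (augIdeal ε)} (hw : RelGen φ ε w) :
    augIdeal.bar ε w ∈ relWord φ ε := by
  induction hw with
  | cons x w hw ih =>
    rw [augIdeal.bar, barD_cons]
    exact sub_mem (add_mem (Submodule.subset_span (RelGen.cons _ _ hw)) (merge_mem_relWord _ hw))
      (cons_mem_relWord _ ih)
  | base x y n w =>
    have hm : augIdeal.mul ε (augIdeal.smulR φ ε (augIdeal.J ε x) (N.J n)) y =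
        augIdeal.mul ε (augIdeal.J ε x) (augIdeal.smulL φ ε (N.J n) y) :=
      Subtype.ext (mul_assoc (A.J x) (φ (N.J n)) y)
    rw [augIdeal.bar, map_sub]
    simp only [barD_cons, merge_cons, d_smulR, d_smulL, J_smulR, J_smulL, J_J, map_add, map_sub,
      LinearMap.add_apply, hm]
    have e1 := base_mem (φ := φ) (augIdeal.d ε x) y n w
    have e2 := base_mem (φ := φ) (augIdeal.J ε x) y (N.d n) w
    rw [J_d, map_neg, LinearMap.neg_apply, map_neg, LinearMap.neg_apply, map_neg] at e2
    have e3 := base_mem (φ := φ) (augIdeal.J ε x) (augIdeal.d ε y) (N.J n) w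
    have e4 := base_merge_mem (φ := φ) (augIdeal.J ε x) (augIdeal.J ε y) (N.J n) w
    have e5 := base_mem (φ := φ) (augIdeal.J ε x) (augIdeal.J ε y) (N.J n)
      (barD (augIdeal.d ε) (augIdeal.J ε) (augIdeal.mul ε) w)
    rw [J_J] at e3 e4 e5
    convert add_mem (sub_mem (sub_mem (add_mem e1 e2) e3) e4) e5 using 1
    abel

theorem tmul_relWord_mem (n : N) {w : Word (augIdeal ε)} (hw : w ∈ relWord φ ε) :
    n ⊗ₜ w ∈ relBarRel φ ε := by
  induction hw using Submodule.span_induction with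
  | zero => simp
  | add a b _ _ ha hb => rw [TensorProduct.tmul_add]; exact add_mem ha hb
  | smul r a _ ha => rw [TensorProduct.tmul_smul]; exact Submodule.smul_mem _ _ ha
  | mem a ha => exact Submodule.subset_span (Or.inl ⟨n, a, ha, rfl⟩)

theorem left_mem (n m : N) (x : augIdeal ε) (w : Word (augIdeal ε)) :
    n ⊗ₜ cons (augIdeal.smulL φ ε m x) w - (n * m) ⊗ₜ cons x w ∈ relBarRel φ ε :=
  Submodule.subset_span (Or.inr ⟨n, m, x, w, rfl⟩)

theorem left_merge_mem (n m : N) (x : augIdeal ε) (w : Word (augIdeal ε)) :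
    n ⊗ₜ merge (augIdeal.mul ε) (augIdeal.smulL φ ε m x) w -
      (n * m) ⊗ₜ merge (augIdeal.mul ε) x w ∈ relBarRel φ ε := by
  have : Submodule.comap (TensorProduct.mk ℚ N _ n ∘ₗ
      merge (augIdeal.mul ε) (augIdeal.smulL φ ε m x) -
      TensorProduct.mk ℚ N _ (n * m) ∘ₗ merge (augIdeal.mul ε) x) (relBarRel φ ε) = ⊤ := by
    apply word_top
    · simp
    · intro z w _
      rw [Submodule.mem_comap]
      simp only [LinearMap.sub_apply, LinearMap.comp_apply, merge_cons, TensorProduct.mk_apply]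
      have h : augIdeal.mul ε (augIdeal.smulL φ ε m x) z =
          augIdeal.smulL φ ε m (augIdeal.mul ε x z) := Subtype.ext (mul_assoc (φ _) (x : A) z)
      rw [h]
      exact left_mem _ _ _ _
  have hw : w ∈ (⊤ : Submodule ℚ (Word (augIdeal ε))) := trivial
  rw [← this] at hw
  exact hw

theorem preRelBarD_mem (t : N ⊗[ℚ] Word (augIdeal ε)) (ht : t ∈ relBarRel φ ε) :
    preRelBarD ε t ∈ relBarRel φ ε := by
  induction ht using Submodule.span_induction with
  | zero => simp
  | add a b _ _ ha hb => rw [map_add]; exact add_mem ha hb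
  | smul r a _ ha => rw [map_smul]; exact Submodule.smul_mem _ _ ha
  | mem a ha =>
    rcases ha with ⟨n, w, hw, rfl⟩ | ⟨n, m, x, w, rfl⟩
    · exact add_mem (tmul_relWord_mem _ (Submodule.subset_span hw))
        (tmul_relWord_mem _ (bar_mem_relWord hw))
    · have e1 := left_mem (φ := φ) (N.d n) m x w
      have e2 := left_mem (φ := φ) (N.J n) (N.d m) x w
      have e3 := left_mem (φ := φ) (N.J n) (N.J m) (augIdeal.d ε x) w
      have e4 := left_merge_mem (φ := φ) (N.J n) (N.J m) (augIdeal.J ε x) w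
      have e5 := left_mem (φ := φ) (N.J n) (N.J m) (augIdeal.J ε x) (augIdeal.bar ε w)
      convert sub_mem (add_mem (add_mem (add_mem e1 e2) e3) e4) e5 using 1
      rw [map_sub]
      simp only [preRelBarD, LinearMap.add_apply, LinearMap.rTensor_tmul, TensorProduct.map_tmul]
      simp only [augIdeal.bar, barD_cons, d_smulL, J_smulL, d_mul, J_mul, map_add,
        LinearMap.add_apply, TensorProduct.add_tmul, TensorProduct.tmul_add, TensorProduct.tmul_sub]
      abel

variable (φ ε)

/-- The differential of the relative bar complex. -/
noncomputable def relBarD : RelBar φ ε →ₗ[ℚ] RelBar φ ε :=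
  Submodule.mapQ _ _ (preRelBarD ε) preRelBarD_mem

end RelBar

section RelBarReduction

open AdamsCDGA

variable {N A : AdamsCDGA.{u}} (φ : Hom N A) (ε : Hom A N)

/-- The reduction `[x₁|…|xₙ] ↦ [x̄₁|…|x̄ₙ]` of words in the augmentation ideal to words in
`A ⊗_N ℚ`. -/
noncomputable def wordReduce : Word (augIdeal ε) →ₗ[ℚ] Word (fiber φ) :=
  wmap ((fiberHom φ).toAlgHom.toLinearMap ∘ₗ (augIdeal ε).subtype)

variable {φ ε}

theorem aug_J (n : N) : N.aug (N.J n) = N.aug n := by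
  induction n using gr_induction with
  | h0 => simp
  | ha x z hx hz => simp only [map_add, hx, hz]
  | h n r x hx =>
    rcases Nat.eq_zero_or_pos r with rfl | hr
    · by_cases hn : n = 0
      · subst hn; rw [J_of_mem (gr_le_deg _ _ hx)]; simp
      · rw [N.gr_ne_zero n hn, Submodule.mem_bot] at hx
        rw [hx]; simp
    · rw [J_of_mem (gr_le_deg _ _ hx), map_smul, aug_of_mem_plus (gr_le_plus hr hx), smul_zero]

theorem wordReduce_cons (x : augIdeal ε) (w : Word (augIdeal ε)) :
    wordReduce φ ε (cons x w) = cons (fiberHom φ (x : A)) (wordReduce φ ε w) := wmap_cons _ _ _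

theorem wordReduce_relGen {w : Word (augIdeal ε)} (hw : RelGen φ ε w) : wordReduce φ ε w = 0 := by
  induction hw with
  | cons x w _ ih => rw [wordReduce_cons, ih, map_zero]
  | base x y n w =>
    have h1 : fiberHom φ (augIdeal.smulR φ ε x n : A) = N.aug n • fiberHom φ (x : A) := by
      change fiberHom φ (x * φ n) = _
      rw [map_mul, fiberHom_apply, mul_smul_comm, mul_one]
    have h2 : fiberHom φ (augIdeal.smulL φ ε (N.J n) y : A) = N.aug n • fiberHom φ (y : A) := by
      change fiberHom φ (φ (N.J n) * y) = _
      rw [map_mul, fiberHom_apply, smul_mul_assoc, one_mul, aug_J]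
    rw [map_sub]
    simp only [wordReduce_cons, h1, h2, map_smul, LinearMap.smul_apply, sub_self]

variable (φ ε)

/-- The reduction `B̄_N(A) → B̄_N(A) ⊗_N ℚ = B̄(A ⊗_N ℚ)`, `n [x₁|…|xₙ] ↦ ε_N(n) [x̄₁|…|x̄ₙ]`. -/
noncomputable def relReduce : RelBar φ ε →ₗ[ℚ] Word (fiber φ) :=
  (relBarRel φ ε).liftQ
    ((TensorProduct.lid ℚ _).toLinearMap ∘ₗ TensorProduct.map N.aug.toLinearMap (wordReduce φ ε)) (by
      rw [relBarRel, Submodule.span_le]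
      rintro _ (⟨n, w, hw, rfl⟩ | ⟨n, m, x, w, rfl⟩)
      · simp [wordReduce_relGen hw]
      · have h : fiberHom φ (augIdeal.smulL φ ε m x : A) = N.aug m • fiberHom φ (x : A) := by
          change fiberHom φ (φ m * x) = _
          rw [map_mul, fiberHom_apply, smul_mul_assoc, one_mul]
        simp [wordReduce_cons, h, TensorProduct.smul_tmul', mul_comm])

/-- The part of degree `1` of the augmentation ideal. -/
def augIdealOne : Submodule ℚ (augIdeal ε) := (A.deg 1).comap (augIdeal ε).subtype

/-- The map `N¹ ⊗ T(I¹) → N ⊗ T(I) → B̄_N(A)`, where `I` is the augmentation ideal of `A`. -/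
noncomputable def relOne : N.deg 1 ⊗[ℚ] Word (augIdealOne ε) →ₗ[ℚ] RelBar φ ε :=
  (relBarRel φ ε).mkQ ∘ₗ TensorProduct.map (N.deg 1).subtype (wmap (augIdealOne ε).subtype)

/-- The map `T(I¹) → B̄_N(A)`, `w ↦ 1 ⊗ w`. -/
noncomputable def relZero : Word (augIdealOne ε) →ₗ[ℚ] RelBar φ ε :=
  (relBarRel φ ε).mkQ ∘ₗ TensorProduct.mk ℚ N _ 1 ∘ₗ wmap (augIdealOne ε).subtype

/-- `θ` is the connection `H⁰(M) → N¹ ⊗ H⁰(M)` of the object `H⁰_N(B̄_N(A))`, where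
`M = B̄_N(A) ⊗_N ℚ` is the bar complex of `A ⊗_N ℚ`: for a cocycle `z` of degree `0` in `M`, lifted
to an element `1 ⊗ w` of `B̄_N(A)` with `w` a word of degree `0`, the differential of `1 ⊗ w` is in
`N¹ ⊗ T(I¹)`, and it reduces to `θ z`. -/
def IsRelConnection (θ : (fiber φ).χ →ₗ[ℚ] N ⊗[ℚ] Word (fiber φ)) : Prop :=
  ∀ z : (fiber φ).χ, ∃ (w : Word (augIdealOne ε)) (t : N.deg 1 ⊗[ℚ] Word (augIdealOne ε)),
    relReduce φ ε (relZero φ ε w) = (fiber φ).incl z.word ∧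
    relBarD φ ε (relZero φ ε w) = relOne φ ε t ∧
    TensorProduct.map (N.deg 1).subtype
      (wordReduce φ ε ∘ₗ wmap (augIdealOne ε).subtype) t = θ z

end RelBarReduction

/-- The infinitesimal coaction `χ_A → γ_N ⊗ χ_A` of an action of `G_N` on `G_A`: the coaction
`χ_A → χ_N ⊗ χ_A` followed by the projection of `χ_N` to its co-Lie algebra `γ_N = N¹`, the words of
length one. The values are considered as elements of `N ⊗ T(A)`. -/
noncomputable def GroupAction.infinitesimal {N A : AdamsCDGA.{u}} (β : GroupAction N.χ A.χ) :
    A.χ →ₗ[ℚ] N ⊗[ℚ] Word A :=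
  TensorProduct.map ((N.deg 1).subtype ∘ₗ pr₁ ∘ₗ AdamsCDGA.χ.word) (A.incl ∘ₗ AdamsCDGA.χ.word) ∘ₗ
    β.coaction.toLinearMap

/-- The connection `B̄(Γ)` on `H⁰(B̄(Sym^* E))`. -/
noncomputable def Generators.barΓ {N A : AdamsCDGA.{u}} {φ : AdamsCDGA.Hom N A}
    (P : Generators φ.toAlgHom) : (AdamsCDGA.fiber φ).χ →ₗ[ℚ] N ⊗[ℚ] Word (AdamsCDGA.fiber φ) :=
  barConn N.J (AdamsCDGA.fiber φ).J P.conn ∘ₗ (AdamsCDGA.fiber φ).incl ∘ₗ AdamsCDGA.χ.word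

end Adams

open Adams Adams.AdamsCDGA

/-! Write F for the fiber of A over N. All three algebras are connected, so `χ` consists of the
words in letters of degree one killed by `split₂`. Such words behave like iterated integrals: a word
is determined by its coefficient of length zero and by its contractions `ctr l`, in which a linear
form is applied to the first letter. Equalities of words and cocycle conditions can therefore be
checked on classes stable under contraction (`eq_zero_of_stable`, `word_hom_ext`,
`split₂_eq_zero_of_stable`), and a locally nilpotent connection can be integrated to a map into
words (`exists_integral`). Its curvature decides whether the integrals are cocycles.

Replacing every generator e by e - φ(ε e) gives an algebra section σ of A → F for which ε ∘ σ is the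
augmentation. Then A¹ = φ(N¹) ⊕ σ(F¹), and d σ - σ d sends F¹ into the products N¹ · F¹; this is a
connection Γ : F¹ → N¹ ⊗ F¹. The components of d² = 0 say that Γ commutes with the differential of F
(`δFull_d`) and is flat (`curv_Γ`). Flatness needs d F¹ to lie in the subalgebra generated by F¹,
and this is where the filtration in generalized nilpotence enters (`d_mem_adjoin`). Extended to
words as a derivation, Γ preserves cocycles (`split₂_D`).

For the exact sequence, the sum `nabla` of Γ on words and of the removal of the first letter is a
locally nilpotent connection over A whose curvature vanishes on the cocycles of F. Its integral
lifts cocycles of F to cocycles of A, so `χ` of A maps onto `χ` of F (`χMap_surjective`).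
Conversely, a function on G_A that is right invariant under s(G_N) is determined by its restriction
to K (`eq_zero_of_isInv`): the mixed N¹ ⊗ F¹ part of the cocycle condition turns contraction along N
into the connection on the restriction (`D_restrict`). Applied to functions composed with g ↦ g s(π
g)⁻¹, this gives K = ker π, and the semidirect product follows formally (`SplitExt`).

The conjugation action, evaluated on an invariant function x, is x(s(g) k s(g)⁻¹) = x(s(g) k), so
its coaction is read off from the coproduct; by `D_restrict` its infinitesimal part is Γ on words
(`infinitesimal_action`). An action is recovered from its infinitesimal coaction because the matrix
coefficients are words with prescribed initial value and contractions (`ext_infinitesimal`). It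
remains to identify Γ on words with the two connections of the theorem. If ε kills E, then σ is the
inclusion of the symmetric algebra and the signs in `barConn` are trivial in degree one
(`barΓ_apply`). In the relative bar complex, the differential of a lifted cocycle produces letters
with coefficients in N¹, which the relations over N carry to the front without sign
(`relBarD_relZero`); the functional `relSlice` shows that the resulting coefficient in N¹ is well
defined. -/

namespace Adams

/-! ### Contractions of words, integration of connections, curvature. -/

section Contraction

variable {V M X U : Type*} [AddCommGroup V] [Module ℚ V] [AddCommGroup M] [Module ℚ M]
  [AddCommGroup X] [Module ℚ X] [AddCommGroup U] [Module ℚ U]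

/-- Contraction of the first tensor factor with a linear form. -/
noncomputable def slice (l : Module.Dual ℚ V) : V ⊗[ℚ] M →ₗ[ℚ] M :=
  (TensorProduct.lid ℚ M).toLinearMap ∘ₗ l.rTensor M

@[simp] theorem slice_tmul (l : Module.Dual ℚ V) (v : V) (m : M) :
    slice l (v ⊗ₜ[ℚ] m) = l v • m := by simp [slice]

theorem slice_lTensor (l : Module.Dual ℚ V) (f : M →ₗ[ℚ] X) (t : V ⊗[ℚ] M) :
    slice l (f.lTensor V t) = f (slice l t) := by
  induction t with
  | zero => simp
  | add s t hs ht => simp only [map_add, hs, ht]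
  | tmul v m => simp

theorem slice_rTensor (l : Module.Dual ℚ U) (f : V →ₗ[ℚ] U) (t : V ⊗[ℚ] M) :
    slice l (f.rTensor M t) = slice (l ∘ₗ f) t := by
  induction t with
  | zero => simp
  | add s t hs ht => simp only [map_add, hs, ht]
  | tmul v m => simp

theorem slice_map (l : Module.Dual ℚ U) (f : V →ₗ[ℚ] U) (g : M →ₗ[ℚ] X) (t : V ⊗[ℚ] M) :
    slice l (TensorProduct.map f g t) = g (slice (l ∘ₗ f) t) := by
  induction t with
  | zero => simp
  | add s t hs ht => simp only [map_add, hs, ht]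
  | tmul v m => simp

theorem slice_add (l m : Module.Dual ℚ V) (t : V ⊗[ℚ] M) :
    slice (l + m) t = slice l t + slice m t := by
  simp [slice, LinearMap.rTensor_add]

/-- Elements of a tensor product are separated by the linear forms on the first factor. -/
theorem slice_ext {t t' : V ⊗[ℚ] M} (h : ∀ l : Module.Dual ℚ V, slice l t = slice l t') :
    t = t' := by
  classical
  let b := Module.Basis.ofVectorSpace ℚ V
  apply (TensorProduct.equivFinsuppOfBasisLeft b).injective
  have key : ∀ (t : V ⊗[ℚ] M) i, TensorProduct.equivFinsuppOfBasisLeft b t i =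
      slice (b.coord i) t := by
    intro t i
    induction t with
    | zero => simp
    | add s t hs ht => simp only [map_add, Finsupp.add_apply, hs, ht]
    | tmul v m => simp
  ext i
  rw [key, key, h]

/-- Contraction of the first letter of a word with a linear form. -/
noncomputable def ctr (l : Module.Dual ℚ V) : Word V →ₗ[ℚ] Word V := slice l ∘ₗ uncons

@[simp] theorem ctr_one (l : Module.Dual ℚ V) : ctr l 1 = 0 := by simp [ctr, LinearMap.comp_apply]

@[simp] theorem ctr_cons (l : Module.Dual ℚ V) (x : V) (w : Word V) : ctr l (cons x w) = l x • w := by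
  simp [ctr, LinearMap.comp_apply]

theorem ctr_apply (l : Module.Dual ℚ V) (w : Word V) : ctr l w = slice l (uncons w) := rfl

theorem ctr_wmap (l : Module.Dual ℚ U) (f : V →ₗ[ℚ] U) (w : Word V) :
    ctr l (wmap f w) = wmap f (ctr (l ∘ₗ f) w) := by
  rw [ctr_apply, uncons_wmap, slice_map, ctr_apply]

theorem ctr_add (l m : Module.Dual ℚ V) (w : Word V) : ctr (l + m) w = ctr l w + ctr m w :=
  slice_add l m _

theorem cons_uncons (w : Word V) :
    w = wcounit w • (1 : Word V) + TensorProduct.lift (cons (V := V)) (uncons w) := by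
  have : (LinearMap.id : Word V →ₗ[ℚ] Word V) =
      wcounit.smulRight 1 + TensorProduct.lift (cons (V := V)) ∘ₗ uncons := by
    apply word_ext
    · simp [LinearMap.comp_apply]
    · intro x w _
      simp [LinearMap.comp_apply]
  exact LinearMap.congr_fun this w

/-- The elements killed by `k` applications of a connection `M → V ⊗ M`. -/
noncomputable def nilFil (D : M →ₗ[ℚ] V ⊗[ℚ] M) : ℕ → Submodule ℚ M
  | 0 => ⊥
  | k + 1 => ⨅ l : Module.Dual ℚ V, (nilFil D k).comap (slice l ∘ₗ D)

theorem mem_nilFil_succ {D : M →ₗ[ℚ] V ⊗[ℚ] M} {k : ℕ} {m : M} :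
    m ∈ nilFil D (k + 1) ↔ ∀ l : Module.Dual ℚ V, slice l (D m) ∈ nilFil D k := by
  simp [nilFil, Submodule.mem_iInf]

theorem nilFil_mono (D : M →ₗ[ℚ] V ⊗[ℚ] M) : Monotone (nilFil D) := by
  apply monotone_nat_of_le_succ
  intro k
  induction k with
  | zero => exact bot_le
  | succ k ih =>
    intro m hm
    rw [mem_nilFil_succ] at hm ⊢
    exact fun l => ih (hm l)

/-- Each contraction shortens a word, and the empty word is killed by the first one. This lets
arguments about contractions run by induction on length without a grading on words. -/
theorem exists_mem_nilFil_uncons (w : Word V) : ∃ k, w ∈ nilFil (uncons (V := V)) k := by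
  have : (⨆ k, nilFil (uncons (V := V)) k) = ⊤ := by
    apply word_top
    · apply Submodule.mem_iSup_of_mem 1
      simp [mem_nilFil_succ]
    · intro x w hw
      rw [Submodule.mem_iSup_of_directed _ (nilFil_mono _).directed_le] at hw ⊢
      obtain ⟨k, hk⟩ := hw
      refine ⟨k + 1, mem_nilFil_succ.2 fun l => ?_⟩
      rw [uncons_cons, slice_tmul]
      exact Submodule.smul_mem _ _ hk
  rw [← Submodule.mem_iSup_of_directed _ (nilFil_mono _).directed_le, this]
  trivial

/-- A word is zero if it lies in a class of words that is stable under contraction of the first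
letter and whose members have no component in length zero. -/
theorem eq_zero_of_stable (p : Word V → Prop) (h0 : ∀ w, p w → wcounit w = 0)
    (hs : ∀ (l : Module.Dual ℚ V) (w), p w → p (ctr l w)) {w : Word V} (hw : p w) : w = 0 := by
  obtain ⟨k, hk⟩ := exists_mem_nilFil_uncons w
  induction k generalizing w with
  | zero => exact hk
  | succ k ih =>
    -- All contractions of `w` vanish by induction, and linear forms on the first factor separate
    -- tensors.
    have hu : uncons w = 0 := slice_ext fun l => by
      rw [map_zero]
      exact ih (hs l w hw) (mem_nilFil_succ.1 hk l)
    rw [cons_uncons w, h0 w hw, hu]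
    simp

/-- Two linear maps into words agree if they agree in length zero and intertwine the contractions
with the same operators. -/
theorem word_hom_ext {f g : M →ₗ[ℚ] Word V} (D : Module.Dual ℚ V → M → M)
    (h0 : ∀ m, wcounit (f m) = wcounit (g m)) (hf : ∀ l m, ctr l (f m) = f (D l m))
    (hg : ∀ l m, ctr l (g m) = g (D l m)) : f = g := by
  ext m
  rw [← sub_eq_zero]
  refine eq_zero_of_stable (fun w => ∃ m, w = f m - g m) ?_ ?_ ⟨m, rfl⟩
  · rintro _ ⟨m, rfl⟩
    rw [map_sub, h0, sub_self]
  · rintro l _ ⟨m, rfl⟩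
    exact ⟨D l m, by rw [map_sub, hf, hg]⟩

/-- The approximations of the integral of a connection. -/
noncomputable def preIntegral (D : M →ₗ[ℚ] V ⊗[ℚ] M) (c : M →ₗ[ℚ] ℚ) : ℕ → M →ₗ[ℚ] Word V
  | 0 => 0
  | k + 1 => c.smulRight 1 +
      TensorProduct.lift (cons (V := V)) ∘ₗ (preIntegral D c k).lTensor V ∘ₗ D

/-- The k-th approximation contains the words of length less than k, and k applications of the
connection already kill the vector, so longer words do not occur in its integral. -/
theorem preIntegral_eq_succ (D : M →ₗ[ℚ] V ⊗[ℚ] M) (c : M →ₗ[ℚ] ℚ) (k : ℕ) {m : M}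
    (hm : m ∈ nilFil D k) : preIntegral D c (k + 1) m = preIntegral D c k m := by
  induction k generalizing m with
  | zero =>
    obtain rfl : m = 0 := hm
    simp
  | succ k ih =>
    have : (preIntegral D c (k + 1)).lTensor V (D m) = (preIntegral D c k).lTensor V (D m) :=
      slice_ext fun l => by
        rw [slice_lTensor, slice_lTensor]
        exact ih (mem_nilFil_succ.1 hm l)
    change c.smulRight (1 : Word V) m + TensorProduct.lift _ ((preIntegral D c (k + 1)).lTensor V (D m)) = _
    rw [this]
    rfl

theorem preIntegral_eq (D : M →ₗ[ℚ] V ⊗[ℚ] M) (c : M →ₗ[ℚ] ℚ) {k j : ℕ} (hkj : k ≤ j) {m : M}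
    (hm : m ∈ nilFil D k) : preIntegral D c j m = preIntegral D c k m := by
  induction j, hkj using Nat.le_induction with
  | base => rfl
  | succ j hj ih => rw [preIntegral_eq_succ D c j (nilFil_mono D hj hm), ih]

/-- A locally nilpotent connection integrates to a map into words, with prescribed component of
length zero. -/
theorem exists_integral (D : M →ₗ[ℚ] V ⊗[ℚ] M) (c : M →ₗ[ℚ] ℚ) (hD : ∀ m, ∃ k, m ∈ nilFil D k) :
    ∃ L : M →ₗ[ℚ] Word V, (∀ m, wcounit (L m) = c m) ∧ ∀ m, uncons (L m) = L.lTensor V (D m) := by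
  choose K hK using hD
  -- The exponent chosen for a vector is not linear in it; independence of the exponent is what
  -- makes the stable value a linear map.
  have hL : ∀ m k, m ∈ nilFil D k → preIntegral D c (K m) m = preIntegral D c k m := by
    intro m k hk
    rw [← preIntegral_eq D c (le_max_left (K m) k) (hK m),
      preIntegral_eq D c (le_max_right (K m) k) hk]
  let L : M →ₗ[ℚ] Word V :=
    { toFun := fun m => preIntegral D c (K m) m
      map_add' := fun x y => by
        have hx := nilFil_mono D (le_max_left (K x) (K y)) (hK x)
        have hy := nilFil_mono D (le_max_right (K x) (K y)) (hK y)
        rw [hL _ _ (add_mem hx hy), hL _ _ hx, hL _ _ hy, map_add]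
      map_smul' := fun r x => by
        rw [hL _ _ (Submodule.smul_mem _ r (hK x)), map_smul]
        rfl }
  -- The fixed point equation of the iteration: initial value plus one letter followed by the
  -- integral. Both claims are read off by separating length zero from positive length.
  have key : ∀ m, L m = c m • 1 + TensorProduct.lift (cons (V := V)) (L.lTensor V (D m)) := by
    intro m
    have h1 : L.lTensor V (D m) = (preIntegral D c (K m)).lTensor V (D m) :=
      slice_ext fun l => by
        rw [slice_lTensor, slice_lTensor]
        exact hL _ _ (mem_nilFil_succ.1 (nilFil_mono D (Nat.le_succ _) (hK m)) l)
    rw [h1]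
    exact hL m (K m + 1) (nilFil_mono D (Nat.le_succ _) (hK m))
  have e1 : ∀ t : V ⊗[ℚ] Word V, wcounit (TensorProduct.lift (cons (V := V)) t) = 0 := by
    intro t
    induction t with
    | zero => simp
    | add s t hs ht => rw [map_add, map_add, hs, ht, add_zero]
    | tmul x w => simp
  have e2 : ∀ t : V ⊗[ℚ] Word V, uncons (TensorProduct.lift (cons (V := V)) t) = t := by
    intro t
    induction t with
    | zero => simp
    | add s t hs ht => rw [map_add, map_add, hs, ht]
    | tmul x w => simp
  refine ⟨L, fun m => ?_, fun m => ?_⟩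
  · rw [key, map_add, e1, map_smul, wcounit_one]
    simp
  · conv_lhs => rw [key]
    rw [map_add, e2, map_smul, uncons_one, smul_zero, zero_add]

variable (d : V →ₗ[ℚ] U) (c : V →ₗ[ℚ] V →ₗ[ℚ] U)

/-- `x ⊗ m ↦ ∑ c x y ⊗ m'` for a connection `D m = ∑ y ⊗ m'`. -/
noncomputable def quad (D : M →ₗ[ℚ] V ⊗[ℚ] M) : V ⊗[ℚ] M →ₗ[ℚ] U ⊗[ℚ] M :=
  TensorProduct.lift ((LinearMap.lcomp ℚ _ D) ∘ₗ LinearMap.rTensorHom M ∘ₗ c)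

@[simp] theorem quad_tmul (D : M →ₗ[ℚ] V ⊗[ℚ] M) (x : V) (m : M) :
    quad c D (x ⊗ₜ m) = (c x).rTensor _ (D m) := by simp [quad]

theorem quad_add (D E : M →ₗ[ℚ] V ⊗[ℚ] M) (t : V ⊗[ℚ] M) :
    quad c (D + E) t = quad c D t + quad c E t := by
  induction t with
  | zero => simp
  | add s t hs ht => simp only [map_add, hs, ht]; abel
  | tmul x m => simp

theorem quad_zero (t : V ⊗[ℚ] M) : quad c (0 : M →ₗ[ℚ] V ⊗[ℚ] M) t = 0 := by
  simpa using quad_add c 0 0 t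

/-- The curvature of a connection `D : M → V ⊗ M`. -/
noncomputable def curv (D : M →ₗ[ℚ] V ⊗[ℚ] M) : M →ₗ[ℚ] U ⊗[ℚ] M :=
  (d.rTensor M + quad c D) ∘ₗ D

theorem curv_apply (D : M →ₗ[ℚ] V ⊗[ℚ] M) (m : M) :
    curv d c D m = d.rTensor M (D m) + quad c D (D m) := rfl

/-- Curvature only uses the connection twice, so it is natural for maps intertwining connections.
Applied to an integral, it expresses `headSplit` of the resulting word by the curvature of the
integrated connection. -/
theorem curv_map {D : M →ₗ[ℚ] V ⊗[ℚ] M} {E : X →ₗ[ℚ] V ⊗[ℚ] X} {L : M →ₗ[ℚ] X}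
    (hL : ∀ m, E (L m) = L.lTensor V (D m)) (m : M) :
    curv d c E (L m) = L.lTensor U (curv d c D m) := by
  rw [curv_apply, curv_apply, hL, map_add]
  generalize D m = t
  induction t with
  | zero => simp
  | add s t hs ht =>
    simp only [map_add]
    rw [add_add_add_comm, hs, ht]
    abel
  | tmul x m =>
    rw [LinearMap.lTensor_tmul, quad_tmul, quad_tmul, hL, LinearMap.rTensor_tmul,
      LinearMap.rTensor_tmul, LinearMap.lTensor_tmul,
      ← LinearMap.comp_apply (LinearMap.rTensor _ _), LinearMap.rTensor_comp_lTensor,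
      ← LinearMap.lTensor_comp_rTensor, LinearMap.comp_apply]

/-- The component of `split₂` in which the empty word precedes the distinguished letter. -/
noncomputable def headSplit : Word V →ₗ[ℚ] U ⊗[ℚ] Word V := curv d c uncons

@[simp] theorem headSplit_one : headSplit d c 1 = 0 := by simp [headSplit, curv_apply]

@[simp] theorem headSplit_cons (x : V) (w : Word V) :
    headSplit d c (cons x w) = d x ⊗ₜ w + (c x).rTensor _ (uncons w) := by
  simp [headSplit, curv_apply]

/-- The letter on which the differential acts is either at the front or preceded by the first letter
of the word. Iterating this reduces the cocycle condition to `headSplit` on all iterated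
contractions. -/
theorem split₂_uncons (w : Word V) : split₂ d c w = 1 ⊗ₜ headSplit d c w +
    (TensorProduct.lift (cons (V := V))).rTensor _ ((TensorProduct.assoc ℚ V _ _).symm
      ((split₂ d c).lTensor V (uncons w))) := by
  have : split₂ d c = TensorProduct.mk ℚ _ _ 1 ∘ₗ headSplit d c +
      (TensorProduct.lift (cons (V := V))).rTensor _ ∘ₗ (TensorProduct.assoc ℚ V _ _).symm.toLinearMap
        ∘ₗ (split₂ d c).lTensor V ∘ₗ uncons := by
    apply word_ext
    · simp [LinearMap.comp_apply]
    · intro x w _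
      have e : ∀ t : Word V ⊗[ℚ] (U ⊗[ℚ] Word V), (TensorProduct.lift (cons (V := V))).rTensor _
          ((TensorProduct.assoc ℚ V _ _).symm (x ⊗ₜ[ℚ] t)) = (cons x).rTensor _ t := by
        intro t
        induction t with
        | zero => simp
        | add s t hs ht => simp only [TensorProduct.tmul_add, map_add, hs, ht]
        | tmul u v => simp
      simp [LinearMap.comp_apply, e, TensorProduct.tmul_add]
  exact LinearMap.congr_fun this w

/-- A word is a cocycle if it lies in a class of words that is stable under contraction of the first
letter and on which `headSplit` vanishes. -/
theorem split₂_eq_zero_of_stable (p : Word V → Prop) (h0 : ∀ w, p w → headSplit d c w = 0)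
    (hs : ∀ (l : Module.Dual ℚ V) (w), p w → p (ctr l w)) {w : Word V} (hw : p w) :
    split₂ d c w = 0 := by
  obtain ⟨k, hk⟩ := exists_mem_nilFil_uncons w
  induction k generalizing w with
  | zero =>
    obtain rfl : w = 0 := hk
    simp
  | succ k ih =>
    have hu : (split₂ d c).lTensor V (uncons w) = 0 := slice_ext fun l => by
      rw [map_zero, slice_lTensor]
      exact ih (hs l w hw) (mem_nilFil_succ.1 hk l)
    rw [split₂_uncons, h0 w hw, hu]
    simp

/-- The counit on the left factor removes every term in which something precedes the distinguished
letter. -/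
theorem headSplit_eq_zero {w : Word V} (hw : split₂ d c w = 0) : headSplit d c w = 0 := by
  have h := split₂_uncons d c w
  rw [hw] at h
  have h' := congrArg (slice (M := U ⊗[ℚ] Word V) (wcounit (V := V))) h
  have e : ∀ t : (V ⊗[ℚ] Word V) ⊗[ℚ] (U ⊗[ℚ] Word V), slice (wcounit (V := V))
      ((TensorProduct.lift (cons (V := V))).rTensor _ t) = 0 := by
    intro t
    have : (wcounit (V := V)) ∘ₗ TensorProduct.lift (cons (V := V)) = 0 := by
      apply TensorProduct.ext'
      intro x w
      simp
    rw [slice_rTensor, this]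
    simp [slice]
  rw [map_zero, map_add, slice_tmul, wcounit_one, one_smul, e, add_zero] at h'
  exact h'.symm

/-- Contraction acts on the left tensor factor of `split₂`, where it kills the term with the empty
word in front and commutes with the recursion on the remaining terms. -/
theorem split₂_ctr {w : Word V} (hw : split₂ d c w = 0) (l : Module.Dual ℚ V) :
    split₂ d c (ctr l w) = 0 := by
  have h : split₂ d c ∘ₗ ctr l = (ctr l).rTensor _ ∘ₗ split₂ d c := by
    apply word_ext
    · simp [LinearMap.comp_apply]
    · intro x w _
      have : ctr l ∘ₗ cons x = l x • LinearMap.id := by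
        ext w
        simp
      rw [LinearMap.comp_apply, LinearMap.comp_apply, split₂_cons, map_add,
        ← LinearMap.rTensor_comp_apply, this, LinearMap.rTensor_smul]
      simp
  have h' := LinearMap.congr_fun h w
  rw [LinearMap.comp_apply, LinearMap.comp_apply, hw, map_zero] at h'
  exact h'

end Contraction

end Adams

/-! ### Splittings and the flat connection of the fiber in degree one. -/

namespace Adams

namespace AdamsCDGA

variable {A N : AdamsCDGA.{u}}

theorem mul_comm_one {y : A} (hy : y ∈ A.deg 1) (x : A) : x * y = y * A.J x := by
  induction x using gr_induction with
  | h0 => simp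
  | ha x z hx hz => rw [add_mul, map_add, mul_add, hx, hz]
  | h n r x hx =>
    rw [comm_deg (gr_le_deg _ _ hx) hy, J_of_mem (gr_le_deg _ _ hx), mul_one, mul_smul_comm]

theorem J_one {x : A} (hx : x ∈ A.deg 1) : A.J x = -x := by
  rw [J_of_mem hx]
  simp

theorem map_J_of_gr {F : AdamsCDGA.{u}} (f : F →ₗ[ℚ] A) (hf : ∀ i x, x ∈ F.gr i → f x ∈ A.gr i)
    (x : F) : f (F.J x) = A.J (f x) := by
  induction x using gr_induction with
  | h0 => simp
  | ha x z hx hz => simp only [map_add, hx, hz]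
  | h n r x hx =>
    rw [J_of_mem (gr_le_deg _ _ hx), J_of_mem (gr_le_deg _ _ (hf _ _ hx)), map_smul]

theorem map_deg_of_gr {F : AdamsCDGA.{u}} (f : F →ₗ[ℚ] A) (hf : ∀ i x, x ∈ F.gr i → f x ∈ A.gr i)
    {m : ℤ} {x : F} (hx : x ∈ F.deg m) : f x ∈ A.deg m := by
  induction hx using deg_induction with
  | h r x hx => exact gr_le_deg _ _ (hf _ _ hx)
  | h0 => simp
  | ha x y _ _ hx hy => rw [map_add]; exact add_mem hx hy

theorem aug_of_mem_deg {m : ℤ} (hm : m ≠ 0) {x : A} (hx : x ∈ A.deg m) : A.aug x = 0 := by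
  induction hx using deg_induction with
  | h r x hx => exact augLin_of_ne (by rintro h; simp only [Prod.mk.injEq] at h; omega) hx
  | h0 => simp
  | ha x y _ _ hx hy => rw [map_add, hx, hy, add_zero]

end AdamsCDGA

/-- A splitting of `N → A → F`, compatible with the products, in which the differential of `F` on
the part of degree one is decomposable. -/
structure Splitting {N A F : AdamsCDGA.{u}} (φ : Hom N A) (ε : Hom A N) (π : Hom A F) where
  /-- the section of the projection to the fiber -/
  σ : F →ₐ[ℚ] A
  σ_gr : ∀ i x, x ∈ F.gr i → σ x ∈ A.gr i
  π_σ : ∀ x, π (σ x) = x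
  ε_σ : ∀ x, ε (σ x) = F.aug x • 1
  ε_φ : ∀ n, ε (φ n) = n
  π_φ : ∀ n, π (φ n) = N.aug n • 1
  /-- a retraction of the multiplication `N ⊗ F → A` -/
  ret : A →ₗ[ℚ] N ⊗[ℚ] F
  ret_mul : ∀ n f, ret (φ n * σ f) = n ⊗ₜ f
  decomp : ∀ a ∈ A.deg 1, φ (ε a) + σ (π a) = a
  -- The condition 0 < s makes the Adams degree of the factor from the fiber drop strictly; this
  -- drop is the source of local nilpotence.
  conn_mem : ∀ r, ∀ x ∈ F.gr (1, r), A.d (σ x) - σ (F.d x) ∈ Submodule.span ℚ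
    {a | ∃ s t n y, 0 < s ∧ s + t = r ∧ n ∈ N.gr (1, s) ∧ y ∈ F.gr (1, t) ∧ a = φ n * σ y}
  -- Needed for flatness: without it the failure of σ to commute with d on d x could have a
  -- component in N² ⊗ F¹.
  d_mem : ∀ x ∈ F.deg 1, F.d x ∈ Algebra.adjoin ℚ (F.deg 1 : Set F)

namespace Splitting

variable {N A F : AdamsCDGA.{u}} {φ : Hom N A} {ε : Hom A N} {π : Hom A F} (S : Splitting φ ε π)

theorem σ_deg {m : ℤ} {x : F} (hx : x ∈ F.deg m) : S.σ x ∈ A.deg m :=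
  map_deg_of_gr S.σ.toLinearMap S.σ_gr hx

theorem σ_J (x : F) : S.σ (F.J x) = A.J (S.σ x) := map_J_of_gr S.σ.toLinearMap S.σ_gr x

/-- The section in degree one. -/
noncomputable def σ₁ : F.deg 1 →ₗ[ℚ] A.deg 1 := S.σ.toLinearMap.restrict (fun _ hx => S.σ_deg hx)

/-- The section in degree two. -/
noncomputable def σ₂ : F.deg 2 →ₗ[ℚ] A.deg 2 := S.σ.toLinearMap.restrict (fun _ hx => S.σ_deg hx)

theorem decomp₁ (a : A.deg 1) : φ.deg₁ (ε.deg₁ a) + S.σ₁ (π.deg₁ a) = a :=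
  Subtype.ext (S.decomp a a.2)

theorem ε₁_σ₁ (x : F.deg 1) : ε.deg₁ (S.σ₁ x) = 0 := by
  apply Subtype.ext
  change ε (S.σ x) = 0
  rw [S.ε_σ, aug_of_mem_deg one_ne_zero x.2, zero_smul]

include S in
theorem ε₁_φ₁ (n : N.deg 1) : ε.deg₁ (φ.deg₁ n) = n := Subtype.ext (S.ε_φ n)

theorem π₁_σ₁ (x : F.deg 1) : π.deg₁ (S.σ₁ x) = x := Subtype.ext (S.π_σ x)

include S in
theorem π₁_φ₁ (n : N.deg 1) : π.deg₁ (φ.deg₁ n) = 0 := by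
  apply Subtype.ext
  change π (φ n) = 0
  rw [S.π_φ, aug_of_mem_deg one_ne_zero n.2, zero_smul]

/-- The multiplication `N¹ ⊗ F → A`. -/
noncomputable def mulOne : N.deg 1 ⊗[ℚ] F →ₗ[ℚ] A :=
  TensorProduct.lift ((LinearMap.mul ℚ A).compl₁₂ (φ.toAlgHom.toLinearMap ∘ₗ (N.deg 1).subtype)
    S.σ.toLinearMap)

@[simp] theorem mulOne_tmul (n : N.deg 1) (f : F) : S.mulOne (n ⊗ₜ f) = φ n * S.σ f := rfl

theorem ret_mulOne (t : N.deg 1 ⊗[ℚ] F) : S.ret (S.mulOne t) = (N.deg 1).subtype.rTensor F t := by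
  induction t with
  | zero => simp
  | add s t hs ht => simp only [map_add, hs, ht]
  | tmul n f => simp [S.ret_mul]

/-- The failure of the section to commute with the differentials. -/
noncomputable def defect : F →ₗ[ℚ] A := A.d ∘ₗ S.σ.toLinearMap - S.σ.toLinearMap ∘ₗ F.d

theorem defect_apply (f : F) : S.defect f = A.d (S.σ f) - S.σ (F.d f) := rfl

/-- The connection `F¹ → N¹ ⊗ F¹`. -/
noncomputable def Γ : F.deg 1 →ₗ[ℚ] N.deg 1 ⊗[ℚ] F.deg 1 :=
  TensorProduct.map (N.proj 1) (F.proj 1) ∘ₗ S.ret ∘ₗ S.defect ∘ₗ (F.deg 1).subtype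

/-- The component of the connection in the direction `ν`. -/
noncomputable def δ (ν : Module.Dual ℚ (N.deg 1)) : F.deg 1 →ₗ[ℚ] F.deg 1 := slice ν ∘ₗ S.Γ

theorem proj_of_mem {B : AdamsCDGA.{u}} {m : ℤ} {x : B} (hx : x ∈ B.deg m) : B.proj m x = ⟨x, hx⟩ :=
  proj_coe m ⟨x, hx⟩

theorem slice_map_ret (ν : Module.Dual ℚ (N.deg 1)) (n : N.deg 1) (y : F.deg 1) :
    slice ν (TensorProduct.map (N.proj 1) (F.proj 1) (S.ret (φ n * S.σ y))) = ν n • y := by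
  rw [S.ret_mul, TensorProduct.map_tmul, proj_coe, proj_coe, slice_tmul]

/-- The coefficient from N¹ in `conn_mem` takes a positive amount of the Adams degree, so a
component of the connection lowers it. Evaluation on the spanning products is done by
`slice_map_ret`. -/
theorem δ_mem (ν : Module.Dual ℚ (N.deg 1)) {r : ℕ} {x : F} (hx : x ∈ F.gr (1, r)) :
    ∃ y ∈ ⨆ t : {t : ℕ // t < r}, F.gr (1, t), (S.δ ν ⟨x, gr_le_deg _ _ hx⟩ : F) = y := by
  refine ⟨_, ?_, rfl⟩
  change ((slice ν (TensorProduct.map (N.proj 1) (F.proj 1) (S.ret (S.defect x))) : F.deg 1) : F) ∈ _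
  have h := S.conn_mem r x hx
  rw [← defect_apply] at h
  generalize S.defect x = z at h
  induction h using Submodule.span_induction with
  | zero => simp
  | add a b _ _ ha hb => simp only [map_add, Submodule.coe_add]; exact add_mem ha hb
  | smul q a _ ha => simp only [map_smul, Submodule.coe_smul]; exact Submodule.smul_mem _ _ ha
  | mem a ha =>
    obtain ⟨s, t, n, y, hs, hst, hn, hy, rfl⟩ := ha
    have := S.slice_map_ret ν ⟨n, gr_le_deg _ _ hn⟩ ⟨y, gr_le_deg _ _ hy⟩
    simp only at this
    rw [this]
    exact Submodule.smul_mem _ _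
      (Submodule.mem_iSup_of_mem (⟨t, by omega⟩ : {t : ℕ // t < r}) hy)

/-- By `conn_mem` the defect is a sum of products N¹ · F¹, and on these `ret` inverts the
multiplication. So the projection to N¹ ⊗ F¹ in the definition of `Γ` loses nothing. -/
theorem defect_one (x : F.deg 1) :
    S.defect x = S.mulOne ((F.deg 1).subtype.lTensor _ (S.Γ x)) := by
  have h : S.defect x ∈ LinearMap.range (S.mulOne ∘ₗ (F.deg 1).subtype.lTensor (N.deg 1)) := by
    obtain ⟨x, hx⟩ := x
    simp only
    induction hx using deg_induction with
    | h0 => simp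
    | ha x y _ _ hx hy => rw [map_add]; exact add_mem hx hy
    | h r x hx =>
      have h := S.conn_mem r x hx
      rw [← defect_apply] at h
      refine Submodule.span_le.2 ?_ h
      rintro _ ⟨s, t, n, y, -, -, hn, hy, rfl⟩
      exact ⟨⟨n, gr_le_deg _ _ hn⟩ ⊗ₜ ⟨y, gr_le_deg _ _ hy⟩, rfl⟩
  obtain ⟨t, ht⟩ := h
  have h2 : S.Γ x = t := by
    change TensorProduct.map _ _ (S.ret (S.defect x)) = t
    rw [← ht]
    clear ht
    induction t with
    | zero => simp
    | add s t hs ht => simp only [map_add, hs, ht]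
    | tmul n y => simp [S.ret_mul, proj_coe]
  rw [h2, ← ht]
  rfl

theorem mulOne_mul (t : N.deg 1 ⊗[ℚ] F) (f : F) :
    S.mulOne t * S.σ f = S.mulOne ((LinearMap.mulRight ℚ f).lTensor _ t) := by
  induction t with
  | zero => simp
  | add s t hs ht => simp only [map_add, add_mul, hs, ht]
  | tmul n y => simp [mul_assoc]

theorem mul_mulOne (t : N.deg 1 ⊗[ℚ] F) (f : F) :
    S.σ f * S.mulOne t = S.mulOne ((LinearMap.mulLeft ℚ (F.J f)).lTensor _ t) := by
  induction t with
  | zero => simp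
  | add s t hs ht => simp only [map_add, mul_add, hs, ht]
  | tmul n y =>
    rw [mulOne_tmul, ← mul_assoc, mul_comm_one (φ.map_deg n.2), ← S.σ_J]
    simp [mul_assoc]

/-- σ is multiplicative and both differentials obey the Leibniz rule, so their difference is a
derivation along σ. -/
theorem defect_mul (f g : F) :
    S.defect (f * g) = S.defect f * S.σ g + S.σ (F.J f) * S.defect g := by
  simp only [defect_apply, map_mul, d_mul, map_add, S.σ_J, sub_mul, mul_sub]
  abel

/-- The range N¹ · F of `mulOne` is stable under multiplication by σ(F) on both sides. A derivation
along σ that sends the generators into it sends the subalgebra they generate into it. -/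
theorem defect_mem_range {f : F} (hf : f ∈ Algebra.adjoin ℚ (F.deg 1 : Set F)) :
    S.defect f ∈ LinearMap.range S.mulOne := by
  induction hf using Algebra.adjoin_induction with
  | mem x hx => exact ⟨_, (S.defect_one ⟨x, hx⟩).symm⟩
  | algebraMap r =>
    have h : ∀ B : AdamsCDGA.{u}, B.d (1 : B) = 0 := by
      intro B
      have h1 := d_mul (1 : B) 1
      rw [J_of_mem (gr_le_deg 0 0 SetLike.GradedOne.one_mem)] at h1
      simpa using h1
    rw [defect_apply, AlgHom.commutes, Algebra.algebraMap_eq_smul_one, map_smul, h,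
      Algebra.algebraMap_eq_smul_one, map_smul, h]
    simp
  | add x y _ _ hx hy => rw [map_add]; exact add_mem hx hy
  | mul x y _ _ hx hy =>
    obtain ⟨s, hs⟩ := hx
    obtain ⟨t, ht⟩ := hy
    rw [defect_mul, ← hs, ← ht, mulOne_mul, mul_mulOne, ← map_add]
    exact ⟨_, rfl⟩

/-- The component of the connection of `F` in the direction `ν`. -/
noncomputable def δFull (ν : Module.Dual ℚ (N.deg 1)) : F →ₗ[ℚ] F :=
  slice (ν ∘ₗ N.proj 1) ∘ₗ S.ret ∘ₗ S.defect

theorem slice_ret_mulOne (ν : Module.Dual ℚ (N.deg 1)) (t : N.deg 1 ⊗[ℚ] F) :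
    slice (ν ∘ₗ N.proj 1) (S.ret (S.mulOne t)) = slice ν t := by
  rw [ret_mulOne, slice_rTensor]
  congr 2
  ext n
  simp [proj_coe]

theorem δFull_coe (ν : Module.Dual ℚ (N.deg 1)) (x : F.deg 1) : S.δFull ν x = S.δ ν x := by
  change slice (ν ∘ₗ N.proj 1) (S.ret (S.defect x)) = _
  rw [defect_one, slice_ret_mulOne, slice_lTensor]
  rfl

/-- Two signs cancel: the one of the Leibniz rule for the defect, and the one from moving x past the
coefficient in N¹. A component of the connection is thus an ordinary derivation of degree zero. -/
theorem δFull_mul (ν : Module.Dual ℚ (N.deg 1)) (x y : F.deg 1) :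
    S.δFull ν (x * y) = S.δ ν x * y + x * S.δ ν y := by
  change slice (ν ∘ₗ N.proj 1) (S.ret (S.defect (x * y))) = _
  rw [defect_mul, defect_one, defect_one, mulOne_mul, mul_mulOne, map_add, map_add,
    slice_ret_mulOne, slice_ret_mulOne, slice_lTensor, slice_lTensor, slice_lTensor, slice_lTensor]
  rw [← δFull_coe, ← δFull_coe, LinearMap.mulRight_apply, LinearMap.mulLeft_apply,
    J_J, δFull_coe, δFull_coe]
  rfl

/-- The differential of `φ n * σ y` for `n`, `y` of degree one. -/
theorem ret_d_mul (n : N.deg 1) (y : F.deg 1) : S.ret (A.d (φ n * S.σ y)) =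
    N.d n ⊗ₜ (y : F) + (n : N) ⊗ₜ (-F.d y) +
      TensorProduct.map (LinearMap.mulLeft ℚ (-n : N) ∘ₗ (N.deg 1).subtype) (F.deg 1).subtype
        (S.Γ y) := by
  have h1 : A.d (S.σ y) = S.σ (F.d y) + S.mulOne ((F.deg 1).subtype.lTensor _ (S.Γ y)) := by
    rw [← defect_one, defect_apply]
    abel
  have h2 : ∀ t : N.deg 1 ⊗[ℚ] F.deg 1,
      S.ret (φ (-n) * S.mulOne ((F.deg 1).subtype.lTensor _ t)) =
      TensorProduct.map (LinearMap.mulLeft ℚ (-n : N) ∘ₗ (N.deg 1).subtype) (F.deg 1).subtype t := by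
    intro t
    induction t with
    | zero => simp
    | add s t hs ht => simp only [map_add, mul_add, hs, ht]
    | tmul m z =>
      have : φ (-n) * (φ m * S.σ z) = φ (-n * m) * S.σ z := by rw [map_mul, mul_assoc]
      rw [LinearMap.lTensor_tmul, mulOne_tmul, Submodule.subtype_apply, this, S.ret_mul]
      simp
  rw [d_mul, J_one (φ.map_deg n.2), ← φ.map_d', h1, mul_add, map_add, map_add, S.ret_mul, ← map_neg,
    h2, S.ret_mul, TensorProduct.neg_tmul, TensorProduct.tmul_neg, add_assoc]

/-- This is d² = 0 on σ x. Its component with coefficient in N¹ gives `δFull_d`, and the one in N² ⊗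
F¹ gives `curv_Γ`. -/
theorem d_defect (x : F.deg 1) : A.d (S.mulOne ((F.deg 1).subtype.lTensor _ (S.Γ x))) +
    S.defect (F.d x) = 0 := by
  rw [← defect_one, defect_apply, defect_apply, map_sub, A.d_d, F.d_d, map_zero]
  abel

/-- The connection commutes with the differential of `F`. -/
theorem δFull_d (ν : Module.Dual ℚ (N.deg 1)) (x : F.deg 1) :
    S.δFull ν (F.d x) = F.d (S.δ ν x) := by
  have h := congrArg (fun a => slice (ν ∘ₗ N.proj 1) (S.ret a)) (S.d_defect x)
  simp only [map_add, map_zero] at h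
  have key : ∀ t : N.deg 1 ⊗[ℚ] F.deg 1, slice (ν ∘ₗ N.proj 1)
      (S.ret (A.d (S.mulOne ((F.deg 1).subtype.lTensor _ t)))) =
        - F.d (slice ν t : F.deg 1) := by
    intro t
    induction t with
    | zero => simp
    | add s t hs ht => simp only [map_add, hs, ht, Submodule.coe_add, neg_add]
    | tmul n y =>
      -- The terms from Γ y are multiplied by n, so their coefficients have degree two and are
      -- invisible to ν.
      have h0 : (ν ∘ₗ N.proj 1) ∘ₗ (LinearMap.mulLeft ℚ (-n : N) ∘ₗ (N.deg 1).subtype) = 0 := by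
        ext m
        have : N.proj 1 (n * m : N) = 0 := proj_ne (by norm_num) ⟨_, mul_mem_two n.2 m.2⟩
        simp [this]
      have h1 : N.proj 1 (N.d n) = 0 := proj_ne (by norm_num) ⟨_, d_mem_two n.2⟩
      rw [LinearMap.lTensor_tmul, mulOne_tmul, Submodule.subtype_apply, ret_d_mul, map_add, map_add,
        slice_map, h0]
      simp [h1, proj_coe, slice]
  rw [key] at h
  exact (neg_add_eq_zero.1 h).symm

/-- The connection is flat. -/
theorem curv_Γ (x : F.deg 1) : curv N.d₁ N.c₁ S.Γ x = 0 := by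
  have h := congrArg (fun a => TensorProduct.map (N.proj 2) (F.proj 1) (S.ret a)) (S.d_defect x)
  simp only [map_add, map_zero] at h
  -- As d x is decomposable, its defect lies in N¹ · F and has no component in N² ⊗ F¹; only the
  -- first summand of `d_defect` remains, and it is the curvature.
  obtain ⟨t, ht⟩ := S.defect_mem_range (S.d_mem x x.2)
  have h0 : TensorProduct.map (N.proj 2) (F.proj 1) (S.ret (S.defect (F.d x))) = 0 := by
    have e : N.proj 2 ∘ₗ (N.deg 1).subtype = 0 := by
      ext n
      simp [proj_ne (A := N) (m := 2) (n := 1) (by norm_num) n]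
    rw [← ht, ret_mulOne, LinearMap.rTensor, ← LinearMap.comp_apply, ← TensorProduct.map_comp, e]
    simp
  rw [h0, add_zero] at h
  rw [curv_apply, ← h]
  generalize S.Γ x = t
  induction t with
  | zero => simp
  | add s t hs ht =>
    simp only [map_add]
    rw [← hs, ← ht]
    abel
  | tmul n y =>
    have e1 : N.proj 2 (n : N) = 0 := proj_ne (by norm_num) n
    have e2 : N.proj 2 (N.d n) = N.d₁ n := proj_of_mem (d_mem_two n.2)
    have e3 : N.proj 2 ∘ₗ LinearMap.mulLeft ℚ (-n : N) ∘ₗ (N.deg 1).subtype = N.c₁ n := by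
      ext m
      have : N.proj 2 (n * m : N) = ⟨_, mul_mem_two n.2 m.2⟩ := proj_of_mem _
      simp [this, c₁_coe]
    have e4 : F.proj 1 ∘ₗ (F.deg 1).subtype = LinearMap.id := by
      ext y
      simp [proj_coe]
    rw [LinearMap.lTensor_tmul, mulOne_tmul, Submodule.subtype_apply, ret_d_mul, map_add, map_add,
      ← LinearMap.comp_apply (TensorProduct.map _ _), ← TensorProduct.map_comp, e3, e4,
      TensorProduct.map_tmul, TensorProduct.map_tmul, e1, e2, proj_coe, LinearMap.rTensor_tmul,
      quad_tmul, TensorProduct.zero_tmul, add_zero]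
    rfl

end Splitting

end Adams

/-! ### Extension of a connection to words and its curvature. -/

namespace Adams

theorem AdamsCDGA.incl_cons {A : AdamsCDGA.{u}} (x : A.deg 1) (w : Word (A.deg 1)) :
    A.incl (cons x w) = cons (x : A) (A.incl w) := wmap_cons _ _ _

theorem AdamsCDGA.incl_one {A : AdamsCDGA.{u}} : A.incl 1 = 1 := wmap_one _

theorem AdamsCDGA.bar_cons_one {A : AdamsCDGA.{u}} {x : A} (hx : x ∈ A.deg 1) (w : Word A) :
    A.bar (cons x w) = cons (A.d x) w - merge (LinearMap.mul ℚ A) x w + cons x (A.bar w) := by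
  rw [bar, barD_cons, J_one hx]
  simp only [map_neg, LinearMap.neg_apply]
  abel

theorem AdamsCDGA.bar_incl_eq_zero {A : AdamsCDGA.{u}} {w : Word (A.deg 1)} :
    A.bar (A.incl w) = 0 ↔ split₂ A.d₁ A.c₁ w = 0 := by
  rw [bar_incl]
  exact ⟨fun h => glue_injective (h.trans (map_zero _).symm), fun h => by rw [h, map_zero]⟩

section Derivation

variable {V W M : Type*} [AddCommGroup V] [Module ℚ V] [AddCommGroup W] [Module ℚ W]
  [AddCommGroup M] [Module ℚ M]

/-- The extension of a connection on letters to words, as a derivation without signs. -/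
noncomputable def wordConn (Γ : V →ₗ[ℚ] M ⊗[ℚ] V) : Word V →ₗ[ℚ] M ⊗[ℚ] Word V :=
  wordRec 0 ((LinearMap.lTensorHom M ∘ₗ (cons (V := V)).flip).flip ∘ₗ Γ)
    (LinearMap.lTensorHom M ∘ₗ cons)

@[simp] theorem wordConn_one (Γ : V →ₗ[ℚ] M ⊗[ℚ] V) : wordConn Γ 1 = 0 := by simp [wordConn]

@[simp] theorem wordConn_cons (Γ : V →ₗ[ℚ] M ⊗[ℚ] V) (x : V) (w : Word V) :
    wordConn Γ (cons x w) = ((cons (V := V)).flip w).lTensor M (Γ x) +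
      (cons x).lTensor M (wordConn Γ w) := by
  simp [wordConn]

theorem slice_wordConn_cons (Γ : V →ₗ[ℚ] M ⊗[ℚ] V) (ν : Module.Dual ℚ M) (x : V) (w : Word V) :
    slice ν (wordConn Γ (cons x w)) = cons (slice ν (Γ x)) w + cons x (slice ν (wordConn Γ w)) := by
  rw [wordConn_cons, map_add, slice_lTensor, slice_lTensor]
  rfl

/-- A derivation either acts behind the contracted letter or on that letter itself; the second case
replaces the form by its composite with the connection. -/
theorem ctr_slice_wordConn (Γ : V →ₗ[ℚ] M ⊗[ℚ] V) (ν : Module.Dual ℚ M) (l : Module.Dual ℚ V)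
    (w : Word V) : ctr l (slice ν (wordConn Γ w)) =
      slice ν (wordConn Γ (ctr l w)) + ctr (l ∘ₗ slice ν ∘ₗ Γ) w := by
  have : ctr l ∘ₗ slice ν ∘ₗ wordConn Γ =
      slice ν ∘ₗ wordConn Γ ∘ₗ ctr l + ctr (l ∘ₗ slice ν ∘ₗ Γ) := by
    apply word_ext
    · simp [LinearMap.comp_apply]
    · intro x w _
      simp only [LinearMap.comp_apply, LinearMap.add_apply, slice_wordConn_cons]
      simp [LinearMap.comp_apply, add_comm]
  exact LinearMap.congr_fun this w

theorem wcounit_slice_wordConn (Γ : V →ₗ[ℚ] M ⊗[ℚ] V) (ν : Module.Dual ℚ M) (w : Word V) :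
    wcounit (slice ν (wordConn Γ w)) = 0 := by
  have : wcounit ∘ₗ slice ν ∘ₗ wordConn Γ = 0 := by
    apply word_ext
    · simp [LinearMap.comp_apply]
    · intro x w _
      simp only [LinearMap.comp_apply, slice_wordConn_cons]
      simp
  exact LinearMap.congr_fun this w

variable {U : Type*} [AddCommGroup U] [Module ℚ U]

/-- The extension of a flat connection to words is flat. -/
theorem curv_wordConn (d : M →ₗ[ℚ] U) (c : M →ₗ[ℚ] M →ₗ[ℚ] U) (hc : ∀ x y, c x y + c y x = 0)
    (Γ : V →ₗ[ℚ] M ⊗[ℚ] V) (hΓ : ∀ x, curv d c Γ x = 0) (w : Word V) :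
    curv d c (wordConn Γ) w = 0 := by
  have : curv d c (wordConn Γ) = 0 := by
    apply word_ext
    · simp [curv_apply]
    · intro x w hw
      rw [LinearMap.zero_apply, curv_apply] at hw
      have hx := congrArg (((cons (V := V)).flip w).lTensor U) (hΓ x)
      rw [curv_apply, map_add, map_zero] at hx
      have hw' := congrArg ((cons x).lTensor U) hw
      rw [map_add, map_zero] at hw'
      have e1 : ∀ (f : V →ₗ[ℚ] Word V) (t : M ⊗[ℚ] V),
          d.rTensor _ (f.lTensor M t) = f.lTensor U (d.rTensor _ t) := by
        intro f t
        rw [← LinearMap.comp_apply, LinearMap.rTensor_comp_lTensor, ← LinearMap.lTensor_comp_rTensor,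
          LinearMap.comp_apply]
      have e2 : ∀ (f : Word V →ₗ[ℚ] Word V) (t : M ⊗[ℚ] Word V),
          d.rTensor _ (f.lTensor M t) = f.lTensor U (d.rTensor _ t) := by
        intro f t
        rw [← LinearMap.comp_apply, LinearMap.rTensor_comp_lTensor, ← LinearMap.lTensor_comp_rTensor,
          LinearMap.comp_apply]
      -- the mixed terms
      let X : M ⊗[ℚ] V →ₗ[ℚ] U ⊗[ℚ] Word V :=
        TensorProduct.lift (((LinearMap.lcomp ℚ _ ((LinearMap.lTensorHom M ∘ₗ
          (cons (V := V))).flip (wordConn Γ w))) ∘ₗ LinearMap.rTensorHom (Word V) ∘ₗ c))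
      have e3 : ∀ (t : M ⊗[ℚ] V), quad c (wordConn Γ) (((cons (V := V)).flip w).lTensor M t) =
          ((cons (V := V)).flip w).lTensor U (quad c Γ t) + X t := by
        intro t
        induction t with
        | zero => simp
        | add s t hs ht => simp only [map_add, hs, ht]; abel
        | tmul n y =>
          rw [LinearMap.lTensor_tmul, LinearMap.flip_apply, quad_tmul, wordConn_cons, map_add,
            quad_tmul, ← LinearMap.comp_apply (LinearMap.rTensor _ _),
            LinearMap.rTensor_comp_lTensor, ← LinearMap.lTensor_comp_rTensor, LinearMap.comp_apply]
          simp [X]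
      have e4 : ∀ s : M ⊗[ℚ] Word V, quad c (wordConn Γ) ((cons x).lTensor M s) =
          (cons x).lTensor U (quad c (wordConn Γ) s) + quad c
            ((LinearMap.lTensorHom M ∘ₗ (cons (V := V)).flip).flip (Γ x)) s := by
        intro s
        induction s with
        | zero => simp
        | add s t hs ht => simp only [map_add, hs, ht]; abel
        | tmul n v =>
          rw [LinearMap.lTensor_tmul, quad_tmul, wordConn_cons, map_add, quad_tmul, quad_tmul,
            ← LinearMap.comp_apply (LinearMap.rTensor _ _) (LinearMap.lTensor _ _) (wordConn Γ v),
            LinearMap.rTensor_comp_lTensor, ← LinearMap.lTensor_comp_rTensor, LinearMap.comp_apply,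
            add_comm]
          rfl
      -- The connection is applied to the first letter and to the rest of the word in the two
      -- possible orders; the coefficients add up to c n m + c m n.
      have e5 : X (Γ x) + quad c
          ((LinearMap.lTensorHom M ∘ₗ (cons (V := V)).flip).flip (Γ x)) (wordConn Γ w) = 0 := by
        simp only [X]
        generalize Γ x = t
        generalize wordConn Γ w = s
        induction t with
        | zero => rw [map_zero, map_zero, quad_zero, add_zero]
        | add t t' ht ht' => rw [map_add, map_add, quad_add, add_add_add_comm, ht, ht', add_zero]
        | tmul n y =>
          induction s with
          | zero => simp
          | add s s' hs hs' =>
            simp only [TensorProduct.lift.tmul, LinearMap.comp_apply, LinearMap.lcomp_apply,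
              map_add, LinearMap.add_apply] at hs hs' ⊢
            rw [add_add_add_comm, hs, hs', add_zero]
          | tmul m v =>
            simp [← TensorProduct.add_tmul, hc]
      rw [curv_apply, wordConn_cons, map_add, map_add, e1, e2, e3, e4, LinearMap.zero_apply]
      linear_combination (norm := abel) hx + hw' + e5
  exact LinearMap.congr_fun this w

theorem quad_map {B U' M : Type*} [AddCommGroup B] [Module ℚ B]
    [AddCommGroup U'] [Module ℚ U'] [AddCommGroup M] [Module ℚ M]
    {c : V →ₗ[ℚ] V →ₗ[ℚ] U} {c' : B →ₗ[ℚ] B →ₗ[ℚ] U'} {f : V →ₗ[ℚ] B} {g : U →ₗ[ℚ] U'}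
    (h : ∀ x y, c' (f x) (f y) = g (c x y)) (D : M →ₗ[ℚ] V ⊗[ℚ] M) (t : V ⊗[ℚ] M) :
    quad c' (f.rTensor M ∘ₗ D) (f.rTensor M t) = g.rTensor M (quad c D t) := by
  induction t with
  | zero => simp
  | add s t hs ht => simp only [map_add, hs, ht]
  | tmul x m =>
    have : c' (f x) ∘ₗ f = g ∘ₗ c x := LinearMap.ext (h x)
    rw [LinearMap.rTensor_tmul, quad_tmul, quad_tmul, LinearMap.comp_apply,
      ← LinearMap.rTensor_comp_apply, ← LinearMap.rTensor_comp_apply, this]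

variable {B : Type*} [AddCommGroup B] [Module ℚ B]

/-- The mixed terms in the curvature of the sum of the deconcatenation and a connection. -/
theorem quad_mixed (c : B →ₗ[ℚ] B →ₗ[ℚ] U) (hc : ∀ x y, c x y + c y x = 0) (σ : V →ₗ[ℚ] B)
    (φ : M →ₗ[ℚ] B) (Γ : V →ₗ[ℚ] M ⊗[ℚ] V) (w : Word V) :
    quad c (σ.rTensor _ ∘ₗ uncons) (φ.rTensor _ (wordConn Γ w)) +
      quad c (φ.rTensor _ ∘ₗ wordConn Γ) (σ.rTensor _ (uncons w)) +
      ((-TensorProduct.lift (c.compl₁₂ φ σ)) ∘ₗ Γ).rTensor _ (uncons w) = 0 := by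
  have : quad c (σ.rTensor _ ∘ₗ uncons) ∘ₗ φ.rTensor _ ∘ₗ wordConn Γ +
      quad c (φ.rTensor _ ∘ₗ wordConn Γ) ∘ₗ σ.rTensor _ ∘ₗ uncons +
      ((-TensorProduct.lift (c.compl₁₂ φ σ)) ∘ₗ Γ).rTensor _ ∘ₗ uncons = 0 := by
    apply word_ext
    · simp [LinearMap.comp_apply]
    · intro x w _
      simp only [LinearMap.add_apply, LinearMap.comp_apply, uncons_cons, LinearMap.rTensor_tmul,
        quad_tmul, LinearMap.zero_apply]
      -- The connection changes the first letter, which is then removed. This cancels the third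
      -- summand, the deviation of σ from commuting with the differentials.
      have e1 : ∀ t : M ⊗[ℚ] V, quad c (σ.rTensor _ ∘ₗ uncons)
          (φ.rTensor _ (((cons (V := V)).flip w).lTensor _ t)) =
            -((-TensorProduct.lift (c.compl₁₂ φ σ)) t ⊗ₜ w) := by
        intro t
        induction t with
        | zero => simp
        | add s t hs ht => simp only [map_add, hs, ht, TensorProduct.add_tmul, neg_add]
        | tmul n y =>
          rw [LinearMap.lTensor_tmul, LinearMap.rTensor_tmul, quad_tmul, LinearMap.flip_apply,
            LinearMap.comp_apply, uncons_cons, LinearMap.rTensor_tmul, LinearMap.rTensor_tmul,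
            LinearMap.neg_apply, TensorProduct.neg_tmul, neg_neg]
          rfl
      -- The connection acts behind the first letter; the two orders of acting and removing cancel
      -- because c is alternating.
      have e2 : ∀ s : M ⊗[ℚ] Word V, quad c (σ.rTensor _ ∘ₗ uncons)
          (φ.rTensor _ ((cons x).lTensor _ s)) + (c (σ x)).rTensor _ (φ.rTensor _ s) = 0 := by
        intro s
        induction s with
        | zero => simp
        | add s t hs ht =>
          simp only [map_add]
          rw [add_add_add_comm, hs, ht, add_zero]
        | tmul n v =>
          rw [LinearMap.lTensor_tmul, LinearMap.rTensor_tmul, quad_tmul, LinearMap.comp_apply,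
            uncons_cons, LinearMap.rTensor_tmul, LinearMap.rTensor_tmul, LinearMap.rTensor_tmul,
            LinearMap.rTensor_tmul, ← TensorProduct.add_tmul, hc, TensorProduct.zero_tmul]
      rw [wordConn_cons, map_add, map_add, e1]
      linear_combination (norm := abel) e2 (wordConn Γ w)
  exact LinearMap.congr_fun this w

/-- The curvature of the sum of the deconcatenation and a flat connection. -/
theorem curv_sum {UF UN : Type*} [AddCommGroup UF] [Module ℚ UF] [AddCommGroup UN] [Module ℚ UN]
    {d : B →ₗ[ℚ] U} {c : B →ₗ[ℚ] B →ₗ[ℚ] U} {dF : V →ₗ[ℚ] UF} {cF : V →ₗ[ℚ] V →ₗ[ℚ] UF}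
    {dN : M →ₗ[ℚ] UN} {cN : M →ₗ[ℚ] M →ₗ[ℚ] UN} {σ : V →ₗ[ℚ] B} {φ : M →ₗ[ℚ] B}
    {σ₂ : UF →ₗ[ℚ] U} {φ₂ : UN →ₗ[ℚ] U} {Γ : V →ₗ[ℚ] M ⊗[ℚ] V} (hc : ∀ x y, c x y + c y x = 0)
    (hcN : ∀ x y, cN x y + cN y x = 0) (hσ : ∀ x y, c (σ x) (σ y) = σ₂ (cF x y))
    (hφ : ∀ x y, c (φ x) (φ y) = φ₂ (cN x y)) (hdφ : d ∘ₗ φ = φ₂ ∘ₗ dN)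
    (hdσ : d ∘ₗ σ = σ₂ ∘ₗ dF + (-TensorProduct.lift (c.compl₁₂ φ σ)) ∘ₗ Γ)
    (hΓ : ∀ x, curv dN cN Γ x = 0) (w : Word V) :
    curv d c (σ.rTensor _ ∘ₗ uncons + φ.rTensor _ ∘ₗ wordConn Γ) w =
      σ₂.rTensor _ (headSplit dF cF w) := by
  -- The curvature splits into the part over M alone, zero by flatness, the part from removing two
  -- letters, which is `headSplit`, and the mixed part, zero by `quad_mixed`.
  have hG : d.rTensor _ (φ.rTensor _ (wordConn Γ w)) +
      quad c (φ.rTensor _ ∘ₗ wordConn Γ) (φ.rTensor _ (wordConn Γ w)) = 0 := by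
    rw [quad_map hφ, ← LinearMap.rTensor_comp_apply, hdφ, LinearMap.rTensor_comp_apply,
      ← map_add, ← curv_apply, curv_wordConn dN cN hcN Γ hΓ, map_zero]
  have hU : quad c (σ.rTensor _ ∘ₗ uncons) (σ.rTensor _ (uncons w)) =
      σ₂.rTensor _ (quad cF uncons (uncons w)) := quad_map hσ _ _
  have hd : d.rTensor _ (σ.rTensor _ (uncons w)) = σ₂.rTensor _ (dF.rTensor _ (uncons w)) +
      ((-TensorProduct.lift (c.compl₁₂ φ σ)) ∘ₗ Γ).rTensor _ (uncons w) := by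
    rw [← LinearMap.rTensor_comp_apply, hdσ, LinearMap.rTensor_add, LinearMap.add_apply,
      LinearMap.rTensor_comp_apply]
  rw [curv_apply, quad_add, headSplit, curv_apply]
  simp only [LinearMap.add_apply, map_add]
  rw [LinearMap.comp_apply, LinearMap.comp_apply, hU, hd]
  linear_combination (norm := abel) hG + quad_mixed c hc σ φ Γ w

end Derivation

/-! ### The connections `Γbar` and `nabla` on words of the fiber. -/

namespace Splitting

variable {N A F : AdamsCDGA.{u}} {φ : Hom N A} {ε : Hom A N} {π : Hom A F} (S : Splitting φ ε π)

/-- The connection on words in letters of degree one. -/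
noncomputable def Γbar : Word (F.deg 1) →ₗ[ℚ] N.deg 1 ⊗[ℚ] Word (F.deg 1) := wordConn S.Γ

/-- The component of the connection on words in the direction `ν`. -/
noncomputable def D (ν : Module.Dual ℚ (N.deg 1)) : Word (F.deg 1) →ₗ[ℚ] Word (F.deg 1) :=
  slice ν ∘ₗ S.Γbar

@[simp] theorem D_one (ν : Module.Dual ℚ (N.deg 1)) : S.D ν 1 = 0 := by
  simp [D, Γbar, LinearMap.comp_apply]

@[simp] theorem D_cons (ν : Module.Dual ℚ (N.deg 1)) (x : F.deg 1) (w : Word (F.deg 1)) :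
    S.D ν (cons x w) = cons (S.δ ν x) w + cons x (S.D ν w) := slice_wordConn_cons _ _ _ _

theorem ctr_D (ν : Module.Dual ℚ (N.deg 1)) (l : Module.Dual ℚ (F.deg 1)) (w : Word (F.deg 1)) :
    ctr l (S.D ν w) = S.D ν (ctr l w) + ctr (l ∘ₗ S.δ ν) w := ctr_slice_wordConn _ _ _ _

/-- The extension to words in letters of any degree of the component of the connection. -/
noncomputable def DFull (ν : Module.Dual ℚ (N.deg 1)) : Word F →ₗ[ℚ] Word F :=
  wordRec 0 (cons ∘ₗ S.δFull ν) cons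

@[simp] theorem DFull_one (ν : Module.Dual ℚ (N.deg 1)) : S.DFull ν 1 = 0 := by simp [DFull]

@[simp] theorem DFull_cons (ν : Module.Dual ℚ (N.deg 1)) (x : F) (w : Word F) :
    S.DFull ν (cons x w) = cons (S.δFull ν x) w + cons x (S.DFull ν w) := by simp [DFull]

theorem DFull_incl (ν : Module.Dual ℚ (N.deg 1)) (w : Word (F.deg 1)) :
    S.DFull ν (F.incl w) = F.incl (S.D ν w) := by
  have : S.DFull ν ∘ₗ F.incl = F.incl ∘ₗ S.D ν := by
    apply word_ext
    · simp [LinearMap.comp_apply, incl_one]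
    · intro x w hw
      rw [LinearMap.comp_apply, LinearMap.comp_apply] at hw ⊢
      rw [D_cons, map_add, incl_cons, incl_cons, incl_cons, DFull_cons, hw, δFull_coe]
  exact LinearMap.congr_fun this w

theorem DFull_merge (ν : Module.Dual ℚ (N.deg 1)) (x : F.deg 1) (w : Word (F.deg 1)) :
    S.DFull ν (merge (LinearMap.mul ℚ F) (x : F) (F.incl w)) =
      merge (LinearMap.mul ℚ F) (S.δ ν x : F) (F.incl w) +
        merge (LinearMap.mul ℚ F) (x : F) (F.incl (S.D ν w)) := by
  have : S.DFull ν ∘ₗ merge (LinearMap.mul ℚ F) (x : F) ∘ₗ F.incl =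
      merge (LinearMap.mul ℚ F) (S.δ ν x : F) ∘ₗ F.incl +
        merge (LinearMap.mul ℚ F) (x : F) ∘ₗ F.incl ∘ₗ S.D ν := by
    apply word_ext
    · simp [LinearMap.comp_apply, incl_one]
    · intro y w _
      simp only [LinearMap.comp_apply, LinearMap.add_apply, D_cons, map_add, incl_cons, merge_cons,
        DFull_cons, LinearMap.mul_apply', δFull_mul, DFull_incl]
      abel
  exact LinearMap.congr_fun this w

/-- The bar differential is built from the differential of letters, with which the derivation
commutes by `δFull_d`, and from products of adjacent letters, which it respects by `δFull_mul`. -/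
theorem DFull_bar (ν : Module.Dual ℚ (N.deg 1)) (w : Word (F.deg 1)) :
    S.DFull ν (F.bar (F.incl w)) = F.bar (F.incl (S.D ν w)) := by
  have : S.DFull ν ∘ₗ F.bar ∘ₗ F.incl = F.bar ∘ₗ F.incl ∘ₗ S.D ν := by
    apply word_ext
    · simp [LinearMap.comp_apply, incl_one, bar]
    · intro x w hw
      simp only [LinearMap.comp_apply] at hw ⊢
      rw [D_cons, map_add, map_add, incl_cons, incl_cons, incl_cons, bar_cons_one x.2,
        bar_cons_one x.2, bar_cons_one (S.δ ν x).2, map_add, map_sub, DFull_cons, DFull_cons,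
        DFull_merge, DFull_incl, hw, δFull_d, δFull_coe]
      abel
  exact LinearMap.congr_fun this w

/-- The connection preserves the cocycles. -/
theorem split₂_D (ν : Module.Dual ℚ (N.deg 1)) {w : Word (F.deg 1)} (hw : split₂ F.d₁ F.c₁ w = 0) :
    split₂ F.d₁ F.c₁ (S.D ν w) = 0 := by
  rw [← bar_incl_eq_zero] at hw ⊢
  rw [← DFull_bar, hw, map_zero]

/-- The connection on words in `F¹` over `A` that is the sum of the connection over `N` and the
deconcatenation of the first letter. -/
noncomputable def nabla : Word (F.deg 1) →ₗ[ℚ] A.deg 1 ⊗[ℚ] Word (F.deg 1) :=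
  S.σ₁.rTensor _ ∘ₗ uncons + φ.deg₁.rTensor _ ∘ₗ S.Γbar

theorem slice_nabla (l : Module.Dual ℚ (A.deg 1)) (w : Word (F.deg 1)) :
    slice l (S.nabla w) = ctr (l ∘ₗ S.σ₁) w + S.D (l ∘ₗ φ.deg₁) w := by
  change slice l (S.σ₁.rTensor _ _ + φ.deg₁.rTensor _ _) = _
  rw [map_add, slice_rTensor, slice_rTensor]
  rfl

/-- The part of degree one and Adams degree at most `q`. -/
noncomputable def lowOne (F : AdamsCDGA.{u}) (q : ℕ) : Submodule ℚ (F.deg 1) :=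
  (⨆ t : {t : ℕ // t ≤ q}, F.gr (1, t)).comap (F.deg 1).subtype

theorem exists_mem_lowOne (x : F.deg 1) : ∃ q, x ∈ lowOne F q := by
  have hmono : ∀ q q', q ≤ q' → lowOne F q ≤ lowOne F q' := by
    intro q q' h x hx
    have hle : (⨆ t : {t : ℕ // t ≤ q}, F.gr (1, (t : ℕ))) ≤
        ⨆ t : {t : ℕ // t ≤ q'}, F.gr (1, (t : ℕ)) := iSup_le fun t =>
      le_iSup (fun t : {t : ℕ // t ≤ q'} => F.gr (1, (t : ℕ))) ⟨t.1, t.2.trans h⟩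
    exact hle hx
  obtain ⟨x, hx⟩ := x
  induction hx using deg_induction with
  | h0 => exact ⟨0, zero_mem _⟩
  | ha x y hx' hy' hx hy =>
    obtain ⟨q, hq⟩ := hx
    obtain ⟨q', hq'⟩ := hy
    exact ⟨max q q', add_mem (hmono _ _ (le_max_left _ _) hq) (hmono _ _ (le_max_right _ _) hq')⟩
  | h r x hx =>
    exact ⟨r, Submodule.mem_iSup_of_mem (p := fun t : {t : ℕ // t ≤ r} => F.gr (1, t)) ⟨r, le_rfl⟩ hx⟩

theorem lowOne_zero {x : F.deg 1} (hx : x ∈ lowOne F 0) : x = 0 := by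
  apply Subtype.ext
  have h : (⨆ t : {t : ℕ // t ≤ 0}, F.gr (1, t)) ≤ ⊥ := iSup_le fun t => by
    rw [Nat.le_zero.1 t.2, F.gr_ne_zero 1 one_ne_zero]
  exact h hx

/-- Strictness in `δ_mem` gives the shift from q + 1 to q. Since the part of Adams degree zero
vanishes in degree one, repeated application ends at zero. -/
theorem δ_lowOne (ν : Module.Dual ℚ (N.deg 1)) {q : ℕ} {x : F.deg 1} (hx : x ∈ lowOne F (q + 1)) :
    S.δ ν x ∈ lowOne F q := by
  have h : ∀ y ∈ ⨆ t : {t : ℕ // t ≤ q + 1}, F.gr (1, t), ∃ hy : y ∈ F.deg 1,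
      S.δ ν ⟨y, hy⟩ ∈ lowOne F q := by
    intro y hy
    induction hy using Submodule.iSup_induction' with
    | zero => exact ⟨zero_mem _, by rw [show (⟨0, zero_mem _⟩ : F.deg 1) = 0 from rfl, map_zero]; exact zero_mem _⟩
    | add a b _ _ ha hb =>
      obtain ⟨ha, ha'⟩ := ha
      obtain ⟨hb, hb'⟩ := hb
      refine ⟨add_mem ha hb, ?_⟩
      rw [show (⟨a + b, add_mem ha hb⟩ : F.deg 1) = ⟨a, ha⟩ + ⟨b, hb⟩ from rfl, map_add]
      exact add_mem ha' hb'
    | mem t y hy =>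
      refine ⟨gr_le_deg _ _ hy, ?_⟩
      obtain ⟨z, hz, h⟩ := S.δ_mem ν hy
      change (S.δ ν _ : F) ∈ (⨆ s : {s : ℕ // s ≤ q}, F.gr (1, (s : ℕ)))
      rw [h]
      refine (iSup_le fun s => ?_ : (⨆ s : {s : ℕ // s < t.1}, F.gr (1, s)) ≤ _) hz
      have := s.2
      have := t.2
      exact le_iSup (fun t : {t : ℕ // t ≤ q} => F.gr (1, t)) ⟨s.1, by omega⟩
  exact (h x hx).2

/-- One application of `nabla` removes the first letter, lowers its Adams degree, or differentiates
the rest of the word; in each case the bound q + k on the remaining steps drops by at least one. -/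
theorem cons_mem_nilFil (n : ℕ) : ∀ (q k : ℕ), q + k ≤ n → ∀ (x : F.deg 1) (w : Word (F.deg 1)),
    x ∈ lowOne F q → w ∈ nilFil S.nabla k → cons x w ∈ nilFil S.nabla n := by
  induction n with
  | zero =>
    intro q k h x w hx hw
    obtain rfl : q = 0 := by omega
    rw [lowOne_zero hx]
    simp
  | succ n ih =>
    intro q k h x w hx hw
    rcases q with _ | q
    · rw [lowOne_zero hx]
      simp
    · rw [mem_nilFil_succ]
      intro l
      rw [slice_nabla, ctr_cons, D_cons]
      refine add_mem (Submodule.smul_mem _ _ (nilFil_mono _ (by omega) hw))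
        (add_mem (ih q k (by omega) _ _ (S.δ_lowOne _ hx) hw) ?_)
      rcases k with _ | k
      · obtain rfl : w = 0 := hw
        simp
      · refine ih (q + 1) k (by omega) x _ hx ?_
        -- Composing the form with φ ∘ ε kills σ(F¹) and does not change it on φ(N¹). This isolates
        -- the part `D` of `nabla`, so `D` alone also lowers the filtration.
        have := mem_nilFil_succ.1 hw (l ∘ₗ φ.deg₁ ∘ₗ ε.deg₁)
        rw [slice_nabla] at this
        have e1 : (l ∘ₗ φ.deg₁ ∘ₗ ε.deg₁) ∘ₗ S.σ₁ = 0 := by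
          ext y
          simp [S.ε₁_σ₁]
        have e2 : (l ∘ₗ φ.deg₁ ∘ₗ ε.deg₁) ∘ₗ φ.deg₁ = l ∘ₗ φ.deg₁ := by
          ext y
          simp [S.ε₁_φ₁]
        rw [e1, e2] at this
        simpa [ctr, slice] using this

theorem exists_mem_nilFil_nabla (w : Word (F.deg 1)) : ∃ k, w ∈ nilFil S.nabla k := by
  have : (⨆ k, nilFil S.nabla k) = ⊤ := by
    apply word_top
    · apply Submodule.mem_iSup_of_mem 1
      rw [mem_nilFil_succ]
      intro l
      rw [slice_nabla]
      simp
    · intro x w hw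
      rw [Submodule.mem_iSup_of_directed _ (nilFil_mono _).directed_le] at hw ⊢
      obtain ⟨k, hk⟩ := hw
      obtain ⟨q, hq⟩ := exists_mem_lowOne x
      exact ⟨q + k, S.cons_mem_nilFil _ q k le_rfl x w hq hk⟩
  rw [← Submodule.mem_iSup_of_directed _ (nilFil_mono _).directed_le, this]
  trivial

/-- The mixed multiplication `N¹ ⊗ F¹ → A²`. -/
noncomputable def mulTwo : N.deg 1 ⊗[ℚ] F.deg 1 →ₗ[ℚ] A.deg 2 :=
  -TensorProduct.lift (A.c₁.compl₁₂ φ.deg₁ S.σ₁)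

theorem mulTwo_tmul (n : N.deg 1) (y : F.deg 1) :
    S.mulTwo (n ⊗ₜ y) = -A.c₁ (φ.deg₁ n) (S.σ₁ y) := rfl

/-- This is `defect_one` read in A². The product N¹ · F¹ appears as minus `c₁`, the form in which it
cancels the mixed terms of `curv_sum`. -/
theorem d₁_σ₁ (x : F.deg 1) : A.d₁ (S.σ₁ x) = S.σ₂ (F.d₁ x) + S.mulTwo (S.Γ x) := by
  apply Subtype.ext
  have h := S.defect_one x
  rw [defect_apply, sub_eq_iff_eq_add'] at h
  refine h.trans (congrArg _ ?_)
  generalize S.Γ x = t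
  induction t with
  | zero => simp
  | add s t hs ht => simp only [map_add, hs, ht, Submodule.coe_add]
  | tmul n y =>
    rw [mulTwo_tmul, Submodule.coe_neg, c₁_coe, neg_neg]
    rfl

/-- The part over N is flat and the mixed terms cancel, so only the boundary within the fiber
remains. On cocycles of the fiber `nabla` is therefore flat, and its integral produces cocycles of
A. -/
theorem curv_nabla (w : Word (F.deg 1)) :
    curv A.d₁ A.c₁ S.nabla w = S.σ₂.rTensor _ (headSplit F.d₁ F.c₁ w) := by
  refine curv_sum (dN := N.d₁) (cN := N.c₁)
    (φ₂ := φ.toAlgHom.toLinearMap.restrict (fun _ hx => φ.map_deg hx))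
    c₁_add c₁_add ?_ ?_ ?_ (LinearMap.ext S.d₁_σ₁) S.curv_Γ w
  · intro x y
    apply Subtype.ext
    change -(S.σ x * S.σ y) = S.σ (-(x * y : F))
    rw [map_neg, map_mul]
  · intro x y
    apply Subtype.ext
    change -(φ x * φ y) = φ (-(x * y : N))
    rw [map_neg, map_mul]
  · ext n
    exact (φ.map_d' n).symm

end Splitting

end Adams

/-! ### Lifting cocycles from the fiber, and restricting invariant cocycles to it. -/

namespace Adams

section

variable {V U : Type*} [AddCommGroup V] [Module ℚ V] [AddCommGroup U] [Module ℚ U]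

theorem wcounit_ctr (l : Module.Dual ℚ V) (w : Word V) : wcounit (ctr l w) = l (pr₁ w) := by
  have : wcounit ∘ₗ ctr l = l ∘ₗ pr₁ := by
    apply word_ext
    · simp [LinearMap.comp_apply]
    · intro x w _
      simp [LinearMap.comp_apply, mul_comm]
  exact LinearMap.congr_fun this w

theorem deconc_ctr (l : Module.Dual ℚ V) (w : Word V) :
    deconc (ctr l w) = (ctr l).rTensor _ (deconc w) := by
  have : deconc ∘ₗ ctr l = (ctr l).rTensor _ ∘ₗ deconc := by
    apply word_ext
    · simp [LinearMap.comp_apply]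
    · intro x w _
      have : ctr l ∘ₗ cons x = l x • LinearMap.id := by
        ext w
        simp
      rw [LinearMap.comp_apply, LinearMap.comp_apply, deconc_cons, map_add,
        ← LinearMap.rTensor_comp_apply, this, LinearMap.rTensor_smul]
      simp
  exact LinearMap.congr_fun this w

/-- The contraction of `headSplit` by a linear form that is alternating on products. -/
theorem slice_headSplit {d : V →ₗ[ℚ] U} {c : V →ₗ[ℚ] V →ₗ[ℚ] U} {ω : Module.Dual ℚ U}
    {α β : Module.Dual ℚ V} (hω : ∀ a b, ω (c a b) = β a * α b - α a * β b) (w : Word V) :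
    slice ω (headSplit d c w) + ctr β (ctr α w) = ctr (ω ∘ₗ d) w + ctr α (ctr β w) := by
  have : slice ω ∘ₗ headSplit d c + ctr β ∘ₗ ctr α = ctr (ω ∘ₗ d) + ctr α ∘ₗ ctr β := by
    apply word_ext
    · simp [LinearMap.comp_apply]
    · intro x w _
      simp only [LinearMap.add_apply, LinearMap.comp_apply, headSplit_cons, map_add, slice_tmul,
        ctr_cons, map_smul, slice_rTensor]
      have : slice (ω ∘ₗ c x) (uncons w) = β x • ctr α w - α x • ctr β w := by
        rw [show ω ∘ₗ c x = β x • α - α x • β by ext y; simp [hω]]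
        have h : slice (M := Word V) (β x • α - α x • β) = β x • slice α - α x • slice β := by
          apply TensorProduct.ext'
          intro a b
          simp [sub_smul, mul_smul]
        rw [h]
        rfl
      rw [this]
      abel
  exact LinearMap.congr_fun this w

end

namespace AdamsCDGA

variable {A : AdamsCDGA.{u}}

theorem χ.word_closed (z : A.χ) : split₂ A.d₁ A.c₁ z.word = 0 :=
  bar_incl_eq_zero.1 z.2

/-- The element of `χ_A` given by a cocycle. -/
noncomputable def χ.mk (w : Word (A.deg 1)) (hw : split₂ A.d₁ A.c₁ w = 0) : A.χ :=
  (⟨w, bar_incl_eq_zero.2 hw⟩ : A.χSub)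

@[simp] theorem χ.word_mk (w : Word (A.deg 1)) (hw : split₂ A.d₁ A.c₁ w = 0) :
    (χ.mk w hw).word = w := rfl

theorem χ.word_injective : Function.Injective (χ.word (A := A)) := Subtype.val_injective

end AdamsCDGA

namespace Splitting

variable {N A F : AdamsCDGA.{u}} {φ : Hom N A} {ε : Hom A N} {π : Hom A F} (S : Splitting φ ε π)

include S in
/-- The restriction of cocycles to the fiber is surjective. -/
theorem χMap_surjective : Function.Surjective π.χMap := by
  -- Integrating `nabla` attaches to a word of the fiber a word over A with the same constant term
  -- whose contractions are given by `nabla`.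
  obtain ⟨L, hL0, hL⟩ := exists_integral S.nabla wcounit S.exists_mem_nilFil_nabla
  have hctr : ∀ l w, ctr l (L w) = L (slice l (S.nabla w)) := by
    intro l w
    rw [ctr_apply, hL, slice_lTensor]
  intro z
  -- The integrals of cocycles form a class stable under contraction, because both parts of `nabla`
  -- preserve cocycles, and `headSplit` vanishes on it by `curv_nabla`.
  have hc : split₂ A.d₁ A.c₁ (L z.word) = 0 := by
    refine split₂_eq_zero_of_stable A.d₁ A.c₁ (fun v => ∃ w, split₂ F.d₁ F.c₁ w = 0 ∧ v = L w)
      ?_ ?_ ⟨z.word, z.word_closed, rfl⟩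
    · rintro _ ⟨w, hw, rfl⟩
      rw [headSplit, curv_map _ _ hL, curv_nabla, headSplit_eq_zero _ _ hw, map_zero, map_zero]
    · rintro l _ ⟨w, hw, rfl⟩
      refine ⟨_, ?_, hctr l w⟩
      rw [slice_nabla, map_add, split₂_ctr _ _ hw, S.split₂_D _ hw, add_zero]
  refine ⟨χ.mk (L z.word) hc, χ.word_injective ?_⟩
  rw [Hom.χMap_word, χ.word_mk]
  -- A form pulled back along π kills φ(N¹), so after restriction only the removal of the first
  -- letter survives in `nabla`, as for the identity.
  have : wmap π.deg₁ ∘ₗ L = LinearMap.id := by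
    refine word_hom_ext (fun l w => ctr l w) ?_ ?_ (fun _ _ => rfl)
    · intro w
      rw [LinearMap.comp_apply, wcounit_wmap, hL0, LinearMap.id_apply]
    · intro l w
      have e1 : (l ∘ₗ π.deg₁) ∘ₗ S.σ₁ = l := by
        ext y
        simp [S.π₁_σ₁]
      have e2 : (l ∘ₗ π.deg₁) ∘ₗ φ.deg₁ = 0 := by
        ext y
        simp [S.π₁_φ₁]
      rw [LinearMap.comp_apply, LinearMap.comp_apply, ctr_wmap, hctr, slice_nabla, e1, e2]
      simp [D, slice]
  exact LinearMap.congr_fun this z.word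

/-- The cocycles that are invariant under right translation by the image of the section. -/
def IsInv (ε : Hom A N) (x : Word (A.deg 1)) : Prop :=
  split₂ A.d₁ A.c₁ x = 0 ∧ (ε.deg₁ ∘ₗ pr₁).lTensor _ (deconc x) = 0

/-- Contraction acts on the left factor of the deconcatenation and invariance is a condition on the
right factor, so the two commute. -/
theorem IsInv.ctr {x : Word (A.deg 1)} (hx : IsInv ε x) (l : Module.Dual ℚ (A.deg 1)) :
    IsInv ε (ctr l x) := by
  refine ⟨split₂_ctr _ _ hx.1 l, ?_⟩
  rw [deconc_ctr, ← LinearMap.comp_apply (LinearMap.lTensor _ _),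
    LinearMap.lTensor_comp_rTensor, ← LinearMap.rTensor_comp_lTensor, LinearMap.comp_apply, hx.2,
    map_zero]

theorem IsInv.pr₁ {x : Word (A.deg 1)} (hx : IsInv ε x) : ε.deg₁ (pr₁ x) = 0 := by
  have h := congrArg (slice wcounit) hx.2
  rw [slice_lTensor, map_zero] at h
  have e : slice wcounit (deconc x) = x := by
    rw [slice, LinearMap.comp_apply, wcounit_deconc]
    simp
  rwa [e] at h

/-- The linear form on `A²` given by the product of forms on `N¹` and `F¹`. -/
noncomputable def mixedForm (ν : Module.Dual ℚ (N.deg 1)) (μ : Module.Dual ℚ (F.deg 1)) :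
    Module.Dual ℚ (A.deg 2) :=
  μ ∘ₗ F.proj 1 ∘ₗ slice (ν ∘ₗ N.proj 1) ∘ₗ S.ret ∘ₗ (A.deg 2).subtype

theorem form_mul (ν : Module.Dual ℚ (N.deg 1)) (n : N) (f : F) :
    slice (ν ∘ₗ N.proj 1) (S.ret (φ n * S.σ f)) = ν (N.proj 1 n) • f := by
  rw [S.ret_mul, slice_tmul]
  rfl

theorem proj_one_one : N.proj 1 (1 : N) = 0 :=
  proj_ne (by norm_num) ⟨1, gr_le_deg 0 0 SetLike.GradedOne.one_mem⟩

/-- Split both arguments along A¹ = φ(N¹) ⊕ σ(F¹). Only the two mixed products have a component in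
N¹ ⊗ F¹, and they enter with opposite signs because elements of degree one anticommute. -/
theorem mixedForm_c₁ (ν : Module.Dual ℚ (N.deg 1)) (μ : Module.Dual ℚ (F.deg 1)) (a b : A.deg 1) :
    S.mixedForm ν μ (A.c₁ a b) =
      (μ ∘ₗ π.deg₁) a * (ν ∘ₗ ε.deg₁) b - (ν ∘ₗ ε.deg₁) a * (μ ∘ₗ π.deg₁) b := by
  have key : ∀ (n n' : N.deg 1) (y y' : F.deg 1), slice (ν ∘ₗ N.proj 1)
      (S.ret ((φ n + S.σ y) * (φ n' + S.σ y'))) = ν n • (y' : F) - ν n' • (y : F) := by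
    intro n n' y y'
    have e : (φ n + S.σ y) * (φ n' + S.σ y') = φ (n * n') * S.σ 1 + φ n * S.σ y' -
        φ n' * S.σ y + φ 1 * S.σ (y * y') := by
      have : S.σ y * φ n' = -(φ n' * S.σ y) := by
        rw [mul_comm_one (φ.map_deg n'.2), J_one (S.σ_deg y.2), mul_neg]
      simp only [map_mul, map_one, mul_one, one_mul, mul_add, add_mul, this]
      abel
    have h2 : N.proj 1 (n * n' : N) = 0 := proj_ne (by norm_num) ⟨_, mul_mem_two n.2 n'.2⟩
    rw [e, map_add, map_sub, map_add, map_add, map_sub, map_add, form_mul, form_mul, form_mul,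
      form_mul, proj_one_one, h2, proj_coe, proj_coe]
    simp
  have h := key (ε.deg₁ a) (ε.deg₁ b) (π.deg₁ a) (π.deg₁ b)
  have ha := congrArg Subtype.val (S.decomp₁ a)
  have hb := congrArg Subtype.val (S.decomp₁ b)
  change φ (ε.deg₁ a) + S.σ (π.deg₁ a) = _ at ha
  change φ (ε.deg₁ b) + S.σ (π.deg₁ b) = _ at hb
  rw [ha, hb] at h
  change μ (F.proj 1 (slice (ν ∘ₗ N.proj 1) (S.ret (A.c₁ a b : A)))) = _
  rw [c₁_coe, map_neg, map_neg, h, map_neg, map_sub, map_smul, map_smul, proj_coe, proj_coe]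
  simp
  ring

/-- The differentials of N and of F contribute to N² and σ(F²) only; the mixed component of d comes
from the defect of σ. -/
theorem mixedForm_d₁ (ν : Module.Dual ℚ (N.deg 1)) (μ : Module.Dual ℚ (F.deg 1)) :
    S.mixedForm ν μ ∘ₗ A.d₁ = μ ∘ₗ S.δ ν ∘ₗ π.deg₁ := by
  ext a
  have ha := congrArg Subtype.val (S.decomp₁ a)
  change φ (ε.deg₁ a) + S.σ (π.deg₁ a) = _ at ha
  change μ (F.proj 1 (slice (ν ∘ₗ N.proj 1) (S.ret (A.d a)))) = μ (S.δ ν (π.deg₁ a))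
  have h1 : A.d a = φ (N.d (ε.deg₁ a)) * S.σ 1 + φ 1 * S.σ (F.d (π.deg₁ a)) +
      S.mulOne ((F.deg 1).subtype.lTensor _ (S.Γ (π.deg₁ a))) := by
    rw [← ha, map_add, ← φ.map_d', ← defect_one, defect_apply, map_one, map_one, mul_one, one_mul]
    abel
  have h2 : N.proj 1 (N.d (ε.deg₁ a)) = 0 := proj_ne (by norm_num) ⟨_, d_mem_two (ε.deg₁ a).2⟩
  rw [h1]
  simp only [map_add]
  rw [form_mul, form_mul, h2, proj_one_one, slice_ret_mulOne, slice_lTensor]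
  simp only [map_zero, zero_smul, zero_add]
  rw [Submodule.subtype_apply, proj_coe]
  rfl

/-- On invariant cocycles, the connection is the restriction of the contraction along the base. -/
theorem D_restrict {x : Word (A.deg 1)} (hx : IsInv ε x) (ν : Module.Dual ℚ (N.deg 1)) :
    S.D ν (wmap π.deg₁ x) = wmap π.deg₁ (ctr (ν ∘ₗ ε.deg₁) x) := by
  rw [← sub_eq_zero]
  refine eq_zero_of_stable (fun w => ∃ x, IsInv ε x ∧
    w = S.D ν (wmap π.deg₁ x) - wmap π.deg₁ (Adams.ctr (ν ∘ₗ ε.deg₁) x)) ?_ ?_ ⟨x, hx, rfl⟩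
  · rintro _ ⟨x, hx, rfl⟩
    -- In length zero the derivation contributes nothing, and the contraction contributes ν of ε
    -- applied to the part of length one, which vanishes by invariance.
    rw [map_sub, wcounit_wmap, wcounit_ctr, LinearMap.comp_apply, hx.pr₁, map_zero, sub_zero]
    exact wcounit_slice_wordConn _ _ _
  · rintro μ _ ⟨x, hx, rfl⟩
    refine ⟨_, hx.ctr (μ ∘ₗ π.deg₁), ?_⟩
    -- For a cocycle the mixed form gives the commutator of the contractions along N and along F: it
    -- is the contraction by the connection. That term cancels the one from `ctr_D`, so the
    -- difference keeps its shape for the contracted word.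
    have h := slice_headSplit (S.mixedForm_c₁ ν μ) (d := A.d₁) x
    rw [headSplit_eq_zero _ _ hx.1, map_zero, zero_add, mixedForm_d₁] at h
    rw [map_sub, ctr_D, ctr_wmap, ctr_wmap, ctr_wmap, h, map_add, LinearMap.comp_assoc]
    abel

include S in
/-- An invariant cocycle is determined by its restriction to the fiber. -/
theorem eq_zero_of_isInv {x : Word (A.deg 1)} (hx : IsInv ε x) (h : wmap π.deg₁ x = 0) : x = 0 := by
  refine eq_zero_of_stable (fun x => IsInv ε x ∧ wmap π.deg₁ x = 0) ?_ ?_ ⟨hx, h⟩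
  · rintro x ⟨-, h⟩
    rw [← wcounit_wmap π.deg₁, h, map_zero]
  · rintro l x ⟨hx, h⟩
    refine ⟨hx.ctr l, ?_⟩
    -- A form on A¹ is a sum of a form through ε and a form through π. Contraction by the first
    -- restricts to the connection applied to the restriction, by the second to a contraction of it;
    -- both are zero.
    have hl : l = (l ∘ₗ φ.deg₁) ∘ₗ ε.deg₁ + (l ∘ₗ S.σ₁) ∘ₗ π.deg₁ := by
      ext a
      conv_lhs => rw [← S.decomp₁ a]
      simp
    rw [hl, ctr_add, map_add, ← S.D_restrict hx, ← ctr_wmap, h]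
    simp

end Splitting

end Adams

/-! ### Split extensions of affine group schemes, on points. -/

namespace Adams

section PointsLemmas

open WithConv

variable {H B C : Type u} [CommRing H] [HopfAlgebra ℚ H] [CommRing B] [HopfAlgebra ℚ B]
  [CommRing C] [HopfAlgebra ℚ C]

/-- A point as a homomorphism of algebras. -/
def Points.hom {R : Type*} [CommRing R] [Algebra ℚ R] (g : Points H R) : H →ₐ[ℚ] R :=
  WithConv.ofConv g

/-- A homomorphism of algebras as a point. -/
def Points.ofHom {R : Type*} [CommRing R] [Algebra ℚ R] (g : H →ₐ[ℚ] R) : Points H R := toConv g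

theorem Points.ext {R : Type*} [CommRing R] [Algebra ℚ R] {g h : Points H R}
    (hgh : ∀ x, g.hom x = h.hom x) : g = h :=
  WithConv.ofConv_injective (AlgHom.ext hgh)

theorem Points.mul_apply {R : Type*} [CommRing R] [Algebra ℚ R] (g h : Points H R) (x : H) :
    (g * h).hom x =
      Algebra.TensorProduct.productMap g.hom h.hom (Coalgebra.comul (R := ℚ) x) := by
  rw [Algebra.TensorProduct.productMap_eq_comp_map]
  rfl

theorem Points.one_apply {R : Type*} [CommRing R] [Algebra ℚ R] (x : H) :
    (1 : Points H R).hom x = algebraMap ℚ R (Coalgebra.counit x) := rfl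

theorem Points.map_hom {R S : Type*} [CommRing R] [Algebra ℚ R] [CommRing S] [Algebra ℚ S]
    (f : R →ₐ[ℚ] S) (g : Points H R) (x : H) : (Points.map H f g).hom x = f (g.hom x) := rfl

theorem Points.map_comap {R S : Type*} [CommRing R] [Algebra ℚ R] [CommRing S] [Algebra ℚ S]
    (f : R →ₐ[ℚ] S) (p : B →ₐc[ℚ] H) (g : Points H R) :
    Points.map B f (Points.comap p R g) = Points.comap p S (Points.map H f g) := rfl

/-- The universal point. -/
noncomputable def Points.univ (H : Type u) [CommRing H] [HopfAlgebra ℚ H] : Points H H :=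
  Points.ofHom (AlgHom.id ℚ H)

end PointsLemmas

/-- Maps of Hopf algebras dual to a split extension `Spec C → Spec H → Spec B` of group schemes. -/
structure SplitExt (B H C : Type u) [CommRing H] [HopfAlgebra ℚ H] [CommRing B] [HopfAlgebra ℚ B]
    [CommRing C] [HopfAlgebra ℚ C] where
  /-- the map dual to the projection -/
  p : B →ₐc[ℚ] H
  /-- the map dual to the section -/
  e : H →ₐc[ℚ] B
  /-- the map dual to the inclusion of the kernel -/
  q : H →ₐc[ℚ] C
  e_p : ∀ b, e (p b) = b
  q_p : ∀ b, q (p b) = algebraMap ℚ C (Coalgebra.counit b)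
  q_surjective : Function.Surjective q
  -- The first hypothesis says x(g s(h)) = x(g), the second that x vanishes on the kernel. This
  -- single condition replaces exactness in the middle.
  eq_zero : ∀ x, Algebra.TensorProduct.map (AlgHom.id ℚ H) (e : H →ₐ[ℚ] B) (Coalgebra.comul x) =
    x ⊗ₜ 1 → q x = 0 → x = 0

namespace SplitExt

open WithConv

variable {H B C : Type u} [CommRing H] [HopfAlgebra ℚ H] [CommRing B] [HopfAlgebra ℚ B]
  [CommRing C] [HopfAlgebra ℚ C] (X : SplitExt B H C) {R : Type u} [CommRing R] [Algebra ℚ R]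

/-- The projection on points. -/
noncomputable abbrev proj (R : Type u) [CommRing R] [Algebra ℚ R] : Points H R →* Points B R :=
  Points.comap X.p R

/-- The section on points. -/
noncomputable abbrev sec (R : Type u) [CommRing R] [Algebra ℚ R] : Points B R →* Points H R :=
  Points.comap X.e R

/-- The inclusion of the kernel on points. -/
noncomputable abbrev inc (R : Type u) [CommRing R] [Algebra ℚ R] : Points C R →* Points H R :=
  Points.comap X.q R

theorem proj_sec (g : Points B R) : X.proj R (X.sec R g) = g :=
  Points.ext fun b => congrArg g.hom (X.e_p b)

theorem proj_inc (k : Points C R) : X.proj R (X.inc R k) = 1 :=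
  Points.ext fun b => (congrArg k.hom (X.q_p b)).trans (AlgHom.commutes _ _)

theorem inc_injective : Function.Injective (X.inc R) := by
  intro k l h
  refine Points.ext fun c => ?_
  obtain ⟨x, rfl⟩ := X.q_surjective c
  exact DFunLike.congr_fun (congrArg Points.hom h) x

/-- The map of schemes `g ↦ g s(π g)⁻¹`. -/
noncomputable def retr : Points H H :=
  Points.univ H * (X.sec H (X.proj H (Points.univ H)))⁻¹

theorem map_retr (g : Points H R) :
    Points.map H g.hom X.retr = g * (X.sec R (X.proj R g))⁻¹ := by
  rw [retr, map_mul, map_inv]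
  rfl

theorem apply_retr (g : Points H R) (x : H) : g.hom (X.retr.hom x) =
    (g * (X.sec R (X.proj R g))⁻¹).hom x := by
  rw [← map_retr]
  rfl

/-- On the kernel the projection is trivial, so g ↦ g s(π g)⁻¹ is the identity there. -/
theorem q_retr (x : H) : X.q (X.retr.hom x) = X.q x := by
  have h := X.apply_retr (X.inc C (Points.univ C)) x
  rw [X.proj_inc, map_one, inv_one, mul_one] at h
  exact h

theorem map_eq_mul (x : H) :
    Algebra.TensorProduct.map (AlgHom.id ℚ H) (X.e : H →ₐ[ℚ] B) (Coalgebra.comul x) =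
      ((Points.ofHom Algebra.TensorProduct.includeLeft : Points H (H ⊗[ℚ] B)) *
        X.sec _ (Points.ofHom Algebra.TensorProduct.includeRight : Points B (H ⊗[ℚ] B))).hom x :=
  map_eq_conv (AlgHom.id ℚ H) (X.e : H →ₐ[ℚ] B) x

/-- Replacing g by g s(h) replaces s(π g) by s(π g) s(h), and the two factors s(h) cancel. -/
theorem retr_invariant (x : H) : Algebra.TensorProduct.map (AlgHom.id ℚ H) (X.e : H →ₐ[ℚ] B)
    (Coalgebra.comul (X.retr.hom x)) = X.retr.hom x ⊗ₜ 1 := by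
  rw [map_eq_mul, apply_retr, map_mul, proj_sec, map_mul, mul_inv_rev, mul_assoc,
    mul_inv_cancel_left, ← apply_retr]
  rfl

theorem retr_eq_zero {x : H} (hx : X.q x = 0) : X.retr.hom x = 0 :=
  X.eq_zero _ (X.retr_invariant x) ((X.q_retr x).trans hx)

/-- If π g = 1 then g equals g s(π g)⁻¹, so g(x) = g(`retr` x). A function vanishing on the kernel
has zero pullback along `retr`, being invariant and zero on the kernel; hence g factors through q.
-/
theorem exists_inc_eq {g : Points H R} (hg : X.proj R g = 1) : ∃ k, X.inc R k = g := by
  have hker : RingHom.ker (X.q : H →ₐ[ℚ] C).toRingHom ≤ RingHom.ker g.hom.toRingHom := by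
    intro x hx
    have hx : X.q x = 0 := hx
    change g.hom x = 0
    have h := X.apply_retr g x
    rw [hg, map_one, inv_one, mul_one, X.retr_eq_zero hx, map_zero] at h
    exact h.symm
  exact ⟨Points.ofHom (AlgHom.liftOfSurjective (X.q : H →ₐ[ℚ] C) X.q_surjective g.hom hker),
    Points.ext fun x => AlgHom.liftOfSurjective_apply (X.q : H →ₐ[ℚ] C) X.q_surjective g.hom hker x⟩

theorem range_inc : (X.inc R).range = (X.proj R).ker := by
  ext g
  constructor
  · rintro ⟨k, rfl⟩
    exact X.proj_inc k
  · exact X.exists_inc_eq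

theorem exists_conj (g : Points B R) (k : Points C R) :
    ∃ l, X.inc R l = X.sec R g * X.inc R k * (X.sec R g)⁻¹ := by
  apply X.exists_inc_eq
  rw [map_mul, map_mul, map_inv, proj_inc, mul_one, mul_inv_cancel]

/-- The conjugate of a point of the kernel by a point of the section. -/
noncomputable def conj (g : Points B R) (k : Points C R) : Points C R :=
  Classical.choose (X.exists_conj g k)

theorem inc_conj (g : Points B R) (k : Points C R) :
    X.inc R (X.conj g k) = X.sec R g * X.inc R k * (X.sec R g)⁻¹ :=
  Classical.choose_spec (X.exists_conj g k)

theorem conj_one (k : Points C R) : X.conj 1 k = k := X.inc_injective (by simp [inc_conj])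

theorem conj_mul (g h : Points B R) (k : Points C R) :
    X.conj (g * h) k = X.conj g (X.conj h k) := X.inc_injective (by simp [inc_conj, mul_assoc])

/-- The action on the kernel by conjugation by means of the section. -/
noncomputable def action : GroupAction B C where
  act R _ _ :=
    { toFun := fun g =>
        { toFun := X.conj g
          invFun := X.conj g⁻¹
          left_inv := fun k => by rw [← conj_mul, inv_mul_cancel, conj_one]
          right_inv := fun k => by rw [← conj_mul, mul_inv_cancel, conj_one]
          map_mul' := fun k l => X.inc_injective (by simp [inc_conj]) }
      map_one' := MulEquiv.ext X.conj_one
      map_mul' := fun g h => MulEquiv.ext (X.conj_mul g h) }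
  natural R S _ _ _ _ f g k := by
    apply X.inc_injective
    change X.inc S (Points.map C f (X.conj g k)) = X.inc S (X.conj _ _)
    rw [inc_conj, ← Points.map_comap, inc_conj, map_mul, map_mul, map_inv]
    rfl

theorem inc_act (g : Points B R) (k : Points C R) :
    X.inc R (X.action.act R g k) = X.sec R g * X.inc R k * (X.sec R g)⁻¹ := X.inc_conj g k

/-- The isomorphism of the semidirect product with the middle group. -/
noncomputable def semidirectEquiv (R : Type u) [CommRing R] [Algebra ℚ R] :
    Points C R ⋊[X.action.act R] Points B R ≃* Points H R :=
  MulEquiv.ofBijective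
    (SemidirectProduct.lift (X.inc R) (X.sec R) (fun g => by
      ext1 k
      exact X.inc_act g k))
    ⟨by
      rw [injective_iff_map_eq_one]
      intro x hx
      have hx : X.inc R x.left * X.sec R x.right = 1 := hx
      have h1 := congrArg (X.proj R) hx
      rw [map_mul, proj_inc, proj_sec, one_mul, map_one] at h1
      rw [h1, map_one, mul_one] at hx
      exact SemidirectProduct.ext (X.inc_injective (hx.trans (map_one _).symm)) h1,
    by
      intro g
      obtain ⟨k, hk⟩ := X.exists_inc_eq (g := g * (X.sec R (X.proj R g))⁻¹) (by
        rw [map_mul, map_inv, proj_sec, mul_inv_cancel])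
      refine ⟨⟨k, X.proj R g⟩, ?_⟩
      change X.inc R k * X.sec R (X.proj R g) = g
      rw [hk, inv_mul_cancel_right]⟩

theorem semidirectEquiv_apply (x : Points C R ⋊[X.action.act R] Points B R) :
    X.semidirectEquiv R x = X.inc R x.left * X.sec R x.right := rfl

/-- The coaction of the conjugation action on the restriction of an invariant function. -/
theorem coaction_q {x : H} (hx : Algebra.TensorProduct.map (AlgHom.id ℚ H) (X.e : H →ₐ[ℚ] B)
    (Coalgebra.comul x) = x ⊗ₜ 1) : X.action.coaction (X.q x) =
      Algebra.TensorProduct.map (X.e : H →ₐ[ℚ] B) (X.q : H →ₐ[ℚ] C) (Coalgebra.comul x) := by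
  -- The invariance of x as an identity between values at points of all test rings.
  have hinv : ∀ {R : Type u} [CommRing R] [Algebra ℚ R] (g : Points H R) (b : Points B R),
      (g * X.sec R b).hom x = g.hom x := by
    intro R _ _ g b
    have h := congrArg (Algebra.TensorProduct.productMap g.hom b.hom) hx
    rw [map_eq_mul, Algebra.TensorProduct.productMap_left_apply] at h
    rw [← h]
    rw [← Points.map_hom, map_mul, Points.map_comap]
    refine congrArg (fun k : Points H R => k.hom x) (congrArg₂ (· * ·) ?_ ?_)
    · exact (congrArg Points.ofHom (Algebra.TensorProduct.productMap_left g.hom b.hom)).symm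
    · exact congrArg (X.sec R)
        (congrArg Points.ofHom (Algebra.TensorProduct.productMap_right g.hom b.hom)).symm
  -- Evaluate x at s(g) k s(g)⁻¹ for the universal g and k; invariance removes the last factor and
  -- leaves the coproduct.
  have h := congrArg (fun k => Points.hom k x) (X.inc_act (R := B ⊗[ℚ] C)
    (Points.ofHom Algebra.TensorProduct.includeLeft) (Points.ofHom Algebra.TensorProduct.includeRight))
  rw [← map_inv, hinv] at h
  exact h.trans (map_eq_conv (X.e : H →ₐ[ℚ] B) (X.q : H →ₐ[ℚ] C) x).symm

end SplitExt

section Coaction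

variable {B C : Type u} [CommRing B] [HopfAlgebra ℚ B] [CommRing C] [HopfAlgebra ℚ C]

/-- An action is given by its coaction. -/
theorem GroupAction.act_hom (β : GroupAction B C) {R : Type u} [CommRing R] [Algebra ℚ R]
    (g : Points B R) (k : Points C R) (c : C) : (β.act R g k).hom c =
      Algebra.TensorProduct.productMap g.hom k.hom (β.coaction c) := by
  have h := β.natural _ R (Algebra.TensorProduct.productMap g.hom k.hom)
    (Points.ofHom Algebra.TensorProduct.includeLeft)
    (Points.ofHom Algebra.TensorProduct.includeRight)
  have h1 : Points.map B (Algebra.TensorProduct.productMap g.hom k.hom)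
      (Points.ofHom Algebra.TensorProduct.includeLeft) = g :=
    congrArg Points.ofHom (Algebra.TensorProduct.productMap_left g.hom k.hom)
  have h2 : Points.map C (Algebra.TensorProduct.productMap g.hom k.hom)
      (Points.ofHom Algebra.TensorProduct.includeRight) = k :=
    congrArg Points.ofHom (Algebra.TensorProduct.productMap_right g.hom k.hom)
  rw [h1, h2] at h
  rw [← h]
  rfl

theorem GroupAction.ext_coaction {β γ : GroupAction B C} (h : ∀ c, β.coaction c = γ.coaction c) :
    β = γ := by
  have hact : β.act = γ.act := by
    funext R _ _
    ext g k : 2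
    exact Points.ext fun c => by rw [act_hom, act_hom, h]
  cases β
  cases γ
  cases hact
  rfl

theorem GroupAction.counit_coaction (β : GroupAction B C) (c : C) :
    (Coalgebra.counit (R := ℚ) (A := B)).rTensor C (β.coaction c) = 1 ⊗ₜ c := by
  have h := β.act_hom (1 : Points B C) (Points.univ C) c
  rw [map_one] at h
  have e : ∀ t : B ⊗[ℚ] C, Algebra.TensorProduct.productMap (1 : Points B C).hom
      (Points.univ C).hom t = TensorProduct.lid ℚ C (Coalgebra.counit.rTensor C t) := by
    intro t
    induction t with
    | zero => simp
    | add s t hs ht => simp only [map_add, hs, ht]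
    | tmul b c =>
      rw [Algebra.TensorProduct.productMap_apply_tmul, Points.one_apply, LinearMap.rTensor_tmul,
        TensorProduct.lid_tmul, Algebra.smul_def]
      rfl
  rw [e] at h
  apply (TensorProduct.lid ℚ C).injective
  rw [← h, TensorProduct.lid_tmul, one_smul]
  rfl

/-- This is (g h) · k = g · (h · k) for the universal g, h and k over B ⊗ (B ⊗ C), translated
through the coaction. -/
theorem GroupAction.coassoc (β : GroupAction B C) (c : C) :
    TensorProduct.assoc ℚ B B C ((Coalgebra.comul (R := ℚ) (A := B)).rTensor C (β.coaction c)) =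
      β.coaction.toLinearMap.lTensor B (β.coaction c) := by
  let R := B ⊗[ℚ] (B ⊗[ℚ] C)
  let g : Points B R := Points.ofHom Algebra.TensorProduct.includeLeft
  let h : Points B R := Points.ofHom
    (Algebra.TensorProduct.includeRight.comp Algebra.TensorProduct.includeLeft)
  let k : Points C R := Points.ofHom
    (Algebra.TensorProduct.includeRight.comp Algebra.TensorProduct.includeRight)
  have key := congrArg (fun l => Points.hom l c)
    (DFunLike.congr_fun (map_mul (β.act R) g h) k)
  simp only [MulAut.mul_apply] at key
  rw [act_hom, act_hom] at key
  have e1 : ∀ t : B ⊗[ℚ] C, Algebra.TensorProduct.productMap (g * h).hom k.hom t =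
      TensorProduct.assoc ℚ B B C ((Coalgebra.comul (R := ℚ) (A := B)).rTensor C t) := by
    intro t
    induction t with
    | zero => simp
    | add s t hs ht => simp only [map_add, hs, ht]
    | tmul b c =>
      rw [Algebra.TensorProduct.productMap_apply_tmul, Points.mul_apply, LinearMap.rTensor_tmul]
      generalize Coalgebra.comul (R := ℚ) b = s
      induction s with
      | zero => simp
      | add s t hs ht => simp only [map_add, add_mul, TensorProduct.add_tmul, hs, ht]
      | tmul x y =>
        simp only [Algebra.TensorProduct.productMap_apply_tmul, TensorProduct.assoc_tmul]
        change (x ⊗ₜ[ℚ] ((1 : B) ⊗ₜ[ℚ] (1 : C))) * ((1 : B) ⊗ₜ[ℚ] (y ⊗ₜ[ℚ] (1 : C))) *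
          ((1 : B) ⊗ₜ[ℚ] ((1 : B) ⊗ₜ[ℚ] c)) = _
        simp
  have e2 : ∀ t : B ⊗[ℚ] C, Algebra.TensorProduct.productMap g.hom (β.act R h k).hom t =
      β.coaction.toLinearMap.lTensor B t := by
    intro t
    induction t with
    | zero => simp
    | add s t hs ht => simp only [map_add, hs, ht]
    | tmul b c =>
      rw [Algebra.TensorProduct.productMap_apply_tmul, act_hom, LinearMap.lTensor_tmul]
      change _ = b ⊗ₜ[ℚ] β.coaction c
      generalize β.coaction c = s
      induction s with
      | zero => simp
      | add s t hs ht => simp only [map_add, mul_add, TensorProduct.tmul_add, hs, ht]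
      | tmul x y =>
        simp only [Algebra.TensorProduct.productMap_apply_tmul]
        change (b ⊗ₜ[ℚ] ((1 : B) ⊗ₜ[ℚ] (1 : C))) * (((1 : B) ⊗ₜ[ℚ] (x ⊗ₜ[ℚ] (1 : C))) *
          ((1 : B) ⊗ₜ[ℚ] ((1 : B) ⊗ₜ[ℚ] y))) = _
        simp
  rw [← e1, ← e2]
  exact key

end Coaction

end Adams

/-! ### Actions are determined by their infinitesimal coaction. -/

namespace Adams

namespace AdamsCDGA

variable {A B : AdamsCDGA.{u}}

theorem χ.comul_word (x : A.χ) : TensorProduct.map χ.word χ.word (Coalgebra.comul (R := ℚ) x) =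
    deconc x.word := A.χSub_isSubHopf.map_comul x

theorem χ.word_one : χ.word (1 : A.χ) = 1 := rfl

theorem χ.word_algebraMap (r : ℚ) : χ.word (algebraMap ℚ A.χ r) = r • 1 := by
  rw [Algebra.algebraMap_eq_smul_one, map_smul, word_one]

theorem incl_injective : Function.Injective A.incl := by
  refine Function.LeftInverse.injective (g := wmap (A.proj 1)) fun w => ?_
  rw [incl, wmap_wmap]
  convert wmap_id w
  ext x : 1
  exact proj_coe 1 x

theorem wmap_zero_apply {V W : Type*} [AddCommGroup V] [Module ℚ V] [AddCommGroup W] [Module ℚ W]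
    (w : Word V) : wmap (0 : V →ₗ[ℚ] W) w = wcounit w • 1 := by
  have : wmap (0 : V →ₗ[ℚ] W) = wcounit.smulRight 1 := by
    apply word_ext
    · simp
    · intro x w _
      simp
  exact LinearMap.congr_fun this w

theorem pr₁_wmap {V W : Type*} [AddCommGroup V] [Module ℚ V] [AddCommGroup W] [Module ℚ W]
    (f : V →ₗ[ℚ] W) : pr₁ ∘ₗ wmap f = f ∘ₗ pr₁ := by
  apply word_ext
  · simp [LinearMap.comp_apply]
  · intro x w _
    simp [LinearMap.comp_apply, wcounit_wmap]

/-- The projection of `χ_A` to its co-Lie algebra. -/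
noncomputable def χ.lieProj (A : AdamsCDGA.{u}) : A.χ →ₗ[ℚ] A.deg 1 := pr₁ ∘ₗ χ.word

theorem map_injective {M P Q R : Type*} [AddCommGroup M] [Module ℚ M] [AddCommGroup P] [Module ℚ P]
    [AddCommGroup Q] [Module ℚ Q] [AddCommGroup R] [Module ℚ R] {f : M →ₗ[ℚ] P} {g : Q →ₗ[ℚ] R}
    (hf : Function.Injective f) (hg : Function.Injective g) :
    Function.Injective (TensorProduct.map f g) := by
  rw [← LinearMap.lTensor_comp_rTensor]
  exact (Module.Flat.lTensor_preserves_injective_linearMap _ hg).comp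
    (Module.Flat.rTensor_preserves_injective_linearMap _ hf)

theorem map_rTensor_apply {M P Q R X : Type*} [AddCommGroup M] [Module ℚ M] [AddCommGroup P]
    [Module ℚ P] [AddCommGroup Q] [Module ℚ Q] [AddCommGroup R] [Module ℚ R] [AddCommGroup X]
    [Module ℚ X] (f : M →ₗ[ℚ] P) (g : Q →ₗ[ℚ] R) (h : X →ₗ[ℚ] M) (t : X ⊗[ℚ] Q) :
    TensorProduct.map f g (h.rTensor Q t) = TensorProduct.map (f ∘ₗ h) g t := by
  induction t with
  | zero => simp
  | add s t hs ht => simp only [map_add, hs, ht]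
  | tmul x q => simp

end AdamsCDGA

section Uniqueness

variable {N F : AdamsCDGA.{u}}

theorem GroupAction.infinitesimal_apply (β : GroupAction N.χ F.χ) (z : F.χ) :
    β.infinitesimal z = TensorProduct.map (N.deg 1).subtype (F.incl ∘ₗ χ.word)
      ((χ.lieProj N).rTensor _ (β.coaction z)) := by
  exact (map_rTensor_apply (N.deg 1).subtype (F.incl ∘ₗ χ.word) (χ.lieProj N) (β.coaction z)).symm

/-- The matrix coefficients of an action, as words. -/
noncomputable def GroupAction.coeff (β : GroupAction N.χ F.χ) (ξ : Module.Dual ℚ F.χ) :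
    F.χ →ₗ[ℚ] Word (N.deg 1) :=
  slice ξ ∘ₗ (TensorProduct.comm ℚ _ _).toLinearMap ∘ₗ
    (χ.word (A := N)).rTensor F.χ ∘ₗ β.coaction.toLinearMap

theorem slice_comm_rTensor {M P Q : Type*} [AddCommGroup M] [Module ℚ M] [AddCommGroup P]
    [Module ℚ P] [AddCommGroup Q] [Module ℚ Q] (ξ : Module.Dual ℚ P) (f : M →ₗ[ℚ] Q)
    (t : M ⊗[ℚ] P) : slice ξ (TensorProduct.comm ℚ _ _ (f.rTensor P t)) =
      f (slice ξ (TensorProduct.comm ℚ _ _ t)) := by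
  induction t with
  | zero => simp
  | add s t hs ht => simp only [map_add, hs, ht]
  | tmul m p => simp

theorem GroupAction.coeff_apply (β : GroupAction N.χ F.χ) (ξ : Module.Dual ℚ F.χ) (z : F.χ) :
    β.coeff ξ z = χ.word (slice ξ (TensorProduct.comm ℚ _ _ (β.coaction z))) :=
  slice_comm_rTensor _ _ _

/-- The unit acts trivially: this is the initial value of the matrix coefficient. -/
theorem GroupAction.wcounit_coeff (β : GroupAction N.χ F.χ) (ξ : Module.Dual ℚ F.χ) (z : F.χ) :
    wcounit (β.coeff ξ z) = ξ z := by
  have h := congrArg (fun t => slice ξ (TensorProduct.comm ℚ _ _ t)) (β.counit_coaction z)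
  simp only [slice_comm_rTensor] at h
  rw [coeff_apply]
  refine h.trans ?_
  simp

/-- By coassociativity, splitting off the first letter of a matrix coefficient amounts to applying
the infinitesimal coaction to the argument first. This is the differential equation the coefficient
solves. -/
theorem GroupAction.ctr_coeff (β : GroupAction N.χ F.χ) (ξ : Module.Dual ℚ F.χ)
    (l : Module.Dual ℚ (N.deg 1)) (z : F.χ) : ctr l (β.coeff ξ z) =
      β.coeff ξ (slice l ((χ.lieProj N).rTensor _ (β.coaction z))) := by
  have h := congrArg (fun t : N.χ ⊗[ℚ] (N.χ ⊗[ℚ] F.χ) => slice (l ∘ₗ χ.lieProj N)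
    ((slice ξ ∘ₗ (TensorProduct.comm ℚ _ _).toLinearMap ∘ₗ
      (χ.word (A := N)).rTensor F.χ).lTensor N.χ t)) (β.coassoc z)
  beta_reduce at h
  have e1 : ∀ t : N.χ ⊗[ℚ] F.χ, slice (l ∘ₗ χ.lieProj N)
      ((slice ξ ∘ₗ (TensorProduct.comm ℚ _ _).toLinearMap ∘ₗ (χ.word (A := N)).rTensor F.χ).lTensor
        N.χ (TensorProduct.assoc ℚ _ _ _ (Coalgebra.comul.rTensor _ t))) =
      ctr l (χ.word (slice ξ (TensorProduct.comm ℚ _ _ t))) := by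
    intro t
    induction t with
    | zero => simp
    | add s t hs ht => simp only [map_add, hs, ht]
    | tmul b c =>
      rw [LinearMap.rTensor_tmul, TensorProduct.comm_tmul, slice_tmul, map_smul, map_smul,
        ctr_apply, ← pr₁_deconc, slice_rTensor, ← χ.comul_word]
      generalize Coalgebra.comul (R := ℚ) b = s
      induction s with
      | zero => simp
      | add s t hs ht => simp only [map_add, TensorProduct.add_tmul, smul_add, hs, ht]
      | tmul x y => simp [χ.lieProj, LinearMap.comp_apply, smul_comm (ξ c)]
  rw [e1] at h
  rw [coeff_apply, h, slice_lTensor, slice_lTensor, slice_rTensor]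
  rfl

/-- An action is determined by its infinitesimal coaction. -/
theorem GroupAction.ext_infinitesimal {β γ : GroupAction N.χ F.χ}
    (h : β.infinitesimal = γ.infinitesimal) : β = γ := by
  have hi : Function.Injective (F.incl ∘ₗ χ.word) := fun x y hxy =>
    χ.word_injective (incl_injective hxy)
  have hinj := map_injective (f := (N.deg 1).subtype) Subtype.val_injective hi
  -- Equality is given in N ⊗ T(F); inclusions of degree one letters into all letters stay injective
  -- after tensoring.
  have hinf : ∀ z, (χ.lieProj N).rTensor _ (β.coaction z) =
      (χ.lieProj N).rTensor _ (γ.coaction z) := by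
    intro z
    have hz := LinearMap.congr_fun h z
    rw [infinitesimal_apply, infinitesimal_apply] at hz
    exact hinj hz
  refine ext_coaction fun z => ?_
  apply (TensorProduct.comm ℚ _ _).injective
  refine slice_ext fun ξ => χ.word_injective ?_
  rw [← coeff_apply, ← coeff_apply]
  -- Same initial value and same contraction rule, so `word_hom_ext` applies.
  have : β.coeff ξ = γ.coeff ξ := by
    refine word_hom_ext (fun l z => slice l ((χ.lieProj N).rTensor _ (β.coaction z))) ?_ ?_ ?_
    · intro z
      rw [wcounit_coeff, wcounit_coeff]
    · exact fun l z => β.ctr_coeff ξ l z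
    · intro l z
      rw [γ.ctr_coeff, hinf]
  rw [this]

end Uniqueness

namespace Splitting

variable {N A F : AdamsCDGA.{u}} {φ : Hom N A} {ε : Hom A N} {π : Hom A F} (S : Splitting φ ε π)

/-- Projecting the second factor of the invariance identity to the co-Lie algebra kills x ⊗ 1, since
the empty word has no part of length one. Infinitesimal invariance suffices for `D_restrict`. -/
theorem isInv_word {x : A.χ} (hx : Algebra.TensorProduct.map (AlgHom.id ℚ A.χ)
    (ε.χMap : A.χ →ₐ[ℚ] N.χ) (Coalgebra.comul x) = x ⊗ₜ 1) : IsInv ε x.word := by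
  refine ⟨x.word_closed, ?_⟩
  have h := congrArg (TensorProduct.map (χ.word (A := A)) (χ.lieProj N)) hx
  rw [TensorProduct.map_tmul, χ.lieProj, LinearMap.comp_apply, χ.word_one, pr₁_one,
    TensorProduct.tmul_zero] at h
  rw [← h, ← χ.comul_word]
  generalize Coalgebra.comul (R := ℚ) x = t
  induction t with
  | zero => simp
  | add s t hs ht => simp only [map_add, hs, ht]
  | tmul x y =>
    have e := LinearMap.congr_fun (pr₁_wmap ε.deg₁) y.word
    rw [LinearMap.comp_apply, LinearMap.comp_apply] at e
    rw [TensorProduct.map_tmul, LinearMap.lTensor_tmul, Algebra.TensorProduct.map_tmul,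
      TensorProduct.map_tmul, LinearMap.comp_apply, LinearMap.comp_apply, ← e]
    rfl

/-- The split extension of groups given by a splitting. -/
noncomputable def splitExt : SplitExt N.χ A.χ F.χ where
  p := φ.χMap
  e := ε.χMap
  q := π.χMap
  e_p b := χ.word_injective (by
    rw [Hom.χMap_word, Hom.χMap_word, wmap_wmap,
      show ε.deg₁ ∘ₗ φ.deg₁ = LinearMap.id from LinearMap.ext S.ε₁_φ₁, wmap_id])
  q_p b := χ.word_injective (by
    rw [Hom.χMap_word, Hom.χMap_word, wmap_wmap,
      show π.deg₁ ∘ₗ φ.deg₁ = 0 from LinearMap.ext S.π₁_φ₁, wmap_zero_apply, χ.word_algebraMap]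
    rfl)
  q_surjective := S.χMap_surjective
  eq_zero x hx hq := χ.word_injective (by
    rw [map_zero]
    refine S.eq_zero_of_isInv (isInv_word hx) ?_
    rw [← Hom.χMap_word, hq, map_zero])

/-- The infinitesimal coaction of the conjugation action is given by the connection. -/
theorem infinitesimal_action (z : F.χ) : S.splitExt.action.infinitesimal z =
    TensorProduct.map (N.deg 1).subtype F.incl (S.Γbar z.word) := by
  obtain ⟨x₀, rfl⟩ := S.splitExt.q_surjective z
  -- Every function on the kernel is the restriction of an invariant function, obtained from any
  -- lift by `retr`; on such restrictions the coaction is computed by `coaction_q`.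
  have hx := S.splitExt.retr_invariant x₀
  rw [← S.splitExt.q_retr]
  generalize S.splitExt.retr.hom x₀ = x at hx
  have hinv : IsInv ε x.word := isInv_word hx
  rw [GroupAction.infinitesimal_apply, S.splitExt.coaction_q hx]
  change _ = TensorProduct.map (N.deg 1).subtype F.incl (S.Γbar (wmap π.deg₁ x.word))
  -- Applying ε to the first letter and restricting the rest is the infinitesimal part of the
  -- coproduct; `D_restrict` identifies it with the connection, one direction ν at a time.
  have key : S.Γbar (wmap π.deg₁ x.word) =
      TensorProduct.map ε.deg₁ (wmap π.deg₁) (uncons x.word) := by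
    refine slice_ext fun ν => ?_
    rw [slice_map]
    exact S.D_restrict hinv ν
  rw [key, ← pr₁_deconc, ← χ.comul_word]
  generalize Coalgebra.comul (R := ℚ) x = t
  induction t with
  | zero => simp
  | add s t hs ht => simp only [map_add, hs, ht]
  | tmul x y =>
    have e := LinearMap.congr_fun (pr₁_wmap ε.deg₁) x.word
    rw [LinearMap.comp_apply, LinearMap.comp_apply] at e
    rw [Algebra.TensorProduct.map_tmul, LinearMap.rTensor_tmul, TensorProduct.map_tmul,
      TensorProduct.map_tmul, LinearMap.rTensor_tmul, TensorProduct.map_tmul,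
      TensorProduct.map_tmul, ← e]
    rfl

/-- The conjugation action is the only action whose infinitesimal coaction is the connection. -/
theorem infinitesimal_eq_iff (β : GroupAction N.χ F.χ) :
    (∀ z, β.infinitesimal z = TensorProduct.map (N.deg 1).subtype F.incl (S.Γbar z.word)) ↔
      β = S.splitExt.action := by
  constructor
  · intro h
    refine GroupAction.ext_infinitesimal (LinearMap.ext fun z => ?_)
    rw [h, infinitesimal_action]
  · rintro rfl
    exact S.infinitesimal_action

end Splitting

end Adams

/-! ### Truncation by Adams degree, and the ideal of the fiber in low degree. -/

namespace Adams

namespace AdamsCDGA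

variable {A N : AdamsCDGA.{u}}

/-- A homogeneous element of a sum of subspaces of the homogeneous components lies in the
corresponding subspace. -/
theorem mem_of_mem_iSup {K : ℤ × ℕ → Submodule ℚ A} (hK : ∀ i, K i ≤ A.gr i) {x : A}
    (hx : x ∈ ⨆ i, K i) {i : ℤ × ℕ} (hi : x ∈ A.gr i) : x ∈ K i := by
  classical
  have h : (DirectSum.decompose A.gr x i : A) ∈ K i := by
    clear hi
    induction hx using Submodule.iSup_induction' with
    | zero => simp
    | add a b _ _ ha hb =>
      rw [DirectSum.decompose_add, DirectSum.add_apply, Submodule.coe_add]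
      exact add_mem ha hb
    | mem j x hx =>
      by_cases hj : j = i
      · subst hj
        rwa [DirectSum.decompose_of_mem_same _ (hK _ hx)]
      · rw [DirectSum.decompose_of_mem_ne _ (hK _ hx) hj]
        exact zero_mem _
  rwa [DirectSum.decompose_of_mem_same _ hi] at h

theorem IsConnected.cases (hA : A.IsConnected) {n : ℤ} {r : ℕ} {x : A} (hx : x ∈ A.gr (n, r)) :
    x = A.aug x • (1 : A) ∨ (1 ≤ n ∧ 0 < r) := by
  rcases Nat.eq_zero_or_pos r with rfl | hr
  · exact Or.inl (eq_smul_one' hx)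
  · by_cases hn : n ≤ 0
    · rw [hA n r hr hn, Submodule.mem_bot] at hx
      exact Or.inl (by rw [hx]; simp)
    · exact Or.inr ⟨by omega, hr⟩

theorem proj_one_one : A.proj 1 (1 : A) = 0 :=
  proj_ne (by norm_num) ⟨1, gr_le_deg 0 0 SetLike.GradedOne.one_mem⟩

theorem proj_of_mem {m : ℤ} {x : A} (hx : x ∈ A.deg m) : A.proj m x = ⟨x, hx⟩ :=
  proj_coe m ⟨x, hx⟩

theorem proj_of_mem_ne {m n : ℤ} (h : n ≠ m) {x : A} (hx : x ∈ A.deg n) : A.proj m x = 0 :=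
  proj_ne h ⟨x, hx⟩

/-- In a connected algebra, products of elements of positive degree have no component in degree
one. -/
theorem IsConnected.proj_one_mul (hA : A.IsConnected) (x y : A) :
    A.proj 1 (x * y) = A.aug x • A.proj 1 y + A.aug y • A.proj 1 x := by
  induction x using gr_induction with
  | h0 => simp
  | ha x z hx hz => simp only [add_mul, map_add, add_smul, smul_add, hx, hz]; abel
  | h n r x hx =>
    rcases hA.cases hx with h | ⟨hn, hr⟩
    · rw [h, map_smul, map_smul, proj_one_one, map_one]
      simp
    · induction y using gr_induction with
      | h0 => simp
      | ha y z hy hz => simp only [mul_add, map_add, add_smul, smul_add, hy, hz]; abel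
      | h m s y hy =>
        rcases hA.cases hy with h | ⟨hm, hs⟩
        · rw [h, map_smul, map_smul, proj_one_one, map_one]
          simp
        · rw [aug_of_mem_plus (gr_le_plus hr hx), aug_of_mem_plus (gr_le_plus hs hy),
            proj_of_mem_ne (by omega : n + m ≠ 1)
              (mul_mem_deg (gr_le_deg _ _ hx) (gr_le_deg _ _ hy))]
          simp

/-- The projection to the part of Adams degree less than `k`. -/
noncomputable def trunc (N : AdamsCDGA.{u}) (k : ℕ) : N →ₗ[ℚ] N :=
  (DirectSum.toModule ℚ (ℤ × ℕ) N (fun i => (if i.2 < k then (1 : ℚ) else 0) • (N.gr i).subtype)) ∘ₗ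
    (DirectSum.decomposeLinearEquiv N.gr).toLinearMap

theorem trunc_of_mem (k : ℕ) {i : ℤ × ℕ} {x : N} (hx : x ∈ N.gr i) :
    N.trunc k x = if i.2 < k then x else 0 := by
  lift x to N.gr i using hx
  have h : DirectSum.decomposeLinearEquiv N.gr (x : N) = DirectSum.lof ℚ _ _ i x :=
    DirectSum.decompose_coe N.gr x
  rw [trunc, LinearMap.comp_apply, LinearEquiv.coe_coe, h, DirectSum.toModule_lof]
  split_ifs <;> simp

theorem exists_trunc_eq (x : N) : ∃ k, ∀ j, k ≤ j → N.trunc j x = x := by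
  induction x using gr_induction with
  | h0 => exact ⟨0, fun j _ => map_zero _⟩
  | ha x y hx hy =>
    obtain ⟨k, hk⟩ := hx
    obtain ⟨l, hl⟩ := hy
    exact ⟨max k l, fun j hj => by
      rw [map_add, hk j (le_of_max_le_left hj), hl j (le_of_max_le_right hj)]⟩
  | h n r x hx => exact ⟨r + 1, fun j hj => by rw [trunc_of_mem j hx, if_pos (by exact hj)]⟩

/-- The factor n - trunc k n lives in Adams degree at least k, so multiplying it by anything of
positive Adams degree lands in degree at least k + 1, which the truncation removes. -/
theorem trunc_mul (k : ℕ) (n m : N) : N.trunc (k + 1) ((n - N.trunc k n) * m) =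
    N.aug m • N.trunc (k + 1) (n - N.trunc k n) := by
  induction n using gr_induction with
  | h0 => simp
  | ha x y hx hy =>
    rw [map_add, add_sub_add_comm, add_mul, map_add, map_add, hx, hy, smul_add]
  | h a r x hx =>
    rw [trunc_of_mem k hx]
    split_ifs with hr
    · simp
    · rw [sub_zero]
      induction m using gr_induction with
      | h0 => simp
      | ha y z hy hz => rw [mul_add, map_add, map_add, hy, hz, add_smul]
      | h b s y hy =>
        rcases Nat.eq_zero_or_pos s with rfl | hs
        · rw [eq_smul_one' hy, mul_smul_comm, mul_one, map_smul, map_smul, map_one]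
          simp
        · rw [aug_of_mem_plus (gr_le_plus hs hy), zero_smul,
            trunc_of_mem _ (SetLike.GradedMul.mul_mem hx hy), if_neg]
          simp only [Prod.snd_add] at hr ⊢
          omega

section Fiber

variable (φ : Hom N A)

/-- The homogeneous component of degree `i` of the ideal generated by `N₊`. -/
def fiberPart (i : ℤ × ℕ) : Submodule ℚ A := Submodule.span ℚ
  {z | ∃ (j k : ℤ × ℕ) (n : N) (y : A), 0 < j.2 ∧ j + k = i ∧ n ∈ N.gr j ∧ y ∈ A.gr k ∧ z = φ n * y}

theorem mul_mem_fiberPart {j k : ℤ × ℕ} {n : N} {y : A} (hj : 0 < j.2) (hn : n ∈ N.gr j)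
    (hy : y ∈ A.gr k) : φ n * y ∈ fiberPart φ (j + k) :=
  Submodule.subset_span ⟨j, k, n, y, hj, rfl, hn, hy, rfl⟩

theorem fiberPart_le (i : ℤ × ℕ) : fiberPart φ i ≤ A.gr i := by
  rw [fiberPart, Submodule.span_le]
  rintro _ ⟨j, k, n, y, -, rfl, hn, hy, rfl⟩
  exact SetLike.GradedMul.mul_mem (φ.map_gr' hn) hy

theorem mul_fiberPart {c x : A} {p i : ℤ × ℕ} (hc : c ∈ A.gr p) (hx : x ∈ fiberPart φ i) :
    c * x ∈ fiberPart φ (p + i) := by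
  induction hx using Submodule.span_induction with
  | zero => simp
  | add a b _ _ ha hb => rw [mul_add]; exact add_mem ha hb
  | smul r a _ ha => rw [mul_smul_comm]; exact Submodule.smul_mem _ _ ha
  | mem x hx =>
    obtain ⟨j, k, n, y, hj, rfl, hn, hy, rfl⟩ := hx
    rw [← mul_assoc, A.comm p.1 j.1 p.2 j.2 c (φ n) hc (φ.map_gr' hn), smul_mul_assoc, mul_assoc,
      add_left_comm]
    exact Submodule.smul_mem _ _ (mul_mem_fiberPart φ hj hn (SetLike.GradedMul.mul_mem hc hy))

/-- The sum of the subspaces `fiberPart` contains the generators and is stable under left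
multiplication, so it contains the ideal. The gain is control of the bidegrees of both factors of
each product. -/
theorem mem_fiberPart {x : A} (hx : x ∈ fiberIdeal φ) {i : ℤ × ℕ} (hi : x ∈ A.gr i) :
    x ∈ fiberPart φ i := by
  refine mem_of_mem_iSup (fiberPart_le φ) ?_ hi
  clear hi
  refine Submodule.span_induction (p := fun a _ => a ∈ ⨆ i, fiberPart φ i) ?_ (zero_mem _)
    (fun _ _ _ _ => add_mem) ?_ hx
  · rintro _ ⟨n, ⟨i, hi, hn⟩, rfl⟩
    have h := mul_mem_fiberPart φ hi hn (SetLike.GradedOne.one_mem (A := A.gr))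
    rw [mul_one] at h
    exact Submodule.mem_iSup_of_mem _ h
  · intro c x hx' hx
    clear hx'
    rw [smul_eq_mul]
    induction c using gr_induction with
    | h0 => simp
    | ha c c' hc hc' => rw [add_mul]; exact add_mem hc hc'
    | h p q c hc =>
      induction hx using Submodule.iSup_induction' with
      | zero => simp
      | add a b _ _ ha hb => rw [mul_add]; exact add_mem ha hb
      | mem i x hx => exact Submodule.mem_iSup_of_mem _ (mul_fiberPart φ hc hx)

variable (hN : N.IsConnected) (hA : A.IsConnected)

include hN hA

/-- The part of degree one of the ideal generated by `N₊` comes from `N`. -/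
theorem exists_of_mem_fiberIdeal_one {x : A} (hx : x ∈ fiberIdeal φ) (h1 : x ∈ A.deg 1) :
    ∃ n, x = φ n := by
  classical
  suffices h : ∀ i : ℤ × ℕ, i.1 = 1 → ∃ n, (DirectSum.decompose A.gr x i : A) = φ n by
    have hc : ∀ i : ℤ × ℕ, ∃ n, (DirectSum.decompose A.gr x i : A) = φ n := by
      intro i
      by_cases hi : i.1 = 1
      · exact h i hi
      · refine ⟨0, ?_⟩
        rw [map_zero]
        clear h hx
        induction h1 using deg_induction with
        | h0 => simp
        | ha a b _ _ ha hb => rw [DirectSum.decompose_add, DirectSum.add_apply, Submodule.coe_add,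
            ha, hb, add_zero]
        | h r x hx => rw [DirectSum.decompose_of_mem_ne _ hx (by rintro rfl; exact hi rfl)]
    choose n hn using hc
    refine ⟨∑ i ∈ (DirectSum.decompose A.gr x).support, n i, ?_⟩
    rw [map_sum, ← Finset.sum_congr rfl (fun i _ => hn i), DirectSum.sum_support_decompose]
  rintro ⟨m, r⟩ rfl
  have h := mem_fiberPart φ (fiberIdeal_homogeneous φ (1, r) hx) (Subtype.property _)
  generalize (DirectSum.decompose A.gr x (1, r) : A) = z at h
  induction h using Submodule.span_induction with
  | zero => exact ⟨0, (map_zero _).symm⟩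
  | add a b _ _ ha hb =>
    obtain ⟨n, rfl⟩ := ha
    obtain ⟨m, rfl⟩ := hb
    exact ⟨n + m, (map_add _ _ _).symm⟩
  | smul q a _ ha =>
    obtain ⟨n, rfl⟩ := ha
    exact ⟨q • n, (map_smul _ _ _).symm⟩
  | mem z hz =>
    obtain ⟨j, k, n, y, hj, hjk, hn, hy, rfl⟩ := hz
    -- Either y is a scalar, or it has positive degree; then n has degree at most zero and positive
    -- Adams degree, so it vanishes.
    rcases hA.cases hy with h | ⟨hk, -⟩
    · refine ⟨A.aug y • n, ?_⟩
      rw [h, map_smul, mul_smul_comm, mul_one]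
      simp
    · have : n = 0 := by
        have h1 := congrArg Prod.fst hjk
        simp only [Prod.fst_add] at h1
        have ha := hN j.1 j.2 hj (by omega)
        rwa [ha, Submodule.mem_bot] at hn
      exact ⟨0, by rw [this, map_zero, zero_mul]⟩

end Fiber

end AdamsCDGA

end Adams

/-! ### The splitting attached to generators of A over N. -/

namespace Adams

namespace Generators

variable {N A : AdamsCDGA.{u}} {φ : Hom N A} (P : Generators φ.toAlgHom) (ε : Hom A N)

theorem eq_zero_or_pos {i : ℤ × ℕ} {x : A} (hx : x ∈ P.E i) : x = 0 ∨ (1 ≤ i.1 ∧ 0 < i.2) := by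
  by_cases hi : i.1 ≤ 0 ∨ i.2 = 0
  · rw [P.E_eq_bot i.1 i.2 hi, Submodule.mem_bot] at hx
    exact Or.inl hx
  · exact Or.inr (by omega)

theorem aug_of_mem {i : ℤ × ℕ} {x : A} (hx : x ∈ P.E i) : A.aug x = 0 := by
  rcases P.eq_zero_or_pos hx with rfl | ⟨-, hi⟩
  · simp
  · exact aug_of_mem_plus (gr_le_plus hi (P.E_le i hx))

/-- The generators of `Sym^* E`. -/
noncomputable def gen : ↥(⨆ i, P.E i) →ₗ[ℚ] GrSym P.E :=
  (RingQuot.mkAlgHom ℚ (SymRel P.E)).toLinearMap ∘ₗ TensorAlgebra.ι ℚ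

theorem lift_gen (e : ↥(⨆ i, P.E i)) : P.lift (P.gen e) = e := by
  change RingQuot.liftAlgHom ℚ _ (RingQuot.mkAlgHom ℚ _ (TensorAlgebra.ι ℚ e)) = _
  rw [RingQuot.liftAlgHom_mkAlgHom_apply, TensorAlgebra.lift_ι_apply]
  rfl

theorem sym_induction {p : GrSym P.E → Prop} (h0 : ∀ r, p (algebraMap ℚ _ r))
    (hg : ∀ i e (he : e ∈ P.E i), p (P.gen ⟨e, Submodule.mem_iSup_of_mem i he⟩))
    (ha : ∀ s t, p s → p t → p (s + t)) (hm : ∀ s t, p s → p t → p (s * t)) (t : GrSym P.E) :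
    p t := by
  obtain ⟨t, rfl⟩ := RingQuot.mkAlgHom_surjective ℚ (SymRel P.E) t
  induction t using TensorAlgebra.induction with
  | algebraMap r => rw [AlgHom.commutes]; exact h0 r
  | add x y hx hy => rw [map_add]; exact ha _ _ hx hy
  | mul x y hx hy => rw [map_mul]; exact hm _ _ hx hy
  | ι v =>
    change p (P.gen v)
    obtain ⟨v, hv⟩ := v
    induction hv using Submodule.iSup_induction' with
    | mem i x hx => exact hg i x hx
    | zero =>
      rw [show (⟨0, zero_mem _⟩ : ↥(⨆ i, P.E i)) = 0 from rfl, map_zero]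
      simpa using h0 0
    | add x y hx hy h1 h2 =>
      have := ha _ _ h1 h2
      rwa [← map_add] at this

/-- The map `e ↦ e - ε e` on generators. -/
noncomputable def sectionLin : ↥(⨆ i, P.E i) →ₗ[ℚ] A :=
  (LinearMap.id - φ.toAlgHom.toLinearMap ∘ₗ ε.toAlgHom.toLinearMap) ∘ₗ (⨆ i, P.E i).subtype

theorem sectionLin_mem {i : ℤ × ℕ} {e : ↥(⨆ i, P.E i)} (he : (e : A) ∈ P.E i) :
    P.sectionLin ε e ∈ A.gr i :=
  sub_mem (P.E_le i he) (φ.map_gr' (ε.map_gr' (P.E_le i he)))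

/-- The homomorphism `Sym^* E → A` sending a generator `e` to `e - ε e`. -/
noncomputable def symSection : GrSym P.E →ₐ[ℚ] A := RingQuot.liftAlgHom ℚ (s := SymRel P.E)
  ⟨TensorAlgebra.lift ℚ (P.sectionLin ε), by
    rintro _ _ ⟨i, j, x, y, hx, hy⟩
    simp only [map_mul, map_smul, TensorAlgebra.lift_ι_apply]
    exact A.comm _ _ _ _ _ _ (P.sectionLin_mem ε hx) (P.sectionLin_mem ε hy)⟩

theorem symSection_gen (e : ↥(⨆ i, P.E i)) : P.symSection ε (P.gen e) = e - φ (ε e) := by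
  change RingQuot.liftAlgHom ℚ _ (RingQuot.mkAlgHom ℚ _ (TensorAlgebra.ι ℚ e)) = _
  rw [RingQuot.liftAlgHom_mkAlgHom_apply, TensorAlgebra.lift_ι_apply]
  rfl

/-- The isomorphism of algebras `Sym^* E ≅ A ⊗_N ℚ`. -/
noncomputable def symFiber : GrSym P.E ≃ₐ[ℚ] fiber φ :=
  AlgEquiv.ofBijective ((fiberHom φ).toAlgHom.comp P.lift)
    ⟨Function.LeftInverse.injective (g := P.fiberToSym) P.fiberToSym_symToFiber,
      Function.RightInverse.surjective (g := P.fiberToSym) P.symToFiber_fiberToSym⟩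

theorem symFiber_apply (t : GrSym P.E) : P.symFiber t = fiberHom φ (P.lift t) := rfl

theorem symFiber_symm_apply (x : fiber φ) : P.symFiber.symm x = P.fiberToSym x :=
  P.symFiber.symm_apply_eq.2 (P.symToFiber_fiberToSym x).symm

/-- The correction φ(ε e) has augmentation zero, so it disappears modulo the ideal generated by N₊.
-/
theorem fiberHom_symSection (t : GrSym P.E) : fiberHom φ (P.symSection ε t) = P.symFiber t := by
  induction t using P.sym_induction with
  | h0 r => simp only [AlgHom.commutes, AlgEquiv.commutes]
  | ha s t hs ht => simp only [map_add, hs, ht]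
  | hm s t hs ht => simp only [map_mul, hs, ht]
  | hg i e he =>
    rw [symSection_gen, symFiber_apply, lift_gen, map_sub, fiberHom_apply, ε.aug_comp,
      P.aug_of_mem he, zero_smul, sub_zero]

theorem ε_symSection (hε : ∀ n : N, ε (φ n) = n) (t : GrSym P.E) :
    ε (P.symSection ε t) = (fiber φ).aug (P.symFiber t) • (1 : N) := by
  induction t using P.sym_induction with
  | h0 r => simp only [AlgHom.commutes, AlgEquiv.commutes]; exact Algebra.algebraMap_eq_smul_one _
  | ha s t hs ht => simp only [map_add, hs, ht, add_smul]
  | hm s t hs ht => simp only [map_mul, hs, ht, smul_mul_smul_comm, one_mul]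
  | hg i e he =>
    rw [symSection_gen, symFiber_apply, lift_gen, (fiberHom φ).aug_comp, P.aug_of_mem he, map_sub,
      hε, sub_self, zero_smul]

/-- The section of `A → A ⊗_N ℚ`. -/
noncomputable def fiberSection : fiber φ →ₐ[ℚ] A := (P.symSection ε).comp P.symFiber.symm.toAlgHom

theorem fiberSection_symFiber (t : GrSym P.E) :
    P.fiberSection ε (P.symFiber t) = P.symSection ε t :=
  congrArg (P.symSection ε) (P.symFiber.symm_apply_apply t)

theorem fiberHom_fiberSection (x : fiber φ) : fiberHom φ (P.fiberSection ε x) = x := by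
  obtain ⟨t, rfl⟩ := P.symFiber.surjective x
  rw [fiberSection_symFiber, fiberHom_symSection]

/-- The subspaces K i of homogeneous elements with homogeneous section of the same bidegree span the
fiber: their sum contains the generators and is closed under products. A homogeneous element then
lies in its own K i. -/
theorem fiberSection_mem {i : ℤ × ℕ} {x : fiber φ} (hx : x ∈ (fiber φ).gr i) :
    P.fiberSection ε x ∈ A.gr i := by
  let K : ℤ × ℕ → Submodule ℚ (fiber φ) := fun i =>
    (fiber φ).gr i ⊓ (A.gr i).comap (P.fiberSection ε).toLinearMap
  have h : ∀ t, P.symFiber t ∈ ⨆ i, K i := by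
    intro t
    have h1 : (1 : fiber φ) ∈ ⨆ i, K i := Submodule.mem_iSup_of_mem (0, 0)
      ⟨SetLike.GradedOne.one_mem, by
        change P.fiberSection ε 1 ∈ A.gr (0, 0)
        rw [map_one]
        exact SetLike.GradedOne.one_mem⟩
    induction t using P.sym_induction with
    | h0 r =>
      rw [AlgEquiv.commutes, Algebra.algebraMap_eq_smul_one]
      exact Submodule.smul_mem _ _ h1
    | ha s t hs ht => rw [map_add]; exact add_mem hs ht
    | hm s t hs ht =>
      rw [map_mul]
      generalize P.symFiber s = x at hs
      generalize P.symFiber t = y at ht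
      induction hs using Submodule.iSup_induction' with
      | zero => simp
      | add a b _ _ ha hb => rw [add_mul]; exact add_mem ha hb
      | mem i x hx =>
        induction ht using Submodule.iSup_induction' with
        | zero => simp
        | add a b _ _ ha hb => rw [mul_add]; exact add_mem ha hb
        | mem j y hy =>
          refine Submodule.mem_iSup_of_mem (i + j) ⟨SetLike.GradedMul.mul_mem hx.1 hy.1, ?_⟩
          change P.fiberSection ε (x * y) ∈ A.gr (i + j)
          rw [map_mul]
          exact SetLike.GradedMul.mul_mem hx.2 hy.2
    | hg i e he =>
      refine Submodule.mem_iSup_of_mem i ⟨?_, ?_⟩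
      · rw [symFiber_apply, lift_gen]
        exact (fiberHom φ).map_gr' (P.E_le i he)
      · change P.fiberSection ε _ ∈ A.gr i
        rw [fiberSection_symFiber, symSection_gen]
        exact P.sectionLin_mem ε (e := ⟨e, Submodule.mem_iSup_of_mem i he⟩) he
  obtain ⟨t, rfl⟩ := P.symFiber.surjective x
  exact (mem_of_mem_iSup (K := K) (fun i => inf_le_left) (h t) hx).2

/-- The isomorphism `A ≅ N ⊗ (A ⊗_N ℚ)` given by the generators. -/
noncomputable def trivialization : A →ₗ[ℚ] N ⊗[ℚ] fiber φ :=
  P.symFiber.toLinearMap.lTensor N ∘ₗ P.equiv.symm.toLinearMap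

theorem trivialization_equiv (n : N) (t : GrSym P.E) :
    P.trivialization (P.equiv (n ⊗ₜ t)) = n ⊗ₜ P.symFiber t := by
  rw [trivialization, LinearMap.comp_apply, LinearEquiv.coe_coe, LinearEquiv.symm_apply_apply]
  rfl

theorem trivialization_mul (n : N) (a : A) : P.trivialization (φ n * a) =
    (LinearMap.mulLeft ℚ n).rTensor _ (P.trivialization a) := by
  obtain ⟨t, rfl⟩ := P.equiv.surjective a
  induction t with
  | zero => simp
  | add s t hs ht => simp only [map_add, mul_add, hs, ht]
  | tmul m s =>
    have h : φ n * P.equiv (m ⊗ₜ s) = P.equiv ((n * m) ⊗ₜ s) := by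
      rw [equiv_tmul, equiv_tmul, map_mul, mul_assoc]
    rw [h, trivialization_equiv, trivialization_equiv, LinearMap.rTensor_tmul,
      LinearMap.mulLeft_apply]

theorem aug_trivialization (a : A) :
    N.aug.toLinearMap.rTensor _ (P.trivialization a) = 1 ⊗ₜ fiberHom φ a := by
  obtain ⟨t, rfl⟩ := P.equiv.surjective a
  induction t with
  | zero => simp
  | add s t hs ht => simp only [map_add, TensorProduct.tmul_add, hs, ht]
  | tmul m s =>
    rw [trivialization_equiv, equiv_tmul, map_mul, fiberHom_apply, LinearMap.rTensor_tmul,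
      symFiber_apply, smul_mul_assoc, one_mul, AlgHom.toLinearMap_apply, TensorProduct.tmul_smul,
      TensorProduct.smul_tmul', smul_eq_mul, mul_one]

/-- The multiplication `N ⊗ (A ⊗_N ℚ) → A` given by the section. -/
noncomputable def mulSection : N ⊗[ℚ] fiber φ →ₗ[ℚ] A :=
  TensorProduct.lift ((LinearMap.mul ℚ A).compl₁₂ φ.toAlgHom.toLinearMap
    (P.fiberSection ε).toLinearMap)

theorem mulSection_tmul (n : N) (x : fiber φ) :
    P.mulSection ε (n ⊗ₜ x) = φ n * P.fiberSection ε x := rfl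

/-- The section agrees with the trivialization modulo N₊, so multiplying through the section and
trivializing again is the identity up to terms of higher Adams degree in N. -/
theorem trunc_trivialization (k : ℕ) (t : N ⊗[ℚ] fiber φ) :
    (N.trunc (k + 1)).rTensor _ (P.trivialization (P.mulSection ε
      ((LinearMap.id - N.trunc k).rTensor _ t))) =
    (N.trunc (k + 1)).rTensor _ ((LinearMap.id - N.trunc k).rTensor _ t) := by
  induction t with
  | zero => simp
  | add s t hs ht => simp only [map_add, hs, ht]
  | tmul n x =>
    have h := P.aug_trivialization (P.fiberSection ε x)
    rw [fiberHom_fiberSection] at h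
    have key : ∀ t : N ⊗[ℚ] fiber φ, (N.trunc (k + 1)).rTensor _
        ((LinearMap.mulLeft ℚ (n - N.trunc k n)).rTensor _ t) =
        (LinearMap.toSpanSingleton ℚ N (N.trunc (k + 1) (n - N.trunc k n))).rTensor _
          (N.aug.toLinearMap.rTensor _ t) := by
      intro t
      induction t with
      | zero => simp
      | add s t hs ht => simp only [map_add, hs, ht]
      | tmul m y =>
        rw [LinearMap.rTensor_tmul, LinearMap.rTensor_tmul, LinearMap.rTensor_tmul,
          LinearMap.rTensor_tmul, LinearMap.mulLeft_apply, trunc_mul]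
        rfl
    rw [LinearMap.rTensor_tmul, mulSection_tmul, trivialization_mul]
    change (N.trunc (k + 1)).rTensor _ ((LinearMap.mulLeft ℚ (n - N.trunc k n)).rTensor _ _) = _
    rw [key, h, LinearMap.rTensor_tmul, LinearMap.rTensor_tmul, LinearMap.toSpanSingleton_apply,
      one_smul]
    rfl

/-- By `trunc_trivialization` the multiplication is unitriangular for the Adams degree of the factor
in N, so no nonzero tensor can lie in its kernel. -/
theorem mulSection_injective : Function.Injective (P.mulSection ε) := by
  rw [injective_iff_map_eq_zero]
  intro t ht
  -- Removing the Adams degrees one at a time; a tensor involves finitely many of them, hence is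
  -- fixed by a large truncation.
  have h : ∀ k, (N.trunc k).rTensor _ t = 0 := by
    intro k
    induction k with
    | zero =>
      have : N.trunc 0 = 0 := by
        ext x
        induction x using gr_induction with
        | h0 => simp
        | ha x z hx hz => simp only [map_add, hx, hz]
        | h n r x hx => simp [trunc_of_mem 0 hx]
      rw [this]
      simp
    | succ k ih =>
      have h1 : (LinearMap.id - N.trunc k).rTensor _ t = t := by
        rw [LinearMap.rTensor_sub, LinearMap.sub_apply, ih, LinearMap.rTensor_id, sub_zero]
        rfl
      have h2 := P.trunc_trivialization ε k t
      rw [h1, ht, map_zero, map_zero] at h2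
      exact h2.symm
  have h2 : ∃ k, ∀ j, k ≤ j → (N.trunc j).rTensor (fiber φ) t = t := by
    clear ht h
    induction t with
    | zero => exact ⟨0, fun j _ => map_zero _⟩
    | add s t hs ht =>
      obtain ⟨k, hk⟩ := hs
      obtain ⟨l, hl⟩ := ht
      exact ⟨max k l, fun j hj => by
        rw [map_add, hk j (le_of_max_le_left hj), hl j (le_of_max_le_right hj)]⟩
    | tmul n x =>
      obtain ⟨k, hk⟩ := exists_trunc_eq n
      exact ⟨k, fun j hj => by rw [LinearMap.rTensor_tmul, hk j hj]⟩
  obtain ⟨k, hk⟩ := h2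
  rw [← hk k le_rfl, h]

theorem exists_retraction : ∃ r : A →ₗ[ℚ] N ⊗[ℚ] fiber φ,
    ∀ n x, r (φ n * P.fiberSection ε x) = n ⊗ₜ x := by
  obtain ⟨r, hr⟩ := LinearMap.exists_leftInverse_of_injective (P.mulSection ε)
    (LinearMap.ker_eq_bot.2 (P.mulSection_injective ε))
  exact ⟨r, fun n x => LinearMap.congr_fun hr (n ⊗ₜ x)⟩

section

variable (hN : N.IsGenNilp) (hε : ∀ n : N, ε (φ n) = n)

include hN hε

/-- The error lies in the ideal of the fiber and has degree one, so it comes from N; ε kills it and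
is injective on the image of N. -/
theorem decomp_one {a : A} (ha : a ∈ A.deg 1) :
    φ (ε a) + P.fiberSection ε (fiberHom φ a) = a := by
  have hσ : ∀ x, ε (P.fiberSection ε x) = (fiber φ).aug x • (1 : N) := by
    intro x
    obtain ⟨t, rfl⟩ := P.symFiber.surjective x
    rw [fiberSection_symFiber, P.ε_symSection ε hε]
  have h1 : a - φ (ε a) - P.fiberSection ε (fiberHom φ a) ∈ fiberIdeal φ := by
    rw [← fiberMk_eq_zero]
    change fiberHom φ _ = 0
    rw [map_sub, map_sub, fiberHom_fiberSection, fiberHom_apply, ε.aug_comp,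
      aug_of_mem_deg one_ne_zero ha, zero_smul, sub_zero, sub_self]
  have h2 : a - φ (ε a) - P.fiberSection ε (fiberHom φ a) ∈ A.deg 1 := by
    refine sub_mem (sub_mem ha (φ.map_deg (ε.map_deg ha))) ?_
    exact map_deg_of_gr (P.fiberSection ε).toLinearMap (fun _ _ h => P.fiberSection_mem ε h)
      ((fiberHom φ).map_deg ha)
  obtain ⟨n, hn⟩ := exists_of_mem_fiberIdeal_one φ hN.isConnected (P.isConnected hN) h1 h2
  have h3 := congrArg ε.toAlgHom hn
  rw [hε, map_sub, map_sub, hε, sub_self, zero_sub, hσ, (fiberHom φ).aug_comp,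
    aug_of_mem_deg one_ne_zero ha, zero_smul, neg_zero] at h3
  rw [← h3, map_zero, sub_sub, sub_eq_zero] at hn
  exact hn.symm

/-- The defect has degree two, lies in the ideal generated by N₊ and is killed by ε. It is a sum of
products φ(n) y, and subtracting φ ∘ ε turns these into φ(n)(y - φ(ε y)); scalars y drop out, the
remaining n and y have degree one, and `decomp_one` applies to y. -/
theorem conn_mem {r : ℕ} {x : fiber φ} (hx : x ∈ (fiber φ).gr (1, r)) :
    A.d (P.fiberSection ε x) - P.fiberSection ε ((fiber φ).d x) ∈ Submodule.span ℚ
      {a | ∃ s t n y, 0 < s ∧ s + t = r ∧ n ∈ N.gr (1, s) ∧ y ∈ (fiber φ).gr (1, t) ∧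
        a = φ n * P.fiberSection ε y} := by
  have hσ : ∀ x, ε (P.fiberSection ε x) = (fiber φ).aug x • (1 : N) := by
    intro x
    obtain ⟨t, rfl⟩ := P.symFiber.surjective x
    rw [fiberSection_symFiber, P.ε_symSection ε hε]
  have hA := P.isConnected hN
  set z := A.d (P.fiberSection ε x) - P.fiberSection ε ((fiber φ).d x) with hz
  have h1 : z ∈ fiberIdeal φ := by
    rw [← fiberMk_eq_zero]
    change fiberHom φ _ = 0
    rw [hz, map_sub, (fiberHom φ).map_d', fiberHom_fiberSection, fiberHom_fiberSection, sub_self]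
  have h2 : z ∈ A.gr (1 + 1, r) :=
    sub_mem (A.d_mem _ _ _ (P.fiberSection_mem ε hx))
      (P.fiberSection_mem ε ((fiber φ).d_mem _ _ _ hx))
  have h3 : z - φ (ε z) = z := by
    have hd : (fiber φ).d x ∈ (fiber φ).deg 2 := d_mem_two (gr_le_deg _ _ hx)
    rw [hz, map_sub, ε.map_d', hσ, hσ, aug_of_mem_deg one_ne_zero (gr_le_deg _ _ hx),
      aug_of_mem_deg two_ne_zero hd]
    simp
  rw [← h3]
  have h4 := mem_fiberPart φ h1 h2
  clear_value z
  clear h1 h2 h3 hz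
  induction h4 using Submodule.span_induction with
  | zero => simp
  | add a b _ _ ha hb =>
    rw [map_add, map_add, add_sub_add_comm]
    exact add_mem ha hb
  | smul q a _ ha =>
    rw [map_smul, map_smul, ← smul_sub]
    exact Submodule.smul_mem _ _ ha
  | mem z hz =>
    obtain ⟨j, k, n, y, hj, hjk, hn, hy, rfl⟩ := hz
    rw [map_mul, hε, map_mul, ← mul_sub]
    have e1 := congrArg Prod.fst hjk
    have e2 := congrArg Prod.snd hjk
    simp only [Prod.fst_add, Prod.snd_add] at e1 e2
    rcases hA.cases hy with h | ⟨hk, -⟩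
    · rw [h, map_smul, map_smul, map_one, map_one, sub_self, mul_zero]
      exact zero_mem _
    · rcases hN.isConnected.cases hn with h | ⟨hj1, -⟩
      · rw [aug_of_mem_plus (gr_le_plus hj hn), zero_smul] at h
        rw [h, map_zero, zero_mul]
        exact zero_mem _
      · obtain ⟨j1, j2⟩ := j
        obtain ⟨k1, k2⟩ := k
        obtain rfl : j1 = 1 := by simp only at *; omega
        obtain rfl : k1 = 1 := by simp only at *; omega
        refine Submodule.subset_span ⟨j2, k2, n, fiberHom φ y, hj, e2, hn,
          (fiberHom φ).map_gr' hy, ?_⟩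
        rw [sub_eq_iff_eq_add'.2 (P.decomp_one ε hN hε (gr_le_deg _ _ hy)).symm]

end

theorem stage_zero_le (q : ℕ) : stage φ.toAlgHom P.E 0 q ≤ subalgLE φ.toAlgHom P.E 1 := by
  have h : subalgLE φ.toAlgHom P.E 0 ≤ subalgLE φ.toAlgHom P.E 1 := by
    refine Algebra.adjoin_mono (Set.union_subset_union_right _ ?_)
    rintro x ⟨i, hi, hx⟩
    exact ⟨i, by omega, hx⟩
  cases q with
  | zero => exact h
  | succ q =>
    refine Algebra.adjoin_le (Set.union_subset h ?_)
    rintro x ⟨hx, -⟩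
    rwa [zero_add] at hx

/-- There are no generators of degree at most zero, so the initial stage is the image of N, and each
new element has its differential in the previous stage, which lies in `subalgLE 1`. -/
theorem d_mem_of_mem_stage {q : ℕ} {x : A} (hx : x ∈ stage φ.toAlgHom P.E 0 q) :
    A.J x ∈ subalgLE φ.toAlgHom P.E 1 ∧ A.d x ∈ subalgLE φ.toAlgHom P.E 1 := by
  -- Stability under J is part of the condition because the Leibniz rule contains J x; only then is
  -- it closed under products.
  let Q : Subalgebra ℚ A :=
    { carrier := {x | x ∈ subalgLE φ.toAlgHom P.E 1 ∧ A.J x ∈ subalgLE φ.toAlgHom P.E 1 ∧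
        A.d x ∈ subalgLE φ.toAlgHom P.E 1}
      mul_mem' := by
        rintro x y ⟨hx, hx', hx''⟩ ⟨hy, hy', hy''⟩
        refine ⟨mul_mem hx hy, ?_, ?_⟩
        · rw [J_mul]
          exact mul_mem hx' hy'
        · rw [d_mul]
          exact add_mem (mul_mem hx'' hy) (mul_mem hx' hy'')
      add_mem' := by
        rintro x y ⟨hx, hx', hx''⟩ ⟨hy, hy', hy''⟩
        refine ⟨add_mem hx hy, ?_, ?_⟩
        · rw [map_add]
          exact add_mem hx' hy'
        · rw [map_add]
          exact add_mem hx'' hy''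
      algebraMap_mem' := by
        intro r
        have hφ : ∀ n, φ n ∈ subalgLE φ.toAlgHom P.E 1 := fun n =>
          Algebra.subset_adjoin (Or.inl ⟨n, rfl⟩)
        have hr : algebraMap ℚ A r = φ (algebraMap ℚ N r) := (AlgHom.commutes _ _).symm
        rw [hr]
        refine ⟨hφ _, ?_, ?_⟩
        · rw [← φ.map_J]
          exact hφ _
        · rw [← φ.map_d']
          exact hφ _ }
  suffices h : stage φ.toAlgHom P.E 0 q ≤ Q from (h hx).2
  have hφ : ∀ n, φ n ∈ subalgLE φ.toAlgHom P.E 1 := fun n =>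
    Algebra.subset_adjoin (Or.inl ⟨n, rfl⟩)
  have h0 : subalgLE φ.toAlgHom P.E 0 ≤ Q := by
    refine Algebra.adjoin_le (Set.union_subset ?_ ?_)
    · rintro _ ⟨n, rfl⟩
      refine ⟨hφ n, ?_, ?_⟩
      · rw [← φ.map_J]
        exact hφ _
      · rw [← φ.map_d']
        exact hφ _
    · rintro x ⟨i, hi, hx⟩
      rcases P.eq_zero_or_pos hx with rfl | ⟨h, -⟩
      · exact zero_mem Q
      · omega
  clear hx x
  induction q with
  | zero => exact h0
  | succ q ih =>
    refine Algebra.adjoin_le (Set.union_subset h0 ?_)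
    rintro x ⟨hx, hd, hs⟩
    rw [zero_add] at hx hd
    refine ⟨hx, ?_, P.stage_zero_le q hs⟩
    rw [J_one hd]
    exact neg_mem hx

include P in
-- A degree one element of the fiber lifts to the subalgebra generated by N and the generators of
-- degree one. This subalgebra is exhausted by the stages, whose differentials stay inside it, and
-- its image in the fiber is generated in degree one.
theorem d_mem_adjoin (hF : (fiber φ).IsConnected) {x : fiber φ} (hx : x ∈ (fiber φ).deg 1) :
    (fiber φ).d x ∈ Algebra.adjoin ℚ ((fiber φ).deg 1 : Set (fiber φ)) := by
  have hB : ∀ b ∈ subalgLE φ.toAlgHom P.E 1,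
      fiberHom φ b ∈ Algebra.adjoin ℚ ((fiber φ).deg 1 : Set (fiber φ)) := by
    intro b hb
    have h : subalgLE φ.toAlgHom P.E 1 ≤
        (Algebra.adjoin ℚ ((fiber φ).deg 1 : Set (fiber φ))).comap (fiberHom φ).toAlgHom := by
      refine Algebra.adjoin_le (Set.union_subset ?_ ?_)
      · rintro _ ⟨n, rfl⟩
        change fiberHom φ (φ n) ∈ Algebra.adjoin ℚ ((fiber φ).deg 1 : Set (fiber φ))
        rw [fiberHom_apply]
        exact Subalgebra.smul_mem _ (one_mem _) _
      · rintro x ⟨i, hi, hx⟩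
        rcases P.eq_zero_or_pos hx with rfl | ⟨h, -⟩
        · exact zero_mem _
        · obtain ⟨i, r⟩ := i
          obtain rfl : i = 1 := by simp only at *; omega
          exact Algebra.subset_adjoin ((fiberHom φ).map_deg (gr_le_deg _ _ (P.E_le _ hx)))
    exact h hb
  -- By connectedness products of elements of positive degree do not reach degree one, so the degree
  -- one part of the fiber comes from generators of degree one.
  have hgen : ∀ t, ∃ b ∈ subalgLE φ.toAlgHom P.E 1,
      fiberHom φ b = ((fiber φ).proj 1 (P.symFiber t) : fiber φ) := by
    intro t
    induction t using P.sym_induction with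
    | h0 r =>
      refine ⟨0, zero_mem _, ?_⟩
      rw [AlgEquiv.commutes, Algebra.algebraMap_eq_smul_one, map_smul, AdamsCDGA.proj_one_one]
      simp
    | ha s t hs ht =>
      obtain ⟨b, hb, h1⟩ := hs
      obtain ⟨c, hc, h2⟩ := ht
      exact ⟨b + c, add_mem hb hc, by rw [map_add, map_add, map_add, h1, h2]; rfl⟩
    | hm s t hs ht =>
      obtain ⟨b, hb, h1⟩ := hs
      obtain ⟨c, hc, h2⟩ := ht
      refine ⟨(fiber φ).aug (P.symFiber s) • c + (fiber φ).aug (P.symFiber t) • b,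
        add_mem (Subalgebra.smul_mem _ hc _) (Subalgebra.smul_mem _ hb _), ?_⟩
      rw [map_mul, hF.proj_one_mul, map_add, map_smul, map_smul, h1, h2]
      rfl
    | hg i e he =>
      rw [symFiber_apply, lift_gen]
      by_cases hi : i.1 = 1
      · refine ⟨e, Algebra.subset_adjoin (Or.inr ⟨i, hi.le, he⟩), ?_⟩
        obtain ⟨i, r⟩ := i
        simp only at hi
        subst hi
        have h : fiberHom φ e ∈ (fiber φ).deg 1 :=
          (fiberHom φ).map_deg (gr_le_deg _ _ (P.E_le _ he))
        exact (congrArg Subtype.val (AdamsCDGA.proj_of_mem h)).symm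
      · refine ⟨0, zero_mem _, ?_⟩
        have h : fiberHom φ e ∈ (fiber φ).deg i.1 :=
          (fiberHom φ).map_deg (gr_le_deg _ i.2 (P.E_le _ he))
        have h2 := congrArg Subtype.val (AdamsCDGA.proj_of_mem_ne hi h)
        rw [map_zero]
        exact h2.symm
  obtain ⟨t, rfl⟩ := P.symFiber.surjective x
  obtain ⟨b, hb, hbt⟩ := hgen t
  rw [AdamsCDGA.proj_of_mem hx] at hbt
  change fiberHom φ b = P.symFiber t at hbt
  rw [← hbt, ← (fiberHom φ).map_d']
  -- The filtration condition is needed at its first step only, for generators of degree one.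
  obtain ⟨q, hq⟩ := P.nilp 0 b (by simpa using hb)
  exact hB _ (P.d_mem_of_mem_stage (by simpa using hq)).2

/-- The splitting given by generators of `A` over `N`. -/
noncomputable def splitting (hN : N.IsGenNilp) (hε : ∀ n : N, ε (φ n) = n) :
    Splitting φ ε (fiberHom φ) where
  σ := P.fiberSection ε
  σ_gr _ _ h := P.fiberSection_mem ε h
  π_σ := P.fiberHom_fiberSection ε
  ε_σ x := by
    obtain ⟨t, rfl⟩ := P.symFiber.surjective x
    rw [fiberSection_symFiber, P.ε_symSection ε hε]
  ε_φ := hε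
  π_φ := fiberHom_apply φ
  ret := Classical.choose (P.exists_retraction ε)
  ret_mul := Classical.choose_spec (P.exists_retraction ε)
  decomp _ ha := P.decomp_one ε hN hε ha
  conn_mem _ _ hx := P.conn_mem ε hN hε hx
  d_mem _ hx := P.d_mem_adjoin ((P.isConnected hN).fiber φ) hx

end Generators

end Adams

/-! ### Comparison with the connection given by the generators. -/

namespace Adams

section BarConnection

variable {V M : Type*} [AddCommGroup V] [Module ℚ V] [AddCommGroup M] [Module ℚ M]

theorem barConn_cons (JM : M →ₗ[ℚ] M) (J : V →ₗ[ℚ] V) (Γ : V →ₗ[ℚ] M ⊗[ℚ] V) (x : V) (w : Word V) :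
    barConn JM J Γ (cons x w) = ((cons (V := V)).flip w).lTensor M (Γ x) +
      (TensorProduct.map ((1 / 2 : ℚ) • (LinearMap.id + JM)) (cons (-J x)) (barConn JM J Γ w) +
        TensorProduct.map ((1 / 2 : ℚ) • (LinearMap.id - JM)) (cons x) (barConn JM J Γ w)) := by
  rw [barConn, wordRec_cons]
  congr 1
  simp only [LinearMap.comp_apply, TensorProduct.curry_apply, LinearEquiv.coe_coe]
  induction Γ x with
  | zero => simp
  | add s t hs ht => simp only [TensorProduct.add_tmul, map_add, hs, ht]
  | tmul m v => simp

/-- For coefficients of odd degree `JM` is -1: the projector onto even coefficients, which carries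
the sign of the letters, vanishes, and the projector onto odd ones is the identity. What remains is
the derivation without signs. -/
theorem barConn_wmap {U L : Type*} [AddCommGroup U] [Module ℚ U] [AddCommGroup L] [Module ℚ L]
    (JM : M →ₗ[ℚ] M) (J : V →ₗ[ℚ] V) (Γ : V →ₗ[ℚ] M ⊗[ℚ] V) (f : U →ₗ[ℚ] V) (g : L →ₗ[ℚ] M)
    (Δ : U →ₗ[ℚ] L ⊗[ℚ] U) (hΓ : ∀ x, Γ (f x) = TensorProduct.map g f (Δ x))
    (hJ : ∀ n, JM (g n) = -g n) (w : Word U) :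
    barConn JM J Γ (wmap f w) = TensorProduct.map g (wmap f) (wordConn Δ w) := by
  have h : barConn JM J Γ ∘ₗ wmap f = TensorProduct.map g (wmap f) ∘ₗ wordConn Δ := by
    apply word_ext
    · simp [barConn]
    · intro x w hw
      simp only [LinearMap.comp_apply] at hw ⊢
      rw [wmap_cons, barConn_cons, hw, hΓ, wordConn_cons, map_add]
      congr 1
      · induction Δ x with
        | zero => simp
        | add s t hs ht => simp only [map_add, hs, ht]
        | tmul m v => simp
      · induction wordConn Δ w with
        | zero => simp
        | add s t hs ht =>
          simp only [map_add] at hs ht ⊢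
          rw [← hs, ← ht]
          abel
        | tmul m v =>
          simp [hJ]
          rw [← add_smul]
          norm_num
  exact LinearMap.congr_fun h w

end BarConnection

namespace Generators

variable {N A : AdamsCDGA.{u}} {φ : Hom N A} (P : Generators φ.toAlgHom) {ε : Hom A N}

section

variable (h : ∀ i, ∀ x ∈ P.E i, ε x = 0)

include h

theorem symSection_eq_lift (t : GrSym P.E) : P.symSection ε t = P.lift t := by
  induction t using P.sym_induction with
  | h0 r => simp only [AlgHom.commutes]
  | ha s t hs ht => simp only [map_add, hs, ht]
  | hm s t hs ht => simp only [map_mul, hs, ht]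
  | hg i e he => rw [symSection_gen, lift_gen, h i e he, map_zero, sub_zero]

theorem trivialization_fiberSection (n : N) (x : fiber φ) :
    P.trivialization (φ n * P.fiberSection ε x) = n ⊗ₜ x := by
  obtain ⟨t, rfl⟩ := P.symFiber.surjective x
  rw [fiberSection_symFiber, P.symSection_eq_lift h]
  exact P.trivialization_equiv n t

/-- If ε kills the generators, the section is the inclusion of the symmetric algebra, so
trivializing d σ x yields 1 ⊗ d x plus Γ x. Projection away from scalar coefficients removes the
first term and fixes the second. -/
theorem conn_eq (hN : N.IsGenNilp) (hε : ∀ n : N, ε (φ n) = n) (x : (fiber φ).deg 1) :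
    P.conn x = TensorProduct.map (N.deg 1).subtype ((fiber φ).deg 1).subtype
      ((P.splitting ε hN hε).Γ x) := by
  have hσ : P.fiberSection ε (x : fiber φ) = P.lift (P.fiberToSym x) := by
    rw [← P.symSection_eq_lift h, ← symFiber_symm_apply]
    rfl
  have h1 : P.conn x = (LinearMap.id - Algebra.linearMap ℚ N ∘ₗ N.aug.toLinearMap).rTensor _
      (P.trivialization (A.d (P.fiberSection ε (x : fiber φ)))) := by
    rw [hσ]
    change P.symFiber.toLinearMap.lTensor N (LinearMap.rTensor _ _ (P.equiv.symm _)) =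
      LinearMap.rTensor _ _ (P.symFiber.toLinearMap.lTensor N (P.equiv.symm _))
    exact LinearMap.congr_fun ((LinearMap.lTensor_comp_rTensor _ _ _).trans
      (LinearMap.rTensor_comp_lTensor _ _ _).symm) _
  have h2 : A.d (P.fiberSection ε (x : fiber φ)) = φ 1 * P.fiberSection ε ((fiber φ).d x) +
      (P.splitting ε hN hε).mulOne (((fiber φ).deg 1).subtype.lTensor _
        ((P.splitting ε hN hε).Γ x)) := by
    rw [← Splitting.defect_one, Splitting.defect_apply, map_one, one_mul]
    exact (add_sub_cancel _ _).symm
  rw [h1, h2, map_add, map_add, P.trivialization_fiberSection h]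
  have h3 : (LinearMap.id - Algebra.linearMap ℚ N ∘ₗ N.aug.toLinearMap).rTensor (fiber φ)
      ((1 : N) ⊗ₜ (fiber φ).d x) = 0 := by
    simp
  rw [h3, zero_add]
  induction (P.splitting ε hN hε).Γ x with
  | zero => simp
  | add s t hs ht => simp only [map_add, hs, ht]
  | tmul n y =>
    have e : (P.splitting ε hN hε).mulOne (n ⊗ₜ (y : fiber φ)) =
      φ n * P.fiberSection ε (y : fiber φ) := rfl
    rw [LinearMap.lTensor_tmul, Submodule.subtype_apply, e, P.trivialization_fiberSection h]
    simp [aug_of_mem_deg one_ne_zero n.2]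

theorem barΓ_apply (hN : N.IsGenNilp) (hε : ∀ n : N, ε (φ n) = n) (z : (fiber φ).χ) :
    P.barΓ z = TensorProduct.map (N.deg 1).subtype (fiber φ).incl
      ((P.splitting ε hN hε).Γbar z.word) :=
  barConn_wmap _ _ _ _ _ _ (P.conn_eq h hN hε) (fun n => J_one n.2) _

end

end Generators

end Adams

/-! ### Reduction of the relative bar complex along the augmentation of N. -/

namespace Adams

namespace AdamsCDGA

variable {A : AdamsCDGA.{u}}

theorem aug_d (x : A) : A.aug (A.d x) = 0 := by
  induction x using gr_induction with
  | h0 => simp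
  | ha x z hx hz => simp only [map_add, hx, hz, add_zero]
  | h n r x hx =>
    rcases Nat.eq_zero_or_pos r with rfl | hr
    · by_cases hn : n = 0
      · subst hn
        exact aug_of_mem_deg one_ne_zero (gr_le_deg _ _ (A.d_mem 0 0 x hx))
      · rw [A.gr_ne_zero n hn, Submodule.mem_bot] at hx
        rw [hx, map_zero, map_zero]
    · exact aug_of_mem_plus (gr_le_plus hr (A.d_mem n r x hx))

theorem mem_plus_of_aug {x : A} (hx : A.aug x = 0) : x ∈ A.plus := by
  have h := sub_aug_mem_plus x
  rwa [hx, zero_smul, sub_zero] at h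

theorem J_mem_plus {x : A} (hx : x ∈ A.plus) : A.J x ∈ A.plus :=
  mem_plus_of_aug (by rw [aug_J, aug_of_mem_plus hx])

end AdamsCDGA

section Reduction

variable {N A : AdamsCDGA.{u}} {φ : Hom N A} {ε : Hom A N}

theorem relReduce_mk (n : N) (w : Word (augIdeal ε)) :
    relReduce φ ε ((relBarRel φ ε).mkQ (n ⊗ₜ w)) = N.aug n • wordReduce φ ε w := rfl

theorem relBarD_mk (n : N) (w : Word (augIdeal ε)) :
    relBarD φ ε ((relBarRel φ ε).mkQ (n ⊗ₜ w)) =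
      (relBarRel φ ε).mkQ (N.d n ⊗ₜ w + N.J n ⊗ₜ augIdeal.bar ε w) := rfl

theorem relBar_induction {p : RelBar φ ε → Prop} (h0 : p 0)
    (hm : ∀ n w, p ((relBarRel φ ε).mkQ (n ⊗ₜ w))) (ha : ∀ x y, p x → p y → p (x + y))
    (x : RelBar φ ε) : p x := by
  obtain ⟨t, rfl⟩ := (relBarRel φ ε).mkQ_surjective x
  induction t with
  | zero => rw [map_zero]; exact h0
  | add s t hs ht => rw [map_add]; exact ha _ _ hs ht
  | tmul n w => exact hm n w

theorem wordReduce_bar (w : Word (augIdeal ε)) :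
    wordReduce φ ε (augIdeal.bar ε w) = (fiber φ).bar (wordReduce φ ε w) :=
  barD_wmap _ _ _ ((fiberHom φ).toAlgHom.toLinearMap ∘ₗ (augIdeal ε).subtype)
    (fun x => (fiberHom φ).map_d' x) (fun x => (fiberHom φ).map_J x)
    (fun x y => map_mul (fiberHom φ).toAlgHom (x : A) y) w

/-- The reduction is a map of complexes. -/
theorem relReduce_relBarD (x : RelBar φ ε) :
    relReduce φ ε (relBarD φ ε x) = (fiber φ).bar (relReduce φ ε x) := by
  induction x using relBar_induction with
  | h0 => simp
  | ha x y hx hy => simp only [map_add, hx, hy]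
  | hm n w =>
    rw [relBarD_mk, map_add, map_add, relReduce_mk, relReduce_mk, relReduce_mk, aug_d, aug_J,
      zero_smul, zero_add, wordReduce_bar, map_smul]

theorem aug_fiberHom_augIdeal (x : augIdeal ε) : (fiber φ).aug (fiberHom φ (x : A)) = 0 := by
  rw [Hom.aug_comp, ← ε.aug_comp, (mem_augIdeal ε).1 x.2, map_zero]

variable (φ ε) in
/-- The elements `∑ n x` of the augmentation ideal with `n ∈ N₊`. -/
def plusAugIdeal : Submodule ℚ (augIdeal ε) :=
  Submodule.span ℚ {z | ∃ n ∈ N.plus, ∃ x, z = augIdeal.smulL φ ε n x}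

theorem smulL_mem_plusAugIdeal {n : N} (hn : n ∈ N.plus) (x : augIdeal ε) :
    augIdeal.smulL φ ε n x ∈ plusAugIdeal φ ε := Submodule.subset_span ⟨n, hn, x, rfl⟩

theorem augIdeal_proj_mem (hε : ∀ n, ε (φ n) = n) (a : A) : a - φ (ε a) ∈ augIdeal ε := by
  rw [mem_augIdeal, map_sub, hε, sub_self]

theorem mem_plusAugIdeal_of_gr (hε : ∀ n, ε (φ n) = n) {i : ℤ × ℕ} (hi : 0 < i.2) {n : N}
    (hn : n ∈ N.gr i) (c : A) : (⟨c * φ n - φ (ε (c * φ n)), augIdeal_proj_mem hε _⟩ : augIdeal ε) ∈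
      plusAugIdeal φ ε := by
  have hadd : ∀ a b : A, (⟨a + b - φ (ε (a + b)), augIdeal_proj_mem hε _⟩ : augIdeal ε) =
      ⟨a - φ (ε a), augIdeal_proj_mem hε _⟩ + ⟨b - φ (ε b), augIdeal_proj_mem hε _⟩ := by
    intro a b
    apply Subtype.ext
    change a + b - φ (ε (a + b)) = (a - φ (ε a)) + (b - φ (ε b))
    rw [map_add, map_add]
    abel
  induction c using gr_induction with
  | h0 =>
    convert zero_mem (plusAugIdeal φ ε) using 1
    apply Subtype.ext
    simp
  | ha x z hx hz =>
    convert add_mem hx hz using 1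
    rw [← hadd]
    apply Subtype.ext
    simp only [add_mul]
  | h m r c hc =>
    convert Submodule.smul_mem _ ((-1 : ℚ) ^ (m * i.1))
      (smulL_mem_plusAugIdeal (φ := φ) (gr_le_plus hi hn) ⟨c - φ (ε c), augIdeal_proj_mem hε c⟩)
      using 1
    apply Subtype.ext
    change c * φ n - φ (ε (c * φ n)) = (-1 : ℚ) ^ (m * i.1) • (φ n * (c - φ (ε c)))
    rw [A.comm m i.1 r i.2 _ _ hc (φ.map_gr' hn), map_smul, map_smul, map_mul ε.toAlgHom, hε, map_mul,
      mul_sub, smul_sub]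

/-- The projector a ↦ a - φ(ε a) onto the augmentation ideal commutes with left multiplication by N,
so it maps the ideal generated by N₊ into N₊ times the augmentation ideal, and it fixes x. -/
theorem mem_plusAugIdeal (hε : ∀ n, ε (φ n) = n) {x : augIdeal ε} (hx : fiberHom φ (x : A) = 0) :
    x ∈ plusAugIdeal φ ε := by
  have h : ∀ a ∈ fiberIdeal φ, ∀ c, (⟨c * a - φ (ε (c * a)), augIdeal_proj_mem hε _⟩ : augIdeal ε) ∈
      plusAugIdeal φ ε := by
    intro a ha
    refine Submodule.span_induction (p := fun a _ => ∀ c,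
      (⟨c * a - φ (ε (c * a)), augIdeal_proj_mem hε _⟩ : augIdeal ε) ∈ plusAugIdeal φ ε)
      ?_ ?_ ?_ ?_ ha
    · rintro _ ⟨n, ⟨i, hi, hn⟩, rfl⟩ c
      exact mem_plusAugIdeal_of_gr hε hi hn c
    · intro c
      convert zero_mem (plusAugIdeal φ ε) using 1
      apply Subtype.ext
      simp
    · intro x y _ _ hx hy c
      convert add_mem (hx c) (hy c) using 1
      apply Subtype.ext
      change c * (x + y) - φ (ε (c * (x + y))) = (c * x - φ (ε (c * x))) + (c * y - φ (ε (c * y)))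
      rw [mul_add, map_add, map_add]
      abel
    · intro b x _ h c
      simp only [smul_eq_mul, ← mul_assoc]
      exact h (c * b)
  convert h x ((fiberMk_eq_zero φ).1 hx) 1 using 1
  apply Subtype.ext
  simp only [one_mul]
  rw [(mem_augIdeal ε).1 x.2, map_zero, sub_zero]

variable (φ ε) in
/-- The words that vanish in the reduction of the relative bar complex: the span of the relations
and of the words `[n x₁|x₂|…]` with `n ∈ N₊`. -/
def plusWord : Submodule ℚ (Word (augIdeal ε)) :=
  relWord φ ε ⊔ Submodule.span ℚ {v | ∃ z ∈ plusAugIdeal φ ε, ∃ w, v = cons z w}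

theorem cons_mem_plusWord {z : augIdeal ε} (hz : z ∈ plusAugIdeal φ ε) (w : Word (augIdeal ε)) :
    cons z w ∈ plusWord φ ε :=
  Submodule.mem_sup_right (Submodule.subset_span ⟨z, hz, w, rfl⟩)

theorem smulR_mem_plusAugIdeal (hε : ∀ n, ε (φ n) = n) (x : augIdeal ε) {n : N} (hn : n ∈ N.plus) :
    augIdeal.smulR φ ε x n ∈ plusAugIdeal φ ε := by
  apply mem_plusAugIdeal hε
  change fiberHom φ (x * φ n) = 0
  rw [map_mul, fiberHom_apply, aug_of_mem_plus hn, zero_smul, mul_zero]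

/-- In [y|n x|…] the relations over N move n to the right of y up to sign, and y n again lies in N₊
times the augmentation ideal. -/
theorem plusWord_cons (hε : ∀ n, ε (φ n) = n) (y : augIdeal ε) {w : Word (augIdeal ε)}
    (hw : w ∈ plusWord φ ε) : cons y w ∈ plusWord φ ε := by
  suffices h : plusWord φ ε ≤ (plusWord φ ε).comap (cons y) from h hw
  refine sup_le (fun w hw => Submodule.mem_sup_left (cons_mem_relWord y hw)) ?_
  rw [Submodule.span_le]
  rintro _ ⟨z, hz, w, rfl⟩
  change cons y (cons z w) ∈ plusWord φ ε
  induction hz using Submodule.span_induction with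
  | zero => simp
  | add a b _ _ ha hb =>
    rw [map_add, LinearMap.add_apply, map_add]
    exact add_mem ha hb
  | smul r a _ ha =>
    rw [map_smul, LinearMap.smul_apply, map_smul]
    exact Submodule.smul_mem _ _ ha
  | mem z hz =>
    obtain ⟨n, hn, x, rfl⟩ := hz
    have h := base_mem (φ := φ) y x (N.J n) w
    rw [J_J] at h
    have h2 := cons_mem_plusWord (smulR_mem_plusAugIdeal hε y (J_mem_plus hn)) (cons x w)
    have h3 := sub_mem h2 (Submodule.mem_sup_left h)
    rwa [sub_sub_cancel] at h3

theorem mk_one_mem_of_mem_plusWord {w : Word (augIdeal ε)} (hw : w ∈ plusWord φ ε) :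
    (relBarRel φ ε).mkQ (1 ⊗ₜ w) ∈
      (LinearMap.range (N.plus.subtype.rTensor (Word (augIdeal ε)))).map (relBarRel φ ε).mkQ := by
  suffices h : plusWord φ ε ≤ ((LinearMap.range (N.plus.subtype.rTensor (Word (augIdeal ε)))).map
    (relBarRel φ ε).mkQ).comap ((relBarRel φ ε).mkQ ∘ₗ TensorProduct.mk ℚ N _ 1) from h hw
  refine sup_le (fun w hw => ?_) ?_
  · have : (relBarRel φ ε).mkQ (1 ⊗ₜ w) = 0 :=
      (Submodule.Quotient.mk_eq_zero _).2 (tmul_relWord_mem 1 hw)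
    rw [Submodule.mem_comap, LinearMap.comp_apply, TensorProduct.mk_apply, this]
    exact zero_mem _
  · rw [Submodule.span_le]
    rintro _ ⟨z, hz, w, rfl⟩
    rw [SetLike.mem_coe, Submodule.mem_comap, LinearMap.comp_apply]
    induction hz using Submodule.span_induction with
    | zero => simp
    | add a b _ _ ha hb =>
      rw [map_add, LinearMap.add_apply, map_add, map_add]
      exact add_mem ha hb
    | smul r a _ ha =>
      rw [map_smul, LinearMap.smul_apply, map_smul, map_smul]
      exact Submodule.smul_mem _ _ ha
    | mem z hz =>
      obtain ⟨n, hn, x, rfl⟩ := hz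
      refine ⟨n ⊗ₜ cons x w, ⟨⟨n, hn⟩ ⊗ₜ cons x w, rfl⟩, ?_⟩
      have h := left_mem (φ := φ) 1 n x w
      rw [one_mul] at h
      exact ((Submodule.Quotient.eq _).2 h).symm

end Reduction

namespace Splitting

variable {N A : AdamsCDGA.{u}} {φ : Hom N A} {ε : Hom A N} (S : Splitting φ ε (fiberHom φ))

/-- The section of the projection of the augmentation ideal to the fiber. -/
noncomputable def toAugIdeal : fiber φ →ₗ[ℚ] augIdeal ε :=
  (S.σ.toLinearMap - Algebra.linearMap ℚ A ∘ₗ (fiber φ).aug.toLinearMap).codRestrict _ (fun x => by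
    rw [mem_augIdeal]
    change ε (S.σ x - algebraMap ℚ A ((fiber φ).aug x)) = 0
    rw [map_sub, S.ε_σ, AlgHom.commutes, Algebra.algebraMap_eq_smul_one, sub_self])

theorem coe_toAugIdeal (x : fiber φ) : (S.toAugIdeal x : A) = S.σ x - (fiber φ).aug x • 1 := by
  rw [← Algebra.algebraMap_eq_smul_one]
  rfl

theorem coe_toAugIdeal_of_aug {x : fiber φ} (hx : (fiber φ).aug x = 0) :
    (S.toAugIdeal x : A) = S.σ x := by
  rw [coe_toAugIdeal, hx, zero_smul, sub_zero]

theorem fiberHom_toAugIdeal {x : fiber φ} (hx : (fiber φ).aug x = 0) :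
    fiberHom φ (S.toAugIdeal x : A) = x := by
  rw [S.coe_toAugIdeal_of_aug hx, S.π_σ]

theorem sub_toAugIdeal_mem (x : augIdeal ε) :
    x - S.toAugIdeal (fiberHom φ (x : A)) ∈ plusAugIdeal φ ε := by
  apply mem_plusAugIdeal S.ε_φ
  rw [Submodule.coe_sub, map_sub, S.fiberHom_toAugIdeal (aug_fiberHom_augIdeal x), sub_self]

/-- Replace the letters by the lifts of their reductions one at a time; each change is a letter in
N₊ times the augmentation ideal, which `plusWord` allows at any position. -/
theorem sub_wmap_mem_plusWord (w : Word (augIdeal ε)) :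
    w - wmap S.toAugIdeal (wordReduce φ ε w) ∈ plusWord φ ε := by
  have h : (plusWord φ ε).comap (LinearMap.id - wmap S.toAugIdeal ∘ₗ wordReduce φ ε) = ⊤ := by
    apply word_top
    · rw [Submodule.mem_comap, LinearMap.sub_apply, LinearMap.comp_apply, wordReduce, wmap_one,
        wmap_one, LinearMap.id_apply, sub_self]
      exact zero_mem _
    · intro x w hw
      rw [Submodule.mem_comap, LinearMap.sub_apply, LinearMap.comp_apply, LinearMap.id_apply] at hw ⊢
      rw [wordReduce_cons, wmap_cons]
      convert add_mem (plusWord_cons S.ε_φ x hw) (cons_mem_plusWord (S.sub_toAugIdeal_mem x)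
        (wmap S.toAugIdeal (wordReduce φ ε w))) using 1
      rw [map_sub, map_sub, LinearMap.sub_apply]
      abel
  have hw : w ∈ (⊤ : Submodule ℚ (Word (augIdeal ε))) := trivial
  rw [← h] at hw
  exact hw

include S

theorem range_relReduce : LinearMap.range (relReduce φ ε) =
    LinearMap.range (wmap (fiber φ).plus.subtype) := by
  let q : augIdeal ε →ₗ[ℚ] (fiber φ).plus :=
    ((fiberHom φ).toAlgHom.toLinearMap ∘ₗ (augIdeal ε).subtype).codRestrict _
      (fun x => mem_plus_of_aug (aug_fiberHom_augIdeal x))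
  apply le_antisymm
  · rintro _ ⟨x, rfl⟩
    induction x using relBar_induction with
    | h0 => rw [map_zero]; exact zero_mem _
    | ha x y hx hy => rw [map_add]; exact add_mem hx hy
    | hm n w =>
      rw [relReduce_mk]
      refine Submodule.smul_mem _ _ ⟨wmap q w, ?_⟩
      rw [wmap_wmap]
      rfl
  · rintro _ ⟨w, rfl⟩
    refine ⟨(relBarRel φ ε).mkQ (1 ⊗ₜ wmap (S.toAugIdeal ∘ₗ (fiber φ).plus.subtype) w), ?_⟩
    rw [relReduce_mk, map_one, one_smul, wordReduce, wmap_wmap]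
    congr 2
    ext x
    exact S.fiberHom_toAugIdeal (aug_of_mem_plus x.2)

/-- Modulo the image of N₊ ⊗ T(I), every element equals 1 ⊗ the lift of its own reduction, so a
vanishing reduction leaves only that image. -/
theorem ker_relReduce : LinearMap.ker (relReduce φ ε) =
    (LinearMap.range (N.plus.subtype.rTensor (Word (augIdeal ε)))).map (relBarRel φ ε).mkQ := by
  apply le_antisymm
  · intro x hx
    have h : ∀ x : RelBar φ ε, x - (relBarRel φ ε).mkQ (1 ⊗ₜ wmap S.toAugIdeal (relReduce φ ε x)) ∈
        (LinearMap.range (N.plus.subtype.rTensor (Word (augIdeal ε)))).map (relBarRel φ ε).mkQ := by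
      intro x
      induction x using relBar_induction with
      | h0 => simp
      | ha x y hx hy =>
        convert add_mem hx hy using 1
        rw [map_add, map_add, TensorProduct.tmul_add, map_add]
        abel
      | hm n w =>
        have h1 : (relBarRel φ ε).mkQ ((n - N.aug n • 1) ⊗ₜ w) ∈
            (LinearMap.range (N.plus.subtype.rTensor (Word (augIdeal ε)))).map
              (relBarRel φ ε).mkQ :=
          ⟨_, ⟨⟨n - N.aug n • 1, sub_aug_mem_plus n⟩ ⊗ₜ w, rfl⟩, rfl⟩
        have h2 := Submodule.smul_mem _ (N.aug n)
          (mk_one_mem_of_mem_plusWord (S.sub_wmap_mem_plusWord w))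
        convert add_mem h1 h2 using 1
        rw [relReduce_mk, map_smul, TensorProduct.sub_tmul, TensorProduct.tmul_sub,
          TensorProduct.tmul_smul, ← TensorProduct.smul_tmul', map_sub, map_sub, map_smul, map_smul,
          smul_sub]
        abel
    have h2 := h x
    rw [LinearMap.mem_ker.1 hx, map_zero, TensorProduct.tmul_zero, map_zero, sub_zero] at h2
    exact h2
  · rw [Submodule.map_le_iff_le_comap]
    rintro _ ⟨t, rfl⟩
    change relReduce φ ε ((relBarRel φ ε).mkQ _) = 0
    induction t with
    | zero => simp
    | add s t hs ht => simp only [map_add, hs, ht, add_zero]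
    | tmul n w =>
      rw [LinearMap.rTensor_tmul, relReduce_mk, Submodule.subtype_apply, aug_of_mem_plus n.2,
        zero_smul]

end Splitting

end Adams

/-! ### The connection of the relative bar complex. -/

namespace Adams

section WordConnection

variable {N A : AdamsCDGA.{u}} (φ : Hom N A) (ε : Hom A N)

/-- The pairs of `[n x₁|x₂|…]` and `n ⊗ [x₁|x₂|…]` for `n ∈ N¹`, modulo the relations between
words. -/
def leftPairs : Submodule ℚ (Word (augIdeal ε) × (N ⊗[ℚ] Word (augIdeal ε))) :=
  Submodule.span ℚ ({p | p.1 ∈ relWord φ ε ∧ p.2 = 0} ∪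
    {p | ∃ n ∈ N.deg 1, ∃ x w, p = (cons (augIdeal.smulL φ ε n x) w, n ⊗ₜ cons x w)})

variable {φ ε}

theorem mk_eq_of_mem_leftPairs {p : Word (augIdeal ε) × (N ⊗[ℚ] Word (augIdeal ε))}
    (hp : p ∈ leftPairs φ ε) : (relBarRel φ ε).mkQ (1 ⊗ₜ p.1) = (relBarRel φ ε).mkQ p.2 := by
  induction hp using Submodule.span_induction with
  | zero => simp
  | add a b _ _ ha hb =>
    rw [Prod.fst_add, Prod.snd_add, TensorProduct.tmul_add, map_add, map_add, ha, hb]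
  | smul r a _ ha =>
    rw [Prod.smul_fst, Prod.smul_snd, TensorProduct.tmul_smul, map_smul, map_smul, ha]
  | mem a ha =>
    rcases ha with ⟨h1, h2⟩ | ⟨n, hn, x, w, rfl⟩
    · rw [h2, map_zero]
      exact (Submodule.Quotient.mk_eq_zero _).2 (tmul_relWord_mem 1 h1)
    · have h := left_mem (φ := φ) 1 n x w
      rw [one_mul] at h
      exact (Submodule.Quotient.eq _).2 h

theorem smulR_neg_one {n : N} (hn : n ∈ N.deg 1) {y : augIdeal ε} (hy : (y : A) ∈ A.deg 1) :
    augIdeal.smulR φ ε y (-n) = augIdeal.smulL φ ε n y := by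
  apply Subtype.ext
  change (y : A) * φ (-n) = φ n * y
  rw [map_neg, mul_neg, mul_comm_one (φ.map_deg hn), J_one hy, mul_neg, neg_neg]

/-- A letter y of degree one has degree zero in the bar complex, so a coefficient n in N¹ passes
from the next letter to the front of y without sign: y (-n) = n y and J(-n) = n. -/
theorem cons_mem_leftPairs {y : augIdeal ε} (hy : (y : A) ∈ A.deg 1)
    {p : Word (augIdeal ε) × (N ⊗[ℚ] Word (augIdeal ε))} (hp : p ∈ leftPairs φ ε) :
    (cons y p.1, (cons y).lTensor N p.2) ∈ leftPairs φ ε := by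
  suffices h : leftPairs φ ε ≤ (leftPairs φ ε).comap ((cons y).prodMap ((cons y).lTensor N)) from h hp
  rw [leftPairs, Submodule.span_le]
  rintro _ (⟨h1, h2⟩ | ⟨n, hn, x, w, rfl⟩)
  · refine Submodule.subset_span (Or.inl ⟨cons_mem_relWord y h1, ?_⟩)
    rw [LinearMap.prodMap_apply, h2, map_zero]
  · have h := base_mem (φ := φ) y x (-n) w
    rw [smulR_neg_one hn hy, map_neg, J_one hn, neg_neg] at h
    have h1 : (cons y (cons (augIdeal.smulL φ ε n x) w) -
        cons (augIdeal.smulL φ ε n y) (cons x w), (0 : N ⊗[ℚ] Word (augIdeal ε))) ∈ leftPairs φ ε :=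
      Submodule.subset_span (Or.inl ⟨by rw [← neg_sub]; exact neg_mem h, rfl⟩)
    have h2 : (cons (augIdeal.smulL φ ε n y) (cons x w), n ⊗ₜ[ℚ] cons y (cons x w)) ∈
        leftPairs φ ε := Submodule.subset_span (Or.inr ⟨n, hn, y, cons x w, rfl⟩)
    have h3 := add_mem h1 h2
    rw [Prod.mk_add_mk, sub_add_cancel, zero_add] at h3
    exact h3

end WordConnection

namespace Splitting

variable {N A : AdamsCDGA.{u}} {φ : Hom N A} {ε : Hom A N} (S : Splitting φ ε (fiberHom φ))

/-- The section of the projection to the fiber in degree one. -/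
noncomputable def secOne : (fiber φ).deg 1 →ₗ[ℚ] augIdealOne ε :=
  (S.toAugIdeal ∘ₗ ((fiber φ).deg 1).subtype).codRestrict (augIdealOne ε) (fun x => by
    change (S.toAugIdeal x : A) ∈ A.deg 1
    rw [S.coe_toAugIdeal_of_aug (aug_of_mem_deg one_ne_zero x.2)]
    exact S.σ_deg x.2)

/-- The section on words in letters of degree one. -/
noncomputable def wordSecOne : Word ((fiber φ).deg 1) →ₗ[ℚ] Word (augIdealOne ε) :=
  wmap (W := augIdealOne ε) S.secOne

/-- The section on words in letters of degree one, with values in all words. -/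
noncomputable def wordSec : Word ((fiber φ).deg 1) →ₗ[ℚ] Word (augIdeal ε) :=
  wmap (S.toAugIdeal ∘ₗ ((fiber φ).deg 1).subtype)

theorem wordSec_cons (x : (fiber φ).deg 1) (w : Word ((fiber φ).deg 1)) :
    S.wordSec (cons x w) = cons (S.toAugIdeal x) (S.wordSec w) := wmap_cons _ _ _

theorem coe_wordSecOne (w : Word ((fiber φ).deg 1)) :
    wmap (augIdealOne ε).subtype (S.wordSecOne w) = S.wordSec w := by
  rw [wordSecOne, wmap_wmap]
  rfl

theorem coe_toAugIdeal_one (x : (fiber φ).deg 1) :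
    (S.toAugIdeal x : A) = S.σ (x : fiber φ) :=
  S.coe_toAugIdeal_of_aug (aug_of_mem_deg one_ne_zero x.2)

theorem wordReduce_wordSec (w : Word ((fiber φ).deg 1)) :
    wordReduce φ ε (S.wordSec w) = (fiber φ).incl w := by
  rw [wordReduce, wordSec, wmap_wmap, incl]
  refine congrArg (fun f => wmap f w) (LinearMap.ext fun x => ?_)
  exact S.fiberHom_toAugIdeal (aug_of_mem_deg one_ne_zero x.2)

theorem wmap_merge (x : (fiber φ).deg 1) (w : Word ((fiber φ).deg 1)) :
    wmap S.toAugIdeal (merge (LinearMap.mul ℚ (fiber φ)) (x : fiber φ) ((fiber φ).incl w)) =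
      merge (augIdeal.mul ε) (S.toAugIdeal x) (S.wordSec w) := by
  have h : wmap S.toAugIdeal ∘ₗ merge (LinearMap.mul ℚ (fiber φ)) (x : fiber φ) ∘ₗ (fiber φ).incl =
      merge (augIdeal.mul ε) (S.toAugIdeal x) ∘ₗ S.wordSec := by
    apply word_ext
    · simp only [LinearMap.comp_apply, incl_one, merge_one, map_zero, wordSec, wmap_one]
    · intro y w _
      rw [LinearMap.comp_apply, LinearMap.comp_apply, LinearMap.comp_apply, incl_cons, merge_cons,
        wmap_cons, wordSec_cons, merge_cons, incl, wmap_wmap]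
      congr 2
      apply Subtype.ext
      change (S.toAugIdeal (x * y : fiber φ) : A) = S.toAugIdeal x * S.toAugIdeal y
      rw [coe_toAugIdeal_one, coe_toAugIdeal_one, S.coe_toAugIdeal_of_aug, map_mul]
      rw [map_mul, aug_of_mem_deg one_ne_zero x.2, zero_mul]
  exact LinearMap.congr_fun h w

theorem bar_cons_sec (x : (fiber φ).deg 1) (w : Word (augIdeal ε)) :
    augIdeal.bar ε (cons (S.toAugIdeal x) w) = cons (augIdeal.d ε (S.toAugIdeal x)) w -
      merge (augIdeal.mul ε) (S.toAugIdeal x) w + cons (S.toAugIdeal x) (augIdeal.bar ε w) := by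
  have h : augIdeal.J ε (S.toAugIdeal x) = -S.toAugIdeal x := by
    apply Subtype.ext
    change A.J (S.toAugIdeal x) = -(S.toAugIdeal x : A)
    rw [coe_toAugIdeal_one, J_one (S.σ_deg x.2)]
  rw [augIdeal.bar, barD_cons, h]
  simp only [map_neg, LinearMap.neg_apply]
  abel

/-- The lift of a letter fails to commute with d by the defect, which is Γ x multiplied out; its
coefficients already stand at the front. -/
theorem letter_mem_leftPairs (x : (fiber φ).deg 1) (w : Word ((fiber φ).deg 1)) :
    (cons (augIdeal.d ε (S.toAugIdeal x) - S.toAugIdeal ((fiber φ).d x)) (S.wordSec w),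
      TensorProduct.map (N.deg 1).subtype S.wordSec
        (((cons (V := (fiber φ).deg 1)).flip w).lTensor _ (S.Γ x))) ∈ leftPairs φ ε := by
  let L : N.deg 1 ⊗[ℚ] (fiber φ).deg 1 →ₗ[ℚ] augIdeal ε :=
    TensorProduct.lift ((augIdeal.smulL φ ε).compl₁₂ (N.deg 1).subtype
      (S.toAugIdeal ∘ₗ ((fiber φ).deg 1).subtype))
  have hL : augIdeal.d ε (S.toAugIdeal x) - S.toAugIdeal ((fiber φ).d x) = L (S.Γ x) := by
    apply Subtype.ext
    have h1 : (augIdeal.d ε (S.toAugIdeal x) - S.toAugIdeal ((fiber φ).d x) : A) = S.defect x := by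
      rw [defect_apply, S.coe_toAugIdeal_of_aug (aug_d _), ← coe_toAugIdeal_one]
      rfl
    refine h1.trans ?_
    rw [defect_one]
    induction S.Γ x with
    | zero => simp
    | add s t hs ht => simp only [map_add, Submodule.coe_add, hs, ht]
    | tmul n y =>
      rw [LinearMap.lTensor_tmul, mulOne_tmul, Submodule.subtype_apply, ← coe_toAugIdeal_one]
      rfl
  rw [hL]
  induction S.Γ x with
  | zero =>
    simp only [map_zero, LinearMap.zero_apply]
    exact zero_mem _
  | add s t hs ht =>
    simp only [map_add, LinearMap.add_apply]
    exact add_mem hs ht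
  | tmul n y =>
    refine Submodule.subset_span (Or.inr ⟨n, n.2, S.toAugIdeal y, S.wordSec w, ?_⟩)
    rw [LinearMap.lTensor_tmul, TensorProduct.map_tmul, LinearMap.flip_apply, wordSec_cons]
    rfl

/-- Lifting letters of degree one respects products, so the only deviation from a map of complexes
comes from the differentials of letters. Carrying their N¹ coefficients to the front produces
`Γbar`. -/
theorem bar_wordSec_mem (w : Word ((fiber φ).deg 1)) :
    (augIdeal.bar ε (S.wordSec w) - wmap S.toAugIdeal ((fiber φ).bar ((fiber φ).incl w)),
      TensorProduct.map (N.deg 1).subtype S.wordSec (S.Γbar w)) ∈ leftPairs φ ε := by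
  have h : (leftPairs φ ε).comap
      ((augIdeal.bar ε ∘ₗ S.wordSec - wmap S.toAugIdeal ∘ₗ (fiber φ).bar ∘ₗ (fiber φ).incl).prod
        (TensorProduct.map (N.deg 1).subtype S.wordSec ∘ₗ S.Γbar)) = ⊤ := by
    apply word_top
    · rw [Submodule.mem_comap]
      convert zero_mem (leftPairs φ ε) using 1
      refine Prod.ext ?_ ?_
      · change augIdeal.bar ε (S.wordSec 1) -
          wmap S.toAugIdeal ((fiber φ).bar ((fiber φ).incl 1)) = 0
        rw [wordSec, wmap_one, augIdeal.bar, barD_one, incl_one, bar, barD_one, map_zero, sub_zero]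
      · change TensorProduct.map (N.deg 1).subtype S.wordSec (S.Γbar 1) = 0
        rw [Γbar, wordConn_one, map_zero]
    · intro x w hw
      have h1 := add_mem (S.letter_mem_leftPairs x w) (cons_mem_leftPairs (y := S.toAugIdeal x)
        (by rw [coe_toAugIdeal_one]; exact S.σ_deg x.2) hw)
      rw [Submodule.mem_comap]
      convert h1 using 1
      refine Prod.ext ?_ ?_
      · change augIdeal.bar ε (S.wordSec (cons x w)) -
            wmap S.toAugIdeal ((fiber φ).bar ((fiber φ).incl (cons x w))) =
          cons (augIdeal.d ε (S.toAugIdeal x) - S.toAugIdeal ((fiber φ).d x)) (S.wordSec w) +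
            cons (S.toAugIdeal x) (augIdeal.bar ε (S.wordSec w) -
              wmap S.toAugIdeal ((fiber φ).bar ((fiber φ).incl w)))
        have h2 : wmap S.toAugIdeal ((fiber φ).incl w) = S.wordSec w := wmap_wmap _ _ _
        rw [wordSec_cons, bar_cons_sec, incl_cons, bar_cons_one x.2, map_add, map_sub, wmap_merge,
          wmap_cons, wmap_cons, h2, map_sub, map_sub, LinearMap.sub_apply]
        abel
      · change TensorProduct.map (N.deg 1).subtype S.wordSec (S.Γbar (cons x w)) =
          TensorProduct.map (N.deg 1).subtype S.wordSec
            (((cons (V := (fiber φ).deg 1)).flip w).lTensor _ (S.Γ x)) +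
          (cons (S.toAugIdeal x)).lTensor N
            (TensorProduct.map (N.deg 1).subtype S.wordSec (S.Γbar w))
        rw [Γbar, wordConn_cons, map_add]
        congr 1
        induction wordConn S.Γ w with
        | zero => simp
        | add s t hs ht => simp only [map_add, hs, ht]
        | tmul n v => simp [wordSec_cons]
  have hw : w ∈ (⊤ : Submodule ℚ (Word ((fiber φ).deg 1))) := trivial
  rw [← h] at hw
  exact hw

theorem relZero_wordSecOne (w : Word ((fiber φ).deg 1)) :
    relZero φ ε (S.wordSecOne w) = (relBarRel φ ε).mkQ (1 ⊗ₜ S.wordSec w) := by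
  rw [← coe_wordSecOne]
  rfl

theorem map_wordSecOne (t : N.deg 1 ⊗[ℚ] Word ((fiber φ).deg 1)) :
    TensorProduct.map (N.deg 1).subtype (wmap (augIdealOne ε).subtype)
        ((S.wordSecOne).lTensor _ t) = TensorProduct.map (N.deg 1).subtype S.wordSec t := by
  induction t with
  | zero => simp
  | add s t hs ht => simp only [map_add, hs, ht]
  | tmul n w =>
    rw [LinearMap.lTensor_tmul, TensorProduct.map_tmul, TensorProduct.map_tmul, coe_wordSecOne]

/-- For a cocycle of the fiber the lifted boundary vanishes, so in `bar_wordSec_mem` only the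
connection term is left. -/
theorem relBarD_relZero (z : (fiber φ).χ) :
    relBarD φ ε (relZero φ ε (S.wordSecOne z.word)) =
      relOne φ ε ((S.wordSecOne).lTensor _ (S.Γbar z.word)) := by
  have hd : N.d (1 : N) = 0 := by
    have h1 := d_mul (1 : N) 1
    rw [J_of_mem (gr_le_deg 0 0 SetLike.GradedOne.one_mem)] at h1
    simpa using h1
  have hJ : N.J (1 : N) = 1 := by
    rw [J_of_mem (gr_le_deg 0 0 SetLike.GradedOne.one_mem), zpow_zero, one_smul]
  have h := mk_eq_of_mem_leftPairs (S.bar_wordSec_mem z.word)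
  rw [bar_incl_eq_zero.2 z.word_closed, map_zero, sub_zero] at h
  rw [relZero_wordSecOne, relBarD_mk, hd, hJ, TensorProduct.zero_tmul, zero_add, h, relOne,
    LinearMap.comp_apply, map_wordSecOne]

theorem isRelConnection {θ : (fiber φ).χ →ₗ[ℚ] N ⊗[ℚ] Word (fiber φ)}
    (hθ : ∀ z, θ z = TensorProduct.map (N.deg 1).subtype (fiber φ).incl (S.Γbar z.word)) :
    IsRelConnection φ ε θ := by
  intro z
  refine ⟨S.wordSecOne z.word, (S.wordSecOne).lTensor _ (S.Γbar z.word), ?_,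
    S.relBarD_relZero z, ?_⟩
  · rw [relZero_wordSecOne, relReduce_mk, map_one, one_smul, wordReduce_wordSec]
  · rw [hθ]
    induction S.Γbar z.word with
    | zero => simp
    | add s t hs ht => simp only [map_add, hs, ht]
    | tmul n w =>
      rw [LinearMap.lTensor_tmul, TensorProduct.map_tmul, TensorProduct.map_tmul,
        LinearMap.comp_apply, coe_wordSecOne, wordReduce_wordSec]

/-- By the decomposition of A¹, the degree one part of ker ε maps bijectively to F¹. Hence the lift
of a cocycle to a word in these letters is unique. -/
theorem eq_wordSecOne {w : Word (augIdealOne ε)} {v : Word ((fiber φ).deg 1)}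
    (h : wordReduce φ ε (wmap (augIdealOne ε).subtype w) = (fiber φ).incl v) :
    w = S.wordSecOne v := by
  have hinj : Function.Injective (fun w : Word (augIdealOne ε) =>
      wordReduce φ ε (wmap (augIdealOne ε).subtype w)) := by
    refine Function.LeftInverse.injective
      (g := wmap (S.secOne ∘ₗ (fiber φ).proj 1)) fun w => ?_
    simp only [wordReduce, wmap_wmap]
    convert wmap_id w
    ext x : 1
    apply Subtype.ext
    apply Subtype.ext
    have hx : fiberHom φ (x : A) ∈ (fiber φ).deg 1 := (fiberHom φ).map_deg x.2
    change (S.toAugIdeal ((fiber φ).proj 1 (fiberHom φ (x : A)) : fiber φ) : A) = (x : A)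
    rw [Splitting.proj_of_mem hx, S.coe_toAugIdeal_of_aug (aug_of_mem_deg one_ne_zero hx)]
    have h2 := S.decomp x x.2
    rwa [(mem_augIdeal ε).1 x.1.2, map_zero, zero_add] at h2
  apply hinj
  change _ = wordReduce φ ε _
  rw [coe_wordSecOne, wordReduce_wordSec]
  exact h

end Splitting

/-! ### Coefficients in N¹ of the relative bar complex. -/

namespace Generators

variable {N A : AdamsCDGA.{u}} {φ : Hom N A} (P : Generators φ.toAlgHom) (ν : Module.Dual ℚ (N.deg 1))

/-- The derivative in the direction `ν` of the projection to the fiber. -/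
noncomputable def deriv : A →ₗ[ℚ] fiber φ := slice (ν ∘ₗ N.proj 1) ∘ₗ P.trivialization

theorem deriv_mul (hN : N.IsConnected) (n : N) (a : A) : P.deriv ν (φ n * a) =
    ν (N.proj 1 n) • fiberHom φ a + N.aug n • P.deriv ν a := by
  have h1 : (ν ∘ₗ N.proj 1) ∘ₗ LinearMap.mulLeft ℚ n =
      ν (N.proj 1 n) • N.aug.toLinearMap + N.aug n • (ν ∘ₗ N.proj 1) := by
    ext m
    simp only [LinearMap.comp_apply, LinearMap.mulLeft_apply, hN.proj_one_mul, map_add, map_smul,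
      LinearMap.add_apply, LinearMap.smul_apply, AlgHom.toLinearMap_apply, smul_eq_mul]
    ring
  have h2 : slice N.aug.toLinearMap (P.trivialization a) = fiberHom φ a := by
    rw [slice, LinearMap.comp_apply, aug_trivialization, LinearEquiv.coe_coe,
      TensorProduct.lid_tmul, one_smul]
  have h3 : ∀ (r : ℚ) (l : N →ₗ[ℚ] ℚ) (t : N ⊗[ℚ] fiber φ), slice (r • l) t = r • slice l t := by
    intro r l t
    simp [slice, LinearMap.rTensor_smul]
  rw [deriv, LinearMap.comp_apply, trivialization_mul, slice_rTensor, h1, slice_add, h3, h3, h2]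
  rfl

theorem deriv_mul_right (hN : N.IsConnected) (a : A) (n : N) : P.deriv ν (a * φ n) =
    ν (N.proj 1 n) • (fiber φ).J (fiberHom φ a) + N.aug n • P.deriv ν a := by
  induction n using gr_induction with
  | h0 => simp
  | ha x z hx hz => simp only [map_add, mul_add, hx, hz, add_smul]; abel
  | h m r n hn =>
    rcases hN.cases hn with h | ⟨h1, h2⟩
    · rw [h]
      simp [AdamsCDGA.proj_one_one]
    · induction a using gr_induction with
      | h0 => simp
      | ha x z hx hz => simp only [map_add, add_mul, hx, hz, smul_add]; abel
      | h k s a ha =>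
        rw [A.comm k m s r a _ ha (φ.map_gr' hn), map_smul, P.deriv_mul ν hN,
          aug_of_mem_plus (gr_le_plus h2 hn), zero_smul, add_zero, add_zero,
          J_of_mem (gr_le_deg _ _ ((fiberHom φ).map_gr' ha)), smul_smul, smul_smul]
        -- Only the component of n in N¹ is seen by ν; for m = 1 the commutation sign is (-1)ᵏ,
        -- which is J on the letter.
        by_cases hm : m = 1
        · subst hm
          rw [mul_one, mul_comm]
        · rw [AdamsCDGA.proj_of_mem_ne hm (gr_le_deg _ _ hn), map_zero, mul_zero, zero_mul]

variable (ε : Hom A N)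

/-- The derivative in the direction `ν` of the projection to the fiber, on words in the augmentation
ideal. -/
noncomputable def wordDeriv : Word (augIdeal ε) →ₗ[ℚ] Word (fiber φ) :=
  wordRec 0 (LinearMap.lcomp ℚ _ (wordReduce φ ε) ∘ₗ cons ∘ₗ P.deriv ν ∘ₗ (augIdeal ε).subtype)
    (-(cons ∘ₗ (fiber φ).J ∘ₗ (fiberHom φ).toAlgHom.toLinearMap ∘ₗ (augIdeal ε).subtype))

theorem wordDeriv_cons (x : augIdeal ε) (w : Word (augIdeal ε)) : P.wordDeriv ν ε (cons x w) =
    cons (P.deriv ν (x : A)) (wordReduce φ ε w) -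
      cons ((fiber φ).J (fiberHom φ (x : A))) (P.wordDeriv ν ε w) := by
  rw [wordDeriv, wordRec_cons, sub_eq_add_neg]
  rfl

theorem wordDeriv_smulL (hN : N.IsConnected) (n : N) (x : augIdeal ε) (w : Word (augIdeal ε)) :
    P.wordDeriv ν ε (cons (augIdeal.smulL φ ε n x) w) =
      ν (N.proj 1 n) • wordReduce φ ε (cons x w) + N.aug n • P.wordDeriv ν ε (cons x w) := by
  have h1 : P.deriv ν (augIdeal.smulL φ ε n x : A) =
      ν (N.proj 1 n) • fiberHom φ (x : A) + N.aug n • P.deriv ν (x : A) := P.deriv_mul ν hN n x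
  have h2 : fiberHom φ (augIdeal.smulL φ ε n x : A) = N.aug n • fiberHom φ (x : A) := by
    change fiberHom φ (φ n * x) = _
    rw [map_mul, fiberHom_apply, smul_mul_assoc, one_mul]
  rw [wordDeriv_cons, wordDeriv_cons, h1, h2, wordReduce_cons, map_add, map_smul, map_smul, map_smul,
    map_smul, LinearMap.add_apply, LinearMap.smul_apply, LinearMap.smul_apply, LinearMap.smul_apply,
    smul_sub, add_sub_assoc]

theorem wordDeriv_smulR (hN : N.IsConnected) (x : augIdeal ε) (n : N) (w : Word (augIdeal ε)) :
    P.wordDeriv ν ε (cons (augIdeal.smulR φ ε x n) w) =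
      ν (N.proj 1 n) • cons ((fiber φ).J (fiberHom φ (x : A))) (wordReduce φ ε w) +
        N.aug n • P.wordDeriv ν ε (cons x w) := by
  have h1 : P.deriv ν (augIdeal.smulR φ ε x n : A) =
      ν (N.proj 1 n) • (fiber φ).J (fiberHom φ (x : A)) + N.aug n • P.deriv ν (x : A) :=
    P.deriv_mul_right ν hN x n
  have h2 : fiberHom φ (augIdeal.smulR φ ε x n : A) = N.aug n • fiberHom φ (x : A) := by
    change fiberHom φ (x * φ n) = _
    rw [map_mul, fiberHom_apply, mul_smul_comm, mul_one]
  rw [wordDeriv_cons, wordDeriv_cons, h1, h2, map_add, map_smul, map_smul, map_smul,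
    map_smul, LinearMap.add_apply, LinearMap.smul_apply, LinearMap.smul_apply, LinearMap.smul_apply,
    smul_sub, add_sub_assoc]

theorem proj_one_J (n : N) : N.proj 1 (N.J n) = -N.proj 1 n := by
  induction n using gr_induction with
  | h0 => simp
  | ha x z hx hz => simp only [map_add, hx, hz, neg_add]
  | h m r n hn =>
    by_cases hm : m = 1
    · subst hm
      rw [J_one (gr_le_deg _ _ hn), map_neg]
    · rw [J_of_mem (gr_le_deg _ _ hn), map_smul, AdamsCDGA.proj_of_mem_ne hm (gr_le_deg _ _ hn),
        smul_zero, neg_zero]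

/-- In the tensor relation the derivative at n on the right of x gives J x with a plus sign. On the
other side the Koszul sign of passing x and the sign of J on N¹ cancel, so both sides agree. -/
theorem wordDeriv_relGen (hN : N.IsConnected) {w : Word (augIdeal ε)} (hw : RelGen φ ε w) :
    P.wordDeriv ν ε w = 0 := by
  induction hw with
  | cons x w hw ih => rw [wordDeriv_cons, ih, wordReduce_relGen hw, map_zero, map_zero, sub_zero]
  | base x y n w =>
    rw [map_sub, P.wordDeriv_smulR ν ε hN, wordDeriv_cons P ν ε x (cons (augIdeal.smulL φ ε _ y) w),
      P.wordDeriv_smulL ν ε hN, wordDeriv_cons P ν ε x, proj_one_J, aug_J, map_neg]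
    have h : wordReduce φ ε (cons (augIdeal.smulL φ ε (N.J n) y) w) =
        N.aug n • wordReduce φ ε (cons y w) := by
      have h2 : fiberHom φ (augIdeal.smulL φ ε (N.J n) y : A) = N.aug n • fiberHom φ (y : A) := by
        change fiberHom φ (φ (N.J n) * y) = _
        rw [map_mul, fiberHom_apply, smul_mul_assoc, one_mul, aug_J]
      rw [wordReduce_cons, wordReduce_cons, h2, map_smul, LinearMap.smul_apply]
    rw [h]
    simp only [map_add, map_smul, smul_sub, neg_smul, map_neg]
    abel

/-- The coefficient in the direction `ν` of the part of `B̄_N(A)` of degree at most one over `N`. -/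
noncomputable def relSlice (hN : N.IsConnected) : RelBar φ ε →ₗ[ℚ] Word (fiber φ) :=
  (relBarRel φ ε).liftQ
    (slice (ν ∘ₗ N.proj 1) ∘ₗ (wordReduce φ ε).lTensor N +
      slice N.aug.toLinearMap ∘ₗ (P.wordDeriv ν ε).lTensor N) (by
      rw [relBarRel, Submodule.span_le]
      rintro _ (⟨n, w, hw, rfl⟩ | ⟨n, m, x, w, rfl⟩)
      · simp [wordReduce_relGen hw, P.wordDeriv_relGen ν ε hN hw]
      · have h : wordReduce φ ε (cons (augIdeal.smulL φ ε m x) w) =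
            N.aug m • wordReduce φ ε (cons x w) := by
          have h2 : fiberHom φ (augIdeal.smulL φ ε m x : A) = N.aug m • fiberHom φ (x : A) := by
            change fiberHom φ (φ m * x) = _
            rw [map_mul, fiberHom_apply, smul_mul_assoc, one_mul]
          rw [wordReduce_cons, wordReduce_cons, h2, map_smul, LinearMap.smul_apply]
        change (_ : Word (fiber φ)) = 0
        simp only [map_sub, LinearMap.add_apply, LinearMap.comp_apply, LinearMap.lTensor_tmul,
          slice_tmul, AlgHom.toLinearMap_apply, h, P.wordDeriv_smulL ν ε hN, hN.proj_one_mul,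
          map_add, map_smul, map_mul, smul_eq_mul]
        module)

theorem relSlice_relOne (hN : N.IsConnected) (t : N.deg 1 ⊗[ℚ] Word (augIdealOne ε)) :
    P.relSlice ν ε hN (relOne φ ε t) =
      slice ν ((wordReduce φ ε ∘ₗ wmap (augIdealOne ε).subtype).lTensor _ t) := by
  induction t with
  | zero => simp
  | add s t hs ht => simp only [map_add, hs, ht]
  | tmul n w =>
    change slice _ ((n : N) ⊗ₜ wordReduce φ ε _) + slice _ ((n : N) ⊗ₜ P.wordDeriv ν ε _) = _
    rw [slice_tmul, slice_tmul, LinearMap.lTensor_tmul, slice_tmul, AlgHom.toLinearMap_apply,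
      aug_of_mem_deg one_ne_zero n.2, zero_smul, add_zero, LinearMap.comp_apply, proj_coe]
    rfl

include P in
/-- An element of `N¹ ⊗ T(I¹)` is determined up to reduction by its image in `B̄_N(A)`. -/
theorem lTensor_eq_of_relOne_eq (hN : N.IsConnected) {s t : N.deg 1 ⊗[ℚ] Word (augIdealOne ε)}
    (h : relOne φ ε s = relOne φ ε t) :
    (wordReduce φ ε ∘ₗ wmap (augIdealOne ε).subtype).lTensor (N.deg 1) s =
      (wordReduce φ ε ∘ₗ wmap (augIdealOne ε).subtype).lTensor (N.deg 1) t :=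
  slice_ext fun ν => by rw [← P.relSlice_relOne ν ε hN, h, relSlice_relOne]

include P in
-- The lift w is forced by `eq_wordSecOne` and its differential is known from `relBarD_relZero`. The
-- tensor t need not be unique, but its reduction is, because `relSlice` recovers it from the class
-- in the relative bar complex.
theorem eq_of_isRelConnection (hN : N.IsConnected) (S : Splitting φ ε (fiberHom φ))
    {θ : (fiber φ).χ →ₗ[ℚ] N ⊗[ℚ] Word (fiber φ)} (hθ : IsRelConnection φ ε θ) (z : (fiber φ).χ) :
    θ z = TensorProduct.map (N.deg 1).subtype (fiber φ).incl (S.Γbar z.word) := by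
  have key : ∀ t : N.deg 1 ⊗[ℚ] Word (augIdealOne ε), TensorProduct.map (N.deg 1).subtype
      (wordReduce φ ε ∘ₗ wmap (augIdealOne ε).subtype) t = (N.deg 1).subtype.rTensor _
        ((wordReduce φ ε ∘ₗ wmap (augIdealOne ε).subtype).lTensor _ t) := fun t =>
    (LinearMap.congr_fun (LinearMap.rTensor_comp_lTensor _ _ _) t).symm
  obtain ⟨w, t, h1, h2, h3⟩ := hθ z
  have hw : w = S.wordSecOne z.word := by
    apply S.eq_wordSecOne
    rw [← h1]
    change _ = relReduce φ ε ((relBarRel φ ε).mkQ (1 ⊗ₜ _))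
    rw [relReduce_mk, map_one, one_smul]
  rw [hw, S.relBarD_relZero] at h2
  rw [← h3, key, ← P.lTensor_eq_of_relOne_eq ε hN h2]
  induction S.Γbar z.word with
  | zero => simp
  | add s t hs ht => simp only [map_add, hs, ht]
  | tmul n w =>
    rw [LinearMap.lTensor_tmul, LinearMap.lTensor_tmul, LinearMap.rTensor_tmul,
      TensorProduct.map_tmul, LinearMap.comp_apply, S.coe_wordSecOne, S.wordReduce_wordSec]

end Generators

end Adams
-- Assembly of the four statements.
theorem mainTheorem6 (N A : AdamsCDGA.{u}) (φ : Hom N A) (ε : Hom A N)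
    (hε : ∀ n : N, ε (φ n) = n) (hN : N.IsGenNilp) (P : Generators φ.toAlgHom) :
    ∃ α : GroupAction N.χ (fiber φ).χ,
      -- `K = Spec χ (A ⊗_N ℚ)` is the kernel of `π : G_A → G_N`, and `s` is a section of `π`
      (∀ (R : Type u) [CommRing R] [Algebra ℚ R],
        Function.Injective (Points.comap (fiberHom φ).χMap R) ∧
        (Points.comap (fiberHom φ).χMap R).range = (Points.comap φ.χMap R).ker ∧
        ∀ g : Points N.χ R, Points.comap φ.χMap R (Points.comap ε.χMap R g) = g) ∧
      -- `α` is the conjugation action of `G_N` on `K` by means of the splitting `s`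
      (∀ (R : Type u) [CommRing R] [Algebra ℚ R] (g : Points N.χ R) (k : Points (fiber φ).χ R),
        Points.comap (fiberHom φ).χMap R (α.act R g k) =
          Points.comap ε.χMap R g * Points.comap (fiberHom φ).χMap R k *
            (Points.comap ε.χMap R g)⁻¹) ∧
      -- `K ⋊ G_N ≅ G_A`, `(k, g) ↦ k s(g)`, by an isomorphism natural in the test ring
      (∃ Φ : ∀ (R : Type u) [CommRing R] [Algebra ℚ R],
          Points (fiber φ).χ R ⋊[α.act R] Points N.χ R ≃* Points A.χ R,
        (∀ (R : Type u) [CommRing R] [Algebra ℚ R]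
            (x : Points (fiber φ).χ R ⋊[α.act R] Points N.χ R),
          Φ R x = Points.comap (fiberHom φ).χMap R x.left * Points.comap ε.χMap R x.right) ∧
        ∀ (R S : Type u) [CommRing R] [Algebra ℚ R] [CommRing S] [Algebra ℚ S] (f : R →ₐ[ℚ] S)
            (k : Points (fiber φ).χ R) (g : Points N.χ R),
          Points.map A.χ f (Φ R ⟨k, g⟩) = Φ S ⟨Points.map _ f k, Points.map _ f g⟩) ∧
      -- `α` is the unique action whose infinitesimal coaction is the connection given by `Γ`
      ((∀ i, ∀ x ∈ P.E i, ε x = 0) →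
        ∀ β : GroupAction N.χ (fiber φ).χ, β.infinitesimal = P.barΓ ↔ β = α) ∧
      -- `B̄_N(A) ⊗_N ℚ = B̄(A ⊗_N ℚ)` as complexes
      (∀ x, relReduce φ ε (relBarD φ ε x) = (fiber φ).bar (relReduce φ ε x)) ∧
      LinearMap.range (relReduce φ ε) = LinearMap.range (wmap (fiber φ).plus.subtype) ∧
      LinearMap.ker (relReduce φ ε) =
        (LinearMap.range (N.plus.subtype.rTensor (Word (augIdeal ε)))).map (relBarRel φ ε).mkQ ∧
      -- `α` is the unique action whose infinitesimal coaction is the connection of `H⁰_N(B̄_N(A))`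
      (∀ β : GroupAction N.χ (fiber φ).χ, IsRelConnection φ ε β.infinitesimal ↔ β = α) := by
  let S := P.splitting ε hN hε
  let X := S.splitExt
  refine ⟨X.action, fun R _ _ => ⟨X.inc_injective, X.range_inc, X.proj_sec⟩,
    fun R _ _ g k => X.inc_act g k,
    ⟨fun R _ _ => X.semidirectEquiv R, fun R _ _ x => X.semidirectEquiv_apply x,
      fun R T _ _ _ _ f k g => ?_⟩,
    fun h β => ?_, relReduce_relBarD, S.range_relReduce, S.ker_relReduce, fun β => ?_⟩
  · rw [X.semidirectEquiv_apply, X.semidirectEquiv_apply, map_mul]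
    rfl
  -- Being the conjugation action means having `Γbar` as infinitesimal coaction; as ε kills the
  -- generators, this is `barΓ`.
  · rw [← S.infinitesimal_eq_iff, LinearMap.ext_iff]
    exact forall_congr' fun z => by rw [P.barΓ_apply h hN hε]
  · rw [← S.infinitesimal_eq_iff]
    -- A connection of the relative bar complex must be `Γbar`, and `Γbar` is one.
    exact ⟨P.eq_of_isRelConnection ε hN.isConnected S, S.isRelConnection⟩
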